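/- **Setting.** Let $p_1,\dots,p_N\in\mathbb C$, and let $\Gamma$ be a staircase in $\mathbb Z^N$: points $\gamma(i)$, $i\in\mathbb Z$, with $\gamma(0)=0$ and $\gamma(i+1)=\gamma(i)+e_{d(i)}$ for some $d:\mathbb Z\to\{1,\dots,N\}$; write $p_i$ for $p_{d(i)}$ when $i$ is a staircase index, and assume $p_i\ne0$ there. Let $\upsilon:\mathbb Z\to\mathbb C$ be a potential and $K\ge1$. Put $$\mathscr P=\bigcup_i\{\zeta:|p_i-\zeta|>K|p_i+\zeta|\},\quad \mathscr P^*=-\mathscr P,\quad \rho_n(\zeta)=\prod_{r=1}^N\Big(\frac{p_r+\zeta}{p_r-\zeta}\Big)^{n_r},\quad F(i,l;\zeta)=\frac1{2\zeta}\Big[1-\prod_{r=l}^{i-1}\frac{p_r-\zeta}{p_r+\zeta}\Big].$$ The Jost functions are the Neumann series solutions of $\Lambda(i)=1+\sum_{l<i}F(i,l)\upsilon_l\Lambda(l)$ and $\Upsilon(i)=1+\sum_{l>i}F(l,i)\upsilon_l\Upsilon(l)$. The spectral functions are $$\mathtt A=\tfrac1{2\zeta}\big[(p_0+\zeta)\Upsilon(0;\zeta)\Lambda(1;\zeta)-(p_0-\zeta)\Upsilon(1;\zeta)\Lambda(0;\zeta)\big],\qquad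 \mathtt B=\tfrac{p_0-\zeta}{2\zeta}\big[\Lambda(0;-\zeta)\Upsilon(1;\zeta)-\Lambda(1;-\zeta)\Upsilon(0;\zeta)\big],$$ and $R=\mathtt B/\mathtt A$. Assume $\upsilon$ is *admissible*: $\sum_i|\upsilon_i|K^{|i|}(1+|i|)<\infty$, and $\mathtt A$ has finitely many zeros $\zeta_j\neq0$ in $\mathbb C\setminus\overline{\mathscr P}$, all simple. Put $C_j=c_j/\mathtt A'(\zeta_j)$ if $\zeta_j\in\mathscr P^*$, where $\Upsilon(i;\zeta_j)=c_j\Lambda(i;\zeta_j)\rho_{\gamma(i)}(\zeta_j)$ for all $i$, and $C_j=\mathtt B(\zeta_j)/\mathtt A'(\zeta_j)$ otherwise. The *integral equation at $n\in\mathbb Z^N$* is $$\Lambda_n(\zeta)=1-\sum_j\frac{C_j\Lambda_n(\zeta_j)}{\zeta+\zeta_j}\rho_n(\zeta_j)+\frac1{2\pi i}\int_L\frac{R(\sigma)\Lambda_n(\sigma)}{\sigma+\zeta}\rho_n(\sigma)\,d\sigma. \tag{1}$$ A quadrilateral equation is *solved on* a set $S\subseteq\mathbb Z^N$ if it holds for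 all directions $j,k$ on every quadrilateral $n,\ n+e_j,\ n+e_k,\ n+e_j+e_k$ with corners in $S$; below $\tilde u,\hat u$ are the shifts in directions $j,k$, and $(p,P),(q,Q)$ are the parameters of these directions. **(I) $K>1$.** Let $L$ be a positively oriented piecewise $C^1$ simple closed contour in $\mathbb C\setminus\overline{\mathscr P}$ with interior $\mathcal R^+$ and exterior $\mathcal R^-$, such that $\mathscr P^*\subseteq\mathcal R^+$, $0\in\mathcal R^-$, all $\zeta_j\in\mathcal R^+$, $-(\mathcal R^+\cup L)\subseteq\mathcal R^-$, and no $\pm p_r$ lies on $L$ or equals a $\zeta_j$. A solution of (1) is a function continuous on $L$ that satisfies (1) for all $\zeta\in-\mathcal R^-$. Call $n$ *regular* if (1) has a solution there, unique on $-\mathcal R^-$, denoted $\Lambda_n$. Then: (a) For $\zeta\notin\mathscr P$, $\Lambda$ solves $(p_{i+1}+\zeta)\Lambda(i+2)-(p_i+p_{i+1}+\upsilon_{i+1})\Lambda(i+1)+(p_i-\zeta)\Lambda(i)=0$ with $\Lambda\to1$ as $i\to-\infty$, and $\Upsilon$ solves the equation with $\zeta\to-\zeta$ with $\Upsilon\to1$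 as $i\to+\infty$. Every point $\gamma(i)$ is regular, and $\Lambda_{\gamma(i)}(\zeta)=\Lambda(i;\zeta)$ on $-\mathcal R^-$. (b) Let $a\ne0$ with $\pm a\in\mathcal R^-$, $a^2\ne p_r^2$ for all $r$, and $\left|\frac{p_i+a}{p_i-a}\right|,\left|\frac{p_i-a}{p_i+a}\right|<K$ for all $i$. Fix a direction $l$, write $\frown$ for the shift in it, and put $$S(x,y)=\tfrac1{2y}\big(1+(p_l+x)\overset{\frown}\Lambda(x)\Lambda'(y)-(p_l+y)\Lambda(x)\overset{\frown}\Lambda{}'(y)-\Lambda(x)\overset{\frown}\Lambda(y)\big),$$ $$\mathscr Z(a)=\tfrac1{2a}\big([(p_l+a)\overset{\frown}\Lambda{}'(a)+\overset{\frown}\Lambda(a)]\Lambda'(-a)-[(p_l-a)\overset{\frown}\Lambda{}'(-a)+\overset{\frown}\Lambda(-a)]\Lambda'(a)\big),$$ $$\xi=2a\sum_r\frac{p_rn_r}{a^2-p_r^2},\qquad \vartheta=\prod_r\Big(\frac{P_r}{a-p_r}\Big)^{n_r},\qquad \sigma=(-1)^{n_1+\dots+n_N},$$ where $S$ and $\mathscr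 Z$ do not depend on the choice of $l$. With $\mathring p=\frac{a^2}{p^2-a^2}$, $\mathring q=\frac{a^2}{q^2-a^2}$, on the set of $n$ with $n$ and $n+e_l$ regular (of all regular $n$ for $\mathrm H3_\delta$): * for all $\mathscr A,\mathscr D,\xi_o$, the function $u=\frac14((\xi+\xi_o)^2+1)+a(\xi+\xi_o)S(-a,a)+a^2\mathscr Z(a)+\mathscr A\mathscr D+\frac12\mathscr A\rho(a)(1-2aS(a,a))+\frac12\mathscr D\rho(-a)(1+2aS(-a,-a))$ solves $\mathrm{Q2}$: $\mathring p(u-\hat u)(\tilde u-\hat{\tilde u})-\mathring q(u-\tilde u)(\hat u-\hat{\tilde u})+\mathring p\mathring q(\mathring p-\mathring q)(u+\tilde u+\hat u+\hat{\tilde u})-\mathring p\mathring q(\mathring p-\mathring q)(\mathring p^2-\mathring p\mathring q+\mathring q^2)=0$; * if $\mathscr B^2+4\mathscr A\mathscr D=\frac{\delta^2}4$, then $u=\mathscr B(\xi+\xi_o+2aS(-a,a))+\mathscr A\rho(a)(1-2aS(a,a))+\mathscr D\rho(-a)(1+2aS(-a,-a))$ solves $\mathrm{Q1}_\delta$: $\mathring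 p(u-\hat u)(\tilde u-\hat{\tilde u})-\mathring q(u-\tilde u)(\hat u-\hat{\tilde u})+\delta^2\mathring p\mathring q(\mathring p-\mathring q)=0$; * if $P_r^2=a^2-p_r^2$ and $\mathscr A\mathscr D-\mathscr B\mathscr C=-\frac{\delta}{4a}$, then $u=(\mathscr A+\sigma\mathscr B)\vartheta\Lambda(a)+(\sigma\mathscr C+\mathscr D)\vartheta^{-1}\Lambda(-a)$ solves $\mathrm{H3}_\delta$: $Q(u\tilde u+\hat u\hat{\tilde u})-P(u\hat u+\tilde u\hat{\tilde u})+\delta\frac{p^2-q^2}{PQ}=0$. (c) At every regular $n$, $\Lambda_n(\zeta)=1+\Lambda_\epsilon\zeta^{-1}+\Lambda_{\epsilon^2}\zeta^{-2}+O(\zeta^{-3})$ as $|\zeta|\to\infty$. With $\varrho=\sum_rp_rn_r$, on the set of regular $n$: * for all $\mathscr A,\varrho_o,\varrho_1$, $u=(\varrho+\varrho_o)^2+2(\varrho+\varrho_o)\Lambda_\epsilon+2\Lambda_{\epsilon^2}-\mathscr A^2+2\sigma\mathscr A(\varrho+\varrho_1+\Lambda_\epsilon)$ solves $\mathrm{H2}$: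 $(u-\hat{\tilde u})(\tilde u-\hat u)+(p^2-q^2)(u+\tilde u+\hat u+\hat{\tilde u})-p^4+q^4=0$; * if $\mathscr A^2-\mathscr B^2=-1$, then for all $\varrho_o,\varrho_1$, $u=\mathscr B(\varrho+\varrho_o+\Lambda_\epsilon)+\sigma\mathscr A(\varrho+\varrho_1+\Lambda_\epsilon)$ solves $\mathrm{H1}$: $(u-\hat{\tilde u})(\tilde u-\hat u)+p^2-q^2=0$. (d) These are limits of the $\mathrm{Q3}_\delta$ expression: for $P_r$ with $P_r^2=(p_r^2-a^2)(p_r^2-b^2)$ put $\mathcal F(a,b)=\prod_r\big(\frac{(p_r+a)(p_r+b)}{P_r}\big)^{n_r}$, $\mathscr S(a,b)=\frac1{a-b}\big((p_l+a)\overset{\frown}\Lambda(a)\Lambda(b)-(p_l+b)\Lambda(a)\overset{\frown}\Lambda(b)\big)$, and let $u_{Q3}$ be $\mathscr A\mathcal F\mathscr S(a,b)+\mathscr B\mathcal F\mathscr S(a,-b)+\mathscr C\mathcal F\mathscr S(-a,b)+\mathscr D\mathcal F\mathscr S(-a,-b)$. At every $n$ with $n,n+e_l$ regular, as $\epsilon\to0$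 in $\mathbb C\setminus\{0\}$, the function on the left of each colon converges to the stated $u$ (with $\delta\ne0$ where it is divided by; $u_X$ denotes the solution formula for the equation $X$, with the constants substituted as listed): * $\mathrm{Q3}_\delta\to\mathrm{Q2}$, $\frac1{2\epsilon}\big(\frac{4a^2}{\delta}u_{Q3}-\frac1\epsilon-1-\epsilon\big)$: $b=a(1-2\epsilon)$, $P_r\to p_r^2-a^2$, constants $\frac{\delta}{4a^2}\mathscr A\epsilon$, $\frac{\delta}{8a^2}\big(\frac1\epsilon+1\mp\xi_o+(\frac{3+\xi_o^2}2+2\mathscr A\mathscr D)\epsilon\big)$ for $\mathscr B$ (upper sign) and $\mathscr C$ (lower sign), $\frac{\delta}{4a^2}\mathscr D\epsilon$; * $\mathrm{Q2}\to\mathrm{Q1}_\delta$, $\epsilon\big(u_{Q2}-\frac{\delta^2}{4\epsilon^2}\big)$: $\mathscr A\to\frac{2\mathscr A}\epsilon$, $\mathscr D\to\frac{2\mathscr D}\epsilon$, $\xi_o\to\xi_o+\frac{2\mathscr B}\epsilon$; * $\mathrm{Q3}_\delta\to\mathrm{H3}_\delta$, $\frac{2}{\epsilon^3\sqrt\delta}u_{Q3}$: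 $b=\epsilon^{-2}$, all four constants multiplied by $\epsilon^3\frac{\sqrt\delta}2$, and $\epsilon^2P_r^{(\mathrm{Q3})}\to P_r^{(\mathrm{H3})}$; * $\mathrm{Q2}\to\mathrm{H2}$, $\epsilon^{-2}(u_{Q2}-\frac14)$: $a=\frac1\epsilon$, $\mathscr A\to\mathscr A(\epsilon+2\varrho_1\epsilon^2)$, $\mathscr D\to\mathscr A(-\epsilon+2\varrho_1\epsilon^2)$, $\xi_o\to2\epsilon\varrho_o$; * $\mathrm{Q1}_\delta\to\mathrm{H1}$, $\frac{u_{Q1}}{\epsilon\delta}$: $a=\frac1\epsilon$, $\mathscr A\to\frac\delta4\mathscr A(1+2\varrho_1\epsilon)$, $\mathscr B\to\frac\delta2\mathscr B$, $\mathscr D\to\frac\delta4\mathscr A(-1+2\varrho_1\epsilon)$, $\xi_o\to2\epsilon\varrho_o$. **(II) $K=1$, the condition $\sum_i|\upsilon_i|(1+|i|)<\infty$, for $\mathrm{H1}$ and $\mathrm{H2}$.** Let $\mathscr P\cap\mathscr P^*=\emptyset$ (so that both are open half-planes), let $L=\partial\mathscr P$ be oriented with $\mathscr P^*$ on its left, and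 assume that $\mathtt A$ has no zero on $L\setminus\{0\}$ and that $|\mathtt A|$ is bounded below near $0$ in $\mathbb C\setminus(\mathscr P\cup\{0\})$; no $p_r$ lies on $L$, and no $\pm p_r$ is a $\zeta_j$. A solution of (1) is now a bounded continuous function on $\mathbb C\setminus\mathscr P$ satisfying (1) in $\mathscr P^*$; $n$ is *regular* if there is exactly one and it has an expansion $1+\Lambda_\epsilon\zeta^{-1}+\Lambda_{\epsilon^2}\zeta^{-2}+o(\zeta^{-2})$ at infinity in $\mathbb C\setminus\mathscr P$. Then (a) holds, with $\Lambda_{\gamma(i)}(\zeta)=\Lambda(i;\zeta)$ on $\mathbb C\setminus\mathscr P$, and the $\mathrm H2$ and $\mathrm H1$ formulas in (c) give solutions of $\mathrm{H2}$ and $\mathrm{H1}$ on the set of regular points. -/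

import Mathlib

open Filter Topology Set

namespace LatticeIST

noncomputable section

/-! ### The lattice, the equations -/

/-- Points `(n₁, …, n_N)` of the `N`-dimensional lattice. -/
abbrev Lattice (N : ℕ) := Fin N → ℤ

/-- The unit step in the lattice direction `j`. -/
def e {N : ℕ} (j : Fin N) : Lattice N := Pi.single j 1

/-- The equation `H1`, with `u, ut, uh, uth` the values at the four corners
(`t` = shift in the `p`-direction, `h` = shift in the `q`-direction). -/
def EqH1 (p q u ut uh uth : ℂ) : Prop :=
  (u - uth) * (ut - uh) + p ^ 2 - q ^ 2 = 0

def EqH2 (p q u ut uh uth : ℂ) : Prop :=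
  (u - uth) * (ut - uh) + (p ^ 2 - q ^ 2) * (u + ut + uh + uth) - p ^ 4 + q ^ 4 = 0

/-- `H3_δ`; the parameters are the points `(p, P)`, `(q, Q)` of the curve `X² = a² - x²`. -/
def EqH3 (δ p P q Q u ut uh uth : ℂ) : Prop :=
  Q * (u * ut + uh * uth) - P * (u * uh + ut * uth) + δ * ((p ^ 2 - q ^ 2) / (P * Q)) = 0

/-- The parameter `a² / (p² - a²)` of the equations `Q1_δ` and `Q2`. -/
def ringParam (a p : ℂ) : ℂ := a ^ 2 / (p ^ 2 - a ^ 2)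

/-- `Q1_δ`, in the parameters `p° = ringParam a p`, `q° = ringParam a q`. -/
def EqQ1 (δ p q u ut uh uth : ℂ) : Prop :=
  p * (u - uh) * (ut - uth) - q * (u - ut) * (uh - uth) + δ ^ 2 * p * q * (p - q) = 0

/-- `Q2`, in the parameters `p° = ringParam a p`, `q° = ringParam a q`. -/
def EqQ2 (p q u ut uh uth : ℂ) : Prop :=
  p * (u - uh) * (ut - uth) - q * (u - ut) * (uh - uth)
    + p * q * (p - q) * (u + ut + uh + uth)
    - p * q * (p - q) * (p ^ 2 - p * q + q ^ 2) = 0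

/-- The function `u` satisfies the quadrilateral equation `E` (which depends on the two
directions `j, k`) on every elementary quadrilateral whose four corners lie in `S`. -/
def SolvesOn {N : ℕ} (S : Set (Lattice N)) (E : Fin N → Fin N → ℂ → ℂ → ℂ → ℂ → Prop)
    (u : Lattice N → ℂ) : Prop :=
  ∀ (n : Lattice N) (j k : Fin N),
    n ∈ S → n + e j ∈ S → n + e k ∈ S → n + e j + e k ∈ S →
      E j k (u n) (u (n + e j)) (u (n + e k)) (u (n + e j + e k))

/-! ### Direct scattering along a staircase -/

/-- Lattice parameters `p_r`, a staircase `Γ` (the step from the `i`-th to the `(i+1)`-st point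
is made in the direction `dir i`) and a potential `υ` along the staircase. -/
structure InitialData (N : ℕ) where
  p : Fin N → ℂ
  dir : ℤ → Fin N
  υ : ℤ → ℂ

namespace InitialData

variable {N : ℕ} (D : InitialData N)

/-- The parameter of the `i`-th step of the staircase. -/
def q (i : ℤ) : ℂ := D.p (D.dir i)

/-- The `i`-th point of the staircase; the `0`-th one is the origin of the lattice. -/
def pos (i : ℤ) : Lattice N := fun r =>
  (((Finset.Ico 0 i).filter (fun l => D.dir l = r)).card : ℤ)
    - (((Finset.Ico i 0).filter (fun l => D.dir l = r)).card : ℤ)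

/-- The plane-wave factor `ρ(ζ) = ∏_r ((p_r + ζ) / (p_r - ζ)) ^ n_r`. -/
def rho (n : Lattice N) (ζ : ℂ) : ℂ := ∏ r, ((D.p r + ζ) / (D.p r - ζ)) ^ n r

/-- The kernel `F(i, l; ζ) = (1 - ∏_{r=l}^{i-1} (p_r - ζ) / (p_r + ζ)) / (2 ζ)` for `l ≤ i`,
written so that the removable singularity at `ζ = 0` is removed; see `two_mul_kerF`. -/
def kerF (i l : ℤ) (ζ : ℂ) : ℂ :=
  ∑ r ∈ Finset.Ico l i,
    (1 / (D.q r + ζ)) * ∏ s ∈ Finset.Ico l r, ((D.q s - ζ) / (D.q s + ζ))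

theorem two_mul_kerF (l : ℤ) (m : ℕ) (ζ : ℂ) (h : ∀ r, D.q r + ζ ≠ 0) :
    2 * ζ * D.kerF (l + m) l ζ
      = 1 - ∏ r ∈ Finset.Ico l (l + m), ((D.q r - ζ) / (D.q r + ζ)) := by
  induction m with
  | zero => simp [kerF]
  | succ m ih =>
    have hI : Finset.Ico l (l + ((m + 1 : ℕ) : ℤ)) = insert (l + m) (Finset.Ico l (l + m)) := by
      ext x; simp only [Finset.mem_Ico, Finset.mem_insert]; push_cast; omega
    have hn : (l + (m : ℤ)) ∉ Finset.Ico l (l + (m : ℤ)) := by simp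
    have key : 2 * ζ * D.kerF (l + ((m + 1 : ℕ) : ℤ)) l ζ
        = 2 * ζ * (1 / (D.q (l + m) + ζ)
            * ∏ s ∈ Finset.Ico l (l + (m : ℤ)), ((D.q s - ζ) / (D.q s + ζ)))
          + 2 * ζ * D.kerF (l + m) l ζ := by
      unfold kerF
      rw [hI, Finset.sum_insert hn]; ring
    rw [key, ih, hI, Finset.prod_insert hn]
    have := h (l + m)
    field_simp
    ring

/-- The terms `H_k(i; ζ)` of the Neumann series of `Λ`; the sum runs over `l = i - 1 - m < i`. -/
def neumannH : ℕ → ℤ → ℂ → ℂ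
  | 0, _, _ => 1
  | k + 1, i, ζ => ∑' m : ℕ,
      D.kerF i (i - 1 - m) ζ * D.υ (i - 1 - m) * neumannH k (i - 1 - m) ζ

/-- The terms `J_k(i; ζ)` of the Neumann series of `Υ`; the sum runs over `l = i + 1 + m > i`,
and the kernel `G(i, l; ζ)` is `F(l, i; ζ)`. -/
def neumannJ : ℕ → ℤ → ℂ → ℂ
  | 0, _, _ => 1
  | k + 1, i, ζ => ∑' m : ℕ,
      D.kerF (i + 1 + m) i ζ * D.υ (i + 1 + m) * neumannJ k (i + 1 + m) ζ

/-- The Jost function `Λ(i; ζ)`, normalised to `1` as `i → -∞`. -/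
def jostΛ (i : ℤ) (ζ : ℂ) : ℂ := ∑' k : ℕ, D.neumannH k i ζ

/-- The Jost function `Υ(i; ζ)`, normalised to `1` as `i → +∞`. -/
def jostΥ (i : ℤ) (ζ : ℂ) : ℂ := ∑' k : ℕ, D.neumannJ k i ζ

/-- The spectral functions are the coefficients in `ψ = A φ° + B φ`, that is, in
`Υ(i; ζ) = A(ζ) Λ(i; -ζ) + B(ζ) Λ(i; ζ) ∏_{r<i} (p_r + ζ) / (p_r - ζ)`. They are given by
Wronskians, `A = W(ψ, φ) / (2 ζ)` and `B = W(φ°, ψ) / (2 ζ)`, here evaluated at `i = 0`. -/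
def specA (ζ : ℂ) : ℂ :=
  ((D.q 0 + ζ) * D.jostΥ 0 ζ * D.jostΛ 1 ζ - (D.q 0 - ζ) * D.jostΥ 1 ζ * D.jostΛ 0 ζ) / (2 * ζ)

def specB (ζ : ℂ) : ℂ :=
  (D.q 0 - ζ) / (2 * ζ)
    * (D.jostΛ 0 (-ζ) * D.jostΥ 1 ζ - D.jostΛ 1 (-ζ) * D.jostΥ 0 ζ)

/-- The region `P`: `|(p_r - ζ) / (p_r + ζ)| > K` for some direction `r` of the staircase. -/
def regP (K : ℝ) : Set ℂ := {ζ | ∃ i : ℤ, K * ‖D.q i + ζ‖ < ‖D.q i - ζ‖}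

/-- The region `P* = -P`. -/
def regPstar (K : ℝ) : Set ℂ := {ζ | ∃ i : ℤ, K * ‖D.q i - ζ‖ < ‖D.q i + ζ‖}

/-- The summability condition `∑ |υ_i| K^|i| (1 + |i|) < ∞`. -/
def SummableWeight (K : ℝ) : Prop :=
  Summable fun i : ℤ => ‖D.υ i‖ * K ^ i.natAbs * (1 + (i.natAbs : ℝ))

/-- The potential is admissible: it is summable, and the zeros of `A` in `ℂ \ (P ∪ ∂P)` are
finite in number (they form `Z`) and simple. (`A` in general has a pole at `0`.) -/
structure Admissible (K : ℝ) (Z : Finset ℂ) : Prop where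
  summable : D.SummableWeight K
  zeros : ∀ ζ, ζ ∈ Z ↔ ζ ∉ closure (D.regP K) ∧ ζ ≠ 0 ∧ D.specA ζ = 0
  simple : ∀ ζ ∈ Z, deriv D.specA ζ ≠ 0

/-- `c` gives the constants `c_j` with `ψ(i; ζ_j) = c_j φ(i; ζ_j)` at the zeros `ζ_j ∈ P*`. -/
def IsNorming (K : ℝ) (Z : Finset ℂ) (c : ℂ → ℂ) : Prop :=
  ∀ ζ ∈ Z, ζ ∈ D.regPstar K →
    ∀ i : ℤ, D.jostΥ i ζ = c ζ * D.jostΛ i ζ * D.rho (D.pos i) ζ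

open Classical in
/-- The constants `C_j`. -/
def coefC (K : ℝ) (c : ℂ → ℂ) (ζ : ℂ) : ℂ :=
  (if ζ ∈ D.regPstar K then c ζ else D.specB ζ) / deriv D.specA ζ

/-- The reflection coefficient. -/
def refl (ζ : ℂ) : ℂ := D.specB ζ / D.specA ζ

/-- The Jost functions solve the direct scattering problem with potential `υ` and have the
right boundary values. (These are the equations for `φ` and `ψ` after removal of the factors
`∏ ((p_r ± ζ) / (p_r ∓ ζ))^{1/2}`.) -/
def DirectScattering (K : ℝ) : Prop :=
  ∀ ζ ∉ D.regP K,
    (∀ i : ℤ, (D.q (i + 1) + ζ) * D.jostΛ (i + 2) ζ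
      - (D.q i + D.q (i + 1) + D.υ (i + 1)) * D.jostΛ (i + 1) ζ
      + (D.q i - ζ) * D.jostΛ i ζ = 0) ∧
    Tendsto (fun i => D.jostΛ i ζ) atBot (𝓝 1) ∧
    (∀ i : ℤ, (D.q (i + 1) - ζ) * D.jostΥ (i + 2) ζ
      - (D.q i + D.q (i + 1) + D.υ (i + 1)) * D.jostΥ (i + 1) ζ
      + (D.q i + ζ) * D.jostΥ i ζ = 0) ∧
    Tendsto (fun i => D.jostΥ i ζ) atTop (𝓝 1)

end InitialData

/-! ### Contours -/

/-- The integral of `f` along the curve `L : [0, 1] → ℂ`. -/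
def curveInt (L : ℝ → ℂ) (f : ℂ → ℂ) : ℂ := ∫ t in (0 : ℝ)..1, f (L t) * deriv L t

/-- The points of the curve. -/
def curveTrace (L : ℝ → ℂ) : Set ℂ := L '' Icc 0 1

def winding (L : ℝ → ℂ) (z : ℂ) : ℂ :=
  1 / (2 * Real.pi * Complex.I) * curveInt L (fun σ => 1 / (σ - z))

/-- The interior region `R⁺` of a positively oriented closed contour. -/
def intRegion (L : ℝ → ℂ) : Set ℂ := {z | z ∉ curveTrace L ∧ winding L z = 1}

/-- The exterior region `R⁻`. -/
def extRegion (L : ℝ → ℂ) : Set ℂ := {z | z ∉ curveTrace L ∧ winding L z = 0}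

/-- `L` is a positively oriented, piecewise continuously differentiable, simple closed curve. -/
structure IsContour (L : ℝ → ℂ) : Prop where
  pieces : ∃ (m : ℕ) (τ : ℕ → ℝ), τ 0 = 0 ∧ τ m = 1 ∧
    ∀ k < m, τ k < τ (k + 1) ∧ ContDiffOn ℝ 1 L (Icc (τ k) (τ (k + 1)))
  closed : L 0 = L 1
  simple : InjOn L (Ico 0 1)
  oriented : ∀ z ∉ curveTrace L, winding L z = 0 ∨ winding L z = 1

/-! ### The inverse problem -/

/-- The right-hand side, at the point `ζ`, of the singular integral equation
`Λ(ζ) = 1 - ∑_j C_j Λ(ζ_j) ρ(ζ_j) / (ζ + ζ_j) + (2πi)⁻¹ ∫_L R(σ) Λ(σ) ρ(σ) / (σ + ζ) dσ`,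
where `int` is the integration along `L`. -/
def sieRHS (int : (ℂ → ℂ) → ℂ) (Z : Finset ℂ) (C R ρ f : ℂ → ℂ) (ζ : ℂ) : ℂ :=
  1 - ∑ z ∈ Z, C z * f z / (ζ + z) * ρ z
    + 1 / (2 * Real.pi * Complex.I) * int (fun σ => R σ * f σ / (σ + ζ) * ρ σ)

/-- `f(ζ) = 1 + l₁ / ζ + l₂ / ζ² + O(ζ⁻³)` as `|ζ| → ∞`. -/
def HasExpansion (f : ℂ → ℂ) (l₁ l₂ : ℂ) : Prop :=
  (fun ζ => f ζ - (1 + l₁ / ζ + l₂ / ζ ^ 2)) =O[cocompact ℂ] fun ζ => 1 / ζ ^ 3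

/-- `f(ζ) = 1 + l₁ / ζ + l₂ / ζ² + o(ζ⁻²)` as `|ζ| → ∞` in the set `S`. -/
def HasExpansionIn (S : Set ℂ) (f : ℂ → ℂ) (l₁ l₂ : ℂ) : Prop :=
  (fun ζ => f ζ - (1 + l₁ / ζ + l₂ / ζ ^ 2)) =o[cocompact ℂ ⊓ 𝓟 S] fun ζ => 1 / ζ ^ 2

namespace InitialData

variable {N : ℕ} (D : InitialData N)

/-- The standing assumptions on the contour `L`, for an admissible potential with `K > 1`.
The condition `mirror` says that the kernel `1 / (σ + ζ)` of the integral equation has no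
singularity, and the condition `plane_wave` that the plane-wave factors `ρ` are finite and
nonzero, on the contour and at the zeros of `A`. -/
structure ContourSetting (K : ℝ) (L : ℝ → ℂ) (Z : Finset ℂ) (c : ℂ → ℂ) : Prop where
  one_lt : 1 < K
  param_ne : ∀ i, D.q i ≠ 0
  admissible : D.Admissible K Z
  norming : D.IsNorming K Z c
  contour : IsContour L
  avoid : curveTrace L ⊆ (closure (D.regP K))ᶜ
  star_subset : D.regPstar K ⊆ intRegion L
  zero_mem : (0 : ℂ) ∈ extRegion L
  zeros_subset : ↑Z ⊆ intRegion L
  mirror : ∀ z ∈ intRegion L ∪ curveTrace L, -z ∈ extRegion L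
  plane_wave : ∀ r, (∀ z ∈ curveTrace L, z ≠ D.p r ∧ z ≠ -D.p r) ∧ ∀ z ∈ Z, z ≠ D.p r ∧ z ≠ -D.p r

/-- `f` solves the singular integral equation at the lattice point `n`. -/
def IsSolution (K : ℝ) (L : ℝ → ℂ) (Z : Finset ℂ) (c : ℂ → ℂ) (n : Lattice N) (f : ℂ → ℂ) :
    Prop :=
  ContinuousOn f (curveTrace L) ∧
    ∀ ζ, -ζ ∈ extRegion L → f ζ = sieRHS (curveInt L) Z (D.coefC K c) D.refl (D.rho n) f ζ

/-- The lattice points at which the singular integral equation is uniquely solvable. -/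
def regular (K : ℝ) (L : ℝ → ℂ) (Z : Finset ℂ) (c : ℂ → ℂ) : Set (Lattice N) :=
  {n | ∃ f, D.IsSolution K L Z c n f ∧
    ∀ g, D.IsSolution K L Z c n g → ∀ ζ, -ζ ∈ extRegion L → g ζ = f ζ}

/-- The limiting case `K = 1`, with the summability condition `∑ |υ_i| (1 + |i|) < ∞`.
If `P` and `P*` are disjoint, they are complementary open half-planes, and the contour is their
common boundary, a line through `0` (the point `0` needs care since `A` is not defined there). -/
structure LineSetting (Z : Finset ℂ) (c : ℂ → ℂ) : Prop where
  param_ne : ∀ i, D.q i ≠ 0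
  disjoint : Disjoint (D.regP 1) (D.regPstar 1)
  admissible : D.Admissible 1 Z
  norming : D.IsNorming 1 Z c
  boundary_ne : ∀ σ ∈ frontier (D.regP 1), σ ≠ 0 → D.specA σ ≠ 0
  boundary_zero : ∃ b > 0, ∀ᶠ ζ in 𝓝[(D.regP 1)ᶜ \ {0}] 0, b ≤ ‖D.specA ζ‖
  plane_wave : ∀ r, D.p r ∉ frontier (D.regP 1) ∧ ∀ z ∈ Z, z ≠ D.p r ∧ z ≠ -D.p r

/-- The integral along the line `∂P`, with `P*` to the left: `σ = -i p t`, `t ∈ ℝ`, where `p`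
is the parameter of one of the steps of the staircase. -/
def lineInt (f : ℂ → ℂ) : ℂ :=
  ∫ t : ℝ, f (-Complex.I * D.q 0 * t) * (-Complex.I * D.q 0)

/-- `f` is a bounded solution of the singular integral equation in the half-plane, at the lattice
point `n`. -/
def IsLineSolution (Z : Finset ℂ) (c : ℂ → ℂ) (n : Lattice N) (f : ℂ → ℂ) : Prop :=
  ContinuousOn f (D.regP 1)ᶜ ∧ (∃ b, ∀ ζ ∉ D.regP 1, ‖f ζ‖ ≤ b) ∧
    ∀ ζ ∈ D.regPstar 1, f ζ = sieRHS D.lineInt Z (D.coefC 1 c) D.refl (D.rho n) f ζ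

/-- The lattice points at which the singular integral equation is uniquely solvable and the
solution has the expansion coefficients `Λ_ε`, `Λ_{ε²}`. -/
def lineRegular (Z : Finset ℂ) (c : ℂ → ℂ) : Set (Lattice N) :=
  {n | ∃ f, D.IsLineSolution Z c n f ∧ (∃ l₁ l₂, HasExpansionIn (D.regP 1)ᶜ f l₁ l₂) ∧
    ∀ g, D.IsLineSolution Z c n g → ∀ ζ ∉ D.regP 1, g ζ = f ζ}

/-! ### The solutions

In what follows `Λ n ζ` is the `N`-dimensional Jost function, `Λε n`, `Λε2 n` are the
coefficients of its expansion, and `l` is the lattice direction of the shifts that occur. -/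

variable (Λ : Lattice N → ℂ → ℂ) (Λε Λε2 : Lattice N → ℂ)

/-- The factor `F(a, b) = ∏_r ((p_r + a)(p_r + b) / ((p_r - a)(p_r - b))) ^ (n_r / 2)`, where the
square root is the one fixed by the point `(p_r, P_r)` of the curve
`X² = (x² - a²)(x² - b²)`, namely `(p_r + a)(p_r + b) / P_r`. -/
def facF (P : Fin N → ℂ) (n : Lattice N) (a b : ℂ) : ℂ :=
  ∏ r, ((D.p r + a) * (D.p r + b) / P r) ^ n r

/-- `𝒮(a, b)` of the solution of `Q3_δ`. -/
def bigS (l : Fin N) (n : Lattice N) (a b : ℂ) : ℂ :=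
  1 / (a - b) * ((D.p l + a) * Λ (n + e l) a * Λ n b - (D.p l + b) * Λ n a * Λ (n + e l) b)

/-- The inverse scattering solution of `Q3_δ`. -/
def uQ3 (l : Fin N) (a b : ℂ) (P : Fin N → ℂ) (cA cB cC cD : ℂ) (n : Lattice N) : ℂ :=
  cA * D.facF P n a b * D.bigS Λ l n a b + cB * D.facF P n a (-b) * D.bigS Λ l n a (-b)
    + cC * D.facF P n (-a) b * D.bigS Λ l n (-a) b
    + cD * D.facF P n (-a) (-b) * D.bigS Λ l n (-a) (-b)

/-- `S(a, b)` of the solutions of `Q2` and `Q1_δ`. -/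
def smallS (l : Fin N) (n : Lattice N) (a b : ℂ) : ℂ :=
  1 / (2 * b) * (1 + (D.p l + a) * Λ (n + e l) a * deriv (Λ n) b
    - (D.p l + b) * Λ n a * deriv (Λ (n + e l)) b - Λ n a * Λ (n + e l) b)

/-- `𝒵(a)` of the solution of `Q2`. -/
def bigZ (l : Fin N) (n : Lattice N) (a : ℂ) : ℂ :=
  1 / (2 * a) *
    (((D.p l + a) * deriv (Λ (n + e l)) a + Λ (n + e l) a) * deriv (Λ n) (-a)
      - ((D.p l - a) * deriv (Λ (n + e l)) (-a) + Λ (n + e l) (-a)) * deriv (Λ n) a)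

def xi (a : ℂ) (n : Lattice N) : ℂ := 2 * a * ∑ r, D.p r / (a ^ 2 - D.p r ^ 2) * n r

def uQ2 (l : Fin N) (a cA cD ξ₀ : ℂ) (n : Lattice N) : ℂ :=
  1 / 4 * ((D.xi a n + ξ₀) ^ 2 + 1) + a * (D.xi a n + ξ₀) * D.smallS Λ l n (-a) a
    + a ^ 2 * D.bigZ Λ l n a + cA * cD
    + 1 / 2 * cA * D.rho n a * (1 - 2 * a * D.smallS Λ l n a a)
    + 1 / 2 * cD * D.rho n (-a) * (1 + 2 * a * D.smallS Λ l n (-a) (-a))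

def uQ1 (l : Fin N) (a cA cB cD ξ₀ : ℂ) (n : Lattice N) : ℂ :=
  cB * (D.xi a n + ξ₀ + 2 * a * D.smallS Λ l n (-a) a)
    + cA * D.rho n a * (1 - 2 * a * D.smallS Λ l n a a)
    + cD * D.rho n (-a) * (1 + 2 * a * D.smallS Λ l n (-a) (-a))

/-- `σ = (-1) ^ (n₁ + ⋯ + n_N)`. -/
def sgn (n : Lattice N) : ℂ := (-1) ^ (∑ r, n r)

def vartheta (a : ℂ) (P : Fin N → ℂ) (n : Lattice N) : ℂ := ∏ r, (P r / (a - D.p r)) ^ n r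

def uH3 (a : ℂ) (P : Fin N → ℂ) (cA cB cC cD : ℂ) (n : Lattice N) : ℂ :=
  (cA + sgn n * cB) * D.vartheta a P n * Λ n a
    + (sgn n * cC + cD) * (D.vartheta a P n)⁻¹ * Λ n (-a)

def varrho (n : Lattice N) : ℂ := ∑ r, D.p r * n r

def uH2 (cA ρ₀ ρ₁ : ℂ) (n : Lattice N) : ℂ :=
  (D.varrho n + ρ₀) ^ 2 + 2 * (D.varrho n + ρ₀) * Λε n + 2 * Λε2 n - cA ^ 2
    + sgn n * 2 * cA * (D.varrho n + ρ₁ + Λε n)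

def uH1 (cA cB ρ₀ ρ₁ : ℂ) (n : Lattice N) : ℂ :=
  cB * (D.varrho n + ρ₀ + Λε n) + sgn n * cA * (D.varrho n + ρ₁ + Λε n)

end InitialData

end

end LatticeIST

open Filter Topology Set

namespace LatticeIST

noncomputable section

/-! ### Volterra sums -/

/-- The sum of `μ l` over `l < i`. -/
def tailSum (μ : ℤ → ℝ) (i : ℤ) : ℝ := ∑' m : ℕ, μ (i - 1 - m)

theorem summable_comp_left {E : Type*} [NormedAddCommGroup E] [CompleteSpace E] {μ : ℤ → E}
    (h : Summable μ) (i : ℤ) : Summable fun m : ℕ => μ (i - 1 - m) :=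
  h.comp_injective (i := fun m : ℕ => i - 1 - (m : ℤ)) fun a b hab => by simpa using hab

theorem tailSum_nonneg {μ : ℤ → ℝ} (h0 : ∀ l, 0 ≤ μ l) (i : ℤ) : 0 ≤ tailSum μ i :=
  tsum_nonneg fun _ => h0 _

theorem tailSum_succ {μ : ℤ → ℝ} (h : Summable μ) (i : ℤ) :
    tailSum μ (i + 1) = μ i + tailSum μ i := by
  unfold tailSum
  rw [(summable_comp_left h (i + 1)).tsum_eq_zero_add]
  congr 1
  · simp
  · refine tsum_congr fun m => ?_
    congr 1; push_cast; ring

theorem tailSum_mono {μ : ℤ → ℝ} (h0 : ∀ l, 0 ≤ μ l) (h : Summable μ) : Monotone (tailSum μ) :=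
  monotone_int_of_le_succ fun i => by rw [tailSum_succ h]; linarith [h0 i]

theorem tendsto_tailSum_atBot (μ : ℤ → ℝ) :
    Tendsto (tailSum μ) atBot (𝓝 0) := by
  have h1 : Tendsto (fun n : ℕ => tailSum μ (-n)) atTop (𝓝 0) := by
    have := tendsto_sum_nat_add (fun m : ℕ => μ (0 - 1 - m))
    refine this.congr fun n => ?_
    unfold tailSum
    refine tsum_congr fun m => ?_
    congr 1; push_cast; ring
  have h2 : Tendsto (fun i : ℤ => (-i).toNat) atBot atTop := by
    refine tendsto_atTop.2 fun b => ?_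
    filter_upwards [eventually_le_atBot (-(b : ℤ))] with i hi
    omega
  refine (h1.comp h2).congr' ?_
  filter_upwards [eventually_le_atBot (0 : ℤ)] with i hi
  simp only [Function.comp]
  congr 1; omega

theorem sum_range_mul_exp_tailSum_le {μ : ℤ → ℝ} (h : Summable μ) (i : ℤ)
    (M : ℕ) :
    ∑ m ∈ Finset.range M, μ (i - 1 - m) * Real.exp (2 * tailSum μ (i - 1 - m))
      ≤ (Real.exp (2 * tailSum μ i) - Real.exp (2 * tailSum μ (i - M))) / 2 := by
  induction M with
  | zero => simp
  | succ M ih =>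
    rw [Finset.sum_range_succ]
    have e1 : tailSum μ (i - M) = μ (i - 1 - M) + tailSum μ (i - 1 - M) := by
      rw [← tailSum_succ h]; congr 1; ring
    have e2 : i - ((M + 1 : ℕ) : ℤ) = i - 1 - M := by push_cast; ring
    rw [e2]
    have e3 : Real.exp (2 * tailSum μ (i - M))
        = Real.exp (2 * μ (i - 1 - M)) * Real.exp (2 * tailSum μ (i - 1 - M)) := by
      rw [e1, ← Real.exp_add]; congr 1; ring
    have e4 := Real.add_one_le_exp (2 * μ (i - 1 - M))
    have e5 := Real.exp_pos (2 * tailSum μ (i - 1 - M))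
    nlinarith

theorem tsum_mul_exp_tailSum_le {μ : ℤ → ℝ} (h0 : ∀ l, 0 ≤ μ l) (h : Summable μ) (i : ℤ) :
    (Summable fun m : ℕ => μ (i - 1 - m) * Real.exp (2 * tailSum μ (i - 1 - m))) ∧
    ∑' m : ℕ, μ (i - 1 - m) * Real.exp (2 * tailSum μ (i - 1 - m))
      ≤ Real.exp (2 * tailSum μ i) / 2 := by
  have hb : ∀ M, ∑ m ∈ Finset.range M, μ (i - 1 - m) * Real.exp (2 * tailSum μ (i - 1 - m))
      ≤ Real.exp (2 * tailSum μ i) / 2 := fun M =>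
    (sum_range_mul_exp_tailSum_le h i M).trans (by
      have := Real.exp_pos (2 * tailSum μ (i - M)); linarith)
  have hn : ∀ m : ℕ, 0 ≤ μ (i - 1 - m) * Real.exp (2 * tailSum μ (i - 1 - m)) := fun m =>
    mul_nonneg (h0 _) (Real.exp_pos _).le
  exact ⟨summable_of_sum_range_le hn hb, Real.tsum_le_of_sum_range_le hn hb⟩

namespace InitialData

variable {N : ℕ} (D : InitialData N)

/-- `μ` dominates the kernel of the equation for `Λ` at `ζ`, up to the index `I`. -/
structure Dominates (μ : ℤ → ℝ) (t : ℝ) (I : ℤ) (ζ : ℂ) : Prop where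
  nonneg : ∀ l, 0 ≤ μ l
  summable : Summable μ
  t_nonneg : 0 ≤ t
  t_le : t ≤ 1
  bound : ∀ i l, l < i → i ≤ I → ‖D.kerF i l ζ * D.υ l‖ ≤ t * μ l

variable {D} {μ : ℤ → ℝ} {t : ℝ} {I : ℤ} {ζ : ℂ}

theorem Dominates.norm_neumannH_le (h : D.Dominates μ t I ζ) (k : ℕ) :
    ∀ i ≤ I, ‖D.neumannH k i ζ‖ ≤ (1 / 2) ^ k * Real.exp (2 * tailSum μ i) := by
  induction k with
  | zero =>
    intro i _
    simp only [neumannH, norm_one, pow_zero, one_mul]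
    have := tailSum_nonneg h.nonneg i
    exact Real.one_le_exp (by linarith)
  | succ k ih =>
    intro i hi
    obtain ⟨hs, hle⟩ := tsum_mul_exp_tailSum_le h.nonneg h.summable i
    simp only [neumannH]
    have hb : ∀ m : ℕ, ‖D.kerF i (i - 1 - m) ζ * D.υ (i - 1 - m) * D.neumannH k (i - 1 - m) ζ‖
        ≤ (1 / 2) ^ k * (μ (i - 1 - m) * Real.exp (2 * tailSum μ (i - 1 - m))) := by
      intro m
      rw [norm_mul]
      have h1 := h.bound i (i - 1 - m) (by omega) hi
      have h2 := ih (i - 1 - m) (by omega)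
      have h3 := h.nonneg (i - 1 - m)
      have h4 : t * μ (i - 1 - m) ≤ μ (i - 1 - m) := by nlinarith [h.t_le]
      calc _ ≤ μ (i - 1 - m) * ((1 / 2) ^ k * Real.exp (2 * tailSum μ (i - 1 - m))) := by
            gcongr; exact h1.trans h4
        _ = _ := by ring
    calc _ ≤ ∑' m : ℕ, (1 / 2) ^ k * (μ (i - 1 - m) * Real.exp (2 * tailSum μ (i - 1 - m))) :=
          tsum_of_norm_bounded (hs.mul_left _).hasSum hb
      _ = (1 / 2) ^ k * ∑' m : ℕ, (μ (i - 1 - m) * Real.exp (2 * tailSum μ (i - 1 - m))) :=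
          tsum_mul_left
      _ ≤ (1 / 2) ^ k * (Real.exp (2 * tailSum μ i) / 2) := by gcongr
      _ = _ := by ring

theorem Dominates.norm_neumannH_le' (h : D.Dominates μ t I ζ) (k : ℕ) {i : ℤ} (hi : i ≤ I) :
    ‖D.neumannH k i ζ‖ ≤ (1 / 2) ^ k * Real.exp (2 * tailSum μ I) :=
  (h.norm_neumannH_le k i hi).trans (by
    have := tailSum_mono h.nonneg h.summable hi
    gcongr)

theorem Dominates.norm_term_le (h : D.Dominates μ t I ζ) (k : ℕ) {i : ℤ} (hi : i ≤ I) (m : ℕ) :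
    ‖D.kerF i (i - 1 - m) ζ * D.υ (i - 1 - m) * D.neumannH k (i - 1 - m) ζ‖
      ≤ t * ((1 / 2) ^ k * Real.exp (2 * tailSum μ I)) * μ (i - 1 - m) := by
  rw [norm_mul]
  have h1 := h.bound i (i - 1 - m) (by omega) hi
  have h2 := h.norm_neumannH_le' k (i := i - 1 - m) (by omega)
  have h3 := mul_nonneg h.t_nonneg (h.nonneg (i - 1 - m))
  calc _ ≤ t * μ (i - 1 - m) * ((1 / 2) ^ k * Real.exp (2 * tailSum μ I)) := by gcongr
    _ = _ := by ring

theorem Dominates.norm_neumannH_succ_le (h : D.Dominates μ t I ζ) (k : ℕ) {i : ℤ} (hi : i ≤ I) :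
    ‖D.neumannH (k + 1) i ζ‖
      ≤ t * ((1 / 2) ^ k * Real.exp (2 * tailSum μ I)) * tailSum μ i := by
  simp only [neumannH]
  refine (tsum_of_norm_bounded ((summable_comp_left h.summable i).mul_left _).hasSum
    (h.norm_term_le k hi)).trans ?_
  rw [tsum_mul_left]; rfl

theorem Dominates.summable_neumannH (h : D.Dominates μ t I ζ) {i : ℤ} (hi : i ≤ I) :
    Summable fun k => D.neumannH k i ζ :=
  Summable.of_norm_bounded
    ((summable_geometric_of_lt_one (by norm_num) (by norm_num)).mul_right _)
    (fun k => h.norm_neumannH_le' k hi)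

theorem Dominates.norm_jostΛ_le (h : D.Dominates μ t I ζ) {i : ℤ} (hi : i ≤ I) :
    ‖D.jostΛ i ζ‖ ≤ 2 * Real.exp (2 * tailSum μ I) := by
  have := tsum_of_norm_bounded
    ((hasSum_geometric_of_lt_one (by norm_num) (by norm_num)).mul_right
      (Real.exp (2 * tailSum μ I))) (fun k => h.norm_neumannH_le' k hi)
  refine this.trans (le_of_eq ?_)
  norm_num

theorem Dominates.norm_jostΛ_sub_one_le (h : D.Dominates μ t I ζ) {i : ℤ} (hi : i ≤ I) :
    ‖D.jostΛ i ζ - 1‖ ≤ t * (2 * Real.exp (2 * tailSum μ I)) * tailSum μ i := by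
  have e : D.jostΛ i ζ - 1 = ∑' k, D.neumannH (k + 1) i ζ := by
    unfold jostΛ
    rw [(h.summable_neumannH hi).tsum_eq_zero_add]
    simp [neumannH]
  rw [e]
  have hg : HasSum (fun k : ℕ => t * ((1 / 2) ^ k * Real.exp (2 * tailSum μ I)) * tailSum μ i)
      (t * (2 * Real.exp (2 * tailSum μ I)) * tailSum μ i) := by
    have := hasSum_geometric_of_lt_one (r := (1 / 2 : ℝ)) (by norm_num) (by norm_num)
    have e2 : (1 - 1 / 2 : ℝ)⁻¹ = 2 := by norm_num
    rw [e2] at this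
    exact ((this.mul_right _).mul_left t).mul_right _
  exact tsum_of_norm_bounded hg (fun k => h.norm_neumannH_succ_le k hi)

theorem Dominates.norm_jost_term_le (h : D.Dominates μ t I ζ) {i : ℤ} (hi : i ≤ I) (m : ℕ) :
    ‖D.kerF i (i - 1 - m) ζ * D.υ (i - 1 - m) * D.jostΛ (i - 1 - m) ζ‖
      ≤ t * (2 * Real.exp (2 * tailSum μ I)) * μ (i - 1 - m) := by
  rw [norm_mul]
  have h1 := h.bound i (i - 1 - m) (by omega) hi
  have h2 := h.norm_jostΛ_le (i := i - 1 - m) (by omega)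
  have h3 := mul_nonneg h.t_nonneg (h.nonneg (i - 1 - m))
  calc _ ≤ t * μ (i - 1 - m) * (2 * Real.exp (2 * tailSum μ I)) := by gcongr
    _ = _ := by ring

theorem Dominates.summable_jost_term (h : D.Dominates μ t I ζ) {i : ℤ} (hi : i ≤ I) :
    Summable fun m : ℕ => D.kerF i (i - 1 - m) ζ * D.υ (i - 1 - m) * D.jostΛ (i - 1 - m) ζ :=
  Summable.of_norm_bounded ((summable_comp_left h.summable i).mul_left _) (h.norm_jost_term_le hi)

theorem Dominates.jostΛ_eq (h : D.Dominates μ t I ζ) {i : ℤ} (hi : i ≤ I) :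
    D.jostΛ i ζ
      = 1 + ∑' m : ℕ, D.kerF i (i - 1 - m) ζ * D.υ (i - 1 - m) * D.jostΛ (i - 1 - m) ζ := by
  have e : D.jostΛ i ζ = 1 + ∑' k, D.neumannH (k + 1) i ζ := by
    unfold jostΛ
    rw [(h.summable_neumannH hi).tsum_eq_zero_add]
    simp [neumannH]
  rw [e]
  congr 1
  simp only [neumannH]
  have hs : Summable (Function.uncurry fun (k m : ℕ) =>
      D.kerF i (i - 1 - m) ζ * D.υ (i - 1 - m) * D.neumannH k (i - 1 - m) ζ) := by
    have hg : Summable fun k : ℕ => t * ((1 / 2 : ℝ) ^ k * Real.exp (2 * tailSum μ I)) :=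
      ((summable_geometric_of_lt_one (by norm_num) (by norm_num)).mul_right _).mul_left t
    have := hg.mul_of_nonneg (summable_comp_left h.summable i)
      (fun k => mul_nonneg h.t_nonneg (by positivity)) (fun m => h.nonneg _)
    exact Summable.of_norm_bounded this fun x => h.norm_term_le x.1 hi x.2
  rw [← hs.tsum_comm]
  refine tsum_congr fun m => ?_
  rw [tsum_mul_left]; rfl

end InitialData

namespace InitialData

variable {N : ℕ} (D : InitialData N) {K : ℝ} {ζ : ℂ}

/-! ### Bounds for the kernel outside `P` -/

theorem norm_sub_le_of_notMem (h : ζ ∉ D.regP K) (i : ℤ) :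
    ‖D.q i - ζ‖ ≤ K * ‖D.q i + ζ‖ := by
  by_contra hc
  exact h ⟨i, not_le.1 hc⟩

theorem exists_norm_q_ge (hq : ∀ i, D.q i ≠ 0) : ∃ m > 0, ∀ i, m ≤ ‖D.q i‖ := by
  obtain ⟨r, ⟨i, rfl⟩, hr⟩ := Set.exists_min_image (range D.dir) (fun r => ‖D.p r‖)
    (Set.toFinite _) ⟨D.dir 0, mem_range_self 0⟩
  exact ⟨‖D.q i‖, norm_pos_iff.2 (hq i), fun j => hr _ (mem_range_self j)⟩

theorem exists_norm_q_le : ∃ m > 0, ∀ i, ‖D.q i‖ ≤ m := by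
  obtain ⟨r, ⟨i, rfl⟩, hr⟩ := Set.exists_max_image (range D.dir) (fun r => ‖D.p r‖)
    (Set.toFinite _) ⟨D.dir 0, mem_range_self 0⟩
  exact ⟨‖D.q i‖ + 1, by positivity, fun j => (hr _ (mem_range_self j)).trans (by
    change ‖D.q i‖ ≤ _; linarith)⟩

theorem exists_le_norm_add (hK : 1 ≤ K) (hq : ∀ i, D.q i ≠ 0) :
    ∃ C > 0, ∀ ζ ∉ D.regP K, ∀ i, 1 + ‖ζ‖ ≤ C * ‖D.q i + ζ‖ := by
  obtain ⟨m, hm, hmi⟩ := D.exists_norm_q_ge hq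
  refine ⟨(1 + K) / (2 * m) + (3 + K) / 2, by positivity, fun ζ hζ i => ?_⟩
  have h1 := D.norm_sub_le_of_notMem hζ i
  have h2 : 2 * ‖D.q i‖ ≤ (1 + K) * ‖D.q i + ζ‖ := by
    have : ‖(2 : ℂ) * D.q i‖ ≤ ‖D.q i + ζ‖ + ‖D.q i - ζ‖ := by
      have e : (2 : ℂ) * D.q i = (D.q i + ζ) + (D.q i - ζ) := by ring
      rw [e]; exact norm_add_le _ _
    rw [norm_mul] at this
    simp only [Complex.norm_ofNat] at this
    linarith
  have h3 : ‖ζ‖ ≤ ‖D.q i + ζ‖ + ‖D.q i‖ := by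
    have e : ζ = (D.q i + ζ) - D.q i := by ring
    conv_lhs => rw [e]
    exact norm_sub_le _ _
  have h4 : 1 ≤ (1 + K) / (2 * m) * ‖D.q i + ζ‖ := by
    rw [div_mul_eq_mul_div, le_div_iff₀ (by positivity)]
    linarith [hmi i]
  have h5 : ‖ζ‖ ≤ (3 + K) / 2 * ‖D.q i + ζ‖ := by linarith
  rw [add_mul]; linarith

theorem q_add_ne_zero (hK : 1 ≤ K) (hq : ∀ i, D.q i ≠ 0) (h : ζ ∉ D.regP K) (i : ℤ) :
    D.q i + ζ ≠ 0 := by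
  obtain ⟨C, -, hC⟩ := D.exists_le_norm_add hK hq
  intro h0
  have := hC ζ h i
  rw [h0, norm_zero, mul_zero] at this
  linarith [norm_nonneg ζ]

theorem neg_mem_regP_iff : -ζ ∈ D.regP K ↔ ζ ∈ D.regPstar K := by
  simp [regP, regPstar, sub_eq_add_neg]

theorem norm_ratio_le (hK : 1 ≤ K) (hq : ∀ i, D.q i ≠ 0) (h : ζ ∉ D.regP K) (i : ℤ) :
    ‖(D.q i - ζ) / (D.q i + ζ)‖ ≤ K := by
  rw [norm_div, div_le_iff₀ (norm_pos_iff.2 (D.q_add_ne_zero hK hq h i))]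
  exact D.norm_sub_le_of_notMem h i

theorem norm_prod_ratio_le (hK : 1 ≤ K) (hq : ∀ i, D.q i ≠ 0) (h : ζ ∉ D.regP K) (l r : ℤ) :
    ‖∏ s ∈ Finset.Ico l r, ((D.q s - ζ) / (D.q s + ζ))‖ ≤ K ^ (r - l).toNat := by
  rw [norm_prod, ← Int.card_Ico]
  rw [← Finset.prod_const]
  exact Finset.prod_le_prod (fun _ _ => norm_nonneg _) fun s _ => D.norm_ratio_le hK hq h s

theorem norm_kerF_le (hK : 1 ≤ K) (hq : ∀ i, D.q i ≠ 0) {C : ℝ} (hC0 : 0 < C)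
    (hC : ∀ ζ ∉ D.regP K, ∀ i, 1 + ‖ζ‖ ≤ C * ‖D.q i + ζ‖) (h : ζ ∉ D.regP K) (i l : ℤ) :
    ‖D.kerF i l ζ‖ ≤ C / (1 + ‖ζ‖) * ((i - l).toNat * K ^ (i - l).toNat) := by
  unfold kerF
  have h1 : ∀ r ∈ Finset.Ico l i, ‖(1 / (D.q r + ζ))
      * ∏ s ∈ Finset.Ico l r, ((D.q s - ζ) / (D.q s + ζ))‖
      ≤ C / (1 + ‖ζ‖) * K ^ (i - l).toNat := by
    intro r hr
    rw [Finset.mem_Ico] at hr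
    rw [norm_mul, norm_div, norm_one]
    have h2 : 1 / ‖D.q r + ζ‖ ≤ C / (1 + ‖ζ‖) := by
      rw [div_le_div_iff₀ (norm_pos_iff.2 (D.q_add_ne_zero hK hq h r)) (by positivity), one_mul]
      exact hC ζ h r
    have h3 : K ^ (r - l).toNat ≤ K ^ (i - l).toNat := pow_le_pow_right₀ hK (by omega)
    have h4 := (D.norm_prod_ratio_le hK hq h l r).trans h3
    gcongr
  refine (norm_sum_le_of_le _ h1).trans ?_
  rw [Finset.sum_const, Int.card_Ico, nsmul_eq_mul]
  exact le_of_eq (by ring)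

/-- The initial data with another potential. -/
abbrev withPot (υ : ℤ → ℂ) : InitialData N := { D with υ := υ }

theorem exists_dominates (hK : 1 ≤ K) (hq : ∀ i, D.q i ≠ 0) (hs : D.SummableWeight K) (I : ℤ) :
    ∃ μ : ℤ → ℝ, ∀ υ : ℤ → ℂ, (∀ l, ‖υ l‖ ≤ ‖D.υ l‖) → ∀ ζ ∉ D.regP K,
      (D.withPot υ).Dominates μ (1 / (1 + ‖ζ‖)) I ζ := by
  obtain ⟨C, hC0, hC⟩ := D.exists_le_norm_add hK hq
  refine ⟨fun l => C * (1 + I.natAbs) * K ^ I.natAbs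
    * (‖D.υ l‖ * K ^ l.natAbs * (1 + (l.natAbs : ℝ))), fun υ hυ ζ hζ => ?_⟩
  have hK0 : 0 ≤ K := by linarith
  refine ⟨fun l => by positivity, hs.mul_left _, by positivity, ?_, fun i l hl hi => ?_⟩
  · rw [div_le_one (by positivity)]; linarith [norm_nonneg ζ]
  · change ‖D.kerF i l ζ * υ l‖ ≤ _
    rw [norm_mul]
    have h1 := D.norm_kerF_le hK hq hC0 hC hζ i l
    have h2 : (i - l).toNat ≤ I.natAbs + l.natAbs := by omega
    have h3 : K ^ (i - l).toNat ≤ K ^ I.natAbs * K ^ l.natAbs := by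
      rw [← pow_add]; exact pow_le_pow_right₀ hK h2
    have h4 : ((i - l).toNat : ℝ) ≤ (1 + I.natAbs) * (1 + (l.natAbs : ℝ)) := by
      have : ((i - l).toNat : ℝ) ≤ I.natAbs + l.natAbs := by exact_mod_cast h2
      nlinarith [mul_nonneg (Nat.cast_nonneg (α := ℝ) I.natAbs) (Nat.cast_nonneg (α := ℝ) l.natAbs)]
    calc ‖D.kerF i l ζ‖ * ‖υ l‖
        ≤ (C / (1 + ‖ζ‖) * (((1 + I.natAbs) * (1 + (l.natAbs : ℝ)))
            * (K ^ I.natAbs * K ^ l.natAbs))) * ‖D.υ l‖ := by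
          have := hυ l
          refine mul_le_mul (h1.trans ?_) this (norm_nonneg _) (by positivity)
          gcongr
      _ = _ := by ring

/-! ### The Jost function `Λ` -/

theorem isOpen_regP (K : ℝ) : IsOpen (D.regP K) := by
  have : D.regP K = ⋃ i, {ζ | K * ‖D.q i + ζ‖ < ‖D.q i - ζ‖} := by ext; simp [regP]
  rw [this]
  exact isOpen_iUnion fun i => isOpen_lt (by fun_prop) (by fun_prop)

theorem isOpen_regPstar (K : ℝ) : IsOpen (D.regPstar K) := by
  have : D.regPstar K = ⋃ i, {ζ | K * ‖D.q i - ζ‖ < ‖D.q i + ζ‖} := by ext; simp [regPstar]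
  rw [this]
  exact isOpen_iUnion fun i => isOpen_lt (by fun_prop) (by fun_prop)

theorem continuousOn_kerF (hK : 1 ≤ K) (hq : ∀ i, D.q i ≠ 0) (i l : ℤ) :
    ContinuousOn (D.kerF i l) (D.regP K)ᶜ := by
  unfold kerF
  refine continuousOn_finsetSum _ fun r _ => ?_
  refine ContinuousOn.mul ?_ (continuousOn_finsetProd _ fun s _ => ?_)
  · exact continuousOn_const.div (by fun_prop) fun ζ hζ => D.q_add_ne_zero hK hq hζ r
  · exact ContinuousOn.div (by fun_prop) (by fun_prop) fun ζ hζ => D.q_add_ne_zero hK hq hζ s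

theorem differentiableOn_kerF (hK : 1 ≤ K) (hq : ∀ i, D.q i ≠ 0) (i l : ℤ) :
    DifferentiableOn ℂ (D.kerF i l) (closure (D.regP K))ᶜ := by
  have hsub : (closure (D.regP K))ᶜ ⊆ (D.regP K)ᶜ := compl_subset_compl.2 subset_closure
  unfold kerF
  refine DifferentiableOn.fun_sum fun r _ => ?_
  refine DifferentiableOn.mul ?_ (DifferentiableOn.fun_finsetProd fun s _ => ?_)
  · exact (differentiableOn_const _).div (by fun_prop)
      fun ζ hζ => D.q_add_ne_zero hK hq (hsub hζ) r
  · exact DifferentiableOn.div (by fun_prop) (by fun_prop)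
      fun ζ hζ => D.q_add_ne_zero hK hq (hsub hζ) s

variable {μ : ℤ → ℝ} {I : ℤ}

theorem continuousOn_neumannH (hK : 1 ≤ K) (hq : ∀ i, D.q i ≠ 0)
    (h : ∀ ζ ∉ D.regP K, D.Dominates μ (1 / (1 + ‖ζ‖)) I ζ) (k : ℕ) :
    ∀ i ≤ I, ContinuousOn (D.neumannH k i) (D.regP K)ᶜ := by
  induction k with
  | zero => intro i _; exact continuousOn_const
  | succ k ih =>
    intro i hi
    by_cases hne : (D.regP K)ᶜ.Nonempty
    swap
    · rw [Set.not_nonempty_iff_eq_empty.1 hne]; exact continuousOn_empty _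
    obtain ⟨ζ₀, hζ₀⟩ := hne
    have hs := (summable_comp_left (h ζ₀ hζ₀).summable i).mul_left
      ((1 / 2) ^ k * Real.exp (2 * tailSum μ I))
    change ContinuousOn (fun ζ => ∑' m : ℕ,
      D.kerF i (i - 1 - m) ζ * D.υ (i - 1 - m) * D.neumannH k (i - 1 - m) ζ) _
    refine continuousOn_tsum (fun m => ?_) hs fun m ζ hζ => ?_
    · exact ((D.continuousOn_kerF hK hq _ _).mul continuousOn_const).mul (ih _ (by omega))
    · refine ((h ζ hζ).norm_term_le k hi m).trans ?_
      have h1 := (h ζ hζ).t_le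
      have h2 := (h ζ hζ).nonneg (i - 1 - m)
      have h3 : 0 ≤ (1 / 2) ^ k * Real.exp (2 * tailSum μ I) := by positivity
      nlinarith [mul_nonneg h3 h2]

theorem continuousOn_jostΛ_of_dominates (hK : 1 ≤ K) (hq : ∀ i, D.q i ≠ 0)
    (h : ∀ ζ ∉ D.regP K, D.Dominates μ (1 / (1 + ‖ζ‖)) I ζ) {i : ℤ} (hi : i ≤ I) :
    ContinuousOn (D.jostΛ i) (D.regP K)ᶜ :=
  continuousOn_tsum (fun k => D.continuousOn_neumannH hK hq h k i hi)
    ((summable_geometric_of_lt_one (by norm_num) (by norm_num)).mul_right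
      (Real.exp (2 * tailSum μ I)))
    (fun k ζ hζ => (h ζ hζ).norm_neumannH_le' k hi)

theorem differentiableOn_neumannH (hK : 1 ≤ K) (hq : ∀ i, D.q i ≠ 0)
    (h : ∀ ζ ∉ D.regP K, D.Dominates μ (1 / (1 + ‖ζ‖)) I ζ) (k : ℕ) :
    ∀ i ≤ I, DifferentiableOn ℂ (D.neumannH k i) (closure (D.regP K))ᶜ := by
  have hsub : (closure (D.regP K))ᶜ ⊆ (D.regP K)ᶜ := compl_subset_compl.2 subset_closure
  induction k with
  | zero => intro i _; exact differentiableOn_const _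
  | succ k ih =>
    intro i hi
    by_cases hne : (closure (D.regP K))ᶜ.Nonempty
    swap
    · rw [Set.not_nonempty_iff_eq_empty.1 hne]; exact differentiableOn_empty
    obtain ⟨ζ₀, hζ₀⟩ := hne
    have hs := (summable_comp_left (h ζ₀ (hsub hζ₀)).summable i).mul_left
      ((1 / 2) ^ k * Real.exp (2 * tailSum μ I))
    change DifferentiableOn ℂ (fun ζ => ∑' m : ℕ,
      D.kerF i (i - 1 - m) ζ * D.υ (i - 1 - m) * D.neumannH k (i - 1 - m) ζ) _
    refine Complex.differentiableOn_tsum_of_summable_norm hs (fun m => ?_)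
      isClosed_closure.isOpen_compl fun m ζ hζ => ?_
    · exact ((D.differentiableOn_kerF hK hq _ _).mul (differentiableOn_const _)).mul
        (ih _ (by omega))
    · replace hζ := hsub hζ
      refine ((h ζ hζ).norm_term_le k hi m).trans ?_
      have h1 := (h ζ hζ).t_le
      have h2 := (h ζ hζ).nonneg (i - 1 - m)
      have h3 : 0 ≤ (1 / 2) ^ k * Real.exp (2 * tailSum μ I) := by positivity
      nlinarith [mul_nonneg h3 h2]

theorem differentiableOn_jostΛ_of_dominates (hK : 1 ≤ K) (hq : ∀ i, D.q i ≠ 0)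
    (h : ∀ ζ ∉ D.regP K, D.Dominates μ (1 / (1 + ‖ζ‖)) I ζ) {i : ℤ} (hi : i ≤ I) :
    DifferentiableOn ℂ (D.jostΛ i) (closure (D.regP K))ᶜ :=
  Complex.differentiableOn_tsum_of_summable_norm
    ((summable_geometric_of_lt_one (by norm_num) (by norm_num)).mul_right
      (Real.exp (2 * tailSum μ I)))
    (fun k => D.differentiableOn_neumannH hK hq h k i hi)
    isClosed_closure.isOpen_compl
    (fun k ζ hζ => (h ζ fun hc => hζ (subset_closure hc)).norm_neumannH_le' k hi)

/-- The standing assumptions on the data of the direct problem. -/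
structure Direct (K : ℝ) : Prop where
  one_le : 1 ≤ K
  q_ne : ∀ i, D.q i ≠ 0
  summable : D.SummableWeight K

variable {D}

theorem Direct.exists_dominates (h : D.Direct K) (I : ℤ) :
    ∃ μ : ℤ → ℝ, ∀ ζ ∉ D.regP K, D.Dominates μ (1 / (1 + ‖ζ‖)) I ζ := by
  obtain ⟨μ, hμ⟩ := D.exists_dominates h.one_le h.q_ne h.summable I
  exact ⟨μ, fun ζ hζ => hμ D.υ (fun _ => le_rfl) ζ hζ⟩

theorem Direct.continuousOn_jostΛ (h : D.Direct K) (i : ℤ) :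
    ContinuousOn (D.jostΛ i) (D.regP K)ᶜ := by
  obtain ⟨μ, hμ⟩ := h.exists_dominates i
  exact D.continuousOn_jostΛ_of_dominates h.one_le h.q_ne hμ le_rfl

theorem Direct.differentiableOn_jostΛ (h : D.Direct K) (i : ℤ) :
    DifferentiableOn ℂ (D.jostΛ i) (closure (D.regP K))ᶜ := by
  obtain ⟨μ, hμ⟩ := h.exists_dominates i
  exact D.differentiableOn_jostΛ_of_dominates h.one_le h.q_ne hμ le_rfl

theorem Direct.exists_norm_jostΛ_sub_one_le (h : D.Direct K) (I : ℤ) :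
    ∃ C, ∀ ζ ∉ D.regP K, ∀ i ≤ I, ‖D.jostΛ i ζ - 1‖ ≤ C / (1 + ‖ζ‖) := by
  obtain ⟨μ, hμ⟩ := h.exists_dominates I
  refine ⟨2 * Real.exp (2 * tailSum μ I) * tailSum μ I, fun ζ hζ i hi => ?_⟩
  refine ((hμ ζ hζ).norm_jostΛ_sub_one_le hi).trans ?_
  have := tailSum_mono (hμ ζ hζ).nonneg (hμ ζ hζ).summable hi
  calc _ ≤ 1 / (1 + ‖ζ‖) * (2 * Real.exp (2 * tailSum μ I)) * tailSum μ I := by gcongr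
    _ = _ := by ring

theorem Direct.tendsto_jostΛ_atBot (h : D.Direct K) (hζ : ζ ∉ D.regP K) :
    Tendsto (fun i => D.jostΛ i ζ) atBot (𝓝 1) := by
  obtain ⟨μ, hμ⟩ := h.exists_dominates 0
  rw [tendsto_iff_norm_sub_tendsto_zero]
  have h1 : Tendsto (fun i => 1 / (1 + ‖ζ‖) * (2 * Real.exp (2 * tailSum μ 0)) * tailSum μ i)
      atBot (𝓝 0) := by
    simpa using (tendsto_tailSum_atBot μ).const_mul
      (1 / (1 + ‖ζ‖) * (2 * Real.exp (2 * tailSum μ 0)))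
  refine squeeze_zero' (Eventually.of_forall fun _ => norm_nonneg _) ?_ h1
  filter_upwards [eventually_le_atBot (0 : ℤ)] with i hi
  exact (hμ ζ hζ).norm_jostΛ_sub_one_le hi

theorem kerF_succ (i l : ℤ) (hl : l ≤ i) (ζ : ℂ) :
    D.kerF (i + 1) l ζ = D.kerF i l ζ
      + (1 / (D.q i + ζ)) * ∏ s ∈ Finset.Ico l i, ((D.q s - ζ) / (D.q s + ζ)) := by
  unfold kerF
  rw [← Finset.insert_Ico_right_eq_Ico_add_one hl, Finset.sum_insert (by simp), add_comm]

theorem prod_Ico_succ (f : ℤ → ℂ) {l i : ℤ} (hl : l ≤ i) :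
    ∏ s ∈ Finset.Ico l (i + 1), f s = f i * ∏ s ∈ Finset.Ico l i, f s := by
  rw [← Finset.insert_Ico_right_eq_Ico_add_one hl, Finset.prod_insert (by simp)]

theorem Direct.q_mul_jostΛ_sub (h : D.Direct K) (hζ : ζ ∉ D.regP K) (i : ℤ) :
    (Summable fun m : ℕ => (∏ s ∈ Finset.Ico (i - m) i, ((D.q s - ζ) / (D.q s + ζ)))
      * D.υ (i - m) * D.jostΛ (i - m) ζ) ∧
    (D.q i + ζ) * (D.jostΛ (i + 1) ζ - D.jostΛ i ζ)
      = ∑' m : ℕ, (∏ s ∈ Finset.Ico (i - m) i, ((D.q s - ζ) / (D.q s + ζ)))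
        * D.υ (i - m) * D.jostΛ (i - m) ζ := by
  obtain ⟨μ, hμ⟩ := h.exists_dominates (i + 1)
  have hd := hμ ζ hζ
  have hne := D.q_add_ne_zero h.one_le h.q_ne hζ i
  have hs1 : Summable fun m : ℕ => D.kerF (i + 1) (i - m) ζ * D.υ (i - m) * D.jostΛ (i - m) ζ := by
    have := hd.summable_jost_term le_rfl
    simpa only [add_sub_cancel_right] using this
  have hs2 : Summable fun m : ℕ => D.kerF i (i - m) ζ * D.υ (i - m) * D.jostΛ (i - m) ζ := by
    rw [← summable_nat_add_iff 1]
    refine (hd.summable_jost_term (i := i) (by omega)).congr fun m => ?_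
    have : i - ((m + 1 : ℕ) : ℤ) = i - 1 - m := by push_cast; ring
    rw [this]
  have e1 : D.jostΛ (i + 1) ζ = 1 + ∑' m : ℕ,
      D.kerF (i + 1) (i - m) ζ * D.υ (i - m) * D.jostΛ (i - m) ζ := by
    rw [hd.jostΛ_eq le_rfl]
    simp only [add_sub_cancel_right]
  have e2 : D.jostΛ i ζ = 1 + ∑' m : ℕ,
      D.kerF i (i - m) ζ * D.υ (i - m) * D.jostΛ (i - m) ζ := by
    rw [hd.jostΛ_eq (by omega), hs2.tsum_eq_zero_add]
    simp only [Nat.cast_zero, sub_zero, kerF, Finset.Ico_self, Finset.sum_empty, zero_mul, zero_add]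
    congr 1
    refine tsum_congr fun m => ?_
    have : i - ((m + 1 : ℕ) : ℤ) = i - 1 - m := by push_cast; ring
    rw [this]
  have e3 : ∀ m : ℕ, (∏ s ∈ Finset.Ico (i - m) i, ((D.q s - ζ) / (D.q s + ζ)))
        * D.υ (i - m) * D.jostΛ (i - m) ζ
      = (D.q i + ζ) * (D.kerF (i + 1) (i - m) ζ * D.υ (i - m) * D.jostΛ (i - m) ζ
        - D.kerF i (i - m) ζ * D.υ (i - m) * D.jostΛ (i - m) ζ) := by
    intro m
    rw [kerF_succ i (i - m) (by omega) ζ]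
    field_simp
    ring
  simp only [e3]
  refine ⟨(hs1.sub hs2).mul_left _, ?_⟩
  rw [tsum_mul_left, hs1.tsum_sub hs2, e1]
  conv_lhs => rw [e2]
  ring

theorem Direct.recurrence (h : D.Direct K) (hζ : ζ ∉ D.regP K) (i : ℤ) :
    (D.q (i + 1) + ζ) * (D.jostΛ (i + 2) ζ - D.jostΛ (i + 1) ζ)
      = (D.q i - ζ) * (D.jostΛ (i + 1) ζ - D.jostΛ i ζ) + D.υ (i + 1) * D.jostΛ (i + 1) ζ := by
  obtain ⟨hs, he⟩ := h.q_mul_jostΛ_sub hζ i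
  obtain ⟨hs', he'⟩ := h.q_mul_jostΛ_sub hζ (i + 1)
  have hne := D.q_add_ne_zero h.one_le h.q_ne hζ i
  have e2 : i + 1 + 1 = i + 2 := by ring
  rw [e2] at he'
  rw [he', hs'.tsum_eq_zero_add]
  have e3 : ∀ m : ℕ, (∏ s ∈ Finset.Ico (i + 1 - ((m + 1 : ℕ) : ℤ)) (i + 1),
        ((D.q s - ζ) / (D.q s + ζ))) * D.υ (i + 1 - ((m + 1 : ℕ) : ℤ))
        * D.jostΛ (i + 1 - ((m + 1 : ℕ) : ℤ)) ζ
      = (D.q i - ζ) / (D.q i + ζ) * ((∏ s ∈ Finset.Ico (i - m) i, ((D.q s - ζ) / (D.q s + ζ)))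
        * D.υ (i - m) * D.jostΛ (i - m) ζ) := by
    intro m
    have : i + 1 - ((m + 1 : ℕ) : ℤ) = i - m := by push_cast; ring
    rw [this, prod_Ico_succ _ (by omega)]
    ring
  simp only [e3]
  rw [tsum_mul_left, ← he]
  simp only [Nat.cast_zero, sub_zero, Finset.Ico_self, Finset.prod_empty]
  field_simp
  ring

/-! ### The Jost function `Υ`, by reversal of the staircase -/

variable (D) in
/-- The staircase traversed in the opposite direction. -/
def reverse : InitialData N where
  p := D.p
  dir i := D.dir (-1 - i)
  υ i := D.υ (-i)

theorem q_reverse (i : ℤ) : D.reverse.q i = D.q (-1 - i) := rfl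

theorem regP_reverse : D.reverse.regP K = D.regP K := by
  ext ζ
  constructor
  · rintro ⟨i, hi⟩; exact ⟨-1 - i, hi⟩
  · rintro ⟨i, hi⟩
    refine ⟨-1 - i, ?_⟩
    rw [q_reverse]
    simpa using hi

theorem direct_reverse (h : D.Direct K) : D.reverse.Direct K where
  one_le := h.one_le
  q_ne i := h.q_ne _
  summable := by
    have := (Equiv.neg ℤ).summable_iff.2 h.summable
    refine this.congr fun i => ?_
    simp [reverse]

theorem kerF_reverse (hζ : ∀ i, D.q i + ζ ≠ 0) (i : ℤ) (m : ℕ) :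
    D.reverse.kerF (-i) (-i - m) ζ = D.kerF (i + m) i ζ := by
  induction m with
  | zero => simp [kerF]
  | succ m ih =>
    have e1 : i + ((m + 1 : ℕ) : ℤ) = i + m + 1 := by push_cast; ring
    rw [e1, kerF_succ (i + m) i (by omega) ζ, ← ih]
    have e2 : Finset.Ico (-i - ((m + 1 : ℕ) : ℤ)) (-i)
        = insert (-i - m - 1) (Finset.Ico (-i - m : ℤ) (-i)) := by
      ext x; simp only [Finset.mem_Ico, Finset.mem_insert]; push_cast; omega
    have e3 : ∀ r ∈ Finset.Ico (-i - m : ℤ) (-i), Finset.Ico (-i - ((m + 1 : ℕ) : ℤ)) r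
        = insert (-i - m - 1) (Finset.Ico (-i - m : ℤ) r) := by
      intro r hr
      rw [Finset.mem_Ico] at hr
      ext x; simp only [Finset.mem_Ico, Finset.mem_insert]; push_cast; omega
    have e4 : D.reverse.q (-i - m - 1) = D.q (i + m) := by
      rw [q_reverse]; congr 1; ring
    have hne := hζ (i + m)
    have hprod : ∏ s ∈ Finset.Ico (-i - m : ℤ) (-i), ((D.reverse.q s - ζ) / (D.reverse.q s + ζ))
        = ∏ s ∈ Finset.Ico i (i + m), ((D.q s - ζ) / (D.q s + ζ)) := by
      refine Finset.prod_nbij' (fun s => -1 - s) (fun s => -1 - s) ?_ ?_ ?_ ?_ ?_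
      · intro s hs; rw [Finset.mem_Ico] at hs ⊢; omega
      · intro s hs; rw [Finset.mem_Ico] at hs ⊢; omega
      · intro s _; ring
      · intro s _; ring
      · intro s _; rw [q_reverse]
    have hK : ∀ n : ℕ, 2 * ζ * D.reverse.kerF (-i - m + n) (-i - m) ζ = 1 - ∏ s ∈
        Finset.Ico (-i - m : ℤ) (-i - m + n), ((D.reverse.q s - ζ) / (D.reverse.q s + ζ)) :=
      fun n => two_mul_kerF _ _ n ζ fun r => hζ _
    have hKm := hK m
    rw [sub_add_cancel, hprod] at hKm
    have step : D.reverse.kerF (-i) (-i - ((m + 1 : ℕ) : ℤ)) ζ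
        = 1 / (D.q (i + m) + ζ)
          + (D.q (i + m) - ζ) / (D.q (i + m) + ζ) * D.reverse.kerF (-i) (-i - m) ζ := by
      unfold kerF
      rw [e2, Finset.sum_insert (by simp), e4, Finset.mul_sum]
      congr 1
      · have : Finset.Ico (-i - ((m + 1 : ℕ) : ℤ)) (-i - m - 1) = ∅ :=
          Finset.Ico_eq_empty (by push_cast; omega)
        rw [this]; simp
      · refine Finset.sum_congr rfl fun r hr => ?_
        rw [e3 r hr, Finset.prod_insert (by simp), e4]
        ring
    rw [step]
    have : (D.q (i + m) - ζ) = (D.q (i + m) + ζ) - 2 * ζ := by ring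
    rw [this, sub_div, sub_mul, div_self hne, one_mul, div_mul_eq_mul_div, hKm]
    ring

theorem neumannJ_eq (hζ : ∀ i, D.q i + ζ ≠ 0) (k : ℕ) :
    ∀ i, D.neumannJ k i ζ = D.reverse.neumannH k (-i) ζ := by
  induction k with
  | zero => intro i; rfl
  | succ k ih =>
    intro i
    simp only [neumannJ, neumannH]
    refine tsum_congr fun m => ?_
    have e1 : -i - 1 - (m : ℤ) = -i - ((m + 1 : ℕ) : ℤ) := by push_cast; ring
    have e2 : i + 1 + (m : ℤ) = i + ((m + 1 : ℕ) : ℤ) := by push_cast; ring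
    rw [ih, e1, e2, kerF_reverse hζ]
    have e3 : -(i + ((m + 1 : ℕ) : ℤ)) = -i - ((m + 1 : ℕ) : ℤ) := by ring
    rw [e3]
    congr 2
    simp only [reverse]
    congr 1; ring

theorem Direct.jostΥ_eq (h : D.Direct K) (hζ : ζ ∉ D.regP K) (i : ℤ) :
    D.jostΥ i ζ = D.reverse.jostΛ (-i) ζ := by
  unfold jostΥ jostΛ
  exact tsum_congr fun k => neumannJ_eq (fun i => D.q_add_ne_zero h.one_le h.q_ne hζ i) k i

theorem Direct.continuousOn_jostΥ (h : D.Direct K) (i : ℤ) :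
    ContinuousOn (D.jostΥ i) (D.regP K)ᶜ := by
  have := (direct_reverse h).continuousOn_jostΛ (-i)
  rw [regP_reverse] at this
  exact this.congr fun ζ hζ => h.jostΥ_eq hζ i

theorem Direct.differentiableOn_jostΥ (h : D.Direct K) (i : ℤ) :
    DifferentiableOn ℂ (D.jostΥ i) (closure (D.regP K))ᶜ := by
  have := (direct_reverse h).differentiableOn_jostΛ (-i)
  rw [regP_reverse] at this
  exact this.congr fun ζ hζ => h.jostΥ_eq (fun hc => hζ (subset_closure hc)) i

theorem Direct.exists_norm_jostΥ_sub_one_le (h : D.Direct K) (i : ℤ) :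
    ∃ C, ∀ ζ ∉ D.regP K, ‖D.jostΥ i ζ - 1‖ ≤ C / (1 + ‖ζ‖) := by
  obtain ⟨C, hC⟩ := (direct_reverse h).exists_norm_jostΛ_sub_one_le (-i)
  rw [regP_reverse] at hC
  exact ⟨C, fun ζ hζ => by rw [h.jostΥ_eq hζ]; exact hC ζ hζ _ le_rfl⟩

theorem Direct.recurrenceΥ (h : D.Direct K) (hζ : ζ ∉ D.regP K) (i : ℤ) :
    (D.q (i + 1) - ζ) * D.jostΥ (i + 2) ζ
      - (D.q i + D.q (i + 1) + D.υ (i + 1)) * D.jostΥ (i + 1) ζ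
      + (D.q i + ζ) * D.jostΥ i ζ = 0 := by
  have hr := (direct_reverse h).recurrence (ζ := ζ) (by rwa [regP_reverse]) (-i - 2)
  rw [h.jostΥ_eq hζ, h.jostΥ_eq hζ, h.jostΥ_eq hζ]
  have e1 : -i - 2 + 1 = -(i + 1) := by ring
  have e2 : -i - 2 + 2 = -i := by ring
  have e3 : -i - 2 = -(i + 2) := by ring
  rw [e1, e2, e3, q_reverse, q_reverse] at hr
  have e4 : -1 - -(i + 1) = i := by ring
  have e5 : -1 - -(i + 2) = i + 1 := by ring
  have e6 : D.reverse.υ (-(i + 1)) = D.υ (i + 1) := by simp [reverse]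
  rw [e4, e5, e6] at hr
  linear_combination hr

theorem Direct.directScattering (h : D.Direct K) : D.DirectScattering K := by
  intro ζ hζ
  refine ⟨fun i => ?_, h.tendsto_jostΛ_atBot hζ, fun i => h.recurrenceΥ hζ i, ?_⟩
  · linear_combination h.recurrence hζ i
  · have := ((direct_reverse h).tendsto_jostΛ_atBot (ζ := ζ) (by rwa [regP_reverse])).comp
      tendsto_neg_atTop_atBot
    exact this.congr fun i => (h.jostΥ_eq hζ i).symm

end InitialData

namespace InitialData

variable {N : ℕ} {D : InitialData N} {K : ℝ} {ζ : ℂ}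

/-! ### Positions on the staircase and plane waves -/

theorem pos_zero : D.pos 0 = 0 := by
  funext r; simp [pos]

theorem pos_succ (i : ℤ) : D.pos (i + 1) = D.pos i + e (D.dir i) := by
  funext r
  simp only [pos, e, Pi.add_apply, Pi.single_apply]
  rcases le_or_gt 0 i with hi | hi
  · have h1 : Finset.Ico (i + 1) 0 = ∅ := Finset.Ico_eq_empty (by omega)
    have h2 : Finset.Ico i 0 = ∅ := Finset.Ico_eq_empty (by omega)
    rw [h1, h2, ← Finset.insert_Ico_right_eq_Ico_add_one hi, Finset.filter_insert]
    by_cases hr : D.dir i = r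
    · rw [if_pos hr, if_pos hr.symm, Finset.card_insert_of_notMem (by simp)]
      simp
    · rw [if_neg hr, if_neg (fun h => hr h.symm)]
      simp
  · have h1 : Finset.Ico 0 (i + 1) = ∅ := Finset.Ico_eq_empty (by omega)
    have h2 : Finset.Ico 0 i = ∅ := Finset.Ico_eq_empty (by omega)
    have h3 : Finset.Ico i 0 = insert i (Finset.Ico (i + 1) 0) := by
      ext x; simp only [Finset.mem_Ico, Finset.mem_insert]; omega
    rw [h1, h2, h3, Finset.filter_insert]
    by_cases hr : D.dir i = r
    · rw [if_pos hr, if_pos hr.symm, Finset.card_insert_of_notMem (by simp)]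
      simp
    · rw [if_neg hr, if_neg (fun h => hr h.symm)]
      simp

theorem rho_add_e (n : Lattice N) (j : Fin N) (h1 : D.p j + ζ ≠ 0) (h2 : D.p j - ζ ≠ 0) :
    D.rho (n + e j) ζ = D.rho n ζ * ((D.p j + ζ) / (D.p j - ζ)) := by
  unfold rho
  rw [← Finset.mul_prod_erase _ _ (Finset.mem_univ j),
    ← Finset.mul_prod_erase (a := j) _ (fun r => ((D.p r + ζ) / (D.p r - ζ)) ^ n r)
      (Finset.mem_univ j)]
  have : ∏ x ∈ Finset.univ.erase j, ((D.p x + ζ) / (D.p x - ζ)) ^ (n + e j) x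
      = ∏ x ∈ Finset.univ.erase j, ((D.p x + ζ) / (D.p x - ζ)) ^ n x := by
    refine Finset.prod_congr rfl fun x hx => ?_
    have := Finset.ne_of_mem_erase hx
    simp [e, this]
  rw [this]
  have h3 : (n + e j) j = n j + 1 := by simp [e]
  rw [h3, zpow_add_one₀ (div_ne_zero h1 h2)]
  ring

theorem rho_zero : D.rho 0 ζ = 1 := by simp [rho]

theorem rho_ne_zero (n : Lattice N) (h : ∀ r, D.p r + ζ ≠ 0 ∧ D.p r - ζ ≠ 0) :
    D.rho n ζ ≠ 0 :=
  Finset.prod_ne_zero_iff.2 fun r _ => zpow_ne_zero _ (div_ne_zero (h r).1 (h r).2)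

theorem continuousOn_rho (n : Lattice N) :
    ContinuousOn (D.rho n) {ζ | ∀ r, D.p r + ζ ≠ 0 ∧ D.p r - ζ ≠ 0} := by
  unfold rho
  refine continuousOn_finsetProd _ fun r _ => ?_
  refine ContinuousOn.zpow₀ (ContinuousOn.div (by fun_prop) (by fun_prop) fun ζ hζ => (hζ r).2) _ ?_
  exact fun ζ hζ => Or.inl (div_ne_zero (hζ r).1 (hζ r).2)

/-! ### Wronskians -/

theorem Direct.wronskian (h : D.Direct K) (h1 : ζ ∉ D.regP K) (h2 : -ζ ∉ D.regP K) (i : ℤ) :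
    (D.q i + ζ) * D.jostΛ (i + 1) ζ * D.jostΛ i (-ζ)
      - (D.q i - ζ) * D.jostΛ i ζ * D.jostΛ (i + 1) (-ζ) = 2 * ζ := by
  set W : ℤ → ℂ := fun i => (D.q i + ζ) * D.jostΛ (i + 1) ζ * D.jostΛ i (-ζ)
      - (D.q i - ζ) * D.jostΛ i ζ * D.jostΛ (i + 1) (-ζ) with hW
  have hstep : ∀ i, W (i + 1) = W i := by
    intro i
    have r1 := h.recurrence h1 i
    have r2 := h.recurrence h2 i
    simp only [hW]
    have : i + 1 + 1 = i + 2 := by ring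
    rw [this]
    linear_combination D.jostΛ (i + 1) (-ζ) * r1 - D.jostΛ (i + 1) ζ * r2
  have hconst : ∀ j, W j = W 0 := by
    intro j
    induction j using Int.induction_on with
    | zero => rfl
    | succ n ih => rw [hstep, ih]
    | pred n ih => rw [← ih, ← hstep]; congr 1; ring
  have t1 := h.tendsto_jostΛ_atBot h1
  have t2 := h.tendsto_jostΛ_atBot h2
  have t1' : Tendsto (fun i => D.jostΛ (i + 1) ζ) atBot (𝓝 1) :=
    t1.comp (tendsto_atBot_add_const_right _ _ tendsto_id)
  have t2' : Tendsto (fun i => D.jostΛ (i + 1) (-ζ)) atBot (𝓝 1) :=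
    t2.comp (tendsto_atBot_add_const_right _ _ tendsto_id)
  obtain ⟨m, hm, hq⟩ := D.exists_norm_q_le
  have b1 : IsBoundedUnder (· ≤ ·) atBot (norm ∘ fun i => D.q i + ζ) :=
    isBoundedUnder_of ⟨m + ‖ζ‖, fun i => (norm_add_le _ _).trans (by gcongr; exact hq i)⟩
  have b2 : IsBoundedUnder (· ≤ ·) atBot (norm ∘ fun i => D.q i - ζ) :=
    isBoundedUnder_of ⟨m + ‖ζ‖, fun i => (norm_sub_le _ _).trans (by gcongr; exact hq i)⟩
  have s1 : Tendsto (fun i => (D.q i + ζ) * (D.jostΛ (i + 1) ζ * D.jostΛ i (-ζ) - 1)) atBot (𝓝 0) :=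
    isBoundedUnder_le_mul_tendsto_zero b1 (by simpa using (t1'.mul t2).sub_const 1)
  have s2 : Tendsto (fun i => (D.q i - ζ) * (D.jostΛ i ζ * D.jostΛ (i + 1) (-ζ) - 1)) atBot (𝓝 0) :=
    isBoundedUnder_le_mul_tendsto_zero b2 (by simpa using (t1.mul t2').sub_const 1)
  have s3 : Tendsto W atBot (𝓝 (2 * ζ)) := by
    have := (s1.sub s2).add_const (2 * ζ)
    simp only [sub_zero, zero_add] at this
    refine this.congr fun i => ?_
    simp only [hW]; ring
  have s4 : Tendsto W atBot (𝓝 (W 0)) := by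
    rw [show W = fun _ => W 0 from funext hconst]; exact tendsto_const_nhds
  exact (hconst i).trans (tendsto_nhds_unique s4 s3)

theorem Direct.q_sub_ne_zero (h : D.Direct K) (h2 : -ζ ∉ D.regP K) (i : ℤ) : D.q i - ζ ≠ 0 := by
  have := D.q_add_ne_zero h.one_le h.q_ne h2 i
  rwa [← sub_eq_add_neg] at this

theorem Direct.q_add_ne_zero (h : D.Direct K) (h1 : ζ ∉ D.regP K) (i : ℤ) : D.q i + ζ ≠ 0 :=
  D.q_add_ne_zero h.one_le h.q_ne h1 i

theorem Direct.jostΥ_eq_specA_specB (h : D.Direct K) (h1 : ζ ∉ D.regP K) (h2 : -ζ ∉ D.regP K)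
    (h0 : ζ ≠ 0) (i : ℤ) :
    D.jostΥ i ζ = D.specA ζ * D.jostΛ i (-ζ) + D.specB ζ * D.jostΛ i ζ * D.rho (D.pos i) ζ := by
  have hp : ∀ i, D.q i + ζ ≠ 0 := h.q_add_ne_zero h1
  have hm : ∀ i, D.q i - ζ ≠ 0 := h.q_sub_ne_zero h2
  have hrho : ∀ i, D.rho (D.pos (i + 1)) ζ
      = D.rho (D.pos i) ζ * ((D.q i + ζ) / (D.q i - ζ)) := fun i => by
    rw [pos_succ]; exact rho_add_e _ _ (hp i) (hm i)
  set g : ℤ → ℂ := fun i => D.jostΥ i ζ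
    - (D.specA ζ * D.jostΛ i (-ζ) + D.specB ζ * D.jostΛ i ζ * D.rho (D.pos i) ζ) with hg
  have hW := h.wronskian h1 h2 0
  have g0 : g 0 = 0 := by
    simp only [hg, pos_zero, rho_zero, specA, specB]
    rw [zero_add] at hW
    field_simp
    linear_combination (-D.jostΥ 0 ζ) * hW
  have g1 : g 1 = 0 := by
    have := hrho 0
    rw [zero_add, pos_zero, rho_zero, one_mul] at this
    have hm0 := hm 0
    simp only [hg, this, specA, specB]
    rw [zero_add] at hW
    field_simp
    linear_combination (-D.jostΥ 1 ζ) * hW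
  have hrec : ∀ i, (D.q (i + 1) - ζ) * g (i + 2)
      - (D.q i + D.q (i + 1) + D.υ (i + 1)) * g (i + 1) + (D.q i + ζ) * g i = 0 := by
    intro i
    have r1 := h.recurrence h1 i
    have r2 := h.recurrence h2 i
    have r3 := h.recurrenceΥ h1 i
    have e1 : D.rho (D.pos (i + 2)) ζ * (D.q (i + 1) - ζ)
        = D.rho (D.pos (i + 1)) ζ * (D.q (i + 1) + ζ) := by
      have := hrho (i + 1)
      rw [show i + 1 + 1 = i + 2 by ring] at this
      rw [this]; field_simp [hm (i + 1)]
    have e2 : D.rho (D.pos i) ζ * (D.q i + ζ) = D.rho (D.pos (i + 1)) ζ * (D.q i - ζ) := by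
      rw [hrho i]; field_simp [hm i]
    simp only [hg]
    linear_combination r3 - D.specA ζ * r2 - D.specB ζ * D.rho (D.pos (i + 1)) ζ * r1
      - D.specB ζ * D.jostΛ (i + 2) ζ * e1 - D.specB ζ * D.jostΛ i ζ * e2
  have hall : ∀ i, g i = 0 ∧ g (i + 1) = 0 := by
    intro i
    induction i using Int.induction_on with
    | zero => exact ⟨g0, by rw [zero_add]; exact g1⟩
    | succ n ih =>
      refine ⟨ih.2, ?_⟩
      have := hrec n
      rw [ih.1, ih.2, mul_zero, mul_zero, sub_zero, add_zero] at this
      rw [show (n : ℤ) + 1 + 1 = n + 2 by ring]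
      exact (mul_eq_zero.1 this).resolve_left (hm _)
    | pred n ih =>
      have e1 : -(n : ℤ) - 1 + 1 = -n := by ring
      have := hrec (-(n : ℤ) - 1)
      rw [e1, show -(n : ℤ) - 1 + 2 = -n + 1 by ring, ih.1, ih.2, mul_zero, mul_zero, sub_zero,
        zero_add] at this
      exact ⟨(mul_eq_zero.1 this).resolve_left (hp _), by rw [e1]; exact ih.1⟩
  exact sub_eq_zero.1 (hall i).1

/-! ### The spectral functions -/

theorem Direct.continuousOn_specA (h : D.Direct K) :
    ContinuousOn D.specA ((D.regP K)ᶜ \ {0}) := by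
  have hΥ := fun i => (h.continuousOn_jostΥ i).mono (sdiff_subset (t := {(0 : ℂ)}))
  have hΛ := fun i => (h.continuousOn_jostΛ i).mono (sdiff_subset (t := {(0 : ℂ)}))
  unfold specA
  refine ContinuousOn.div ?_ (by fun_prop) fun ζ hζ => mul_ne_zero two_ne_zero hζ.2
  exact ((ContinuousOn.mul (by fun_prop) (hΥ 0)).mul (hΛ 1)).sub
    ((ContinuousOn.mul (by fun_prop) (hΥ 1)).mul (hΛ 0))

theorem Direct.differentiableOn_specA (h : D.Direct K) :
    DifferentiableOn ℂ D.specA ((closure (D.regP K))ᶜ \ {0}) := by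
  have hΥ := fun i => (h.differentiableOn_jostΥ i).mono (sdiff_subset (t := {(0 : ℂ)}))
  have hΛ := fun i => (h.differentiableOn_jostΛ i).mono (sdiff_subset (t := {(0 : ℂ)}))
  unfold specA
  refine DifferentiableOn.div ?_ (by fun_prop) fun ζ hζ => mul_ne_zero two_ne_zero hζ.2
  exact ((DifferentiableOn.mul (by fun_prop) (hΥ 0)).mul (hΛ 1)).sub
    ((DifferentiableOn.mul (by fun_prop) (hΥ 1)).mul (hΛ 0))

theorem Direct.continuousOn_specB (h : D.Direct K) :
    ContinuousOn D.specB ({ζ | ζ ∉ D.regP K ∧ -ζ ∉ D.regP K} \ {0}) := by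
  have hΥ := fun i => (h.continuousOn_jostΥ i).mono
    (s := (D.regP K)ᶜ) (t := {ζ | ζ ∉ D.regP K ∧ -ζ ∉ D.regP K} \ {0}) fun ζ hζ => hζ.1.1
  have hΛ : ∀ i, ContinuousOn (fun ζ => D.jostΛ i (-ζ))
      ({ζ | ζ ∉ D.regP K ∧ -ζ ∉ D.regP K} \ {0}) := fun i =>
    (h.continuousOn_jostΛ i).comp continuousOn_neg fun ζ hζ => hζ.1.2
  unfold specB
  refine ContinuousOn.mul (ContinuousOn.div (by fun_prop) (by fun_prop)
    fun ζ hζ => mul_ne_zero two_ne_zero hζ.2) ?_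
  exact ((hΛ 0).mul (hΥ 1)).sub ((hΛ 1).mul (hΥ 0))

/-! ### Truncation of the potential -/

variable (D) in
/-- The potential cut off outside `[-M, M]`. -/
def trunc (M : ℕ) : InitialData N := D.withPot fun l => if l.natAbs ≤ M then D.υ l else 0

theorem kerF_trunc (M : ℕ) (i l : ℤ) (ζ : ℂ) : (D.trunc M).kerF i l ζ = D.kerF i l ζ := rfl

theorem norm_trunc_le (M : ℕ) (l : ℤ) : ‖if l.natAbs ≤ M then D.υ l else 0‖ ≤ ‖D.υ l‖ := by
  split_ifs <;> simp

theorem Direct.exists_dominates_trunc (h : D.Direct K) (I : ℤ) :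
    ∃ μ : ℤ → ℝ, ∀ ζ ∉ D.regP K, D.Dominates μ (1 / (1 + ‖ζ‖)) I ζ ∧
      ∀ M, (D.trunc M).Dominates μ (1 / (1 + ‖ζ‖)) I ζ := by
  obtain ⟨μ, hμ⟩ := D.exists_dominates h.one_le h.q_ne h.summable I
  exact ⟨μ, fun ζ hζ => ⟨hμ D.υ (fun _ => le_rfl) ζ hζ,
    fun M => hμ _ (fun l => norm_trunc_le M l) ζ hζ⟩⟩

theorem direct_trunc (hK : 1 ≤ K) (hq : ∀ i, D.q i ≠ 0) (M : ℕ) : (D.trunc M).Direct K where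
  one_le := hK
  q_ne := hq
  summable := by
    refine summable_of_hasFiniteSupport ((Set.finite_Icc (-(M : ℤ)) M).subset fun l hl => ?_)
    by_contra hc
    refine hl ?_
    have : ¬ l.natAbs ≤ M := fun h => hc ⟨by omega, by omega⟩
    simp [trunc, this]

theorem Direct.tendsto_jostΛ_trunc (h : D.Direct K) (hζ : ζ ∉ D.regP K) (i : ℤ) :
    Tendsto (fun M => (D.trunc M).jostΛ i ζ) atTop (𝓝 (D.jostΛ i ζ)) := by
  obtain ⟨μ, hμ⟩ := h.exists_dominates_trunc i
  obtain ⟨hd, hdM⟩ := hμ ζ hζ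
  have hυ : ∀ l, Tendsto (fun M => (D.trunc M).υ l) atTop (𝓝 (D.υ l)) := fun l => by
    refine tendsto_const_nhds.congr' ?_
    filter_upwards [eventually_ge_atTop l.natAbs] with M hM
    simp [trunc, hM]
  have hH : ∀ k, ∀ j ≤ i, Tendsto (fun M => (D.trunc M).neumannH k j ζ) atTop
      (𝓝 (D.neumannH k j ζ)) := by
    intro k
    induction k with
    | zero => intro j _; exact tendsto_const_nhds
    | succ k ih =>
      intro j hj
      simp only [neumannH]
      refine tendsto_tsum_of_dominated_convergence
        ((summable_comp_left hd.summable j).mul_left _) (fun m => ?_)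
        (Eventually.of_forall fun M m => (hdM M).norm_term_le k hj m)
      simp only [kerF_trunc]
      exact ((hυ (j - 1 - m)).const_mul (D.kerF j (j - 1 - m) ζ)).mul (ih (j - 1 - m) (by omega))
  exact tendsto_tsum_of_dominated_convergence
    ((summable_geometric_of_lt_one (by norm_num) (by norm_num)).mul_right _)
    (fun k => hH k i le_rfl)
    (Eventually.of_forall fun M k => (hdM M).norm_neumannH_le' k le_rfl)

theorem Direct.exists_norm_jostΛ_trunc_le (h : D.Direct K) (i : ℤ) :
    ∃ C, ∀ ζ ∉ D.regP K, ∀ M, ‖(D.trunc M).jostΛ i ζ‖ ≤ C := by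
  obtain ⟨μ, hμ⟩ := h.exists_dominates_trunc i
  exact ⟨_, fun ζ hζ M => ((hμ ζ hζ).2 M).norm_jostΛ_le le_rfl⟩

/-! ### The expansion at infinity for `K = 1` -/

theorem tendsto_prod_ratio (T : Finset ℤ) :
    ∃ g, Tendsto (fun ζ => ζ * (∏ s ∈ T, ((D.q s - ζ) / (D.q s + ζ)) - (-1) ^ T.card))
      (cocompact ℂ) (𝓝 g) := by
  have hr : ∀ s, Tendsto (fun ζ => ζ * ((D.q s - ζ) / (D.q s + ζ) + 1)) (cocompact ℂ)
      (𝓝 (2 * D.q s)) := by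
    intro s
    have h1 : Tendsto (fun ζ : ℂ => D.q s / (D.q s + ζ)) (cocompact ℂ) (𝓝 0) := by
      have : Tendsto (fun ζ : ℂ => D.q s + ζ) (cocompact ℂ) (cocompact ℂ) :=
        (Homeomorph.addLeft (D.q s)).isClosedEmbedding.tendsto_cocompact
      simpa [div_eq_mul_inv] using ((tendsto_inv₀_cobounded (α := ℂ)).comp
        (by rwa [Metric.cobounded_eq_cocompact] : Tendsto _ _ _)).const_mul (D.q s)
    have h2 : Tendsto (fun ζ : ℂ => 2 * D.q s * (1 - D.q s / (D.q s + ζ))) (cocompact ℂ)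
        (𝓝 (2 * D.q s)) := by
      simpa using (tendsto_const_nhds (x := (1 : ℂ)).sub h1).const_mul (2 * D.q s)
    refine h2.congr' ?_
    have : ∀ᶠ ζ : ℂ in cocompact ℂ, ζ ≠ -D.q s :=
      (isCompact_singleton (x := -D.q s)).compl_mem_cocompact
    filter_upwards [this] with ζ hζ
    have : D.q s + ζ ≠ 0 := fun hc => hζ (by linear_combination hc)
    field_simp
    ring
  have hr0 : ∀ s, Tendsto (fun ζ => (D.q s - ζ) / (D.q s + ζ)) (cocompact ℂ) (𝓝 (-1)) := by
    intro s
    have h1 : Tendsto (fun ζ : ℂ => ζ⁻¹) (cocompact ℂ) (𝓝 0) := by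
      rw [← Metric.cobounded_eq_cocompact]; exact tendsto_inv₀_cobounded
    have h2 := (h1.mul (hr s)).sub_const 1
    simp only [zero_mul, zero_sub] at h2
    refine h2.congr' ?_
    have : ∀ᶠ ζ : ℂ in cocompact ℂ, ζ ≠ 0 := (isCompact_singleton (x := 0)).compl_mem_cocompact
    filter_upwards [this] with ζ hζ
    rw [inv_mul_cancel_left₀ hζ]; ring
  induction T using Finset.induction_on with
  | empty => exact ⟨0, by simp⟩
  | insert a T ha ih =>
    obtain ⟨g, hg⟩ := ih
    refine ⟨_, (((hr0 a).mul hg).add ((hr a).const_mul ((-1) ^ T.card))).congr fun ζ => ?_⟩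
    rw [Finset.prod_insert ha, Finset.card_insert_of_notMem ha]
    ring

theorem norm_prod_ratio_sub_le (h : D.Direct 1) : ∃ C ≥ 0, ∀ ζ ∉ D.regP 1, ∀ T : Finset ℤ,
    ‖ζ * (∏ s ∈ T, ((D.q s - ζ) / (D.q s + ζ)) - (-1) ^ T.card)‖ ≤ C * T.card := by
  obtain ⟨m, hm, hq⟩ := D.exists_norm_q_le
  obtain ⟨C, hC0, hC⟩ := D.exists_le_norm_add h.one_le h.q_ne
  refine ⟨2 * m * C, by positivity, fun ζ hζ T => ?_⟩
  induction T using Finset.induction_on with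
  | empty => simp
  | insert a T ha ih =>
    rw [Finset.prod_insert ha, Finset.card_insert_of_notMem ha]
    have hne := h.q_add_ne_zero hζ a
    have e1 : ζ * ((D.q a - ζ) / (D.q a + ζ) * ∏ s ∈ T, ((D.q s - ζ) / (D.q s + ζ))
        - (-1) ^ (T.card + 1))
        = (D.q a - ζ) / (D.q a + ζ) * (ζ * (∏ s ∈ T, ((D.q s - ζ) / (D.q s + ζ)) - (-1) ^ T.card))
          + (-1) ^ T.card * (2 * D.q a * ζ / (D.q a + ζ)) := by
      field_simp; ring
    rw [e1]
    have h1 := D.norm_ratio_le h.one_le h.q_ne hζ a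
    have h2 : ‖2 * D.q a * ζ / (D.q a + ζ)‖ ≤ 2 * m * C := by
      rw [norm_div, norm_mul, norm_mul, Complex.norm_ofNat,
        div_le_iff₀ (norm_pos_iff.2 hne)]
      have := hC ζ hζ a
      calc 2 * ‖D.q a‖ * ‖ζ‖ ≤ 2 * m * (C * ‖D.q a + ζ‖) := by
            gcongr
            · exact hq a
            · linarith
        _ = _ := by ring
    refine (norm_add_le _ _).trans ?_
    rw [norm_mul, norm_mul ((-1) ^ T.card), norm_pow, norm_neg, norm_one, one_pow, one_mul]
    have h3 : ‖(D.q a - ζ) / (D.q a + ζ)‖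
        * ‖ζ * (∏ s ∈ T, ((D.q s - ζ) / (D.q s + ζ)) - (-1) ^ T.card)‖ ≤ 1 * (2 * m * C * T.card) := by
      gcongr
    push_cast
    linarith

theorem Direct.exists_hasExpansionIn (h : D.Direct 1) (i : ℤ) :
    ∃ l₁ l₂, HasExpansionIn (D.regP 1)ᶜ (D.jostΛ i) l₁ l₂ := by
  set F := cocompact ℂ ⊓ 𝓟 (D.regP 1)ᶜ with hF
  obtain ⟨C, hC⟩ := h.exists_norm_jostΛ_sub_one_le i
  obtain ⟨C', hC'0, hC'⟩ := norm_prod_ratio_sub_le h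
  obtain ⟨μ, hμ⟩ := h.exists_dominates i
  have hmem : ∀ᶠ ζ in F, ζ ∉ D.regP 1 := mem_inf_of_right (mem_principal_self _)
  have hne : ∀ᶠ ζ in F, ζ ≠ 0 :=
    mem_inf_of_left (isCompact_singleton (x := (0 : ℂ))).compl_mem_cocompact
  have hnorm : Tendsto (fun ζ : ℂ => 1 / (1 + ‖ζ‖)) F (𝓝 0) := by
    have h1 : Tendsto (fun ζ : ℂ => ‖ζ‖) F atTop := tendsto_norm_cocompact_atTop.mono_left inf_le_left
    simp only [one_div]
    exact (tendsto_atTop_add_const_left F 1 h1).inv_tendsto_atTop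
  have hΛ1 : ∀ l ≤ i, Tendsto (fun ζ => D.jostΛ l ζ) F (𝓝 1) := by
    intro l hl
    rw [tendsto_iff_norm_sub_tendsto_zero]
    have h1 : Tendsto (fun ζ : ℂ => C * (1 / (1 + ‖ζ‖))) F (𝓝 0) := by simpa using hnorm.const_mul C
    refine squeeze_zero' (Eventually.of_forall fun _ => norm_nonneg _) ?_ h1
    filter_upwards [hmem] with ζ hζ
    refine (hC ζ hζ l hl).trans (le_of_eq (by ring))
  have hC0 : ∀ ζ ∉ D.regP 1, 0 ≤ C := fun ζ hζ => by
    have := (norm_nonneg _).trans (hC ζ hζ i le_rfl)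
    exact (div_nonneg_iff.1 this).elim (fun h => h.1) fun h => by
      linarith [h.2, norm_nonneg ζ]
  have hΛb : ∀ ζ ∉ D.regP 1, ∀ l ≤ i, ‖D.jostΛ l ζ‖ ≤ C + 1 := by
    intro ζ hζ l hl
    have h1 := hC ζ hζ l hl
    have h2 : C / (1 + ‖ζ‖) ≤ C := div_le_self (hC0 ζ hζ) (by linarith [norm_nonneg ζ])
    have h3 : ‖D.jostΛ l ζ‖ ≤ ‖D.jostΛ l ζ - 1‖ + ‖(1 : ℂ)‖ := by
      simpa using norm_add_le (D.jostΛ l ζ - 1) 1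
    rw [norm_one] at h3
    linarith
  have hζΛb : ∀ ζ ∉ D.regP 1, ∀ l ≤ i, ‖ζ * (D.jostΛ l ζ - 1)‖ ≤ C := by
    intro ζ hζ l hl
    rw [norm_mul]
    have h1 := hC ζ hζ l hl
    rw [le_div_iff₀ (by positivity)] at h1
    nlinarith [norm_nonneg (D.jostΛ l ζ - 1)]
  obtain ⟨Pr, hPr⟩ : ∃ Pr : ℤ → ℕ → ℂ → ℂ, ∀ j m ζ, Pr j m ζ =
    ∏ s ∈ Finset.Ico (j - 1 - m) j, ((D.q s - ζ) / (D.q s + ζ)) := ⟨_, fun _ _ _ => rfl⟩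
  have hcard : ∀ (j : ℤ) (m : ℕ), (Finset.Ico (j - 1 - m) j).card = m + 1 := fun j m => by
    rw [Int.card_Ico]; omega
  choose g hg using fun T => tendsto_prod_ratio (D := D) T
  obtain ⟨G, hG⟩ : ∃ G : ℕ → ℂ, ∀ m, G m = (1 - (-1) ^ (m + 1)) / 2 := ⟨_, fun _ => rfl⟩
  have hGb : ∀ m, ‖G m‖ ≤ 1 := fun m => by
    simp only [hG]
    rw [norm_div, Complex.norm_ofNat, div_le_one (by norm_num)]
    refine (norm_sub_le _ _).trans ?_
    rw [norm_pow, norm_neg, norm_one, one_pow]; norm_num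
  have hker : ∀ ζ ∉ D.regP 1, ∀ (j : ℤ) (m : ℕ),
      ζ * D.kerF j (j - 1 - m) ζ = (1 - Pr j m ζ) / 2 := by
    intro ζ hζ j m
    have := two_mul_kerF D (j - 1 - m) (m + 1) ζ (h.q_add_ne_zero hζ)
    have e1 : j - 1 - (m : ℤ) + ((m + 1 : ℕ) : ℤ) = j := by push_cast; ring
    rw [e1] at this
    simp only [hPr]
    linear_combination this / 2
  have hPrb : ∀ ζ ∉ D.regP 1, ∀ j m, ‖(1 - Pr j m ζ) / 2‖ ≤ 1 := by
    intro ζ hζ j m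
    rw [norm_div, Complex.norm_ofNat, div_le_one (by norm_num)]
    refine (norm_sub_le _ _).trans ?_
    have := D.norm_prod_ratio_le h.one_le h.q_ne hζ (j - 1 - m) j
    rw [one_pow, ← hPr] at this
    rw [norm_one]; linarith
  have hPr1 : ∀ (j : ℤ) (m : ℕ), Tendsto (fun ζ => ζ * (ζ * D.kerF j (j - 1 - m) ζ - G m)) F
      (𝓝 (-g (Finset.Ico (j - 1 - m) j) / 2)) := by
    intro j m
    have h1 := (((hg (Finset.Ico (j - 1 - m) j)).mono_left (inf_le_left : F ≤ _)).neg).div_const 2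
    refine h1.congr' ?_
    filter_upwards [hmem] with ζ hζ
    rw [hker ζ hζ, hcard]
    simp only [hPr, hG]; ring
  have hinv : Tendsto (fun ζ : ℂ => ζ⁻¹) F (𝓝 0) := by
    have : Tendsto (fun ζ : ℂ => ζ⁻¹) (cocompact ℂ) (𝓝 0) := by
      rw [← Metric.cobounded_eq_cocompact]; exact tendsto_inv₀_cobounded
    exact this.mono_left inf_le_left
  have hPr0 : ∀ (j : ℤ) (m : ℕ), Tendsto (fun ζ => ζ * D.kerF j (j - 1 - m) ζ) F (𝓝 (G m)) := by
    intro j m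
    have h1 := (hinv.mul (hPr1 j m)).add_const (G m)
    rw [zero_mul, zero_add] at h1
    refine h1.congr' ?_
    filter_upwards [hne] with ζ hζ
    rw [inv_mul_cancel_left₀ hζ]; ring
  have hυ : ∀ j, Summable fun m : ℕ => ‖D.υ (j - 1 - m)‖ := fun j => by
    refine (summable_comp_left (h.summable) j).of_nonneg_of_le (fun _ => norm_nonneg _) fun m => ?_
    simp only [one_pow, mul_one]
    exact le_mul_of_one_le_right (norm_nonneg _) (by simp)
  have hυ1 : Summable fun m : ℕ => ‖D.υ (i - 1 - m)‖ * (m + 1) := by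
    refine ((summable_comp_left (h.summable) i).mul_left (1 + (i.natAbs : ℝ))).of_nonneg_of_le
      (fun _ => by positivity) fun m => ?_
    simp only [one_pow, mul_one]
    have h1 : ((m + 1 : ℕ) : ℝ) ≤ ((i.natAbs + (i - 1 - (m : ℤ)).natAbs : ℕ) : ℝ) := by
      exact_mod_cast (by omega : m + 1 ≤ i.natAbs + (i - 1 - (m : ℤ)).natAbs)
    push_cast at h1
    have h2 : (m : ℝ) + 1 ≤ (1 + i.natAbs) * (1 + ((i - 1 - (m : ℤ)).natAbs : ℝ)) := by
      nlinarith [mul_nonneg (Nat.cast_nonneg (α := ℝ) i.natAbs)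
        (Nat.cast_nonneg (α := ℝ) (i - 1 - (m : ℤ)).natAbs)]
    calc _ ≤ ‖D.υ (i - 1 - m)‖ * ((1 + i.natAbs) * (1 + ((i - 1 - (m : ℤ)).natAbs : ℝ))) := by gcongr
      _ = _ := by ring
  obtain ⟨l₁, hl₁⟩ : ∃ l₁ : ℤ → ℂ, ∀ j, l₁ j = ∑' m : ℕ, G m * D.υ (j - 1 - m) :=
    ⟨_, fun _ => rfl⟩
  have heq : ∀ ζ ∉ D.regP 1, ∀ j ≤ i, ζ * (D.jostΛ j ζ - 1) = ∑' m : ℕ,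
      ζ * D.kerF j (j - 1 - m) ζ * D.υ (j - 1 - m) * D.jostΛ (j - 1 - m) ζ := by
    intro ζ hζ j hj
    rw [(hμ ζ hζ).jostΛ_eq hj, add_sub_cancel_left, ← tsum_mul_left]
    exact tsum_congr fun m => by ring
  have hstepA : ∀ j ≤ i, Tendsto (fun ζ => ζ * (D.jostΛ j ζ - 1)) F (𝓝 (l₁ j)) := by
    intro j hj
    rw [hl₁]
    have h1 : Tendsto (fun ζ => ∑' m : ℕ,
        ζ * D.kerF j (j - 1 - m) ζ * D.υ (j - 1 - m) * D.jostΛ (j - 1 - m) ζ) F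
        (𝓝 (∑' m : ℕ, G m * D.υ (j - 1 - m))) := by
      refine tendsto_tsum_of_dominated_convergence ((hυ j).mul_right (C + 1)) (fun m => ?_) ?_
      · simpa using ((hPr0 j m).mul_const (D.υ (j - 1 - m))).mul (hΛ1 (j - 1 - m) (by omega))
      · filter_upwards [hmem] with ζ hζ m
        rw [norm_mul, norm_mul]
        have h1 := hPrb ζ hζ j m
        rw [← hker ζ hζ] at h1
        have h2 := hΛb ζ hζ (j - 1 - m) (by omega)
        calc _ ≤ 1 * ‖D.υ (j - 1 - m)‖ * (C + 1) := by gcongr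
          _ = _ := by ring
    refine h1.congr' ?_
    filter_upwards [hmem] with ζ hζ
    exact (heq ζ hζ j hj).symm
  have hstepB : Tendsto (fun ζ => ζ * (ζ * (D.jostΛ i ζ - 1) - l₁ i)) F
      (𝓝 (∑' m : ℕ, D.υ (i - 1 - m) * (-g (Finset.Ico (i - 1 - m) i) / 2 * 1
        + G m * l₁ (i - 1 - m)))) := by
    have h1 : Tendsto (fun ζ => ∑' m : ℕ, D.υ (i - 1 - m)
        * (ζ * (ζ * D.kerF i (i - 1 - m) ζ - G m) * D.jostΛ (i - 1 - m) ζ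
          + G m * (ζ * (D.jostΛ (i - 1 - m) ζ - 1)))) F (𝓝 (∑' m : ℕ, D.υ (i - 1 - m)
          * (-g (Finset.Ico (i - 1 - m) i) / 2 * 1 + G m * l₁ (i - 1 - m)))) := by
      refine tendsto_tsum_of_dominated_convergence
        (hυ1.mul_right (C' * (C + 1) + C)) (fun m => ?_) ?_
      · exact (((hPr1 i m).mul (hΛ1 _ (by omega))).add
          ((hstepA _ (by omega)).const_mul (G m))).const_mul _
      · filter_upwards [hmem] with ζ hζ m
        have hC0' := hC0 ζ hζ
        rw [norm_mul]
        have h1 : ‖ζ * (ζ * D.kerF i (i - 1 - m) ζ - G m)‖ ≤ C' * (m + 1) := by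
          have h2 := hC' ζ hζ (Finset.Ico (i - 1 - m) i)
          rw [hcard] at h2
          have h3 : ζ * (ζ * D.kerF i (i - 1 - m) ζ - G m) = -(1 / 2) *
              (ζ * (∏ s ∈ Finset.Ico (i - 1 - m) i, ((D.q s - ζ) / (D.q s + ζ))
                - (-1) ^ (m + 1))) := by
            rw [hker ζ hζ]; simp only [hPr, hG]; ring
          rw [h3, norm_mul]
          have h4 : ‖(-(1 / 2) : ℂ)‖ ≤ 1 := by norm_num
          push_cast at h2
          calc _ ≤ 1 * (C' * (m + 1)) := by gcongr
            _ = _ := one_mul _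
        have h2 := hΛb ζ hζ (i - 1 - m) (by omega)
        have h3 := hζΛb ζ hζ (i - 1 - m) (by omega)
        have h4 := hGb m
        have h5 : ‖ζ * (ζ * D.kerF i (i - 1 - m) ζ - G m) * D.jostΛ (i - 1 - m) ζ
          + G m * (ζ * (D.jostΛ (i - 1 - m) ζ - 1))‖ ≤ (m + 1) * (C' * (C + 1) + C) := by
          refine (norm_add_le _ _).trans ?_
          rw [norm_mul, norm_mul (G m)]
          have h6 : ‖ζ * (ζ * D.kerF i (i - 1 - m) ζ - G m)‖ * ‖D.jostΛ (i - 1 - m) ζ‖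
              ≤ C' * (m + 1) * (C + 1) := by gcongr
          have h7 : ‖G m‖ * ‖ζ * (D.jostΛ (i - 1 - m) ζ - 1)‖ ≤ 1 * C := by gcongr
          nlinarith [mul_nonneg (Nat.cast_nonneg (α := ℝ) m) hC0']
        calc _ ≤ ‖D.υ (i - 1 - m)‖ * ((m + 1) * (C' * (C + 1) + C)) := by gcongr
          _ = _ := by ring
    refine h1.congr' ?_
    filter_upwards [hmem] with ζ hζ
    have hs1 : Summable fun m : ℕ =>
        ζ * D.kerF i (i - 1 - m) ζ * D.υ (i - 1 - m) * D.jostΛ (i - 1 - m) ζ := by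
      refine (((hμ ζ hζ).summable_jost_term le_rfl).mul_left ζ).congr fun m => by ring
    have hs2 : Summable fun m : ℕ => G m * D.υ (i - 1 - m) := by
      refine Summable.of_norm_bounded (hυ i) fun m => ?_
      rw [norm_mul]
      exact mul_le_of_le_one_left (norm_nonneg _) (hGb m)
    rw [heq ζ hζ i le_rfl, hl₁, ← hs1.tsum_sub hs2, ← tsum_mul_left]
    exact tsum_congr fun m => by ring
  obtain ⟨l₂, hl₂⟩ : ∃ l₂, Tendsto (fun ζ => ζ * (ζ * (D.jostΛ i ζ - 1) - l₁ i)) F (𝓝 l₂) :=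
    ⟨_, hstepB⟩
  refine ⟨l₁ i, l₂, ?_⟩
  unfold HasExpansionIn
  rw [Asymptotics.isLittleO_iff_tendsto']
  · have h1 := hl₂.sub_const l₂
    rw [sub_self] at h1
    refine h1.congr' ?_
    filter_upwards [hne] with ζ hζ
    field_simp
    ring
  · filter_upwards [hne] with ζ hζ h0
    exact absurd h0 (one_div_ne_zero (pow_ne_zero 2 hζ))

end InitialData

/-! ### Integral equations with the kernel `1 / (σ + ζ)` -/

theorem _root_.ContinuousOn.fun_div {f g : ℂ → ℂ} {s : Set ℂ} (hf : ContinuousOn f s)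
    (hg : ContinuousOn g s) (h0 : ∀ x ∈ s, g x ≠ 0) : ContinuousOn (fun x => f x / g x) s :=
  hf.div hg h0

/-- A linear functional on functions on `E` that commutes with itself (Fubini's theorem) for the
kernel `1 / (σ + τ)`. -/
structure CauchyFunctional (E : Set ℂ) (I : (ℂ → ℂ) → ℂ) : Prop where
  ne : ∀ σ ∈ E, ∀ τ ∈ E, σ + τ ≠ 0
  congr : ∀ φ ψ : ℂ → ℂ, (∀ σ ∈ E, φ σ = ψ σ) → I φ = I ψ
  add : ∀ φ ψ : ℂ → ℂ, ContinuousOn φ E → ContinuousOn ψ E →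
    I (fun σ => φ σ + ψ σ) = I φ + I ψ
  smul : ∀ (c : ℂ) (φ : ℂ → ℂ), ContinuousOn φ E → I (fun σ => c * φ σ) = c * I φ
  fubini : ∀ α β : ℂ → ℂ, ContinuousOn α E → ContinuousOn β E →
    I (fun σ => α σ * I fun τ => β τ / (τ + σ)) = I fun τ => β τ * I fun σ => α σ / (σ + τ)

/-- `f(ζ) = f₀ + I(ρ f / (σ + ζ))` on `V`. -/
structure SolvesIE (E V : Set ℂ) (I : (ℂ → ℂ) → ℂ) (ρ : ℂ → ℂ) (f₀ : ℂ) (f : ℂ → ℂ) : Prop where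
  subset : E ⊆ V
  ne : ∀ σ ∈ E, ∀ ζ ∈ V, σ + ζ ≠ 0
  contρ : ContinuousOn ρ E
  cont : ContinuousOn f E
  eq : ∀ ζ ∈ V, f ζ = f₀ + I fun σ => ρ σ * f σ / (σ + ζ)

variable {E V : Set ℂ} {I : (ℂ → ℂ) → ℂ} {ρ ρ' ρ'' f g h : ℂ → ℂ} {f₀ g₀ h₀ α₀ β₀ α₁ : ℂ}

theorem SolvesIE.continuousOn_div (hf : SolvesIE E V I ρ f₀ f) {φ : ℂ → ℂ} (hφ : ContinuousOn φ E)
    {ζ : ℂ} (hζ : ζ ∈ V) : ContinuousOn (fun σ => φ σ / (σ + ζ)) E :=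
  hφ.fun_div (by fun_prop) fun σ hσ => hf.ne σ hσ ζ hζ

/-- Multiplication of a solution by a linear polynomial, compensated in the weight. -/
theorem SolvesIE.transfer (hI : CauchyFunctional E I) (hg : SolvesIE E V I ρ' g₀ g)
    (hα : ∀ σ ∈ E, (α₀ + α₁ * σ) * ρ σ = (α₀ - α₁ * σ) * ρ' σ) {ζ : ℂ} (hζ : ζ ∈ V) :
    (α₀ + α₁ * ζ) * g ζ = (α₀ + α₁ * ζ) * g₀ + α₁ * I (fun σ => ρ' σ * g σ)
      + I fun σ => ρ σ * ((α₀ + α₁ * σ) * g σ) / (σ + ζ) := by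
  have c1 : ContinuousOn (fun σ => ρ' σ * g σ) E := hg.contρ.fun_mul hg.cont
  have c2 : ContinuousOn (fun σ => (α₀ - α₁ * σ) * (ρ' σ * g σ) / (σ + ζ)) E :=
    hg.continuousOn_div (ContinuousOn.fun_mul (by fun_prop) c1) hζ
  have e1 : (α₀ + α₁ * ζ) * I (fun σ => ρ' σ * g σ / (σ + ζ))
      = I fun σ => α₁ * (ρ' σ * g σ) + (α₀ - α₁ * σ) * (ρ' σ * g σ) / (σ + ζ) := by
    rw [← hI.smul _ _ (hg.continuousOn_div c1 hζ)]
    refine hI.congr _ _ fun σ hσ => ?_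
    have := hg.ne σ hσ ζ hζ
    field_simp
    ring
  rw [hI.add _ _ (continuousOn_const.fun_mul c1) c2, hI.smul _ _ c1] at e1
  have e2 : I (fun σ => (α₀ - α₁ * σ) * (ρ' σ * g σ) / (σ + ζ))
      = I fun σ => ρ σ * ((α₀ + α₁ * σ) * g σ) / (σ + ζ) := by
    refine hI.congr _ _ fun σ hσ => ?_
    rw [show ρ σ * ((α₀ + α₁ * σ) * g σ) = (α₀ + α₁ * σ) * ρ σ * g σ by ring, hα σ hσ]
    ring
  rw [e2] at e1
  rw [hg.eq ζ hζ, mul_add, e1]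
  ring

/-- The bilinear identity for solutions of two integral equations with related weights. -/
theorem SolvesIE.bilinear (hI : CauchyFunctional E I) (hf : SolvesIE E V I ρ f₀ f)
    (hg : SolvesIE E V I ρ' g₀ g)
    (hα : ∀ σ ∈ E, (α₀ + α₁ * σ) * ρ σ = (α₀ - α₁ * σ) * ρ' σ)
    {ζ : ℂ} (hζ : ζ ∈ V) (hζ' : -ζ ∈ V) :
    (α₀ + α₁ * ζ) * g ζ * f (-ζ) - (α₀ - α₁ * ζ) * g (-ζ) * f ζ = 2 * α₁ * f₀ * g₀ * ζ := by
  set c₀ := I (fun σ => ρ σ * f σ)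
  set c₁ := I (fun σ => ρ' σ * g σ) with hc₁
  set γ : ℂ → ℂ := fun σ => ρ σ * f σ * ((α₀ + α₁ * σ) * g σ) with hγ
  have ca : ContinuousOn (fun σ => ρ σ * f σ) E := hf.contρ.fun_mul hf.cont
  have cβ : ContinuousOn (fun σ => ρ σ * ((α₀ + α₁ * σ) * g σ)) E :=
    hf.contρ.fun_mul (ContinuousOn.fun_mul (by fun_prop) hg.cont)
  have cγ : ContinuousOn γ E := ca.fun_mul (ContinuousOn.fun_mul (by fun_prop) hg.cont)
  suffices H : ∀ ζ, ζ ∈ V → -ζ ∈ V → (α₀ + α₁ * ζ) * g ζ * f (-ζ)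
      = (α₀ + α₁ * ζ) * g₀ * f₀ + α₁ * (c₁ * f₀ - c₀ * g₀)
        + (I (fun σ => γ σ / (σ + ζ)) + I (fun σ => γ σ / (σ + -ζ))) by
    have h1 := H ζ hζ hζ'
    have h2 := H (-ζ) hζ' (by rwa [neg_neg])
    rw [neg_neg] at h2
    linear_combination h1 - h2
  intro ζ hζ hζ'
  have ht : ∀ ξ ∈ V, (α₀ + α₁ * ξ) * g ξ = (α₀ + α₁ * ξ) * g₀ + α₁ * c₁
      + I fun σ => ρ σ * ((α₀ + α₁ * σ) * g σ) / (σ + ξ) := fun ξ hξ => hg.transfer hI hα hξ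
  set f₁ := I (fun σ => ρ σ * f σ / (σ + -ζ)) with hf₁
  have hfζ : f (-ζ) = f₀ + f₁ := hf.eq _ hζ'
  set M := I (fun σ => ρ σ * ((α₀ + α₁ * σ) * g σ) / (σ + ζ)) with hM
  have cM : ContinuousOn (fun ξ => I fun σ => ρ σ * ((α₀ + α₁ * σ) * g σ) / (σ + ξ)) E := by
    have : ContinuousOn (fun ξ => (α₀ + α₁ * ξ) * g ξ - (α₀ + α₁ * ξ) * g₀ - α₁ * c₁) E :=
      ((ContinuousOn.fun_mul (by fun_prop) hg.cont).fun_sub (by fun_prop)).fun_sub continuousOn_const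
    exact this.congr fun ξ hξ => by simp only [ht ξ (hg.subset hξ)]; ring
  have cf₁ : ContinuousOn (fun ξ => I fun σ => ρ σ * f σ / (σ + ξ)) E := by
    have : ContinuousOn (fun ξ => f ξ - f₀) E := hf.cont.sub continuousOn_const
    exact this.congr fun ξ hξ => by simp only; linear_combination -hf.eq ξ (hf.subset hξ)
  -- the product of the two integrals, by partial fractions
  have prod : f₁ * M
      = I (fun σ => ρ σ * f σ / (σ + -ζ)
          * I fun τ => ρ τ * ((α₀ + α₁ * τ) * g τ) / (τ + σ))
        + I (fun τ => ρ τ * ((α₀ + α₁ * τ) * g τ) / (τ + ζ)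
          * I fun σ => ρ σ * f σ / (σ + τ)) := by
    rw [← hI.fubini _ _ ca (hf.continuousOn_div cβ hζ)]
    have c3 : ContinuousOn (fun σ => ρ σ * f σ *
        I fun τ => ρ τ * ((α₀ + α₁ * τ) * g τ) / (τ + ζ) / (τ + σ)) E := by
      refine ca.fun_mul ?_
      have c4 : ContinuousOn (fun σ => (M - I fun τ => ρ τ * ((α₀ + α₁ * τ) * g τ) / (τ + σ))
          / (σ + -ζ)) E := hf.continuousOn_div (continuousOn_const.fun_sub cM) hζ'
      refine c4.congr fun σ hσ => ?_
      have hne := hf.ne σ hσ (-ζ) hζ'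
      simp only
      rw [eq_div_iff hne, mul_comm, ← hI.smul _ _
        ((hf.continuousOn_div cβ hζ).fun_div (by fun_prop) fun τ hτ => hI.ne τ hτ σ hσ)]
      rw [eq_sub_iff_add_eq, hM, ← hI.add]
      · refine hI.congr _ _ fun τ hτ => ?_
        have h1 := hf.ne τ hτ ζ hζ
        have h2 := hI.ne τ hτ σ hσ
        field_simp
        ring
      · exact continuousOn_const.fun_mul
          ((hf.continuousOn_div cβ hζ).fun_div (by fun_prop) fun τ hτ => hI.ne τ hτ σ hσ)
      · exact cβ.fun_div (by fun_prop) fun τ hτ => hI.ne τ hτ σ hσ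
    rw [← hI.add _ _ ((hf.continuousOn_div ca hζ').fun_mul cM) c3, mul_comm, hf₁,
      ← hI.smul _ _ (hf.continuousOn_div ca hζ')]
    refine hI.congr _ _ fun σ hσ => ?_
    have hne := hf.ne σ hσ (-ζ) hζ'
    have e1 : M = I (fun τ => ρ τ * ((α₀ + α₁ * τ) * g τ) / (τ + σ))
        + (σ + -ζ) * I (fun τ => ρ τ * ((α₀ + α₁ * τ) * g τ) / (τ + ζ) / (τ + σ)) := by
      rw [← hI.smul _ _
        ((hf.continuousOn_div cβ hζ).fun_div (by fun_prop) fun τ hτ => hI.ne τ hτ σ hσ), hM, ← hI.add]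
      · refine hI.congr _ _ fun τ hτ => ?_
        have h1 := hf.ne τ hτ ζ hζ
        have h2 := hI.ne τ hτ σ hσ
        field_simp
        ring
      · exact cβ.fun_div (by fun_prop) fun τ hτ => hI.ne τ hτ σ hσ
      · exact continuousOn_const.fun_mul
          ((hf.continuousOn_div cβ hζ).fun_div (by fun_prop) fun τ hτ => hI.ne τ hτ σ hσ)
    rw [e1]
    field_simp
  have p1 : I (fun σ => ρ σ * f σ / (σ + -ζ)
      * I fun τ => ρ τ * ((α₀ + α₁ * τ) * g τ) / (τ + σ))
      = I (fun σ => γ σ / (σ + -ζ)) - (g₀ * ((α₀ + α₁ * ζ) * f₁ + α₁ * c₀) + α₁ * c₁ * f₁) := by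
    rw [eq_sub_iff_add_eq]
    have e1 : g₀ * ((α₀ + α₁ * ζ) * f₁ + α₁ * c₀) + α₁ * c₁ * f₁
        = I fun σ => (g₀ * (α₀ + α₁ * ζ) + α₁ * c₁) * (ρ σ * f σ / (σ + -ζ))
          + g₀ * α₁ * (ρ σ * f σ) := by
      rw [hI.add _ _ (continuousOn_const.fun_mul (hf.continuousOn_div ca hζ'))
        (continuousOn_const.fun_mul ca), hI.smul _ _ (hf.continuousOn_div ca hζ'), hI.smul _ _ ca]
      ring
    rw [e1, ← hI.add _ _ ((hf.continuousOn_div ca hζ').fun_mul cM)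
      ((continuousOn_const.fun_mul (hf.continuousOn_div ca hζ')).fun_add (continuousOn_const.fun_mul ca))]
    refine hI.congr _ _ fun σ hσ => ?_
    have hne := hf.ne σ hσ (-ζ) hζ'
    have := ht σ (hf.subset hσ)
    rw [← sub_eq_iff_eq_add'] at this
    rw [← this, hγ]
    field_simp
    ring
  have p2 : I (fun τ => ρ τ * ((α₀ + α₁ * τ) * g τ) / (τ + ζ) * I fun σ => ρ σ * f σ / (σ + τ))
      = I (fun σ => γ σ / (σ + ζ)) - f₀ * M := by
    rw [eq_sub_iff_add_eq, hM, ← hI.smul _ _ (hf.continuousOn_div cβ hζ),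
      ← hI.add _ _ ((hf.continuousOn_div cβ hζ).fun_mul cf₁)
        (continuousOn_const.fun_mul (hf.continuousOn_div cβ hζ))]
    refine hI.congr _ _ fun τ hτ => ?_
    have := hf.eq τ (hf.subset hτ)
    rw [← sub_eq_iff_eq_add'] at this
    rw [← this, hγ]
    ring
  rw [p1, p2] at prod
  rw [ht ζ hζ, hfζ]
  linear_combination prod

/-- Linear relations between solutions at neighbouring lattice points, from uniqueness. -/
theorem SolvesIE.linear_relation (hI : CauchyFunctional E I) (hf : SolvesIE E V I ρ 1 f)
    (hu : ∀ h, SolvesIE E V I ρ 1 h → ∀ ζ ∈ V, h ζ = f ζ)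
    (hg : SolvesIE E V I ρ' 1 g) (hh : SolvesIE E V I ρ'' 1 h)
    (hα : ∀ σ ∈ E, (α₀ + α₁ * σ) * ρ σ = (α₀ - α₁ * σ) * ρ' σ)
    (hβ : ∀ σ ∈ E, (β₀ + α₁ * σ) * ρ σ = (β₀ - α₁ * σ) * ρ'' σ) {ζ : ℂ} (hζ : ζ ∈ V) :
    (α₀ + α₁ * ζ) * g ζ - (β₀ + α₁ * ζ) * h ζ
      = (α₀ - β₀ + α₁ * (I (fun σ => ρ' σ * g σ) - I (fun σ => ρ'' σ * h σ))) * f ζ := by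
  set κ := α₀ - β₀ + α₁ * (I (fun σ => ρ' σ * g σ) - I (fun σ => ρ'' σ * h σ)) with hκ
  set w : ℂ → ℂ := fun ζ => (α₀ + α₁ * ζ) * g ζ - (β₀ + α₁ * ζ) * h ζ with hw
  have cg : ContinuousOn (fun σ => (α₀ + α₁ * σ) * g σ) E := ContinuousOn.fun_mul (by fun_prop) hg.cont
  have ch : ContinuousOn (fun σ => (β₀ + α₁ * σ) * h σ) E := ContinuousOn.fun_mul (by fun_prop) hh.cont
  have cw : ContinuousOn w E := cg.fun_sub ch
  have ew : ∀ ζ ∈ V, w ζ = κ + I fun σ => ρ σ * w σ / (σ + ζ) := by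
    intro ζ hζ
    have e1 : I (fun σ => ρ σ * w σ / (σ + ζ)) + I (fun σ => ρ σ * ((β₀ + α₁ * σ) * h σ) / (σ + ζ))
        = I (fun σ => ρ σ * ((α₀ + α₁ * σ) * g σ) / (σ + ζ)) := by
      rw [← hI.add _ _ (hf.continuousOn_div (hf.contρ.fun_mul cw) hζ)
        (hf.continuousOn_div (hf.contρ.fun_mul ch) hζ)]
      refine hI.congr _ _ fun σ _ => ?_
      simp only [hw]; ring
    have h1 := hg.transfer hI hα hζ
    have h2 := hh.transfer hI hβ hζ
    simp only [hw] at e1 ⊢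
    linear_combination h1 - h2 - e1
  have hs : SolvesIE E V I ρ 1 fun ζ => f ζ + (w ζ - κ * f ζ) := by
    have c1 : ContinuousOn (fun σ => ρ σ * f σ) E := hf.contρ.fun_mul hf.cont
    refine ⟨hf.subset, hf.ne, hf.contρ, hf.cont.fun_add (cw.fun_sub (continuousOn_const.fun_mul hf.cont)),
      fun ζ hζ => ?_⟩
    have e1 : I (fun σ => ρ σ * (f σ + (w σ - κ * f σ)) / (σ + ζ))
        = (1 - κ) * I (fun σ => ρ σ * f σ / (σ + ζ)) + I (fun σ => ρ σ * w σ / (σ + ζ)) := by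
      rw [← hI.smul _ _ (hf.continuousOn_div c1 hζ), ← hI.add _ _
        (continuousOn_const.fun_mul (hf.continuousOn_div c1 hζ))
        (hf.continuousOn_div (hf.contρ.fun_mul cw) hζ)]
      exact hI.congr _ _ fun σ _ => by ring
    rw [e1, ew ζ hζ]
    have := hf.eq ζ hζ
    linear_combination (1 - κ) * this
  have := hu _ hs ζ hζ
  simp only [hw] at this ⊢
  linear_combination this

open MeasureTheory

/-! ### Integrals along contours -/

theorem IsContour.continuousOn {L : ℝ → ℂ} (hL : IsContour L) : ContinuousOn L (Icc 0 1) := by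
  obtain ⟨m, τ, h0, h1, h⟩ := hL.pieces
  have key : ∀ k ≤ m, τ 0 ≤ τ k ∧ ContinuousOn L (Icc (τ 0) (τ k)) := by
    intro k hk
    induction k with
    | zero => simp
    | succ k ih =>
      obtain ⟨i1, i2⟩ := ih (by omega)
      obtain ⟨h2, h3⟩ := h k (by omega)
      refine ⟨i1.trans h2.le, ?_⟩
      rw [← Icc_union_Icc_eq_Icc i1 h2.le]
      exact i2.union_of_isClosed h3.continuousOn isClosed_Icc isClosed_Icc
  simpa [h0, h1] using (key m le_rfl).2

theorem IsContour.exists_norm_deriv_le {L : ℝ → ℂ} (hL : IsContour L) :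
    ∃ B : ℝ, 0 ≤ B ∧ ∀ᵐ t ∂(volume.restrict (Ioc (0 : ℝ) 1)), ‖deriv L t‖ ≤ B := by
  obtain ⟨m, τ, h0, h1, h⟩ := hL.pieces
  have key : ∀ k ≤ m, τ 0 ≤ τ k ∧ ∃ B : ℝ, 0 ≤ B ∧
      ∀ᵐ t, t ∈ Ioc (τ 0) (τ k) → ‖deriv L t‖ ≤ B := by
    intro k hk
    induction k with
    | zero => exact ⟨le_rfl, 0, le_rfl, by simp⟩
    | succ k ih =>
      obtain ⟨i1, B, hB, i2⟩ := ih (by omega)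
      obtain ⟨h2, h3⟩ := h k (by omega)
      refine ⟨i1.trans h2.le, ?_⟩
      have hc : ContinuousOn (derivWithin L (Icc (τ k) (τ (k + 1)))) (Icc (τ k) (τ (k + 1))) :=
        h3.continuousOn_derivWithin (uniqueDiffOn_Icc h2) le_rfl
      obtain ⟨C, hC⟩ := isCompact_Icc.exists_bound_of_continuousOn hc
      refine ⟨max B C, hB.trans (le_max_left _ _), ?_⟩
      have hn : ∀ᵐ t : ℝ, t ≠ τ (k + 1) := by
        simp [ae_iff, measure_singleton]
      filter_upwards [i2, hn] with t ht hne hmem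
      rcases le_or_gt t (τ k) with h' | h'
      · exact (ht ⟨hmem.1, h'⟩).trans (le_max_left _ _)
      · have hlt : t < τ (k + 1) := lt_of_le_of_ne hmem.2 hne
        have : derivWithin L (Icc (τ k) (τ (k + 1))) t = deriv L t :=
          derivWithin_of_mem_nhds (Icc_mem_nhds h' hlt)
        rw [← this]
        exact (hC t ⟨h'.le, hlt.le⟩).trans (le_max_right _ _)
  obtain ⟨-, B, hB, hb⟩ := key m le_rfl
  refine ⟨B, hB, ?_⟩
  rw [ae_restrict_iff' measurableSet_Ioc]
  simpa [h0, h1] using hb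

theorem isCompact_curveTrace {L : ℝ → ℂ} (hL : IsContour L) : IsCompact (curveTrace L) :=
  isCompact_Icc.image_of_continuousOn hL.continuousOn

theorem curveInt_eq (L : ℝ → ℂ) (f : ℂ → ℂ) :
    curveInt L f = ∫ t in Ioc (0 : ℝ) 1, f (L t) * deriv L t :=
  intervalIntegral.integral_of_le zero_le_one

theorem mem_curveTrace {L : ℝ → ℂ} {t : ℝ} (ht : t ∈ Ioc (0 : ℝ) 1) : L t ∈ curveTrace L :=
  mem_image_of_mem _ (Ioc_subset_Icc_self ht)

theorem curveInt_congr {L : ℝ → ℂ} {f g : ℂ → ℂ} (h : ∀ σ ∈ curveTrace L, f σ = g σ) :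
    curveInt L f = curveInt L g := by
  rw [curveInt_eq, curveInt_eq]
  exact setIntegral_congr_fun measurableSet_Ioc fun t ht => by simp only [h _ (mem_curveTrace ht)]

section

variable {L : ℝ → ℂ}

theorem IsContour.continuousOn_comp (hL : IsContour L) {f : ℂ → ℂ} (hf : ContinuousOn f (curveTrace L)) :
    ContinuousOn (fun t => f (L t)) (Ioc 0 1) :=
  hf.comp (hL.continuousOn.mono Ioc_subset_Icc_self) fun _ ht => mem_curveTrace ht

theorem IsContour.aestronglyMeasurable (hL : IsContour L) {f : ℂ → ℂ} (hf : ContinuousOn f (curveTrace L)) :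
    AEStronglyMeasurable (fun t => f (L t) * deriv L t) (volume.restrict (Ioc (0 : ℝ) 1)) :=
  ((hL.continuousOn_comp hf).aestronglyMeasurable measurableSet_Ioc).mul
    (measurable_deriv L).aestronglyMeasurable

theorem IsContour.integrable (hL : IsContour L) {f : ℂ → ℂ} (hf : ContinuousOn f (curveTrace L)) :
    Integrable (fun t => f (L t) * deriv L t) (volume.restrict (Ioc (0 : ℝ) 1)) := by
  obtain ⟨B, hB, hb⟩ := hL.exists_norm_deriv_le
  obtain ⟨C, hC⟩ := (isCompact_curveTrace hL).exists_bound_of_continuousOn hf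
  refine Integrable.mono' (integrable_const (|C| * B)) (hL.aestronglyMeasurable hf) ?_
  filter_upwards [hb, ae_restrict_mem measurableSet_Ioc] with t ht hm
  rw [norm_mul]
  exact mul_le_mul ((hC _ (mem_curveTrace hm)).trans (le_abs_self C)) ht (norm_nonneg _)
    (abs_nonneg C)

theorem IsContour.exists_norm_curveInt_le (hL : IsContour L) : ∃ B : ℝ, 0 ≤ B ∧ ∀ (f : ℂ → ℂ) (M : ℝ), 0 ≤ M →
    (∀ σ ∈ curveTrace L, ‖f σ‖ ≤ M) → ‖curveInt L f‖ ≤ B * M := by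
  obtain ⟨B, hB, hb⟩ := hL.exists_norm_deriv_le
  refine ⟨B, hB, fun f M hM hf => ?_⟩
  rw [curveInt_eq]
  refine (norm_integral_le_of_norm_le (integrable_const (B * M)) ?_).trans (by simp)
  filter_upwards [hb, ae_restrict_mem measurableSet_Ioc] with t ht hm
  rw [norm_mul, mul_comm]
  exact mul_le_mul ht (hf _ (mem_curveTrace hm)) (norm_nonneg _) hB

theorem IsContour.curveInt_add (hL : IsContour L) {f g : ℂ → ℂ} (hf : ContinuousOn f (curveTrace L))
    (hg : ContinuousOn g (curveTrace L)) :
    curveInt L (fun σ => f σ + g σ) = curveInt L f + curveInt L g := by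
  rw [curveInt_eq, curveInt_eq, curveInt_eq, ← integral_add (hL.integrable hf) (hL.integrable hg)]
  simp only [add_mul]

theorem curveInt_const_mul (c : ℂ) (f : ℂ → ℂ) :
    curveInt L (fun σ => c * f σ) = c * curveInt L f := by
  rw [curveInt_eq, curveInt_eq, ← integral_const_mul]
  simp only [mul_assoc]

theorem IsContour.curveInt_sum (hL : IsContour L) {ι : Type*} (s : Finset ι) (f : ι → ℂ → ℂ)
    (hf : ∀ i ∈ s, ContinuousOn (f i) (curveTrace L)) :
    curveInt L (fun σ => ∑ i ∈ s, f i σ) = ∑ i ∈ s, curveInt L (f i) := by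
  simp only [curveInt_eq]
  rw [← integral_finsetSum s fun i hi => hL.integrable (hf i hi)]
  simp only [Finset.sum_mul]

theorem IsContour.curveInt_curveInt_swap (hL : IsContour L) {k : ℂ → ℂ → ℂ}
    (hk : ContinuousOn (Function.uncurry k) (curveTrace L ×ˢ curveTrace L)) :
    curveInt L (fun σ => curveInt L fun τ => k σ τ)
      = curveInt L (fun τ => curveInt L fun σ => k σ τ) := by
  obtain ⟨B, hB, hb⟩ := hL.exists_norm_deriv_le
  obtain ⟨C, hC⟩ := ((isCompact_curveTrace hL).prod
    (isCompact_curveTrace hL)).exists_bound_of_continuousOn hk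
  simp only [curveInt_eq]
  have hc : ContinuousOn (fun s : ℝ × ℝ => k (L s.1) (L s.2)) (Ioc 0 1 ×ˢ Ioc 0 1) := by
    have hL' := hL.continuousOn.mono Ioc_subset_Icc_self
    exact hk.comp (f := fun s : ℝ × ℝ => (L s.1, L s.2))
      ((hL'.comp continuousOn_fst fun s hs => hs.1).prodMk
        (hL'.comp continuousOn_snd fun s hs => hs.2))
      fun s hs => ⟨mem_curveTrace hs.1, mem_curveTrace hs.2⟩
  have hm : AEStronglyMeasurable (fun s : ℝ × ℝ => k (L s.1) (L s.2) * deriv L s.2 * deriv L s.1)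
      ((volume.restrict (Ioc (0 : ℝ) 1)).prod (volume.restrict (Ioc (0 : ℝ) 1))) := by
    rw [Measure.prod_restrict]
    exact ((hc.aestronglyMeasurable (measurableSet_Ioc.prod measurableSet_Ioc)).mul
      ((measurable_deriv L).comp measurable_snd).aestronglyMeasurable).mul
      ((measurable_deriv L).comp measurable_fst).aestronglyMeasurable
  have hi : Integrable (fun s : ℝ × ℝ => k (L s.1) (L s.2) * deriv L s.2 * deriv L s.1)
      ((volume.restrict (Ioc (0 : ℝ) 1)).prod (volume.restrict (Ioc (0 : ℝ) 1))) := by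
    refine Integrable.mono' (integrable_const (|C| * B * B)) hm ?_
    have e1 := Measure.quasiMeasurePreserving_fst (μ := volume.restrict (Ioc (0 : ℝ) 1))
      (ν := volume.restrict (Ioc (0 : ℝ) 1))
    have e2 := Measure.quasiMeasurePreserving_snd (μ := volume.restrict (Ioc (0 : ℝ) 1))
      (ν := volume.restrict (Ioc (0 : ℝ) 1))
    filter_upwards [e1.ae hb, e2.ae hb, e1.ae (ae_restrict_mem measurableSet_Ioc),
      e2.ae (ae_restrict_mem measurableSet_Ioc)] with s h1 h2 h3 h4
    rw [norm_mul, norm_mul]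
    have := (hC (L s.1, L s.2) ⟨mem_curveTrace h3, mem_curveTrace h4⟩).trans (le_abs_self C)
    exact mul_le_mul (mul_le_mul this h2 (norm_nonneg _) (abs_nonneg C)) h1 (norm_nonneg _)
      (by positivity)
  calc _ = ∫ t in Ioc (0 : ℝ) 1, ∫ s in Ioc (0 : ℝ) 1, k (L t) (L s) * deriv L s * deriv L t := by
        simp only [← integral_mul_const]
    _ = ∫ s in Ioc (0 : ℝ) 1, ∫ t in Ioc (0 : ℝ) 1, k (L t) (L s) * deriv L s * deriv L t :=
        integral_integral_swap hi
    _ = _ := by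
        simp only [← integral_mul_const]
        congr 1; ext s; congr 1; ext t; ring

/-- Integrals along a contour depend analytically on parameters. -/
theorem IsContour.differentiableOn_curveInt (hL : IsContour L) {U : Set ℂ} (hU : IsOpen U) {k : ℂ → ℂ → ℂ}
    (hc : ContinuousOn (Function.uncurry k) (U ×ˢ curveTrace L))
    (hd : ∀ w ∈ curveTrace L, DifferentiableOn ℂ (fun z => k z w) U) :
    DifferentiableOn ℂ (fun z => curveInt L (k z)) U := by
  intro z₀ hz₀
  obtain ⟨r, hr, hrU⟩ := Metric.nhds_basis_closedBall.mem_iff.1 (hU.mem_nhds hz₀)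
  obtain ⟨B, hB, hb⟩ := hL.exists_norm_deriv_le
  obtain ⟨C, hC⟩ := ((isCompact_closedBall z₀ r).prod
    (isCompact_curveTrace hL)).exists_bound_of_continuousOn (hc.mono (prod_mono_left hrU))
  have hC' : ∀ z ∈ Metric.closedBall z₀ r, ∀ w ∈ curveTrace L, ‖k z w‖ ≤ |C| := fun z hz w hw =>
    (hC (z, w) ⟨hz, hw⟩).trans (le_abs_self C)
  have hk : ∀ z ∈ U, ContinuousOn (k z) (curveTrace L) := fun z hz =>
    hc.comp (continuousOn_const.prodMk continuousOn_id) fun w hw => ⟨hz, hw⟩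
  set ν := volume.restrict (Ioc (0 : ℝ) 1)
  have hball : ∀ z ∈ Metric.ball z₀ (r / 2), Metric.closedBall z (r / 2) ⊆ Metric.closedBall z₀ r := by
    intro z hz w hw
    rw [Metric.mem_closedBall] at hw ⊢
    rw [Metric.mem_ball] at hz
    linarith [dist_triangle w z z₀]
  have hnhds : ∀ z ∈ Metric.ball z₀ (r / 2), U ∈ 𝓝 z := fun z hz =>
    mem_of_superset (Metric.closedBall_mem_nhds z (by positivity)) ((hball z hz).trans hrU)
  have hF' : AEStronglyMeasurable (fun t => deriv (fun z => k z (L t)) z₀ * deriv L t) ν := by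
    have hs : Tendsto (fun n : ℕ => z₀ + (r : ℂ) * (1 / ((n : ℂ) + 1))) atTop (𝓝[≠] z₀) := by
      rw [tendsto_nhdsWithin_iff]
      constructor
      · have := (tendsto_one_div_add_atTop_nhds_zero_nat (𝕜 := ℂ)).const_mul (r : ℂ)
        simpa using this.const_add z₀
      · refine Eventually.of_forall fun n => ?_
        have : (n : ℂ) + 1 ≠ 0 := by exact_mod_cast n.succ_ne_zero
        have hr' : (r : ℂ) ≠ 0 := by exact_mod_cast hr.ne'
        simp [this, hr']
    refine aestronglyMeasurable_of_tendsto_ae atTop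
      (f := fun (n : ℕ) t => slope (fun z => k z (L t)) z₀ (z₀ + (r : ℂ) * (1 / ((n : ℂ) + 1)))
        * deriv L t) (fun n => ?_) ?_
    · have hmem : z₀ + (r : ℂ) * (1 / ((n : ℂ) + 1)) ∈ U := by
        apply hrU
        rw [Metric.mem_closedBall, dist_eq_norm, add_sub_cancel_left, norm_mul, norm_div, norm_one,
          Complex.norm_real, Real.norm_of_nonneg hr.le]
        have : ‖(n : ℂ) + 1‖ = n + 1 := by
          rw [show (n : ℂ) + 1 = ((n + 1 : ℕ) : ℂ) by push_cast; rfl, Complex.norm_natCast]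
          push_cast; rfl
        rw [this]
        have h1 : 1 / ((n : ℝ) + 1) ≤ 1 := by
          rw [div_le_one (by positivity)]; linarith [(Nat.cast_nonneg n : (0 : ℝ) ≤ n)]
        nlinarith
      refine AEStronglyMeasurable.mul ?_ (measurable_deriv L).aestronglyMeasurable
      simp only [slope, vsub_eq_sub, smul_eq_mul]
      exact (continuousOn_const.mul ((hL.continuousOn_comp (hk _ hmem)).sub (hL.continuousOn_comp (hk _ hz₀)))).aestronglyMeasurable measurableSet_Ioc
    · filter_upwards [ae_restrict_mem measurableSet_Ioc] with t ht
      have hdt : HasDerivAt (fun z => k z (L t)) (deriv (fun z => k z (L t)) z₀) z₀ :=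
        ((hd _ (mem_curveTrace ht)).differentiableAt (hU.mem_nhds hz₀)).hasDerivAt
      exact ((hasDerivAt_iff_tendsto_slope.1 hdt).comp hs).mul_const _
  have main := hasDerivAt_integral_of_dominated_loc_of_deriv_le (μ := ν) (𝕜 := ℂ)
    (F := fun z t => k z (L t) * deriv L t)
    (F' := fun z t => deriv (fun z => k z (L t)) z * deriv L t) (x₀ := z₀)
    (s := Metric.ball z₀ (r / 2)) (bound := fun _ => |C| / (r / 2) * B)
    (Metric.ball_mem_nhds z₀ (by positivity))
    (by
      filter_upwards [hU.mem_nhds hz₀] with z hz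
      exact hL.aestronglyMeasurable (hk z hz))
    (hL.integrable (hk z₀ hz₀)) hF'
    (by
      filter_upwards [hb, ae_restrict_mem measurableSet_Ioc] with t ht hm z hz
      rw [norm_mul]
      refine mul_le_mul ?_ ht (norm_nonneg _) (by positivity)
      refine Complex.norm_deriv_le_of_forall_mem_sphere_norm_le (by positivity) ?_ ?_
      · refine DifferentiableOn.diffContOnCl ?_
        rw [closure_ball _ (by positivity)]
        exact (hd _ (mem_curveTrace hm)).mono ((hball z hz).trans hrU)
      · exact fun w hw => hC' w (hball z hz (Metric.sphere_subset_closedBall hw)) _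
          (mem_curveTrace hm))
    (integrable_const _)
    (by
      filter_upwards [ae_restrict_mem measurableSet_Ioc] with t hm z hz
      exact (((hd _ (mem_curveTrace hm)).differentiableAt (hnhds z hz)).hasDerivAt).mul_const _)
  have h2 := main.2.differentiableAt
  simp only [curveInt_eq]
  exact h2.differentiableWithinAt

end

/-! ### Cauchy's theorem for contours -/

theorem continuousOn_uncurry_dslope {f : ℂ → ℂ} {U : Set ℂ} (hU : IsOpen U)
    (hf : DifferentiableOn ℂ f U) : ContinuousOn (Function.uncurry (dslope f)) (U ×ˢ U) := by
  rintro ⟨a, b⟩ ⟨ha, hb⟩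
  apply ContinuousAt.continuousWithinAt
  by_cases hab : a = b
  · subst hab
    have han : AnalyticAt ℂ f a := hf.analyticAt (hU.mem_nhds ha)
    have hs : HasStrictFDerivAt f _ a := han.hasStrictDerivAt
    have hd : ContinuousAt (deriv f) a := han.deriv.continuousAt
    rw [Metric.continuousAt_iff']
    intro ε hε
    have h1 := hs.isLittleO.def (half_pos hε)
    have h2 : ∀ᶠ x : ℂ × ℂ in 𝓝 (a, a), dist (deriv f x.1) (deriv f a) < ε :=
      (continuousAt_fst (p := (a, a))).eventually (Metric.continuousAt_iff'.1 hd ε hε)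
    filter_upwards [h1, h2] with ⟨z, w⟩ h1 h2
    simp only [Function.uncurry_apply_pair, dslope_same]
    by_cases hzw : w = z
    · subst hzw; simpa [dslope_same] using h2
    · rw [dslope_of_ne _ hzw, slope_def_field, dist_eq_norm]
      have hne : z - w ≠ 0 := sub_ne_zero.2 (Ne.symm hzw)
      have hne' : w - z ≠ 0 := sub_ne_zero.2 hzw
      have e : (f w - f z) / (w - z) - deriv f a = (f z - f w - (z - w) * deriv f a) / (z - w) := by
        field_simp
        ring
      simp only [ContinuousLinearMap.toSpanSingleton_apply, smul_eq_mul] at h1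
      rw [e, norm_div, div_lt_iff₀ (norm_pos_iff.2 hne)]
      have := norm_pos_iff.2 hne
      nlinarith
  · have hev : ∀ᶠ x : ℂ × ℂ in 𝓝 (a, b), x.2 ≠ x.1 := by
      have : IsOpen {x : ℂ × ℂ | x.2 ≠ x.1} := isOpen_ne_fun continuous_snd continuous_fst
      exact this.mem_nhds (Ne.symm hab)
    have hca : ContinuousAt f a := (hf.differentiableAt (hU.mem_nhds ha)).continuousAt
    have hcb : ContinuousAt f b := (hf.differentiableAt (hU.mem_nhds hb)).continuousAt
    have h : ContinuousAt (fun x : ℂ × ℂ => (f x.2 - f x.1) / (x.2 - x.1)) (a, b) :=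
      ((ContinuousAt.comp (f := Prod.snd) (x := (a, b)) hcb continuousAt_snd).sub
        (ContinuousAt.comp (f := Prod.fst) (x := (a, b)) hca continuousAt_fst)).div
        (continuousAt_snd.sub continuousAt_fst) (sub_ne_zero.2 (Ne.symm hab))
    refine h.congr ?_
    filter_upwards [hev] with x hx
    rw [Function.uncurry, dslope_of_ne _ hx, slope_def_field]

theorem two_pi_I_ne_zero : (2 * Real.pi * Complex.I : ℂ) ≠ 0 := Complex.two_pi_I_ne_zero

section

variable {L : ℝ → ℂ} {φ f : ℂ → ℂ} {U : Set ℂ}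

theorem IsContour.differentiableOn_cauchy (hL : IsContour L)
    (hφ : ContinuousOn φ (curveTrace L)) :
    DifferentiableOn ℂ (fun z => curveInt L fun w => φ w / (w - z)) (curveTrace L)ᶜ := by
  refine hL.differentiableOn_curveInt (isCompact_curveTrace hL).isClosed.isOpen_compl
    (k := fun z w => φ w / (w - z)) ?_ ?_
  · refine ContinuousOn.div (hφ.comp continuousOn_snd fun x hx => hx.2)
      (by fun_prop) fun x hx h => hx.1 ?_
    rw [sub_eq_zero] at h
    exact h ▸ hx.2
  · intro w hw z hz
    have : w - z ≠ 0 := sub_ne_zero.2 fun h => hz (h ▸ hw)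
    exact ((differentiableAt_const _).div (by fun_prop) this).differentiableWithinAt

theorem IsContour.tendsto_cauchy (hL : IsContour L) (hφ : ContinuousOn φ (curveTrace L)) :
    Tendsto (fun z => curveInt L fun w => φ w / (w - z)) (cocompact ℂ) (𝓝 0) := by
  obtain ⟨B, hB, hb⟩ := hL.exists_norm_curveInt_le
  obtain ⟨C, hC⟩ := (isCompact_curveTrace hL).exists_bound_of_continuousOn hφ
  obtain ⟨R, hR⟩ := (isCompact_curveTrace hL).isBounded.exists_norm_le
  have ht : Tendsto (fun z : ℂ => ‖z‖ - R) (cocompact ℂ) atTop :=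
    tendsto_atTop_add_const_right _ _ tendsto_norm_cocompact_atTop
  have ht' : Tendsto (fun z : ℂ => B * (|C| / (‖z‖ - R))) (cocompact ℂ) (𝓝 0) := by
    simpa using (ht.const_div_atTop |C|).const_mul B
  refine squeeze_zero_norm' ?_ ht'
  filter_upwards [ht.eventually_gt_atTop 0] with z hz
  refine hb _ _ (by positivity) fun σ hσ => ?_
  rw [norm_div]
  have h1 : ‖z‖ - R ≤ ‖σ - z‖ := by
    have := norm_sub_norm_le z σ
    rw [norm_sub_rev] at this
    linarith [hR σ hσ]
  exact div_le_div₀ (abs_nonneg C) ((hC σ hσ).trans (le_abs_self C)) hz h1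

theorem IsContour.continuousOn_winding (hL : IsContour L) :
    ContinuousOn (winding L) (curveTrace L)ᶜ :=
  continuousOn_const.mul (hL.differentiableOn_cauchy continuousOn_const).continuousOn

theorem IsContour.isOpen_winding_preimage (hL : IsContour L) (c : ℂ) :
    IsOpen {z | z ∉ curveTrace L ∧ winding L z ≠ c} :=
  hL.continuousOn_winding.isOpen_inter_preimage
    (isCompact_curveTrace hL).isClosed.isOpen_compl isOpen_compl_singleton

theorem IsContour.isOpen_intRegion (hL : IsContour L) : IsOpen (intRegion L) := by
  convert hL.isOpen_winding_preimage 0 using 1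
  ext z
  refine ⟨fun h => ⟨h.1, by rw [h.2]; exact one_ne_zero⟩, fun h => ⟨h.1, ?_⟩⟩
  exact (hL.oriented z h.1).resolve_left h.2

theorem IsContour.isOpen_extRegion (hL : IsContour L) : IsOpen (extRegion L) := by
  convert hL.isOpen_winding_preimage 1 using 1
  ext z
  refine ⟨fun h => ⟨h.1, by rw [h.2]; exact zero_ne_one⟩, fun h => ⟨h.1, ?_⟩⟩
  exact (hL.oriented z h.1).resolve_right h.2

theorem IsContour.compl_extRegion (hL : IsContour L) :
    (extRegion L)ᶜ = intRegion L ∪ curveTrace L := by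
  ext z
  by_cases h : z ∈ curveTrace L
  · simp [extRegion, h]
  · rcases hL.oriented z h with h' | h' <;> simp [extRegion, intRegion, h, h']

theorem disjoint_intRegion_extRegion : Disjoint (intRegion L) (extRegion L) :=
  Set.disjoint_left.2 fun _ h h' => zero_ne_one (h'.2.symm.trans h.2)

theorem IsContour.extRegion_mem_cocompact (hL : IsContour L) :
    extRegion L ∈ cocompact ℂ := by
  have h : Tendsto (winding L) (cocompact ℂ) (𝓝 0) := by
    have := (hL.tendsto_cauchy (continuousOn_const (c := (1 : ℂ)))).const_mul
      (1 / (2 * Real.pi * Complex.I))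
    rwa [mul_zero] at this
  filter_upwards [(isCompact_curveTrace hL).compl_mem_cocompact,
    h.eventually (isOpen_compl_singleton.mem_nhds (zero_ne_one (α := ℂ)))] with z h1 h2
  exact ⟨h1, (hL.oriented z h1).resolve_right h2⟩

theorem IsContour.curveInt_dslope (hL : IsContour L) (hf : ContinuousOn f (curveTrace L))
    {z : ℂ} (hz : z ∉ curveTrace L) :
    curveInt L (dslope f z) = curveInt L (fun w => f w / (w - z))
      - 2 * Real.pi * Complex.I * winding L z * f z := by
  have hc : ContinuousOn (fun w => w - z) (curveTrace L) := by fun_prop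
  have hne : ∀ w ∈ curveTrace L, w - z ≠ 0 := fun w hw => sub_ne_zero.2 fun h => hz (h ▸ hw)
  have h1 : curveInt L (dslope f z)
      = curveInt L fun w => f w / (w - z) + -f z * (1 / (w - z)) := by
    refine curveInt_congr fun w hw => ?_
    rw [dslope_of_ne _ (sub_ne_zero.1 (hne w hw)), slope_def_field]
    have := hne w hw
    field_simp
    ring
  rw [h1, hL.curveInt_add (hf.fun_div hc hne)
    (continuousOn_const.fun_mul (continuousOn_const.fun_div hc hne)), curveInt_const_mul, winding]
  have := two_pi_I_ne_zero
  field_simp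
  ring

theorem IsContour.differentiableOn_curveInt_dslope (hL : IsContour L) (hU : IsOpen U)
    (hf : DifferentiableOn ℂ f U) (ht : curveTrace L ⊆ U) :
    DifferentiableOn ℂ (fun z => curveInt L (dslope f z)) U := by
  refine hL.differentiableOn_curveInt hU
    ((continuousOn_uncurry_dslope hU hf).mono (prod_mono_right ht)) fun w hw => ?_
  have h := (Complex.differentiableOn_dslope (hU.mem_nhds (ht hw))).2 hf
  refine h.congr fun z _ => ?_
  by_cases hzw : z = w
  · rw [hzw]
  · rw [dslope_of_ne _ hzw, dslope_of_ne _ (Ne.symm hzw), slope_comm]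

/-- Cauchy's theorem for functions analytic on and inside the contour. -/
theorem IsContour.curveInt_div_sub_eq_zero (hL : IsContour L) (hU : IsOpen U)
    (hf : DifferentiableOn ℂ f U) (hsub : (extRegion L)ᶜ ⊆ U) {z : ℂ} (hz : z ∈ extRegion L) :
    curveInt L (fun w => f w / (w - z)) = 0 := by
  have ht : curveTrace L ⊆ U := fun w hw => hsub fun h => h.1 hw
  have hfc := hf.continuousOn.mono ht
  classical
  set H : ℂ → ℂ := fun z => if z ∈ U then curveInt L (dslope f z)
    else curveInt L (fun w => f w / (w - z)) with hH
  have hext : ∀ z ∈ extRegion L, H z = curveInt L (fun w => f w / (w - z)) := by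
    intro z hz
    simp only [hH]
    split_ifs with h
    · rw [hL.curveInt_dslope hfc hz.1, hz.2]; ring
    · rfl
  have hd : Differentiable ℂ H := by
    intro z
    by_cases h : z ∈ U
    · refine ((hL.differentiableOn_curveInt_dslope hU hf ht).differentiableAt
        (hU.mem_nhds h)).congr_of_eventuallyEq ?_
      filter_upwards [hU.mem_nhds h] with w hw
      simp [hH, hw]
    · have h' : z ∈ extRegion L := by by_contra h'; exact h (hsub h')
      refine ((hL.differentiableOn_cauchy hfc).differentiableAt
        ((isCompact_curveTrace hL).isClosed.isOpen_compl.mem_nhds h'.1)).congr_of_eventuallyEq ?_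
      filter_upwards [hL.isOpen_extRegion.mem_nhds h'] with w hw
      exact hext w hw
  have hlim : Tendsto H (cocompact ℂ) (𝓝 0) := by
    refine (hL.tendsto_cauchy hfc).congr' ?_
    filter_upwards [hL.extRegion_mem_cocompact] with w hw
    exact (hext w hw).symm
  rw [← hext z hz]
  exact hd.apply_eq_of_tendsto_cocompact z hlim

/-- Cauchy's formula for functions analytic on and outside the contour. -/
theorem IsContour.curveInt_div_sub_eq (hL : IsContour L) (hU : IsOpen U)
    (hf : DifferentiableOn ℂ f U) (hsub : (intRegion L)ᶜ ⊆ U) {l : ℂ}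
    (hl : Tendsto f (cocompact ℂ) (𝓝 l)) {z : ℂ} (hz : z ∈ extRegion L) :
    curveInt L (fun w => f w / (w - z)) = 2 * Real.pi * Complex.I * (l - f z) := by
  have ht : curveTrace L ⊆ U := fun w hw => hsub fun h => h.1 hw
  have hext : extRegion L ⊆ U := fun w hw => hsub fun h =>
    Set.disjoint_left.1 disjoint_intRegion_extRegion h hw
  have hfc := hf.continuousOn.mono ht
  classical
  set H : ℂ → ℂ := fun z => if z ∈ U then curveInt L (dslope f z) + 2 * Real.pi * Complex.I * f z
    else curveInt L (fun w => f w / (w - z)) with hH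
  have hint : ∀ z ∈ intRegion L, H z = curveInt L (fun w => f w / (w - z)) := by
    intro z hz
    simp only [hH]
    split_ifs with h
    · rw [hL.curveInt_dslope hfc hz.1, hz.2]; ring
    · rfl
  have he : ∀ z ∈ extRegion L, H z = curveInt L (fun w => f w / (w - z))
      + 2 * Real.pi * Complex.I * f z := by
    intro z hz
    simp only [hH, if_pos (hext hz)]
    rw [hL.curveInt_dslope hfc hz.1, hz.2]; ring
  have hd : Differentiable ℂ H := by
    intro z
    by_cases h : z ∈ U
    · refine (((hL.differentiableOn_curveInt_dslope hU hf ht).differentiableAt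
        (hU.mem_nhds h)).add (((hf.differentiableAt (hU.mem_nhds h))).const_mul
          (2 * Real.pi * Complex.I))).congr_of_eventuallyEq ?_
      filter_upwards [hU.mem_nhds h] with w hw
      simp [hH, hw]
    · have h' : z ∈ intRegion L := by by_contra h'; exact h (hsub h')
      refine ((hL.differentiableOn_cauchy hfc).differentiableAt
        ((isCompact_curveTrace hL).isClosed.isOpen_compl.mem_nhds h'.1)).congr_of_eventuallyEq ?_
      filter_upwards [hL.isOpen_intRegion.mem_nhds h'] with w hw
      exact hint w hw
  have hlim : Tendsto H (cocompact ℂ) (𝓝 (2 * Real.pi * Complex.I * l)) := by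
    have := (hL.tendsto_cauchy hfc).add (hl.const_mul (2 * Real.pi * Complex.I))
    rw [zero_add] at this
    refine this.congr' ?_
    filter_upwards [hL.extRegion_mem_cocompact] with w hw
    exact (he w hw).symm
  have := hd.apply_eq_of_tendsto_cocompact z hlim
  rw [he z hz] at this
  linear_combination this

theorem curveInt_one_div_sub (L : ℝ → ℂ) (z : ℂ) :
    curveInt L (fun w => 1 / (w - z)) = 2 * Real.pi * Complex.I * winding L z := by
  rw [winding]
  have := two_pi_I_ne_zero
  field_simp

theorem IsContour.curveInt_simple_pole (hL : IsContour L) {z v : ℂ} (hz : z ∈ extRegion L)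
    (hv : v ∈ intRegion L) :
    curveInt L (fun w => 1 / (w - v) / (w - z)) = 2 * Real.pi * Complex.I / (v - z) := by
  have hvz : v - z ≠ 0 := sub_ne_zero.2 fun h =>
    Set.disjoint_left.1 disjoint_intRegion_extRegion hv (h ▸ hz)
  have h1 : ∀ w ∈ curveTrace L, w - v ≠ 0 := fun w hw => sub_ne_zero.2 fun h => hv.1 (h ▸ hw)
  have h2 : ∀ w ∈ curveTrace L, w - z ≠ 0 := fun w hw => sub_ne_zero.2 fun h => hz.1 (h ▸ hw)
  have e : curveInt L (fun w => 1 / (w - v) / (w - z))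
      = curveInt L fun w => (1 / (v - z)) * (1 / (w - v)) + -(1 / (v - z)) * (1 / (w - z)) := by
    refine curveInt_congr fun w hw => ?_
    have := h1 w hw
    have := h2 w hw
    field_simp
    ring
  rw [e, hL.curveInt_add (continuousOn_const.fun_mul (continuousOn_const.fun_div (by fun_prop) h1))
    (continuousOn_const.fun_mul (continuousOn_const.fun_div (by fun_prop) h2)), curveInt_const_mul,
    curveInt_const_mul, curveInt_one_div_sub, curveInt_one_div_sub, hz.2, hv.2]
  ring

end

/-- Partial fractions at simple zeros of the denominator. -/
theorem exists_partial_fractions {U : Set ℂ} (hU : IsOpen U) {Z : Finset ℂ}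
    {f A : ℂ → ℂ} (hf : DifferentiableOn ℂ f U) (hA : DifferentiableOn ℂ A U)
    (h0 : ∀ z ∈ Z, A z = 0) (hne : ∀ z ∈ U, z ∉ Z → A z ≠ 0) (hs : ∀ z ∈ Z, deriv A z ≠ 0) :
    ∃ E : ℂ → ℂ, DifferentiableOn ℂ E U ∧
      ∀ ζ ∈ U, ζ ∉ Z → f ζ / A ζ = E ζ + ∑ z ∈ Z, f z / deriv A z * (1 / (ζ - z)) := by
  classical
  set g : ℂ → ℂ → ℂ := fun z ζ => f ζ / dslope A z ζ with hg
  set E : ℂ → ℂ := fun ζ => if ζ ∈ Z then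
      dslope (g ζ) ζ ζ - ∑ z ∈ Z.erase ζ, f z / deriv A z * (1 / (ζ - z))
    else f ζ / A ζ - ∑ z ∈ Z, f z / deriv A z * (1 / (ζ - z)) with hE
  refine ⟨E, fun ζ hζ => DifferentiableAt.differentiableWithinAt ?_, fun ζ _ hζ => by simp [hE, hζ]⟩
  by_cases hz : ζ ∈ Z
  · have hdA : DifferentiableOn ℂ (dslope A ζ) U :=
      (Complex.differentiableOn_dslope (hU.mem_nhds hζ)).2 hA
    have hd0 : dslope A ζ ζ ≠ 0 := by rw [dslope_same]; exact hs ζ hz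
    have hcont : ContinuousAt (dslope A ζ) ζ :=
      (hdA.differentiableAt (hU.mem_nhds hζ)).continuousAt
    have hev : ∀ᶠ w in 𝓝 ζ, dslope A ζ w ≠ 0 := hcont.eventually_ne hd0
    have hev' : ∀ᶠ w in 𝓝 ζ, w ∈ U ∧ dslope A ζ w ≠ 0 ∧ w ∉ Z.erase ζ := by
      filter_upwards [hU.mem_nhds hζ, hev,
        (Z.erase ζ).finite_toSet.isClosed.isOpen_compl.mem_nhds (by simp)] with w h1 h2 h3
      exact ⟨h1, h2, h3⟩
    obtain ⟨W, hW, hWo, hζW⟩ := eventually_nhds_iff.1 hev'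
    have hgd : DifferentiableOn ℂ (g ζ) W :=
      (hf.mono fun w hw => (hW w hw).1).div (hdA.mono fun w hw => (hW w hw).1)
        fun w hw => (hW w hw).2.1
    have h1 : DifferentiableOn ℂ (dslope (g ζ) ζ) W :=
      (Complex.differentiableOn_dslope (hWo.mem_nhds hζW)).2 hgd
    have h2 : DifferentiableOn ℂ (fun w => ∑ z ∈ Z.erase ζ, f z / deriv A z * (1 / (w - z))) W := by
      refine DifferentiableOn.fun_sum fun z hz' => ?_
      refine (differentiableOn_const _).mul ((differentiableOn_const _).div (by fun_prop) ?_)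
      intro w hw h
      exact (hW w hw).2.2 (by rw [sub_eq_zero.1 h]; exact hz')
    refine ((h1.sub h2).differentiableAt (hWo.mem_nhds hζW)).congr_of_eventuallyEq ?_
    filter_upwards [hWo.mem_nhds hζW] with w hw
    by_cases hwζ : w = ζ
    · subst hwζ; simp [hE, hz]
    · have hwZ : w ∉ Z := fun h => (hW w hw).2.2 (Finset.mem_erase.2 ⟨hwζ, h⟩)
      have hsub : w - ζ ≠ 0 := sub_ne_zero.2 hwζ
      have e1 : A w = (w - ζ) * dslope A ζ w := by
        have := sub_smul_dslope A ζ w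
        rw [h0 ζ hz, sub_zero, smul_eq_mul] at this
        exact this.symm
      have e2 : g ζ ζ = f ζ / deriv A ζ := by simp [hg]
      simp only [hE, if_neg hwZ, Pi.sub_apply]
      rw [← Finset.add_sum_erase Z _ hz, dslope_of_ne _ hwζ, slope_def_field, e2, e1]
      have := (hW w hw).2.1
      have := hs ζ hz
      simp only [hg]
      field_simp
      ring
  · have h1 : DifferentiableAt ℂ (fun w => f w / A w - ∑ z ∈ Z, f z / deriv A z * (1 / (w - z))) ζ := by
      refine ((hf.differentiableAt (hU.mem_nhds hζ)).fun_div (hA.differentiableAt (hU.mem_nhds hζ))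
        (hne ζ hζ hz)).sub (DifferentiableAt.fun_sum fun z hz' => ?_)
      refine (differentiableAt_const _).mul ((differentiableAt_const _).div (by fun_prop) ?_)
      intro h
      exact hz (by rw [sub_eq_zero.1 h]; exact hz')
    refine h1.congr_of_eventuallyEq ?_
    filter_upwards [Z.finite_toSet.isClosed.isOpen_compl.mem_nhds (show ζ ∈ (↑Z : Set ℂ)ᶜ from hz)]
      with w hw
    have hw' : w ∉ Z := hw
    simp [hE, hw']

theorem IsContour.cauchyFunctional {L : ℝ → ℂ} (hL : IsContour L) (Z : Finset ℂ) (C : ℂ → ℂ)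
    {R : ℂ → ℂ} (hR : ContinuousOn R (curveTrace L)) (a : ℂ)
    (hne : ∀ σ ∈ curveTrace L ∪ ↑Z, ∀ τ ∈ curveTrace L ∪ ↑Z, σ + τ ≠ 0) :
    CauchyFunctional (curveTrace L ∪ ↑Z)
      (fun φ => -∑ z ∈ Z, C z * φ z + a * curveInt L fun σ => R σ * φ σ) := by
  have hc : ∀ {φ : ℂ → ℂ}, ContinuousOn φ (curveTrace L ∪ ↑Z) → ContinuousOn φ (curveTrace L) :=
    fun h => h.mono subset_union_left
  have hZ : ∀ z ∈ Z, z ∈ curveTrace L ∪ ↑Z := fun z hz => Or.inr hz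
  refine ⟨hne, fun φ ψ h => ?_, fun φ ψ hφ hψ => ?_, fun c φ hφ => ?_, fun α β hα hβ => ?_⟩
  · have h1 : curveInt L (fun σ => R σ * φ σ) = curveInt L fun σ => R σ * ψ σ :=
      curveInt_congr fun σ hσ => by rw [h σ (Or.inl hσ)]
    rw [h1, Finset.sum_congr rfl fun z hz => by rw [h z (hZ z hz)]]
  · have h1 : curveInt L (fun σ => R σ * (φ σ + ψ σ))
        = curveInt L (fun σ => R σ * φ σ) + curveInt L fun σ => R σ * ψ σ := by
      rw [← hL.curveInt_add (hR.fun_mul (hc hφ)) (hR.fun_mul (hc hψ))]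
      simp only [mul_add]
    rw [h1]
    simp only [mul_add, Finset.sum_add_distrib]
    ring
  · have h1 : curveInt L (fun σ => R σ * (c * φ σ)) = c * curveInt L fun σ => R σ * φ σ := by
      rw [← curveInt_const_mul]
      simp only [mul_left_comm]
    rw [h1]
    simp only [mul_left_comm _ c, ← Finset.mul_sum]
    ring
  · have key : ∀ α β : ℂ → ℂ, ContinuousOn α (curveTrace L ∪ ↑Z) →
        ContinuousOn β (curveTrace L ∪ ↑Z) →
        -∑ z ∈ Z, C z * (α z * (-∑ w ∈ Z, C w * (β w / (w + z))
          + a * curveInt L fun τ => R τ * (β τ / (τ + z))))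
          + a * curveInt L (fun σ => R σ * (α σ * (-∑ w ∈ Z, C w * (β w / (w + σ))
          + a * curveInt L fun τ => R τ * (β τ / (τ + σ)))))
        = ∑ z ∈ Z, ∑ w ∈ Z, C z * C w * α z * β w / (w + z)
          - a * ∑ z ∈ Z, C z * α z * curveInt L (fun τ => R τ * (β τ / (τ + z)))
          - a * ∑ w ∈ Z, C w * β w * curveInt L (fun σ => R σ * (α σ / (σ + w)))
          + a ^ 2 * curveInt L fun σ => curveInt L fun τ => R σ * α σ * (R τ * β τ) / (τ + σ) := by
      intro α β hα hβ
      have hRα := hR.fun_mul (hc hα)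
      have hRβ := hR.fun_mul (hc hβ)
      have e0 : curveInt L (fun σ => R σ * (α σ * (-∑ w ∈ Z, C w * (β w / (w + σ))
          + a * curveInt L fun τ => R τ * (β τ / (τ + σ)))))
          = curveInt L fun σ => (-1) * (∑ w ∈ Z, C w * β w * (R σ * (α σ / (σ + w))))
            + a * curveInt L fun τ => R σ * α σ * (R τ * β τ) / (τ + σ) := by
        refine curveInt_congr fun σ hσ => ?_
        have e1 : curveInt L (fun τ => R σ * α σ * (R τ * β τ) / (τ + σ))
            = R σ * α σ * curveInt L fun τ => R τ * (β τ / (τ + σ)) := by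
          rw [← curveInt_const_mul]
          congr 1; ext τ; ring
        rw [e1, mul_add, mul_add, mul_neg, mul_neg, Finset.mul_sum, Finset.mul_sum, neg_one_mul]
        congr 1
        · congr 1
          refine Finset.sum_congr rfl fun w _ => ?_
          rw [add_comm w σ]; ring
        · ring
      have ck : ContinuousOn (Function.uncurry fun σ τ => R σ * α σ * (R τ * β τ) / (τ + σ))
          (curveTrace L ×ˢ curveTrace L) := by
        refine ContinuousOn.div ((hRα.comp continuousOn_fst fun x hx => hx.1).mul
          (hRβ.comp continuousOn_snd fun x hx => hx.2)) (by fun_prop) fun x hx => ?_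
        exact hne x.2 (Or.inl hx.2) x.1 (Or.inl hx.1)
      have c1 : ∀ w ∈ Z, ContinuousOn (fun σ => R σ * (α σ / (σ + w))) (curveTrace L) :=
        fun w hw => hR.fun_mul ((hc hα).fun_div (by fun_prop)
          fun σ hσ => hne σ (Or.inl hσ) w (hZ w hw))
      have c2 : ContinuousOn (fun σ => curveInt L fun τ => R σ * α σ * (R τ * β τ) / (τ + σ))
          (curveTrace L) := by
        have d := (hL.differentiableOn_cauchy hRβ).continuousOn
        have : ContinuousOn (fun σ => R σ * α σ * curveInt L fun τ => R τ * β τ / (τ - -σ))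
            (curveTrace L) := by
          refine hRα.fun_mul (d.comp (f := fun σ => -σ) continuousOn_neg fun σ hσ h => ?_)
          exact hne σ (Or.inl hσ) (-σ) (Or.inl h) (by ring)
        refine this.congr fun σ _ => ?_
        simp only
        rw [← curveInt_const_mul]
        congr 1; ext τ; rw [sub_neg_eq_add]; ring
      rw [e0, hL.curveInt_add (continuousOn_const.fun_mul (continuousOn_finsetSum _ fun w hw =>
        continuousOn_const.fun_mul (c1 w hw))) (continuousOn_const.fun_mul c2), curveInt_const_mul,
        curveInt_const_mul, hL.curveInt_sum _ _ fun w hw => continuousOn_const.fun_mul (c1 w hw)]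
      simp only [curveInt_const_mul]
      have e2 : ∑ z ∈ Z, C z * (α z * (-∑ w ∈ Z, C w * (β w / (w + z))
          + a * curveInt L fun τ => R τ * (β τ / (τ + z))))
          = -∑ z ∈ Z, ∑ w ∈ Z, C z * C w * α z * β w / (w + z)
            + a * ∑ z ∈ Z, C z * α z * curveInt L (fun τ => R τ * (β τ / (τ + z))) := by
        rw [Finset.mul_sum, ← Finset.sum_neg_distrib, ← Finset.sum_add_distrib]
        refine Finset.sum_congr rfl fun z _ => ?_
        rw [← Finset.sum_neg_distrib, mul_add, mul_add, Finset.mul_sum, Finset.mul_sum,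
          ← Finset.sum_neg_distrib]
        congr 1
        · refine Finset.sum_congr rfl fun w _ => by ring
        · ring
      rw [e2]
      ring
    have k1 := key α β hα hβ
    have k2 := key β α hβ hα
    have hsw : curveInt L (fun σ => curveInt L fun τ => R σ * α σ * (R τ * β τ) / (τ + σ))
        = curveInt L fun σ => curveInt L fun τ => R σ * β σ * (R τ * α τ) / (τ + σ) := by
      rw [hL.curveInt_curveInt_swap]
      · congr 1; ext σ; congr 1; ext τ; rw [add_comm]; ring
      · refine ContinuousOn.div (((hR.fun_mul (hc hα)).comp continuousOn_fst fun x hx => hx.1).mul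
          ((hR.fun_mul (hc hβ)).comp continuousOn_snd fun x hx => hx.2)) (by fun_prop) fun x hx => ?_
        exact hne x.2 (Or.inl hx.2) x.1 (Or.inl hx.1)
    have hsum : ∑ z ∈ Z, ∑ w ∈ Z, C z * C w * α z * β w / (w + z)
        = ∑ z ∈ Z, ∑ w ∈ Z, C z * C w * β z * α w / (w + z) := by
      rw [Finset.sum_comm]
      refine Finset.sum_congr rfl fun z _ => Finset.sum_congr rfl fun w _ => ?_
      rw [add_comm]; ring
    simp only
    rw [k1, k2, hsw, hsum]
    ring

theorem tendsto_neg_cocompact : Tendsto (fun z : ℂ => -z) (cocompact ℂ) (cocompact ℂ) :=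
  (Homeomorph.neg ℂ).isClosedEmbedding.tendsto_cocompact

theorem tendsto_one_div_sub_cocompact (v : ℂ) :
    Tendsto (fun z : ℂ => 1 / (z - v)) (cocompact ℂ) (𝓝 0) := by
  have h : Tendsto (fun z : ℂ => z - v) (cocompact ℂ) (cocompact ℂ) :=
    (Homeomorph.subRight v).isClosedEmbedding.tendsto_cocompact
  simpa [Function.comp_def] using (tendsto_inv₀_cobounded (α := ℂ)).comp
    (by simpa [Metric.cobounded_eq_cocompact] using h)

section

variable {L : ℝ → ℂ} {Z : Finset ℂ} {R φ : ℂ → ℂ}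

theorem IsContour.tendsto_curveInt (hL : IsContour L) {F : ℕ → ℂ → ℂ} {f : ℂ → ℂ} (C : ℝ)
    (hF : ∀ n, ContinuousOn (F n) (curveTrace L)) (hC : ∀ n, ∀ σ ∈ curveTrace L, ‖F n σ‖ ≤ C)
    (hf : ∀ σ ∈ curveTrace L, Tendsto (fun n => F n σ) atTop (𝓝 (f σ))) :
    Tendsto (fun n => curveInt L (F n)) atTop (𝓝 (curveInt L f)) := by
  simp only [curveInt_eq]
  obtain ⟨B, hB, hb⟩ := hL.exists_norm_deriv_le
  refine tendsto_integral_of_dominated_convergence (fun _ => |C| * B)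
    (fun n => hL.aestronglyMeasurable (hF n)) (integrable_const _) (fun n => ?_) ?_
  · filter_upwards [hb, ae_restrict_mem measurableSet_Ioc] with t ht hm
    rw [norm_mul]
    exact mul_le_mul ((hC n _ (mem_curveTrace hm)).trans (le_abs_self C)) ht (norm_nonneg _)
      (abs_nonneg C)
  · filter_upwards [ae_restrict_mem measurableSet_Ioc] with t hm
    exact (hf _ (mem_curveTrace hm)).mul_const _

/-- Integration along `L` with weight `R`, and point masses at `Z`. -/
def contourFun (L : ℝ → ℂ) (Z : Finset ℂ) (C R φ : ℂ → ℂ) : ℂ :=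
  -∑ z ∈ Z, C z * φ z + 1 / (2 * Real.pi * Complex.I) * curveInt L fun σ => R σ * φ σ

theorem IsContour.differentiableOn_contourFun (hL : IsContour L) (C : ℂ → ℂ)
    (hR : ContinuousOn R (curveTrace L)) (hφ : ContinuousOn φ (curveTrace L ∪ ↑Z)) :
    DifferentiableOn ℂ (fun ζ => contourFun L Z C R fun σ => φ σ / (σ + ζ))
      {ζ | -ζ ∉ curveTrace L ∪ ↑Z} := by
  have h1 := hL.differentiableOn_cauchy (hR.fun_mul (hφ.mono subset_union_left))
  unfold contourFun
  refine DifferentiableOn.add (DifferentiableOn.fun_neg (DifferentiableOn.fun_sum fun z hz => ?_)) ?_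
  · refine (differentiableOn_const _).mul ((differentiableOn_const _).div (by fun_prop) ?_)
    intro ζ hζ h
    exact hζ (Or.inr (by rw [show -ζ = z by linear_combination -h]; exact hz))
  · refine DifferentiableOn.const_mul ?_ _
    have h2 := h1.comp (g := fun ζ => curveInt L fun w => R w * φ w / (w - ζ))
      (t := (curveTrace L)ᶜ) (s := {ζ | -ζ ∉ curveTrace L ∪ ↑Z}) (differentiableOn_neg _)
      fun ζ hζ h => hζ (Or.inl h)
    refine h2.congr fun ζ _ => ?_
    simp only [Function.comp, sub_neg_eq_add, mul_div_assoc]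

theorem IsContour.tendsto_contourFun (hL : IsContour L) (C : ℂ → ℂ)
    (hR : ContinuousOn R (curveTrace L)) (hφ : ContinuousOn φ (curveTrace L)) :
    Tendsto (fun ζ => contourFun L Z C R fun σ => φ σ / (σ + ζ)) (cocompact ℂ) (𝓝 0) := by
  have h1 := ((hL.tendsto_cauchy (hR.fun_mul hφ)).comp tendsto_neg_cocompact).const_mul
    (1 / (2 * Real.pi * Complex.I))
  have h2 : Tendsto (fun ζ => -∑ z ∈ Z, C z * φ z * (1 / (ζ - -z))) (cocompact ℂ) (𝓝 0) := by
    have := (tendsto_finsetSum Z fun z _ =>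
      (tendsto_one_div_sub_cocompact (-z)).const_mul (C z * φ z)).neg
    simpa only [mul_zero, Finset.sum_const_zero, neg_zero] using this
  have h3 := h2.add h1
  rw [mul_zero, add_zero] at h3
  refine h3.congr fun ζ => ?_
  simp only [contourFun, Function.comp, sub_neg_eq_add, mul_div_assoc]
  congr 2
  refine Finset.sum_congr rfl fun z _ => ?_
  rw [add_comm]; ring

end

namespace InitialData

variable {N : ℕ} {D : InitialData N} {K : ℝ} {L : ℝ → ℂ} {Z : Finset ℂ} {c : ℂ → ℂ}

theorem closure_regP_subset {K' : ℝ} (hq : ∀ i, D.q i ≠ 0) (h : K < K') :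
    closure (D.regP K') ⊆ D.regP K := by
  have hsub : D.regP K' ⊆ ⋃ r ∈ Set.range D.dir,
      {ζ : ℂ | K' * ‖D.p r + ζ‖ ≤ ‖D.p r - ζ‖} := by
    rintro ζ ⟨i, hi⟩
    simp only [mem_iUnion]
    exact ⟨D.dir i, ⟨i, rfl⟩, hi.le⟩
  have hcl : IsClosed (⋃ r ∈ Set.range D.dir, {ζ : ℂ | K' * ‖D.p r + ζ‖ ≤ ‖D.p r - ζ‖}) :=
    (Set.toFinite _).isClosed_biUnion fun r _ => isClosed_le (by fun_prop) (by fun_prop)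
  intro ζ hζ
  have := closure_minimal hsub hcl hζ
  simp only [mem_iUnion] at this
  obtain ⟨r, ⟨i, rfl⟩, hi⟩ := this
  refine ⟨i, ?_⟩
  change K' * ‖D.q i + ζ‖ ≤ ‖D.q i - ζ‖ at hi
  rcases (norm_nonneg (D.q i + ζ)).eq_or_lt with h0 | h0
  · rw [← h0, mul_zero]
    have h1 : ζ = -D.q i := by
      have := norm_eq_zero.1 h0.symm
      linear_combination this
    rw [h1, norm_pos_iff, sub_neg_eq_add, ← two_mul]
    exact mul_ne_zero two_ne_zero (hq i)
  · nlinarith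

namespace ContourSetting

variable (h : D.ContourSetting K L Z c)

theorem direct (h : D.ContourSetting K L Z c) : D.Direct K :=
  ⟨h.one_lt.le, h.param_ne, h.admissible.summable⟩

theorem regP_subset (h : D.ContourSetting K L Z c) : D.regP K ⊆ extRegion L := by
  intro ζ hζ
  have h1 : -ζ ∈ D.regPstar K := by rw [← neg_mem_regP_iff, neg_neg]; exact hζ
  simpa using h.mirror (-ζ) (Or.inl (h.star_subset h1))

theorem subset_closure_regP (h : D.ContourSetting K L Z c) :
    (extRegion L)ᶜ ⊆ (closure (D.regP K))ᶜ \ {0} := by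
  rw [h.contour.compl_extRegion]
  rintro ζ (hζ | hζ)
  · refine ⟨fun hc => ?_, fun h0 => ?_⟩
    · have : Disjoint (intRegion L) (closure (D.regP K)) :=
        (disjoint_intRegion_extRegion.mono_right h.regP_subset).closure_right
          h.contour.isOpen_intRegion
      exact Set.disjoint_left.1 this hζ hc
    · rw [mem_singleton_iff.1 h0] at hζ
      exact Set.disjoint_left.1 disjoint_intRegion_extRegion hζ h.zero_mem
  · refine ⟨h.avoid hζ, fun h0 => ?_⟩
    rw [mem_singleton_iff.1 h0] at hζ
    exact h.zero_mem.1 hζ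

theorem subset_compl_ext (h : D.ContourSetting K L Z c) :
    curveTrace L ∪ ↑Z ⊆ (extRegion L)ᶜ := by
  rw [h.contour.compl_extRegion, union_comm]
  exact union_subset_union_left _ h.zeros_subset

theorem notMem_regP (h : D.ContourSetting K L Z c) {ζ : ℂ} (hζ : ζ ∉ extRegion L) :
    ζ ∉ D.regP K := fun hp => hζ (h.regP_subset hp)

theorem neg_mem_ext (h : D.ContourSetting K L Z c) {ζ : ℂ} (hζ : ζ ∉ extRegion L) :
    -ζ ∈ extRegion L := h.mirror ζ (by rw [← h.contour.compl_extRegion]; exact hζ)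

theorem neg_notMem_regP (h : D.ContourSetting K L Z c) {ζ : ℂ} (hζ : ζ ∉ intRegion L) :
    -ζ ∉ D.regP K := fun hp => hζ (h.star_subset ((D.neg_mem_regP_iff).1 hp))

theorem notMem_regP_of_neg (h : D.ContourSetting K L Z c) {ζ : ℂ} (hζ : -ζ ∈ extRegion L) :
    ζ ∉ D.regP K := by
  have := h.neg_notMem_regP fun hc => Set.disjoint_left.1 disjoint_intRegion_extRegion hc hζ
  rwa [neg_neg] at this

theorem specA_ne_zero (h : D.ContourSetting K L Z c) {σ : ℂ} (hσ : σ ∈ curveTrace L) :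
    D.specA σ ≠ 0 := by
  intro h0
  have h1 := h.subset_closure_regP (h.subset_compl_ext (Or.inl hσ))
  have := h.zeros_subset ((h.admissible.zeros σ).2 ⟨h1.1, h1.2, h0⟩)
  exact this.1 hσ

theorem continuousOn_refl (h : D.ContourSetting K L Z c) :
    ContinuousOn D.refl (curveTrace L) := by
  refine ContinuousOn.div ?_ ?_ fun σ hσ => h.specA_ne_zero hσ
  · refine h.direct.continuousOn_specB.mono fun σ hσ => ?_
    have h1 := h.subset_compl_ext (Or.inl hσ)
    exact ⟨⟨h.notMem_regP h1, h.neg_notMem_regP fun hi => hi.1 hσ⟩, (h.subset_closure_regP h1).2⟩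
  · exact h.direct.differentiableOn_specA.continuousOn.mono fun σ hσ =>
      h.subset_closure_regP (h.subset_compl_ext (Or.inl hσ))

theorem add_ne_zero (h : D.ContourSetting K L Z c) {σ ζ : ℂ} (hσ : σ ∈ curveTrace L ∪ ↑Z)
    (hζ : -ζ ∈ extRegion L) : σ + ζ ≠ 0 := by
  intro h0
  rw [← eq_neg_iff_add_eq_zero] at h0
  exact h.subset_compl_ext hσ (h0 ▸ hζ)

theorem cauchyFunctional (h : D.ContourSetting K L Z c) :
    CauchyFunctional (curveTrace L ∪ ↑Z) (contourFun L Z (D.coefC K c) D.refl) :=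
  h.contour.cauchyFunctional Z _ h.continuousOn_refl _ fun _ hσ _ hτ =>
    h.add_ne_zero hσ (h.neg_mem_ext (h.subset_compl_ext hτ))

theorem param (h : D.ContourSetting K L Z c) {σ : ℂ} (hσ : σ ∈ curveTrace L ∪ ↑Z) (r : Fin N) :
    D.p r + σ ≠ 0 ∧ D.p r - σ ≠ 0 := by
  have : σ ≠ D.p r ∧ σ ≠ -D.p r := by
    rcases hσ with hσ | hσ
    · exact (h.plane_wave r).1 σ hσ
    · exact (h.plane_wave r).2 σ hσ
  exact ⟨fun h0 => this.2 (by linear_combination h0), fun h0 => this.1 (by linear_combination -h0)⟩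

theorem continuousOn_rho (h : D.ContourSetting K L Z c) (n : Lattice N) :
    ContinuousOn (D.rho n) (curveTrace L ∪ ↑Z) :=
  (D.continuousOn_rho n).mono fun _ hσ => h.param hσ

theorem sieRHS_eq (n : Lattice N) (f : ℂ → ℂ) (ζ : ℂ) :
    sieRHS (curveInt L) Z (D.coefC K c) D.refl (D.rho n) f ζ
      = 1 + contourFun L Z (D.coefC K c) D.refl fun σ => D.rho n σ * f σ / (σ + ζ) := by
  unfold sieRHS contourFun
  rw [sub_eq_add_neg, add_assoc]
  congr 2
  · congr 1
    refine Finset.sum_congr rfl fun z _ => ?_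
    rw [add_comm]; ring
  · congr 2
    ext σ
    ring

/-- Solutions of inhomogeneous equations with weight `ρ_n`. -/
abbrev Solves (D : InitialData N) (K : ℝ) (L : ℝ → ℂ) (Z : Finset ℂ) (c : ℂ → ℂ) (n : Lattice N)
    (f₀ : ℂ) (f : ℂ → ℂ) : Prop :=
  SolvesIE (curveTrace L ∪ ↑Z) {ζ | -ζ ∈ extRegion L} (contourFun L Z (D.coefC K c) D.refl)
    (D.rho n) f₀ f

theorem isOpen_V (h : D.ContourSetting K L Z c) : IsOpen {ζ | -ζ ∈ extRegion L} :=
  h.contour.isOpen_extRegion.preimage continuous_neg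

theorem differentiableOn_of_eq (h : D.ContourSetting K L Z c) {φ f : ℂ → ℂ} {f₀ : ℂ}
    (hφ : ContinuousOn φ (curveTrace L))
    (hf : ∀ ζ, -ζ ∈ extRegion L →
      f ζ = f₀ + contourFun L Z (D.coefC K c) D.refl fun σ => φ σ / (σ + ζ)) :
    DifferentiableOn ℂ f {ζ | -ζ ∈ extRegion L} := by
  classical
  have hφ' : ContinuousOn φ (curveTrace L ∪ ↑Z) := by
    refine hφ.union_of_isClosed ?_ (isCompact_curveTrace h.contour).isClosed
      Z.finite_toSet.isClosed
    exact Z.finite_toSet.continuousOn _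
  refine (((h.contour.differentiableOn_contourFun (D.coefC K c) h.continuousOn_refl hφ').mono
    fun ζ hζ hc => h.subset_compl_ext hc hζ).const_add f₀).congr fun ζ hζ => hf ζ hζ

theorem solves_of_eq (h : D.ContourSetting K L Z c) {n : Lattice N} {f : ℂ → ℂ} {f₀ : ℂ}
    (hc : ContinuousOn f (curveTrace L))
    (hf : ∀ ζ, -ζ ∈ extRegion L → f ζ = f₀ + contourFun L Z (D.coefC K c) D.refl fun σ =>
      D.rho n σ * f σ / (σ + ζ)) : Solves D K L Z c n f₀ f where
  subset := fun _ hσ => h.neg_mem_ext (h.subset_compl_ext hσ)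
  ne := fun _ hσ _ hζ => h.add_ne_zero hσ hζ
  contρ := h.continuousOn_rho n
  cont := (h.differentiableOn_of_eq (((h.continuousOn_rho n).mono subset_union_left).fun_mul hc)
    hf).continuousOn.mono fun _ hσ => h.neg_mem_ext (h.subset_compl_ext hσ)
  eq := hf

theorem solves_iff (h : D.ContourSetting K L Z c) {n : Lattice N} {f : ℂ → ℂ} :
    D.IsSolution K L Z c n f ↔ Solves D K L Z c n 1 f := by
  refine ⟨fun hf => h.solves_of_eq hf.1 fun ζ hζ => ?_, fun hf =>
    ⟨hf.cont.mono subset_union_left, fun ζ hζ => ?_⟩⟩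
  · rw [hf.2 ζ hζ, sieRHS_eq]
  · rw [hf.eq ζ hζ, sieRHS_eq]

theorem differentiableOn_of_solves (h : D.ContourSetting K L Z c) {n : Lattice N} {f : ℂ → ℂ}
    {f₀ : ℂ} (hf : Solves D K L Z c n f₀ f) : DifferentiableOn ℂ f {ζ | -ζ ∈ extRegion L} :=
  h.differentiableOn_of_eq ((hf.contρ.fun_mul hf.cont).mono subset_union_left) hf.eq

/-! ### The staircase -/

theorem curveInt_jostΛ (h : D.ContourSetting K L Z c) (i : ℤ) {w : ℂ} (hw : w ∈ extRegion L) :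
    curveInt L (fun σ => D.jostΛ i (-σ) / (σ - w))
      = 2 * Real.pi * Complex.I * (1 - D.jostΛ i (-w)) := by
  have hw' : -w ∉ D.regP K := h.notMem_regP_of_neg (by rwa [neg_neg])
  have htr : ∀ σ ∈ curveTrace L, -σ ∉ D.regP K := fun σ hσ => h.neg_notMem_regP fun hi => hi.1 hσ
  have hne : ∀ σ ∈ curveTrace L, σ - w ≠ 0 := fun σ hσ => sub_ne_zero.2 fun h0 =>
    hw.1 (h0 ▸ hσ)
  have key : ∀ M, curveInt L (fun σ => (D.trunc M).jostΛ i (-σ) / (σ - w))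
      = 2 * Real.pi * Complex.I * (1 - (D.trunc M).jostΛ i (-w)) := by
    intro M
    have hd := direct_trunc (D := D) (K := K) h.direct.one_le h.param_ne M
    have hd' := direct_trunc (D := D) (K := K + 1) (by linarith [h.one_lt]) h.param_ne M
    refine h.contour.curveInt_div_sub_eq (U := {σ | -σ ∉ closure (D.regP (K + 1))})
      (isClosed_closure.isOpen_compl.preimage continuous_neg)
      ((hd'.differentiableOn_jostΛ i).comp (differentiableOn_neg _) fun σ hσ => hσ)
      (fun σ hσ hc => h.neg_notMem_regP hσ (closure_regP_subset h.param_ne (by linarith) hc))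
      ?_ hw
    obtain ⟨C, hC⟩ := hd.exists_norm_jostΛ_sub_one_le i
    rw [tendsto_iff_norm_sub_tendsto_zero]
    have ht : Tendsto (fun σ : ℂ => C / (1 + ‖σ‖)) (cocompact ℂ) (𝓝 0) :=
      (tendsto_atTop_add_const_left _ 1 tendsto_norm_cocompact_atTop).const_div_atTop C
    refine squeeze_zero' (Eventually.of_forall fun _ => norm_nonneg _) ?_ ht
    filter_upwards [h.contour.extRegion_mem_cocompact] with σ hσ
    have := hC (-σ) (h.neg_notMem_regP fun hi =>
      Set.disjoint_left.1 disjoint_intRegion_extRegion hi hσ) i le_rfl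
    rwa [norm_neg] at this
  obtain ⟨C, hC⟩ := h.direct.exists_norm_jostΛ_trunc_le i
  have hcd : ContinuousOn (fun σ => 1 / (σ - w)) (curveTrace L) :=
    continuousOn_const.fun_div (by fun_prop) hne
  obtain ⟨C', hC'⟩ := (isCompact_curveTrace h.contour).exists_bound_of_continuousOn hcd
  have h1 := h.contour.tendsto_curveInt (F := fun M σ => (D.trunc M).jostΛ i (-σ) / (σ - w))
    (f := fun σ => D.jostΛ i (-σ) / (σ - w)) (|C| * |C'|) (fun M => ?_) (fun M σ hσ => ?_)
    (fun σ hσ => (h.direct.tendsto_jostΛ_trunc (htr σ hσ) i).div_const _)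
  · simp only [key] at h1
    exact tendsto_nhds_unique h1
      (((h.direct.tendsto_jostΛ_trunc hw' i).const_sub 1).const_mul _)
  · refine ContinuousOn.fun_div ?_ (by fun_prop) hne
    exact ((direct_trunc h.direct.one_le h.param_ne M).continuousOn_jostΛ i).comp
      continuousOn_neg htr
  · rw [div_eq_mul_one_div, norm_mul]
    exact mul_le_mul ((hC _ (htr σ hσ) M).trans (le_abs_self C)) ((hC' σ hσ).trans (le_abs_self C'))
      (norm_nonneg _) (abs_nonneg C)

theorem jostΥ_div (h : D.ContourSetting K L Z c) (i : ℤ) {z : ℂ} (hz : z ∈ Z) :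
    D.jostΥ i z / deriv D.specA z = D.coefC K c z * (D.rho (D.pos i) z * D.jostΛ i z) := by
  unfold coefC
  have hz' : z ∉ extRegion L := h.subset_compl_ext (Or.inr hz)
  split_ifs with hs
  · rw [h.norming z hz hs i]; ring
  · obtain ⟨-, h0, hA⟩ := (h.admissible.zeros z).1 hz
    rw [h.direct.jostΥ_eq_specA_specB (h.notMem_regP hz')
      (fun hc => hs (D.neg_mem_regP_iff.1 hc)) h0, hA]
    ring

theorem solves_jostΛ (h : D.ContourSetting K L Z c) (i : ℤ) :
    Solves D K L Z c (D.pos i) 1 (D.jostΛ i) := by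
  have htr : ∀ σ ∈ curveTrace L, σ ∉ D.regP K := fun σ hσ =>
    h.notMem_regP (h.subset_compl_ext (Or.inl hσ))
  have htr' : ∀ σ ∈ curveTrace L, -σ ∉ D.regP K := fun σ hσ => h.neg_notMem_regP fun hi => hi.1 hσ
  have hcΛ := (h.direct.continuousOn_jostΛ i).mono htr
  refine h.solves_of_eq hcΛ fun ζ hζ => ?_
  have hUo : IsOpen ((closure (D.regP K))ᶜ \ {0}) :=
    isClosed_closure.isOpen_compl.sdiff isClosed_singleton
  obtain ⟨E, hE, hEq⟩ := exists_partial_fractions hUo (Z := Z) (f := D.jostΥ i) (A := D.specA)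
    ((h.direct.differentiableOn_jostΥ i).mono sdiff_subset) h.direct.differentiableOn_specA
    (fun z hz => ((h.admissible.zeros z).1 hz).2.2)
    (fun z hzU hz h0 => hz ((h.admissible.zeros z).2 ⟨hzU.1, hzU.2, h0⟩)) h.admissible.simple
  have hEc : ContinuousOn E (curveTrace L) := hE.continuousOn.mono fun σ hσ =>
    h.subset_closure_regP (h.subset_compl_ext (Or.inl hσ))
  have hne : ∀ σ ∈ curveTrace L, σ - -ζ ≠ 0 := fun σ hσ => sub_ne_zero.2 fun h0 =>
    hζ.1 (h0 ▸ hσ)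
  have hneZ : ∀ z ∈ Z, ∀ σ ∈ curveTrace L, σ - z ≠ 0 := fun z hz σ hσ => sub_ne_zero.2 fun h0 =>
    (h.zeros_subset hz).1 (h0 ▸ hσ)
  have e1 : curveInt L (fun σ => D.refl σ * (D.rho (D.pos i) σ * D.jostΛ i σ / (σ + ζ)))
      = curveInt L fun σ => (E σ / (σ - -ζ) + ∑ z ∈ Z, D.jostΥ i z / deriv D.specA z *
        (1 / (σ - z) / (σ - -ζ))) + (-1) * (D.jostΛ i (-σ) / (σ - -ζ)) := by
    refine curveInt_congr fun σ hσ => ?_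
    have hU := h.subset_closure_regP (h.subset_compl_ext (Or.inl hσ))
    have h1 := hEq σ hU fun hz => (h.zeros_subset hz).1 hσ
    have h2 := h.direct.jostΥ_eq_specA_specB (htr σ hσ) (htr' σ hσ) hU.2 i
    have h3 := h.specA_ne_zero hσ
    have h4 : D.refl σ * (D.rho (D.pos i) σ * D.jostΛ i σ) = D.jostΥ i σ / D.specA σ
        - D.jostΛ i (-σ) := by
      rw [h2, refl]; field_simp; ring
    rw [mul_div_assoc', h4, h1, sub_neg_eq_add, sub_div, add_div, Finset.sum_div]
    simp only [mul_div_assoc]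
    ring
  have c1 : ∀ z ∈ Z, ContinuousOn (fun σ => D.jostΥ i z / deriv D.specA z *
      (1 / (σ - z) / (σ - -ζ))) (curveTrace L) := fun z hz => continuousOn_const.fun_mul
    ((continuousOn_const.fun_div (by fun_prop) (hneZ z hz)).fun_div (by fun_prop) hne)
  have c2 : ContinuousOn (fun σ => E σ / (σ - -ζ)) (curveTrace L) :=
    hEc.fun_div (by fun_prop) hne
  have c3 : ContinuousOn (fun σ => D.jostΛ i (-σ) / (σ - -ζ)) (curveTrace L) :=
    ((h.direct.continuousOn_jostΛ i).comp continuousOn_neg htr').fun_div (by fun_prop) hne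
  rw [h.contour.curveInt_add (c2.fun_add (continuousOn_finsetSum _ c1))
    (continuousOn_const.fun_mul c3), h.contour.curveInt_add c2 (continuousOn_finsetSum _ c1),
    h.contour.curveInt_sum _ _ c1, curveInt_const_mul, h.curveInt_jostΛ i hζ,
    h.contour.curveInt_div_sub_eq_zero hUo hE h.subset_closure_regP hζ, neg_neg] at e1
  have e2 : ∑ z ∈ Z, curveInt L (fun σ => D.jostΥ i z / deriv D.specA z *
      (1 / (σ - z) / (σ - -ζ))) = 2 * Real.pi * Complex.I *
      ∑ z ∈ Z, D.coefC K c z * (D.rho (D.pos i) z * D.jostΛ i z / (z + ζ)) := by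
    rw [Finset.mul_sum]
    refine Finset.sum_congr rfl fun z hz => ?_
    rw [curveInt_const_mul, h.contour.curveInt_simple_pole hζ (h.zeros_subset hz),
      h.jostΥ_div i hz, sub_neg_eq_add]
    ring
  rw [contourFun, e1, e2]
  have := two_pi_I_ne_zero
  field_simp
  ring

theorem eq_zero_of_solves (h : D.ContourSetting K L Z c) (i : ℤ) {f : ℂ → ℂ}
    (hf : Solves D K L Z c (D.pos i) 0 f) {ζ : ℂ} (hζ : -ζ ∈ extRegion L) : f ζ = 0 := by
  have h1 : ∀ ζ, -ζ ∈ extRegion L → ζ ∈ extRegion L → ζ ≠ 0 → f ζ = 0 := by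
    intro ζ hζ hζ' h0
    have hζ'' : -(-ζ) ∈ extRegion L := by rwa [neg_neg]
    have b1 := hf.bilinear h.cauchyFunctional (h.solves_jostΛ i) (α₀ := 1) (α₁ := 0)
      (fun σ _ => by ring) hζ'' (by simpa using hζ)
    have b2 := hf.bilinear h.cauchyFunctional (h.solves_jostΛ (i + 1)) (α₀ := D.q i) (α₁ := 1)
      (fun σ hσ => by
        obtain ⟨h1, h2⟩ := h.param hσ (D.dir i)
        rw [pos_succ, D.rho_add_e _ _ h1 h2]
        simp only [q]
        field_simp) hζ'' (by simpa using hζ)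
    have w := h.direct.wronskian (h.notMem_regP_of_neg hζ'')
      (by rw [neg_neg]; exact h.notMem_regP_of_neg hζ) i
    rw [neg_neg] at b1 b2 w
    have : 2 * ζ * f ζ = 0 := by
      linear_combination f ζ * w - D.jostΛ i ζ * b2 + (D.q i + ζ) * D.jostΛ (i + 1) ζ * b1
    simpa [h0] using this
  have hd := h.differentiableOn_of_solves hf
  have h2 : ∀ ζ, -ζ ∈ extRegion L → ζ ∈ extRegion L → f ζ = 0 := by
    intro ζ hζ hζ'
    by_cases h0 : ζ = 0
    · have hc : Tendsto f (𝓝[≠] ζ) (𝓝 (f ζ)) :=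
        ((hd.differentiableAt (h.isOpen_V.mem_nhds hζ)).continuousAt).mono_left nhdsWithin_le_nhds
      refine tendsto_nhds_unique hc (tendsto_const_nhds.congr' ?_)
      filter_upwards [self_mem_nhdsWithin, mem_nhdsWithin_of_mem_nhds (h.isOpen_V.mem_nhds hζ),
        mem_nhdsWithin_of_mem_nhds (h.contour.isOpen_extRegion.mem_nhds hζ')] with w h3 h4 h5
      exact (h1 w h4 h5 (by rw [h0] at h3; exact h3)).symm
    · exact h1 ζ hζ hζ' h0
  classical
  set H : ℂ → ℂ := fun ζ => if -ζ ∈ extRegion L then f ζ else 0 with hH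
  have hz : ∀ ζ ∈ extRegion L, H ζ = 0 := by
    intro ζ hζ
    simp only [hH]
    split_ifs with h'
    · exact h2 ζ h' hζ
    · rfl
  have hHd : Differentiable ℂ H := by
    intro z
    by_cases hzV : -z ∈ extRegion L
    · refine (hd.differentiableAt (h.isOpen_V.mem_nhds hzV)).congr_of_eventuallyEq ?_
      filter_upwards [h.isOpen_V.mem_nhds hzV] with w hw
      exact if_pos hw
    · have : z ∈ extRegion L := by
        by_contra hc
        exact hzV (h.neg_mem_ext hc)
      refine (differentiableAt_const (0 : ℂ)).congr_of_eventuallyEq ?_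
      filter_upwards [h.contour.isOpen_extRegion.mem_nhds this] with w hw
      exact hz w hw
  have hlim : Tendsto H (cocompact ℂ) (𝓝 0) := by
    refine tendsto_const_nhds.congr' ?_
    filter_upwards [h.contour.extRegion_mem_cocompact] with w hw
    exact (hz w hw).symm
  have := hHd.apply_eq_of_tendsto_cocompact ζ hlim
  simpa only [hH, if_pos hζ] using this

theorem eq_jostΛ (h : D.ContourSetting K L Z c) (i : ℤ) {f : ℂ → ℂ}
    (hf : D.IsSolution K L Z c (D.pos i) f) {ζ : ℂ} (hζ : -ζ ∈ extRegion L) :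
    f ζ = D.jostΛ i ζ := by
  have h1 := h.solves_iff.1 hf
  have h2 := h.solves_jostΛ i
  have h3 : Solves D K L Z c (D.pos i) 0 fun ζ => f ζ - D.jostΛ i ζ := by
    refine ⟨h1.subset, h1.ne, h1.contρ, h1.cont.fun_sub h2.cont, fun ζ hζ => ?_⟩
    have hI := h.cauchyFunctional
    have c1 := h1.continuousOn_div (h1.contρ.fun_mul h1.cont) hζ
    have c2 := h1.continuousOn_div (h1.contρ.fun_mul h2.cont) hζ
    have e : contourFun L Z (D.coefC K c) D.refl
        (fun σ => D.rho (D.pos i) σ * (f σ - D.jostΛ i σ) / (σ + ζ))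
        = contourFun L Z (D.coefC K c) D.refl (fun σ => D.rho (D.pos i) σ * f σ / (σ + ζ)
          + (-1) * (D.rho (D.pos i) σ * D.jostΛ i σ / (σ + ζ))) := by
      congr 1; ext σ; ring
    rw [e, hI.add _ _ c1 (continuousOn_const.fun_mul c2), hI.smul _ _ c2, h1.eq ζ hζ, h2.eq ζ hζ]
    ring
  exact sub_eq_zero.1 (h.eq_zero_of_solves i h3 hζ)

theorem pos_mem_regular (h : D.ContourSetting K L Z c) (i : ℤ) :
    D.pos i ∈ D.regular K L Z c :=
  ⟨D.jostΛ i, h.solves_iff.2 (h.solves_jostΛ i), fun _ hg _ hζ => h.eq_jostΛ i hg hζ⟩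

end ContourSetting

end InitialData

open Asymptotics

/-! ### The equations `H1` and `H2` -/

/-- The relation between the expansion coefficients at the ends of an edge, from the Wronskian. -/
theorem edge_relation {l : Filter ℂ} [l.NeBot] (hl : l ≤ cocompact ℂ) {f g : ℂ → ℂ}
    {p c d c' d' : ℂ}
    (hf : (fun ζ => f ζ - (1 + c / ζ + d / ζ ^ 2)) =o[l] fun ζ => 1 / ζ ^ 2)
    (hf' : (fun ζ => f (-ζ) - (1 - c / ζ + d / ζ ^ 2)) =o[l] fun ζ => 1 / ζ ^ 2)
    (hg : (fun ζ => g ζ - (1 + c' / ζ + d' / ζ ^ 2)) =o[l] fun ζ => 1 / ζ ^ 2)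
    (hg' : (fun ζ => g (-ζ) - (1 - c' / ζ + d' / ζ ^ 2)) =o[l] fun ζ => 1 / ζ ^ 2)
    (hW : ∀ᶠ ζ in l, (p + ζ) * g ζ * f (-ζ) - (p - ζ) * g (-ζ) * f ζ = 2 * ζ) :
    d + d' = c * c' + p * (c - c') := by
  have hw : Tendsto (fun ζ : ℂ => 1 / ζ) l (𝓝 0) := by
    have := tendsto_one_div_sub_cocompact 0
    simp only [sub_zero] at this
    exact this.mono_left hl
  have hne : ∀ᶠ ζ : ℂ in l, ζ ≠ 0 :=
    hl ((isCompact_singleton (x := (0 : ℂ))).compl_mem_cocompact)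
  have key : ∀ {F : ℂ → ℂ} {e b : ℂ}, (fun ζ => F ζ - (1 + e / ζ + b / ζ ^ 2)) =o[l]
      (fun ζ => 1 / ζ ^ 2) → Tendsto (fun ζ => ζ ^ 2 * (F ζ - (1 + e / ζ))) l (𝓝 b) := by
    intro F e b h
    have h1 := h.tendsto_div_nhds_zero.add_const b
    rw [zero_add] at h1
    refine h1.congr' ?_
    filter_upwards [hne] with ζ h0
    field_simp
    ring
  have k1 := key hf
  have k2 := key (e := -c) (by simpa only [neg_div, ← sub_eq_add_neg] using hf')
  have k3 := key hg
  have k4 := key (e := -c') (by simpa only [neg_div, ← sub_eq_add_neg] using hg')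
  set D₁ := fun ζ => ζ ^ 2 * (f ζ - (1 + c / ζ))
  set D₂ := fun ζ => ζ ^ 2 * (f (-ζ) - (1 + -c / ζ))
  set E₁ := fun ζ => ζ ^ 2 * (g ζ - (1 + c' / ζ))
  set E₂ := fun ζ => ζ ^ 2 * (g (-ζ) - (1 + -c' / ζ))
  have lim : Tendsto (fun ζ => (E₁ ζ + E₂ ζ + D₁ ζ + D₂ ζ - 2 * (c * c') + 2 * p * (c' - c))
      + (1 / ζ) * (p * (E₁ ζ + D₂ ζ - E₂ ζ - D₁ ζ) + c' * (D₂ ζ - D₁ ζ) - c * (E₁ ζ - E₂ ζ))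
      + (1 / ζ) ^ 2 * (E₁ ζ * D₂ ζ + E₂ ζ * D₁ ζ + p * (c' * (D₁ ζ + D₂ ζ) - c * (E₁ ζ + E₂ ζ)))
      + (1 / ζ) ^ 3 * (p * (E₁ ζ * D₂ ζ - E₂ ζ * D₁ ζ))) l
      (𝓝 ((d' + d' + d + d - 2 * (c * c') + 2 * p * (c' - c))
      + 0 * (p * (d' + d - d' - d) + c' * (d - d) - c * (d' - d'))
      + 0 ^ 2 * (d' * d + d' * d + p * (c' * (d + d) - c * (d' + d')))
      + 0 ^ 3 * (p * (d' * d - d' * d)))) := by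
    refine ((Tendsto.add ?_ (hw.mul ?_)).add ((hw.pow 2).mul ?_)).add ((hw.pow 3).mul ?_)
    · exact ((((k3.add k4).add k1).add k2).sub_const _).add_const _
    · exact ((((((k3.add k2).sub k4).sub k1)).const_mul p).add ((k2.sub k1).const_mul c')).sub
        ((k3.sub k4).const_mul c)
    · exact ((k3.mul k2).add (k4.mul k1)).add
        ((((k1.add k2).const_mul c').sub ((k3.add k4).const_mul c)).const_mul p)
    · exact ((k3.mul k2).sub (k4.mul k1)).const_mul p
  have h0 : Tendsto (fun _ : ℂ => (0 : ℂ)) l (𝓝 ((d' + d' + d + d - 2 * (c * c') + 2 * p * (c' - c))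
      + 0 * (p * (d' + d - d' - d) + c' * (d - d) - c * (d' - d'))
      + 0 ^ 2 * (d' * d + d' * d + p * (c' * (d + d) - c * (d' + d')))
      + 0 ^ 3 * (p * (d' * d - d' * d)))) := by
    refine lim.congr' ?_
    filter_upwards [hne, hW] with ζ h0 hW
    have e1 : f ζ = 1 + c / ζ + D₁ ζ / ζ ^ 2 := by simp only [D₁]; field_simp; ring
    have e2 : f (-ζ) = 1 - c / ζ + D₂ ζ / ζ ^ 2 := by simp only [D₂]; field_simp; ring
    have e3 : g ζ = 1 + c' / ζ + E₁ ζ / ζ ^ 2 := by simp only [E₁]; field_simp; ring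
    have e4 : g (-ζ) = 1 - c' / ζ + E₂ ζ / ζ ^ 2 := by simp only [E₂]; field_simp; ring
    rw [e1, e2, e3, e4] at hW
    generalize D₁ ζ = x1 at *
    generalize D₂ ζ = x2 at *
    generalize E₁ ζ = y1 at *
    generalize E₂ ζ = y2 at *
    have : ζ * ((p + ζ) * (1 + c' / ζ + y1 / ζ ^ 2) * (1 - c / ζ + x2 / ζ ^ 2)
      - (p - ζ) * (1 - c' / ζ + y2 / ζ ^ 2) * (1 + c / ζ + x1 / ζ ^ 2) - 2 * ζ) = 0 := by
      rw [hW]; ring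
    rw [← this]
    field_simp
    ring
  have := tendsto_nhds_unique h0 tendsto_const_nhds
  linear_combination (1 / 2 : ℂ) * this

namespace InitialData

variable {N : ℕ} {D : InitialData N} {S : Set (Lattice N)} {c d : Lattice N → ℂ}

theorem sum_add_e {a : Fin N → ℂ} (n : Lattice N) (j : Fin N) :
    ∑ r, a r * ((n + e j) r : ℤ) = ∑ r, a r * (n r : ℤ) + a j := by
  have : ∀ r, a r * ((n + e j) r : ℤ) = a r * (n r : ℤ) + if r = j then a j else 0 := by
    intro r
    by_cases h : r = j
    · subst h; simp [e]; ring
    · simp [e, h]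
  simp only [this, Finset.sum_add_distrib, Finset.sum_ite_eq', Finset.mem_univ, if_true]

theorem varrho_add_e (n : Lattice N) (j : Fin N) : D.varrho (n + e j) = D.varrho n + D.p j :=
  sum_add_e n j

theorem sgn_add_e (n : Lattice N) (j : Fin N) : sgn (n + e j) = -sgn n := by
  have : ∑ r, (n + e j) r = ∑ r, n r + 1 := by
    simp [e, Finset.sum_add_distrib]
  rw [sgn, sgn, this, zpow_add_one₀ (by norm_num)]
  ring

theorem sgn_sq (n : Lattice N) : sgn n ^ 2 = 1 := by
  rw [sgn, ← zpow_natCast, ← zpow_mul, mul_comm, zpow_mul]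
  norm_num

/-- The relations between the expansion coefficients on the edges of a set of lattice points. -/
def EdgeRelations (D : InitialData N) (S : Set (Lattice N)) (c d : Lattice N → ℂ) : Prop :=
  ∀ n j, n ∈ S → n + e j ∈ S →
    d n + d (n + e j) = c n * c (n + e j) + D.p j * (c n - c (n + e j))

theorem EdgeRelations.quad (h : EdgeRelations D S c d) {n : Lattice N} {j k : Fin N}
    (h0 : n ∈ S) (h1 : n + e j ∈ S) (h2 : n + e k ∈ S) (h3 : n + e j + e k ∈ S) :
    (D.varrho n + c n - (D.varrho n + D.p j + D.p k + c (n + e j + e k)))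
      * (D.varrho n + D.p j + c (n + e j) - (D.varrho n + D.p k + c (n + e k)))
      = -(D.p j ^ 2 - D.p k ^ 2) := by
  have e1 := h n j h0 h1
  have e2 := h n k h0 h2
  have e3 := h (n + e j) k h1 h3
  have hc : n + e k + e j = n + e j + e k := by abel
  have e4 := h (n + e k) j h2 (by rwa [hc])
  rw [hc] at e4
  linear_combination -e1 + e2 + e3 - e4

theorem EdgeRelations.solvesOn_H1 (h : EdgeRelations D S c d) {cA cB : ℂ} (ρ₀ ρ₁ : ℂ)
    (hAB : cA ^ 2 - cB ^ 2 = -1) :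
    SolvesOn S (fun j k => EqH1 (D.p j) (D.p k)) (D.uH1 c cA cB ρ₀ ρ₁) := by
  intro n j k h0 h1 h2 h3
  have q := h.quad h0 h1 h2 h3
  have hs := sgn_sq n
  simp only [EqH1, uH1, sgn_add_e, varrho_add_e]
  linear_combination (cB ^ 2 - sgn n ^ 2 * cA ^ 2) * q
    + (D.p j ^ 2 - D.p k ^ 2) * (hAB + cA ^ 2 * hs)

theorem EdgeRelations.solvesOn_H2 (h : EdgeRelations D S c d) (cA ρ₀ ρ₁ : ℂ) :
    SolvesOn S (fun j k => EqH2 (D.p j) (D.p k)) (D.uH2 c d cA ρ₀ ρ₁) := by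
  intro n j k h0 h1 h2 h3
  have q := h.quad h0 h1 h2 h3
  have hs := sgn_sq n
  have e1 := h n j h0 h1
  have e2 := h n k h0 h2
  have e3 := h (n + e j) k h1 h3
  have hc : n + e k + e j = n + e j + e k := by abel
  have e4 := h (n + e k) j h2 (by rwa [hc])
  rw [hc] at e4
  simp only [EqH2, uH2, sgn_add_e, varrho_add_e]
  set s := sgn n
  set W := D.varrho n + ρ₀ + c n with hW
  set W₁ := D.varrho n + D.p j + ρ₀ + c (n + e j) with hW₁
  set W₂ := D.varrho n + D.p k + ρ₀ + c (n + e k) with hW₂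
  set W₃ := D.varrho n + D.p j + D.p k + ρ₀ + c (n + e j + e k) with hW₃
  have q' : (W - W₃) * (W₁ - W₂) = -(D.p j ^ 2 - D.p k ^ 2) := by
    simp only [hW, hW₁, hW₂, hW₃]; linear_combination q
  set U := (D.varrho n + ρ₀) ^ 2 + 2 * (D.varrho n + ρ₀) * c n + 2 * d n with hU
  set U₁ := (D.varrho n + D.p j + ρ₀) ^ 2 + 2 * (D.varrho n + D.p j + ρ₀) * c (n + e j)
    + 2 * d (n + e j) with hU₁
  set U₂ := (D.varrho n + D.p k + ρ₀) ^ 2 + 2 * (D.varrho n + D.p k + ρ₀) * c (n + e k)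
    + 2 * d (n + e k) with hU₂
  set U₃ := (D.varrho n + D.p j + D.p k + ρ₀) ^ 2
    + 2 * (D.varrho n + D.p j + D.p k + ρ₀) * c (n + e j + e k) + 2 * d (n + e j + e k) with hU₃
  have r1 : U + U₁ = 2 * W * W₁ + D.p j ^ 2 := by
    simp only [hU, hU₁, hW, hW₁]; linear_combination 2 * e1
  have r2 : U + U₂ = 2 * W * W₂ + D.p k ^ 2 := by
    simp only [hU, hU₂, hW, hW₂]; linear_combination 2 * e2
  have r3 : U₁ + U₃ = 2 * W₁ * W₃ + D.p k ^ 2 := by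
    simp only [hU₁, hU₃, hW₁, hW₃]; linear_combination 2 * e3
  have r4 : U₂ + U₃ = 2 * W₂ * W₃ + D.p j ^ 2 := by
    simp only [hU₂, hU₃, hW₂, hW₃]; linear_combination 2 * e4
  have y0 : D.varrho n + ρ₁ + c n = W + (ρ₁ - ρ₀) := by simp only [hW]; ring
  have y1 : D.varrho n + D.p j + ρ₁ + c (n + e j) = W₁ + (ρ₁ - ρ₀) := by simp only [hW₁]; ring
  have y2 : D.varrho n + D.p k + ρ₁ + c (n + e k) = W₂ + (ρ₁ - ρ₀) := by simp only [hW₂]; ring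
  have y3 : D.varrho n + D.p j + D.p k + ρ₁ + c (n + e j + e k) = W₃ + (ρ₁ - ρ₀) := by
    simp only [hW₃]; ring
  rw [y0, y1, y2, y3]
  clear_value W W₁ W₂ W₃ U U₁ U₂ U₃ s
  generalize D.p j = p at *
  generalize D.p k = q₀ at *
  generalize ρ₁ - ρ₀ = y at *
  have d1 : U - U₃ = 2 * W₁ * (W - W₃) + (p ^ 2 - q₀ ^ 2) := by linear_combination r1 - r3
  have d2 : U₁ - U₂ = 2 * W * (W₁ - W₂) + (p ^ 2 - q₀ ^ 2) := by linear_combination r1 - r2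
  have sm : U + U₁ + U₂ + U₃ = 2 * W * W₁ + 2 * W₂ * W₃ + 2 * p ^ 2 := by linear_combination r1 + r4
  have f1 : U - cA ^ 2 + s * 2 * cA * (W + y) - (U₃ - cA ^ 2 + - -s * 2 * cA * (W₃ + y))
      = (2 * W₁ + 2 * s * cA) * (W - W₃) + (p ^ 2 - q₀ ^ 2) := by linear_combination d1
  have f2 : U₁ - cA ^ 2 + -s * 2 * cA * (W₁ + y) - (U₂ - cA ^ 2 + -s * 2 * cA * (W₂ + y))
      = (2 * W - 2 * s * cA) * (W₁ - W₂) + (p ^ 2 - q₀ ^ 2) := by linear_combination d2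
  rw [f1, f2]
  linear_combination (p ^ 2 - q₀ ^ 2) * sm
    + ((2 * W₁ + 2 * s * cA) * (2 * W - 2 * s * cA) + 2 * (p ^ 2 - q₀ ^ 2)) * q'
    + 4 * (p ^ 2 - q₀ ^ 2) * cA ^ 2 * hs

end InitialData

/-- Analytic functions on a set of lattice points that satisfy the linear relations of the lattice
Jost functions. -/
structure LaxSystem {N : ℕ} (p : Fin N → ℂ) (S : Set (Lattice N)) (V : Set ℂ)
    (Λ : Lattice N → ℂ → ℂ) (c : Lattice N → ℂ) : Prop where
  isOpen : IsOpen V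
  diff : ∀ n ∈ S, DifferentiableOn ℂ (Λ n) V
  wronskian : ∀ n j, n ∈ S → n + e j ∈ S → ∀ ζ ∈ V, -ζ ∈ V →
    (p j + ζ) * Λ (n + e j) ζ * Λ n (-ζ) - (p j - ζ) * Λ (n + e j) (-ζ) * Λ n ζ = 2 * ζ
  up_up : ∀ n j k, n ∈ S → n + e j ∈ S → n + e k ∈ S → ∀ ζ ∈ V,
    (p j + ζ) * Λ (n + e j) ζ - (p k + ζ) * Λ (n + e k) ζ
      = (p j - p k + c (n + e j) - c (n + e k)) * Λ n ζ
  up_down : ∀ n j k, n ∈ S → n + e j ∈ S → n + e j + e k ∈ S → ∀ ζ ∈ V,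
    (p k + ζ) * Λ (n + e j + e k) ζ + (p j - ζ) * Λ n ζ
      = (p k + p j + c (n + e j + e k) - c n) * Λ (n + e j) ζ
  down_down : ∀ n j k, n + e k ∈ S → n + e j ∈ S → n + e j + e k ∈ S → ∀ ζ ∈ V,
    (p j - ζ) * Λ (n + e k) ζ - (p k - ζ) * Λ (n + e j) ζ
      = (p j - p k + c (n + e j) - c (n + e k)) * Λ (n + e j + e k) ζ

namespace InitialData

namespace ContourSetting

variable {N : ℕ} {D : InitialData N} {K : ℝ} {L : ℝ → ℂ} {Z : Finset ℂ} {c : ℂ → ℂ}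

theorem exists_hasExpansion (h : D.ContourSetting K L Z c) {φ f : ℂ → ℂ}
    (hφ : ContinuousOn φ (curveTrace L ∪ ↑Z))
    (hf : ∀ ζ, -ζ ∈ extRegion L →
      f ζ = 1 + contourFun L Z (D.coefC K c) D.refl fun σ => φ σ / (σ + ζ)) :
    ∃ d, HasExpansion f (contourFun L Z (D.coefC K c) D.refl φ) d := by
  set I := contourFun L Z (D.coefC K c) D.refl with hI'
  have hI : CauchyFunctional (curveTrace L ∪ ↑Z) I := h.cauchyFunctional
  have hV : ∀ᶠ ζ in cocompact ℂ, -ζ ∈ extRegion L :=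
    tendsto_neg_cocompact.eventually h.contour.extRegion_mem_cocompact
  have hne : ∀ᶠ ζ : ℂ in cocompact ℂ, ζ ≠ 0 := (isCompact_singleton (x := (0 : ℂ))).compl_mem_cocompact
  have step : ∀ ψ : ℂ → ℂ, ContinuousOn ψ (curveTrace L ∪ ↑Z) → ∀ ζ, -ζ ∈ extRegion L → ζ ≠ 0 →
      I (fun σ => ψ σ / (σ + ζ)) = 1 / ζ * (I ψ - I fun σ => σ * ψ σ / (σ + ζ)) := by
    intro ψ hψ ζ hζ h0
    have hne : ∀ σ ∈ curveTrace L ∪ ↑Z, σ + ζ ≠ 0 := fun σ hσ => h.add_ne_zero hσ hζ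
    have c1 : ContinuousOn (fun σ => ψ σ / (σ + ζ)) (curveTrace L ∪ ↑Z) :=
      hψ.fun_div (by fun_prop) hne
    have c2 : ContinuousOn (fun σ => σ * ψ σ / (σ + ζ)) (curveTrace L ∪ ↑Z) :=
      (continuousOn_id.fun_mul hψ).fun_div (by fun_prop) hne
    have e : I ψ = I fun σ => ζ * (ψ σ / (σ + ζ)) + σ * ψ σ / (σ + ζ) :=
      hI.congr _ _ fun σ hσ => by have := hne σ hσ; field_simp; ring
    rw [hI.add _ _ (continuousOn_const.fun_mul c1) c2, hI.smul _ _ c1] at e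
    rw [e]
    field_simp
    ring
  have hφ1 : ContinuousOn (fun σ => σ * φ σ) (curveTrace L ∪ ↑Z) := continuousOn_id.fun_mul hφ
  have hφ2 : ContinuousOn (fun σ => σ * (σ * φ σ)) (curveTrace L ∪ ↑Z) :=
    continuousOn_id.fun_mul hφ1
  have hφ3 : ContinuousOn (fun σ => σ * (σ * (σ * φ σ))) (curveTrace L) :=
    (continuousOn_id.fun_mul hφ2).mono subset_union_left
  have lim := (h.contour.tendsto_contourFun (Z := Z) (D.coefC K c) h.continuousOn_refl
    hφ3).const_sub (I fun σ => σ * (σ * φ σ))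
  refine ⟨-I fun σ => σ * φ σ, ?_⟩
  unfold HasExpansion
  rw [isBigO_iff]
  obtain ⟨C, hC⟩ := (lim.norm.isBoundedUnder_le).eventually_le
  refine ⟨C, ?_⟩
  filter_upwards [hV, hne, hC] with ζ hζ h0 hC
  have e1 : f ζ - (1 + I φ / ζ + (-I fun σ => σ * φ σ) / ζ ^ 2)
      = 1 / ζ ^ 3 * ((I fun σ => σ * (σ * φ σ)) - I fun σ => σ * (σ * (σ * φ σ)) / (σ + ζ)) := by
    rw [hf ζ hζ, step φ hφ ζ hζ h0, step _ hφ1 ζ hζ h0, step _ hφ2 ζ hζ h0]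
    field_simp
    ring
  rw [e1, norm_mul, mul_comm]
  exact mul_le_mul_of_nonneg_right hC (norm_nonneg _)

variable {Λ : Lattice N → ℂ → ℂ}

/-- The first coefficient of the expansion at infinity. -/
def firstCoef (D : InitialData N) (K : ℝ) (L : ℝ → ℂ) (Z : Finset ℂ) (c : ℂ → ℂ)
    (Λ : Lattice N → ℂ → ℂ) (n : Lattice N) : ℂ :=
  contourFun L Z (D.coefC K c) D.refl fun σ => D.rho n σ * Λ n σ

theorem eq_of_solves (h : D.ContourSetting K L Z c)
    (hΛ : ∀ n ∈ D.regular K L Z c, D.IsSolution K L Z c n (Λ n)) {n : Lattice N}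
    (hn : n ∈ D.regular K L Z c) {f : ℂ → ℂ} (hf : Solves D K L Z c n 1 f) :
    ∀ ζ ∈ {ζ | -ζ ∈ extRegion L}, f ζ = Λ n ζ := by
  intro ζ hζ
  have hs := hΛ n hn
  obtain ⟨g, -, hg⟩ := hn
  rw [hg f (h.solves_iff.2 hf) ζ hζ, hg (Λ n) hs ζ hζ]

theorem rho_add_e_mul (h : D.ContourSetting K L Z c) (n : Lattice N) (j : Fin N) {σ : ℂ}
    (hσ : σ ∈ curveTrace L ∪ ↑Z) :
    (D.p j - σ) * D.rho (n + e j) σ = (D.p j + σ) * D.rho n σ := by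
  obtain ⟨h1, h2⟩ := h.param hσ j
  rw [D.rho_add_e _ _ h1 h2]
  field_simp

theorem laxSystem (h : D.ContourSetting K L Z c)
    (hΛ : ∀ n ∈ D.regular K L Z c, D.IsSolution K L Z c n (Λ n)) :
    LaxSystem D.p (D.regular K L Z c) {ζ | -ζ ∈ extRegion L} Λ (firstCoef D K L Z c Λ) := by
  have hI := h.cauchyFunctional
  have hs : ∀ n ∈ D.regular K L Z c, Solves D K L Z c n 1 (Λ n) :=
    fun n hn => h.solves_iff.1 (hΛ n hn)
  refine ⟨h.isOpen_V, fun n hn => h.differentiableOn_of_solves (hs n hn), ?_, ?_, ?_, ?_⟩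
  · intro n j h0 h1 ζ hζ hζ'
    have := (hs n h0).bilinear hI (hs _ h1) (α₀ := D.p j) (α₁ := 1)
      (fun σ hσ => by linear_combination -h.rho_add_e_mul n j hσ) hζ hζ'
    linear_combination this
  · intro n j k h0 h1 h2 ζ hζ
    have := (hs n h0).linear_relation hI (fun f hf => h.eq_of_solves hΛ h0 hf) (hs _ h1) (hs _ h2)
      (α₀ := D.p j) (α₁ := 1) (β₀ := D.p k)
      (fun σ hσ => by linear_combination -h.rho_add_e_mul n j hσ)
      (fun σ hσ => by linear_combination -h.rho_add_e_mul n k hσ) hζ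
    simp only [firstCoef]
    linear_combination this
  · intro n j k h0 h1 h2 ζ hζ
    have := (hs _ h1).linear_relation hI (fun f hf => h.eq_of_solves hΛ h1 hf) (hs _ h2) (hs _ h0)
      (α₀ := D.p k) (α₁ := 1) (β₀ := -D.p j)
      (fun σ hσ => by linear_combination -h.rho_add_e_mul (n + e j) k hσ)
      (fun σ hσ => by linear_combination -h.rho_add_e_mul n j hσ) hζ
    simp only [firstCoef]
    linear_combination this
  · intro n j k h2 h1 h3 ζ hζ
    have hc : n + e k + e j = n + e j + e k := by abel
    have := (hs _ h3).linear_relation hI (fun f hf => h.eq_of_solves hΛ h3 hf) (hs _ h2) (hs _ h1)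
      (α₀ := D.p j) (α₁ := -1) (β₀ := D.p k)
      (fun σ hσ => by
        have := h.rho_add_e_mul (n + e k) j hσ
        rw [hc] at this
        linear_combination this)
      (fun σ hσ => by linear_combination h.rho_add_e_mul (n + e j) k hσ) hζ
    simp only [firstCoef]
    linear_combination this

theorem hasExpansion (h : D.ContourSetting K L Z c)
    (hΛ : ∀ n ∈ D.regular K L Z c, D.IsSolution K L Z c n (Λ n)) {n : Lattice N}
    (hn : n ∈ D.regular K L Z c) : ∃ d, HasExpansion (Λ n) (firstCoef D K L Z c Λ n) d := by
  have hs := h.solves_iff.1 (hΛ n hn)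
  exact h.exists_hasExpansion (hs.contρ.fun_mul hs.cont) hs.eq

theorem edgeRelations (h : D.ContourSetting K L Z c)
    (hΛ : ∀ n ∈ D.regular K L Z c, D.IsSolution K L Z c n (Λ n)) {Λε Λε2 : Lattice N → ℂ}
    (hE : ∀ n ∈ D.regular K L Z c, HasExpansion (Λ n) (Λε n) (Λε2 n)) :
    EdgeRelations D (D.regular K L Z c) Λε Λε2 := by
  have h3 : (fun ζ : ℂ => 1 / ζ ^ 3) =o[cocompact ℂ] fun ζ => 1 / ζ ^ 2 := by
    have hz : Tendsto (fun ζ : ℂ => 1 / ζ) (cocompact ℂ) (𝓝 0) := by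
      simpa only [sub_zero] using tendsto_one_div_sub_cocompact 0
    have := (isLittleO_one_iff ℂ).2 hz
    refine (this.mul_isBigO (isBigO_refl (fun ζ : ℂ => 1 / ζ ^ 2) _)).congr ?_ ?_
    · intro ζ; ring
    · intro ζ; ring
  have hl : ∀ n ∈ D.regular K L Z c, (fun ζ => Λ n ζ - (1 + Λε n / ζ + Λε2 n / ζ ^ 2))
      =o[cocompact ℂ] fun ζ => 1 / ζ ^ 2 := fun n hn => (hE n hn).trans_isLittleO h3
  have hl' : ∀ n ∈ D.regular K L Z c, (fun ζ => Λ n (-ζ) - (1 - Λε n / ζ + Λε2 n / ζ ^ 2))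
      =o[cocompact ℂ] fun ζ => 1 / ζ ^ 2 := by
    intro n hn
    refine ((hl n hn).comp_tendsto tendsto_neg_cocompact).congr (fun ζ => ?_) fun ζ => ?_
    · simp only [Function.comp, neg_sq, div_neg, ← sub_eq_add_neg]
    · simp only [Function.comp, neg_sq]
  intro n j h0 h1
  refine edge_relation le_rfl (hl n h0) (hl' n h0) (hl _ h1) (hl' _ h1) ?_
  filter_upwards [h.contour.extRegion_mem_cocompact,
    tendsto_neg_cocompact.eventually h.contour.extRegion_mem_cocompact] with ζ hζ hζ'
  exact (h.laxSystem hΛ).wronskian n j h0 h1 ζ hζ' (by simpa using hζ)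

end ContourSetting

end InitialData

namespace InitialData

variable {N : ℕ} {D : InitialData N}

/-- The bilinear expression in `𝒮(x, y) = T(x, y) / (x - y)`. -/
def bigT (D : InitialData N) (Λ : Lattice N → ℂ → ℂ) (l : Fin N) (n : Lattice N) (x y : ℂ) : ℂ :=
  (D.p l + x) * Λ (n + e l) x * Λ n y - (D.p l + y) * Λ n x * Λ (n + e l) y

variable {Λ : Lattice N → ℂ → ℂ} {S : Set (Lattice N)} {V : Set ℂ} {c : Lattice N → ℂ}
  {n : Lattice N} {j k l l' : Fin N} {a b x y : ℂ}

theorem bigS_eq : D.bigS Λ l n x y = D.bigT Λ l n x y / (x - y) := by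
  rw [bigS, bigT]; ring

theorem bigT_swap : D.bigT Λ l n y x = -D.bigT Λ l n x y := by
  simp only [bigT]; ring

theorem bigT_eq (h : LaxSystem D.p S V Λ c) (h0 : n ∈ S) (h1 : n + e l ∈ S) (h2 : n + e l' ∈ S)
    (hx : x ∈ V) (hy : y ∈ V) : D.bigT Λ l n x y = D.bigT Λ l' n x y := by
  have e1 := h.up_up n l l' h0 h1 h2 x hx
  have e2 := h.up_up n l l' h0 h1 h2 y hy
  simp only [bigT]
  linear_combination Λ n y * e1 - Λ n x * e2

theorem bigT_add_e (h : LaxSystem D.p S V Λ c) (h0 : n ∈ S) (h1 : n + e j ∈ S)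
    (h2 : n + e j + e l ∈ S) (hx : x ∈ V) (hy : y ∈ V) :
    D.bigT Λ l (n + e j) x y = (D.p j - y) * Λ (n + e j) x * Λ n y
      - (D.p j - x) * Λ n x * Λ (n + e j) y := by
  have e1 := h.up_down n j l h0 h1 h2 x hx
  have e2 := h.up_down n j l h0 h1 h2 y hy
  simp only [bigT]
  linear_combination Λ (n + e j) y * e1 - Λ (n + e j) x * e2

theorem bigT_self_neg (h : LaxSystem D.p S V Λ c) (h0 : n ∈ S) (h1 : n + e l ∈ S)
    (hx : x ∈ V) (hx' : -x ∈ V) : D.bigT Λ l n x (-x) = 2 * x := by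
  have := h.wronskian n l h0 h1 x hx hx'
  simp only [bigT]
  linear_combination this

theorem deriv_bigT (h : LaxSystem D.p S V Λ c) (h0 : n ∈ S) (h1 : n + e l ∈ S) (hy : y ∈ V) (x : ℂ) :
    HasDerivAt (D.bigT Λ l n x) ((D.p l + x) * Λ (n + e l) x * deriv (Λ n) y
      - (Λ n x * Λ (n + e l) y + (D.p l + y) * Λ n x * deriv (Λ (n + e l)) y)) y := by
  have d0 := ((h.diff n h0).differentiableAt (h.isOpen.mem_nhds hy)).hasDerivAt
  have d1 := ((h.diff _ h1).differentiableAt (h.isOpen.mem_nhds hy)).hasDerivAt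
  have := (d0.const_mul ((D.p l + x) * Λ (n + e l) x)).sub
    ((((hasDerivAt_id y).const_add (D.p l)).mul_const (Λ n x)).mul d1)
  rw [one_mul] at this
  exact this

theorem smallS_eq (h : LaxSystem D.p S V Λ c) (h0 : n ∈ S) (h1 : n + e l ∈ S) (hy : y ∈ V) (x : ℂ) :
    D.smallS Λ l n x y = 1 / (2 * y) * (1 + deriv (D.bigT Λ l n x) y) := by
  rw [(deriv_bigT h h0 h1 hy x).deriv, smallS]
  ring

theorem bigZ_eq (h : LaxSystem D.p S V Λ c) (h0 : n ∈ S) (h1 : n + e l ∈ S) (ha : a ∈ V)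
    (ha' : -a ∈ V) :
    D.bigZ Λ l n a = 1 / (2 * a) * deriv (fun x => deriv (D.bigT Λ l n x) (-a)) a := by
  have d0 := ((h.diff n h0).differentiableAt (h.isOpen.mem_nhds ha)).hasDerivAt
  have d1 := ((h.diff _ h1).differentiableAt (h.isOpen.mem_nhds ha)).hasDerivAt
  have e1 : (fun x => deriv (D.bigT Λ l n x) (-a)) = fun x =>
      (D.p l + x) * Λ (n + e l) x * deriv (Λ n) (-a)
        - Λ n x * (Λ (n + e l) (-a) + (D.p l + -a) * deriv (Λ (n + e l)) (-a)) := by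
    ext x
    rw [(deriv_bigT h h0 h1 ha' x).deriv]
    ring
  have := ((((hasDerivAt_id a).const_add (D.p l)).mul d1).mul_const (deriv (Λ n) (-a))).sub
    (d0.mul_const (Λ (n + e l) (-a) + (D.p l + -a) * deriv (Λ (n + e l)) (-a)))
  have e2 := this.deriv
  simp only [Pi.mul_def, id, Pi.sub_def] at e2
  rw [e1, e2, bigZ]
  ring

theorem smallS_indep (h : LaxSystem D.p S V Λ c) (h0 : n ∈ S) (h1 : n + e l ∈ S)
    (h2 : n + e l' ∈ S) (hx : x ∈ V) (hy : y ∈ V) :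
    D.smallS Λ l n x y = D.smallS Λ l' n x y := by
  rw [smallS_eq h h0 h1 hy, smallS_eq h h0 h2 hy]
  congr 2
  refine EventuallyEq.deriv_eq ?_
  filter_upwards [h.isOpen.mem_nhds hy] with w hw
  exact bigT_eq h h0 h1 h2 hx hw

theorem bigZ_indep (h : LaxSystem D.p S V Λ c) (h0 : n ∈ S) (h1 : n + e l ∈ S)
    (h2 : n + e l' ∈ S) (ha : a ∈ V) (ha' : -a ∈ V) :
    D.bigZ Λ l n a = D.bigZ Λ l' n a := by
  rw [bigZ_eq h h0 h1 ha ha', bigZ_eq h h0 h2 ha ha']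
  congr 1
  refine EventuallyEq.deriv_eq ?_
  filter_upwards [h.isOpen.mem_nhds ha] with x hx
  refine EventuallyEq.deriv_eq ?_
  filter_upwards [h.isOpen.mem_nhds ha'] with w hw
  exact bigT_eq h h0 h1 h2 hx hw

/-! ### The quadrilateral identity for `Q3` -/

/-- `∑ m_{st} g(s a) h(t b)` over the signs `s, t`. -/
def sgnSum (m : Fin 4 → ℂ) (a b : ℂ) (w : ℂ → ℂ → ℂ) : ℂ :=
  m 0 * w a b + m 1 * w a (-b) + m 2 * w (-a) b + m 3 * w (-a) (-b)

theorem quad_identity {m : Fin 4 → ℂ} {p q P Q κ : ℂ} {f f₁ f₂ f₃ : ℂ → ℂ} {u u₁ u₂ u₃ : ℂ}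
    (ha : a ≠ 0) (hpa : p ^ 2 ≠ a ^ 2) (hqa : q ^ 2 ≠ a ^ 2) (hP0 : P ≠ 0) (hQ0 : Q ≠ 0)
    (hP : P ^ 2 = (p ^ 2 - a ^ 2) * (p ^ 2 - b ^ 2)) (hQ : Q ^ 2 = (q ^ 2 - a ^ 2) * (q ^ 2 - b ^ 2))
    (up : ∀ x, x = a ∨ x = -a ∨ x = b ∨ x = -b → (p + x) * f₁ x - (q + x) * f₂ x = κ * f x)
    (down : ∀ x, x = a ∨ x = -a ∨ x = b ∨ x = -b → (p - x) * f₂ x - (q - x) * f₁ x = κ * f₃ x)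
    (wa : (p + a) * f₁ a * f (-a) - (p - a) * f₁ (-a) * f a = 2 * a)
    (wb : (p + b) * f₁ b * f (-b) - (p - b) * f₁ (-b) * f b = 2 * b)
    (hu : u = sgnSum m a b fun x y => (p + x) * f₁ x * f y - (p + y) * f x * f₁ y)
    (hu₁ : P * u₁ = sgnSum m a b fun x y => (p + x) * (p + y) *
      ((p - y) * f₁ x * f y - (p - x) * f x * f₁ y))
    (hu₂ : Q * u₂ = sgnSum m a b fun x y => (q + x) * (q + y) *
      ((q - y) * f₂ x * f y - (q - x) * f x * f₂ y))
    (hu₃ : P * Q * u₃ = sgnSum m a b fun x y => (p + x) * (p + y) * (q + x) * (q + y) *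
      ((q - y) * f₃ x * f₁ y - (q - x) * f₁ x * f₃ y)) :
    P * (u * u₂ + u₁ * u₃) - Q * (u * u₁ + u₂ * u₃) - (p ^ 2 - q ^ 2) * (u₁ * u₂ + u * u₃)
      = (p ^ 2 - q ^ 2) / (P * Q) * (4 * a * b * (a ^ 2 - b ^ 2) ^ 2 * (m 0 * m 3 - m 1 * m 2)) := by
  have up1 := up a (by simp)
  have up2 := up (-a) (by simp)
  have up3 := up b (by simp)
  have up4 := up (-b) (by simp)
  have dn1 := down a (by simp)
  have dn2 := down (-a) (by simp)
  have dn3 := down b (by simp)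
  have dn4 := down (-b) (by simp)
  by_cases hκ : κ = 0
  · subst hκ
    simp only [zero_mul] at up1 up2 up3 up4 dn1 dn2 dn3 dn4
    have hpq : p ^ 2 = q ^ 2 := by
      by_contra hne
      have hpa' : p + a ≠ 0 := fun h => hpa (by linear_combination (p - a) * h)
      have hpa'' : p - a ≠ 0 := fun h => hpa (by linear_combination (p + a) * h)
      have hqa' : q + a ≠ 0 := fun h => hqa (by linear_combination (q - a) * h)
      have hqa'' : q - a ≠ 0 := fun h => hqa (by linear_combination (q + a) * h)
      have hz : ∀ {s : ℂ}, (p + s) * f₁ s - (q + s) * f₂ s = 0 → (p - s) * f₂ s - (q - s) * f₁ s = 0 →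
          q + s ≠ 0 → f₁ s = 0 := by
        intro s h1 h2 h3
        have : (p ^ 2 - q ^ 2) * f₁ s = 0 := by linear_combination (p - s) * h1 + (q + s) * h2
        exact (mul_eq_zero.1 this).resolve_left (sub_ne_zero.2 hne)
      have z1 := hz up1 dn1 hqa'
      have z2 := hz up2 dn2 (by rwa [← sub_eq_add_neg])
      rw [z1, z2] at wa
      exact ha (by linear_combination -(1 / 2 : ℂ) * wa)
    have e1 : P * u₁ = Q * u₂ := by
      rw [hu₁, hu₂]
      simp only [sgnSum]
      have hb2 : q ^ 2 = p ^ 2 := hpq.symm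
      have r : ∀ {x y : ℂ}, (p + x) * f₁ x - (q + x) * f₂ x = 0 →
          (p + y) * f₁ y - (q + y) * f₂ y = 0 →
          (p + x) * (p + y) * ((p - y) * f₁ x * f y - (p - x) * f x * f₁ y)
          = (q + x) * (q + y) * ((q - y) * f₂ x * f y - (q - x) * f x * f₂ y) := by
        intro x y h1 h2
        linear_combination (p ^ 2 - y ^ 2) * f y * h1 - (p ^ 2 - x ^ 2) * f x * h2
          - ((q + x) * f₂ x * f y - (q + y) * f₂ y * f x) * hb2
      rw [r up1 up3, r up1 up4, r up2 up3, r up2 up4]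
    have e2 : P ^ 2 = Q ^ 2 := by rw [hP, hQ, hpq]
    rw [hpq]
    have : Q * (P * (u * u₂ + u₁ * u₃) - Q * (u * u₁ + u₂ * u₃)) = 0 := by
      linear_combination (-P * u + Q * u₃) * e1 + u * u₁ * e2
    have := (mul_eq_zero.1 this).resolve_left hQ0
    linear_combination this
  · set X : (ℂ → ℂ) → (ℂ → ℂ) → ℂ := fun g h => sgnSum m a b fun x y => g x * h y with hX
    set φ₁ : ℂ → ℂ := fun x => (p + x) * f₁ x with hφ₁
    set φ₂ : ℂ → ℂ := fun x => (q + x) * f₂ x with hφ₂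
    have k0 : κ * u = -X φ₁ φ₂ + X φ₂ φ₁ := by
      rw [hu]
      have r : ∀ {x y : ℂ}, (p + x) * f₁ x - (q + x) * f₂ x = κ * f x →
          (p + y) * f₁ y - (q + y) * f₂ y = κ * f y →
          κ * ((p + x) * f₁ x * f y - (p + y) * f x * f₁ y) = -(φ₁ x * φ₂ y) + φ₂ x * φ₁ y := by
        intro x y h1 h2
        simp only [hφ₁, hφ₂]
        linear_combination (p + y) * f₁ y * h1 - (p + x) * f₁ x * h2
      simp only [hX, sgnSum]
      linear_combination m 0 * r up1 up3 + m 1 * r up1 up4 + m 2 * r up2 up3 + m 3 * r up2 up4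
    have k1 : κ * (P * u₁) = (a ^ 2 - b ^ 2) * X φ₁ φ₁ - (p ^ 2 - b ^ 2) * X φ₁ φ₂
        + (p ^ 2 - a ^ 2) * X φ₂ φ₁ := by
      rw [hu₁]
      have r : ∀ {x y : ℂ}, (p + x) * f₁ x - (q + x) * f₂ x = κ * f x →
          (p + y) * f₁ y - (q + y) * f₂ y = κ * f y →
          κ * ((p + x) * (p + y) * ((p - y) * f₁ x * f y - (p - x) * f x * f₁ y))
          = (x ^ 2 - y ^ 2) * (φ₁ x * φ₁ y) - (p ^ 2 - y ^ 2) * (φ₁ x * φ₂ y)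
            + (p ^ 2 - x ^ 2) * (φ₂ x * φ₁ y) := by
        intro x y h1 h2
        simp only [hφ₁, hφ₂]
        linear_combination (p + x) * (p + y) * (p - x) * f₁ y * h1
          - (p + x) * (p + y) * (p - y) * f₁ x * h2
      simp only [hX, sgnSum]
      linear_combination m 0 * r up1 up3 + m 1 * r up1 up4 + m 2 * r up2 up3 + m 3 * r up2 up4
    have k2 : κ * (Q * u₂) = -(a ^ 2 - b ^ 2) * X φ₂ φ₂ + (q ^ 2 - b ^ 2) * X φ₂ φ₁
        - (q ^ 2 - a ^ 2) * X φ₁ φ₂ := by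
      rw [hu₂]
      have r : ∀ {x y : ℂ}, (p + x) * f₁ x - (q + x) * f₂ x = κ * f x →
          (p + y) * f₁ y - (q + y) * f₂ y = κ * f y →
          κ * ((q + x) * (q + y) * ((q - y) * f₂ x * f y - (q - x) * f x * f₂ y))
          = -(x ^ 2 - y ^ 2) * (φ₂ x * φ₂ y) + (q ^ 2 - y ^ 2) * (φ₂ x * φ₁ y)
            - (q ^ 2 - x ^ 2) * (φ₁ x * φ₂ y) := by
        intro x y h1 h2
        simp only [hφ₁, hφ₂]
        linear_combination (q + x) * (q + y) * (q - x) * f₂ y * h1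
          - (q + x) * (q + y) * (q - y) * f₂ x * h2
      simp only [hX, sgnSum]
      linear_combination m 0 * r up1 up3 + m 1 * r up1 up4 + m 2 * r up2 up3 + m 3 * r up2 up4
    have k3 : κ * (P * Q * u₃) = (q ^ 2 - b ^ 2) * (p ^ 2 - a ^ 2) * X φ₂ φ₁
        - (q ^ 2 - a ^ 2) * (p ^ 2 - b ^ 2) * X φ₁ φ₂ := by
      rw [hu₃]
      have r : ∀ {x y : ℂ}, (p - x) * f₂ x - (q - x) * f₁ x = κ * f₃ x →
          (p - y) * f₂ y - (q - y) * f₁ y = κ * f₃ y →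
          κ * ((p + x) * (p + y) * (q + x) * (q + y) * ((q - y) * f₃ x * f₁ y - (q - x) * f₁ x * f₃ y))
          = (q ^ 2 - y ^ 2) * (p ^ 2 - x ^ 2) * (φ₂ x * φ₁ y)
            - (q ^ 2 - x ^ 2) * (p ^ 2 - y ^ 2) * (φ₁ x * φ₂ y) := by
        intro x y h1 h2
        simp only [hφ₁, hφ₂]
        linear_combination (p + x) * (p + y) * (q + x) * (q + y) *
          (-(q - y) * f₁ y * h1 + (q - x) * f₁ x * h2)
      simp only [hX, sgnSum]
      linear_combination m 0 * r dn1 dn3 + m 1 * r dn1 dn4 + m 2 * r dn2 dn3 + m 3 * r dn2 dn4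
    have da : φ₁ a * φ₂ (-a) - φ₁ (-a) * φ₂ a = -(2 * a * κ) := by
      simp only [hφ₁, hφ₂]
      linear_combination -κ * wa - (p + a) * f₁ a * up2 + (p - a) * f₁ (-a) * up1
    have db : φ₁ b * φ₂ (-b) - φ₁ (-b) * φ₂ b = -(2 * b * κ) := by
      simp only [hφ₁, hφ₂]
      linear_combination -κ * wb - (p + b) * f₁ b * up4 + (p - b) * f₁ (-b) * up3
    have det : X φ₁ φ₁ * X φ₂ φ₂ - X φ₁ φ₂ * X φ₂ φ₁
        = κ ^ 2 * (4 * a * b * (m 0 * m 3 - m 1 * m 2)) := by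
      have : X φ₁ φ₁ * X φ₂ φ₂ - X φ₁ φ₂ * X φ₂ φ₁ = (φ₁ a * φ₂ (-a) - φ₁ (-a) * φ₂ a)
          * (φ₁ b * φ₂ (-b) - φ₁ (-b) * φ₂ b) * (m 0 * m 3 - m 1 * m 2) := by
        simp only [hX, sgnSum]; ring
      rw [this, da, db]; ring
    generalize X φ₁ φ₁ = x11 at *
    generalize X φ₁ φ₂ = x12 at *
    generalize X φ₂ φ₁ = x21 at *
    generalize X φ₂ φ₂ = x22 at *
    generalize m 0 * m 3 - m 1 * m 2 = M at *
    have id1 : P ^ 2 * ((κ * u) * (κ * (Q * u₂))) + (κ * (P * u₁)) * (κ * (P * Q * u₃))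
        - Q ^ 2 * ((κ * u) * (κ * (P * u₁))) - (κ * (Q * u₂)) * (κ * (P * Q * u₃))
        - (p ^ 2 - q ^ 2) * ((κ * (P * u₁)) * (κ * (Q * u₂)) + (κ * u) * (κ * (P * Q * u₃)))
        = (p ^ 2 - q ^ 2) * (a ^ 2 - b ^ 2) ^ 2 * (x11 * x22 - x12 * x21) := by
      rw [k0, k1, k2, k3, hP, hQ]
      ring
    rw [det] at id1
    have hPQ : P * Q ≠ 0 := mul_ne_zero hP0 hQ0
    have hκ2 : κ ^ 2 ≠ 0 := pow_ne_zero 2 hκ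
    rw [div_mul_eq_mul_div, eq_div_iff hPQ]
    refine mul_left_cancel₀ hκ2 ?_
    linear_combination id1

theorem facF_add_e {P : Fin N → ℂ} (h : (D.p j + x) * (D.p j + y) / P j ≠ 0) :
    D.facF P (n + e j) x y = D.facF P n x y * ((D.p j + x) * (D.p j + y) / P j) := by
  unfold facF
  rw [← Finset.mul_prod_erase _ _ (Finset.mem_univ j),
    ← Finset.mul_prod_erase (a := j) _ (fun r => ((D.p r + x) * (D.p r + y) / P r) ^ n r)
      (Finset.mem_univ j)]
  have h1 : ∀ r ∈ Finset.univ.erase j, ((D.p r + x) * (D.p r + y) / P r) ^ (n + e j) r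
      = ((D.p r + x) * (D.p r + y) / P r) ^ n r := by
    intro r hr
    have : r ≠ j := Finset.ne_of_mem_erase hr
    simp [e, this]
  rw [Finset.prod_congr rfl h1]
  simp only [Pi.add_apply, e, Pi.single_eq_same]
  rw [zpow_add_one₀ h]
  ring

theorem facF_mul_neg {P : Fin N → ℂ}
    (h : ∀ r, P r ^ 2 = (D.p r ^ 2 - x ^ 2) * (D.p r ^ 2 - y ^ 2)) (h0 : ∀ r, P r ≠ 0) :
    D.facF P n x y * D.facF P n (-x) (-y) = 1 := by
  unfold facF
  rw [← Finset.prod_mul_distrib]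
  refine Finset.prod_eq_one fun r _ => ?_
  rw [← mul_zpow]
  have : (D.p r + x) * (D.p r + y) / P r * ((D.p r + -x) * (D.p r + -y) / P r) = 1 := by
    have := h0 r
    field_simp
    linear_combination -h r
  rw [this, one_zpow]

theorem uQ3_quad (h : LaxSystem D.p S V Λ c) {P : Fin N → ℂ} (cA cB cC cD : ℂ) (l : Fin N)
    (h0 : n ∈ S ∧ n + e l ∈ S) (h1 : n + e j ∈ S ∧ n + e j + e l ∈ S)
    (h2 : n + e k ∈ S ∧ n + e k + e l ∈ S) (h3 : n + e j + e k ∈ S ∧ n + e j + e k + e l ∈ S)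
    (haV : a ∈ V) (haV' : -a ∈ V) (hbV : b ∈ V) (hbV' : -b ∈ V) (ha : a ≠ 0)
    (hab : a ^ 2 ≠ b ^ 2) (hpa : ∀ r, D.p r ^ 2 ≠ a ^ 2) (hpb : ∀ r, D.p r ^ 2 ≠ b ^ 2)
    (hP : ∀ r, P r ^ 2 = (D.p r ^ 2 - a ^ 2) * (D.p r ^ 2 - b ^ 2)) :
    P j * (D.uQ3 Λ l a b P cA cB cC cD n * D.uQ3 Λ l a b P cA cB cC cD (n + e k)
        + D.uQ3 Λ l a b P cA cB cC cD (n + e j) * D.uQ3 Λ l a b P cA cB cC cD (n + e j + e k))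
      - P k * (D.uQ3 Λ l a b P cA cB cC cD n * D.uQ3 Λ l a b P cA cB cC cD (n + e j)
        + D.uQ3 Λ l a b P cA cB cC cD (n + e k) * D.uQ3 Λ l a b P cA cB cC cD (n + e j + e k))
      - (D.p j ^ 2 - D.p k ^ 2)
        * (D.uQ3 Λ l a b P cA cB cC cD (n + e j) * D.uQ3 Λ l a b P cA cB cC cD (n + e k)
        + D.uQ3 Λ l a b P cA cB cC cD n * D.uQ3 Λ l a b P cA cB cC cD (n + e j + e k))
      = (D.p j ^ 2 - D.p k ^ 2) / (P j * P k)
        * (4 * a * b * (cB * cC * (a - b) ^ 2 - cA * cD * (a + b) ^ 2)) := by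
  have hP0 : ∀ r, P r ≠ 0 := fun r h0 => by
    have := hP r
    rw [h0] at this
    exact mul_ne_zero (sub_ne_zero.2 (hpa r)) (sub_ne_zero.2 (hpb r)) (by rw [← this]; ring)
  have hP' : ∀ r, P r ^ 2 = (D.p r ^ 2 - a ^ 2) * (D.p r ^ 2 - (-b) ^ 2) := fun r => by
    rw [hP r, neg_sq]
  have hV : ∀ {x}, x = a ∨ x = -a ∨ x = b ∨ x = -b → x ∈ V := by
    rintro x (rfl | rfl | rfl | rfl) <;> assumption
  have hne : ∀ {x}, x = a ∨ x = -a ∨ x = b ∨ x = -b → ∀ r, D.p r + x ≠ 0 := by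
    rintro x (rfl | rfl | rfl | rfl) r h
    · exact hpa r (by linear_combination (D.p r - x) * h)
    · exact hpa r (by linear_combination (D.p r + a) * h)
    · exact hpb r (by linear_combination (D.p r - x) * h)
    · exact hpb r (by linear_combination (D.p r + b) * h)
  have hsub : a - b ≠ 0 := fun h => hab (by linear_combination (a + b) * h)
  have hadd : a + b ≠ 0 := fun h => hab (by linear_combination (a - b) * h)
  have hsub' : -a + b ≠ 0 := fun h => hsub (by linear_combination -h)
  have hadd' : -a - b ≠ 0 := fun h => hadd (by linear_combination -h)
  set m : Fin 4 → ℂ := ![cA * D.facF P n a b / (a - b), cB * D.facF P n a (-b) / (a + b),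
    cC * D.facF P n (-a) b / (-a - b), cD * D.facF P n (-a) (-b) / (-a + b)] with hm
  have hmm : ∀ w : ℂ → ℂ → ℂ, sgnSum m a b w = cA * D.facF P n a b * (w a b / (a - b))
      + cB * D.facF P n a (-b) * (w a (-b) / (a - -b))
      + cC * D.facF P n (-a) b * (w (-a) b / (-a - b))
      + cD * D.facF P n (-a) (-b) * (w (-a) (-b) / (-a - -b)) := by
    intro w
    simp only [sgnSum, hm, Matrix.cons_val, sub_neg_eq_add]
    ring
  have hF : ∀ {x y : ℂ} (i : Lattice N) (r : Fin N), x = a ∨ x = -a ∨ x = b ∨ x = -b →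
      y = a ∨ y = -a ∨ y = b ∨ y = -b →
      P r * D.facF P (i + e r) x y = D.facF P i x y * ((D.p r + x) * (D.p r + y)) := by
    intro x y i r hx hy
    rw [facF_add_e (div_ne_zero (mul_ne_zero (hne hx r) (hne hy r)) (hP0 r))]
    have := hP0 r
    field_simp
  have ma : a = a ∨ a = -a ∨ a = b ∨ a = -b := by simp
  have ma' : -a = a ∨ -a = -a ∨ -a = b ∨ -a = -b := by simp
  have mb : b = a ∨ b = -a ∨ b = b ∨ b = -b := by simp
  have mb' : -b = a ∨ -b = -a ∨ -b = b ∨ -b = -b := by simp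
  have det : m 0 * m 3 - m 1 * m 2
      = cB * cC / (a + b) ^ 2 - cA * cD / (a - b) ^ 2 := by
    have f1 := D.facF_mul_neg (n := n) hP hP0
    have f2 := D.facF_mul_neg (n := n) hP' hP0
    rw [neg_neg] at f2
    simp only [hm, Matrix.cons_val]
    have e1 : cA * D.facF P n a b / (a - b) * (cD * D.facF P n (-a) (-b) / (-a + b))
        = cA * cD / ((a - b) * (-a + b)) := by
      rw [div_mul_div_comm]; congr 1; linear_combination cA * cD * f1
    have e2 : cB * D.facF P n a (-b) / (a + b) * (cC * D.facF P n (-a) b / (-a - b))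
        = cB * cC / ((a + b) * (-a - b)) := by
      rw [div_mul_div_comm]; congr 1; linear_combination cB * cC * f2
    rw [e1, e2, show (a - b) * (-a + b) = -(a - b) ^ 2 by ring,
      show (a + b) * (-a - b) = -(a + b) ^ 2 by ring, div_neg, div_neg]
    ring
  have hc : n + e k + e j = n + e j + e k := by abel
  have main := quad_identity (m := m) (p := D.p j) (q := D.p k) (P := P j) (Q := P k)
    (κ := D.p j - D.p k + c (n + e j) - c (n + e k)) (f := Λ n) (f₁ := Λ (n + e j))
    (f₂ := Λ (n + e k)) (f₃ := Λ (n + e j + e k)) (u := D.uQ3 Λ l a b P cA cB cC cD n)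
    (u₁ := D.uQ3 Λ l a b P cA cB cC cD (n + e j)) (u₂ := D.uQ3 Λ l a b P cA cB cC cD (n + e k))
    (u₃ := D.uQ3 Λ l a b P cA cB cC cD (n + e j + e k)) ha (hpa j) (hpa k) (hP0 j) (hP0 k)
    (hP j) (hP k)
    (fun x hx => h.up_up n j k h0.1 h1.1 h2.1 x (hV hx))
    (fun x hx => h.down_down n j k h2.1 h1.1 h3.1 x (hV hx))
    (h.wronskian n j h0.1 h1.1 a haV haV') (h.wronskian n j h0.1 h1.1 b hbV hbV') ?_ ?_ ?_ ?_
  · rw [main, det]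
    field_simp
    ring
  · rw [hmm]
    simp only [uQ3, bigS_eq]
    rw [bigT_eq h h0.1 h0.2 h1.1 haV hbV, bigT_eq h h0.1 h0.2 h1.1 haV hbV',
      bigT_eq h h0.1 h0.2 h1.1 haV' hbV, bigT_eq h h0.1 h0.2 h1.1 haV' hbV']
    rfl
  · rw [hmm]
    simp only [uQ3, bigS_eq]
    rw [bigT_add_e h h0.1 h1.1 h1.2 haV hbV, bigT_add_e h h0.1 h1.1 h1.2 haV hbV',
      bigT_add_e h h0.1 h1.1 h1.2 haV' hbV, bigT_add_e h h0.1 h1.1 h1.2 haV' hbV']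
    have f1 := hF n j ma mb
    have f2 := hF n j ma mb'
    have f3 := hF n j ma' mb
    have f4 := hF n j ma' mb'
    linear_combination (exp := 1) cA * (((D.p j - b) * Λ (n + e j) a * Λ n b
      - (D.p j - a) * Λ n a * Λ (n + e j) b) / (a - b)) * f1
      + cB * (((D.p j - -b) * Λ (n + e j) a * Λ n (-b)
      - (D.p j - a) * Λ n a * Λ (n + e j) (-b)) / (a - -b)) * f2
      + cC * (((D.p j - b) * Λ (n + e j) (-a) * Λ n b
      - (D.p j - -a) * Λ n (-a) * Λ (n + e j) b) / (-a - b)) * f3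
      + cD * (((D.p j - -b) * Λ (n + e j) (-a) * Λ n (-b)
      - (D.p j - -a) * Λ n (-a) * Λ (n + e j) (-b)) / (-a - -b)) * f4
  · rw [hmm]
    simp only [uQ3, bigS_eq]
    rw [bigT_add_e h h0.1 h2.1 h2.2 haV hbV, bigT_add_e h h0.1 h2.1 h2.2 haV hbV',
      bigT_add_e h h0.1 h2.1 h2.2 haV' hbV, bigT_add_e h h0.1 h2.1 h2.2 haV' hbV']
    have f1 := hF n k ma mb
    have f2 := hF n k ma mb'
    have f3 := hF n k ma' mb
    have f4 := hF n k ma' mb'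
    linear_combination (exp := 1) cA * (((D.p k - b) * Λ (n + e k) a * Λ n b
      - (D.p k - a) * Λ n a * Λ (n + e k) b) / (a - b)) * f1
      + cB * (((D.p k - -b) * Λ (n + e k) a * Λ n (-b)
      - (D.p k - a) * Λ n a * Λ (n + e k) (-b)) / (a - -b)) * f2
      + cC * (((D.p k - b) * Λ (n + e k) (-a) * Λ n b
      - (D.p k - -a) * Λ n (-a) * Λ (n + e k) b) / (-a - b)) * f3
      + cD * (((D.p k - -b) * Λ (n + e k) (-a) * Λ n (-b)
      - (D.p k - -a) * Λ n (-a) * Λ (n + e k) (-b)) / (-a - -b)) * f4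
  · rw [hmm]
    simp only [uQ3, bigS_eq]
    rw [bigT_add_e h h1.1 h3.1 h3.2 haV hbV, bigT_add_e h h1.1 h3.1 h3.2 haV hbV',
      bigT_add_e h h1.1 h3.1 h3.2 haV' hbV, bigT_add_e h h1.1 h3.1 h3.2 haV' hbV']
    have hFF : ∀ {x y : ℂ}, x = a ∨ x = -a ∨ x = b ∨ x = -b → y = a ∨ y = -a ∨ y = b ∨ y = -b →
        P j * P k * D.facF P (n + e j + e k) x y
          = D.facF P n x y * ((D.p j + x) * (D.p j + y) * (D.p k + x) * (D.p k + y)) := by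
      intro x y hx hy
      linear_combination P j * hF (n + e j) k hx hy + (D.p k + x) * (D.p k + y) * hF n j hx hy
    have f1 := hFF ma mb
    have f2 := hFF ma mb'
    have f3 := hFF ma' mb
    have f4 := hFF ma' mb'
    linear_combination (exp := 1) cA * (((D.p k - b) * Λ (n + e j + e k) a * Λ (n + e j) b
      - (D.p k - a) * Λ (n + e j) a * Λ (n + e j + e k) b) / (a - b)) * f1
      + cB * (((D.p k - -b) * Λ (n + e j + e k) a * Λ (n + e j) (-b)
      - (D.p k - a) * Λ (n + e j) a * Λ (n + e j + e k) (-b)) / (a - -b)) * f2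
      + cC * (((D.p k - b) * Λ (n + e j + e k) (-a) * Λ (n + e j) b
      - (D.p k - -a) * Λ (n + e j) (-a) * Λ (n + e j + e k) b) / (-a - b)) * f3
      + cD * (((D.p k - -b) * Λ (n + e j + e k) (-a) * Λ (n + e j) (-b)
      - (D.p k - -a) * Λ (n + e j) (-a) * Λ (n + e j + e k) (-b)) / (-a - -b)) * f4

end InitialData

/-! ### `Q2` as a limit of `Q3` -/

theorem tendsto_of_sub_one_div {g : ℂ → ℂ} {γ : ℂ}
    (h : Tendsto (fun ε => (g ε - 1) / ε) (𝓝[≠] 0) (𝓝 γ)) : Tendsto g (𝓝[≠] 0) (𝓝 1) := by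
  have h1 := (tendsto_nhdsWithin_of_tendsto_nhds (s := {(0 : ℂ)}ᶜ) tendsto_id).mul h
  have h2 := h1.const_add 1
  simp only [id, zero_mul, add_zero] at h2
  refine h2.congr' ?_
  filter_upwards [self_mem_nhdsWithin] with ε hε
  have : ε ≠ 0 := hε
  field_simp
  ring

theorem tendsto_zpow_sub_one_div {g : ℂ → ℂ} {γ : ℂ} (m : ℤ)
    (h : Tendsto (fun ε => (g ε - 1) / ε) (𝓝[≠] 0) (𝓝 γ)) :
    Tendsto (fun ε => (g ε ^ m - 1) / ε) (𝓝[≠] 0) (𝓝 (m * γ)) := by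
  have hd : HasDerivAt (fun z : ℂ => z ^ m) m 1 := by
    simpa using hasDerivAt_zpow m (1 : ℂ) (Or.inl one_ne_zero)
  have hc : ContinuousAt (dslope (fun z : ℂ => z ^ m) 1) 1 :=
    continuousAt_dslope_same.2 hd.differentiableAt
  have h1 := (hc.tendsto.comp (tendsto_of_sub_one_div h)).mul h
  rw [dslope_same, hd.deriv] at h1
  refine h1.congr fun ε => ?_
  have := sub_smul_dslope (fun z : ℂ => z ^ m) 1 (g ε)
  simp only [one_zpow, smul_eq_mul] at this
  rw [← this]
  simp only [Function.comp]
  ring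

theorem tendsto_prod_sub_one_div {ι : Type*} (s : Finset ι) {g : ι → ℂ → ℂ} {γ : ι → ℂ}
    (h : ∀ r ∈ s, Tendsto (fun ε => (g r ε - 1) / ε) (𝓝[≠] 0) (𝓝 (γ r))) :
    Tendsto (fun ε => (∏ r ∈ s, g r ε - 1) / ε) (𝓝[≠] 0) (𝓝 (∑ r ∈ s, γ r)) := by
  classical
  induction s using Finset.induction_on with
  | empty => simp
  | insert r s hr ih =>
    have h1 := h r (Finset.mem_insert_self r s)
    have h2 := ih fun r' hr' => h r' (Finset.mem_insert_of_mem hr')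
    have h3 := (h1.mul (tendsto_of_sub_one_div h2)).add h2
    rw [mul_one] at h3
    rw [Finset.sum_insert hr]
    refine h3.congr fun ε => ?_
    rw [Finset.prod_insert hr]
    ring

theorem tendsto_diff_quot {f : ℂ → ℂ} {f' y : ℂ} (hf : HasDerivAt f f' y) (c : ℂ) :
    Tendsto (fun ε => (f (y + c * ε) - f y) / ε) (𝓝[≠] 0) (𝓝 (c * f')) := by
  have h1 : HasDerivAt (fun ε : ℂ => y + c * ε) c 0 := by
    simpa using ((hasDerivAt_id (0 : ℂ)).const_mul c).const_add y
  have h2 : HasDerivAt (fun ε : ℂ => f (y + c * ε)) (f' * c) 0 :=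
    HasDerivAt.comp (0 : ℂ) (by simpa using hf) h1
  have h3 := hasDerivAt_iff_tendsto_slope_zero.1 h2
  rw [mul_comm]
  refine h3.congr fun ε => ?_
  simp only [zero_add, mul_zero, add_zero, smul_eq_mul]
  ring

namespace InitialData

variable {N : ℕ} {D : InitialData N} {Λ : Lattice N → ℂ → ℂ} {S : Set (Lattice N)} {V : Set ℂ}
  {c : Lattice N → ℂ} {n : Lattice N} {j k l : Fin N} {a : ℂ}

/-- The parameters `(p_r, P_r)` for `b = a (1 - 2 ε)`, as `ε → 0`. -/
def Q2Branch (D : InitialData N) (a : ℂ) (P : ℂ → Fin N → ℂ) : Prop :=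
  ∀ r, (∀ᶠ ε in 𝓝[≠] 0, P ε r ^ 2
      = (D.p r ^ 2 - a ^ 2) * (D.p r ^ 2 - (a * (1 - 2 * ε)) ^ 2)) ∧
    Tendsto (fun ε => P ε r) (𝓝[≠] 0) (𝓝 (D.p r ^ 2 - a ^ 2))

theorem tendsto_b (a : ℂ) : Tendsto (fun ε : ℂ => a * (1 - 2 * ε)) (𝓝[≠] 0) (𝓝 a) := by
  have : Continuous fun ε : ℂ => a * (1 - 2 * ε) := by fun_prop
  simpa using (this.tendsto 0).mono_left nhdsWithin_le_nhds

theorem exists_Q2Branch (hpa : ∀ r, D.p r ^ 2 ≠ a ^ 2) : ∃ P, D.Q2Branch a P := by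
  refine ⟨fun ε r => (D.p r ^ 2 - a ^ 2) *
    ((D.p r ^ 2 - (a * (1 - 2 * ε)) ^ 2) / (D.p r ^ 2 - a ^ 2)) ^ (((2 : ℕ) : ℂ)⁻¹), fun r => ⟨?_, ?_⟩⟩
  · refine Eventually.of_forall fun ε => ?_
    have := sub_ne_zero.2 (hpa r)
    rw [mul_pow, Complex.cpow_nat_inv_pow _ two_ne_zero]
    field_simp
  · have h0 := sub_ne_zero.2 (hpa r)
    have h1 : Tendsto (fun ε : ℂ => (D.p r ^ 2 - (a * (1 - 2 * ε)) ^ 2) / (D.p r ^ 2 - a ^ 2))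
        (𝓝[≠] 0) (𝓝 1) := by
      have := (((tendsto_b a).pow 2).const_sub (D.p r ^ 2)).div_const (D.p r ^ 2 - a ^ 2)
      rwa [div_self h0] at this
    have h2 : ContinuousAt (fun z : ℂ => z ^ (((2 : ℕ) : ℂ)⁻¹)) 1 :=
      continuousAt_cpow_const Complex.one_mem_slitPlane
    have h3 := (h2.tendsto.comp h1).const_mul (D.p r ^ 2 - a ^ 2)
    simpa using h3

theorem Q2Branch.tendsto_facF {P : ℂ → Fin N → ℂ} (hP : D.Q2Branch a P)
    (hpa : ∀ r, D.p r ^ 2 ≠ a ^ 2) (n : Lattice N) :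
    Tendsto (fun ε => D.facF (P ε) n a (a * (1 - 2 * ε))) (𝓝[≠] 0) (𝓝 (D.rho n a)) := by
  unfold facF rho
  refine tendsto_finsetProd _ fun r _ => ?_
  have h0 := sub_ne_zero.2 (hpa r)
  have h1 : D.p r + a ≠ 0 := fun h => hpa r (by linear_combination (D.p r - a) * h)
  have h2 : D.p r - a ≠ 0 := fun h => hpa r (by linear_combination (D.p r + a) * h)
  have h3 := (((tendsto_b a).const_add (D.p r)).const_mul (D.p r + a)).div (hP r).2 h0
  have e1 : (D.p r + a) * (D.p r + a) / (D.p r ^ 2 - a ^ 2) = (D.p r + a) / (D.p r - a) := by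
    rw [div_eq_div_iff h0 h2]; ring
  rw [e1] at h3
  exact h3.zpow₀ _ (Or.inl (div_ne_zero h1 h2))

theorem Q2Branch.tendsto_facF_neg {P : ℂ → Fin N → ℂ} (hP : D.Q2Branch a P)
    (hpa : ∀ r, D.p r ^ 2 ≠ a ^ 2) (n : Lattice N) :
    Tendsto (fun ε => D.facF (P ε) n (-a) (-(a * (1 - 2 * ε)))) (𝓝[≠] 0) (𝓝 (D.rho n (-a))) := by
  have hP' : D.Q2Branch (-a) P := fun r => by simpa only [neg_mul, neg_sq] using hP r
  simpa only [neg_mul] using hP'.tendsto_facF (by simpa using hpa) n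

theorem Q2Branch.tendsto_facF_mixed {P : ℂ → Fin N → ℂ} (hP : D.Q2Branch a P)
    (hpa : ∀ r, D.p r ^ 2 ≠ a ^ 2) (n : Lattice N) :
    Tendsto (fun ε => (D.facF (P ε) n a (-(a * (1 - 2 * ε))) - 1) / ε) (𝓝[≠] 0)
      (𝓝 (-D.xi a n)) := by
  have key : ∀ r, Tendsto (fun ε => ((D.p r + a) * (D.p r + -(a * (1 - 2 * ε))) / P ε r - 1) / ε)
      (𝓝[≠] 0) (𝓝 (2 * a * D.p r / (D.p r ^ 2 - a ^ 2))) := by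
    intro r
    have h0 := sub_ne_zero.2 (hpa r)
    have h1 : D.p r + a ≠ 0 := fun h => hpa r (by linear_combination (D.p r - a) * h)
    have h2 : D.p r - a ≠ 0 := fun h => hpa r (by linear_combination (D.p r + a) * h)
    have hb := tendsto_b a
    have l1 : Tendsto (fun ε => (D.p r + a) * (D.p r + -(a * (1 - 2 * ε))) / P ε r) (𝓝[≠] 0)
        (𝓝 ((D.p r + a) * (D.p r + -a) / (D.p r ^ 2 - a ^ 2))) :=
      ((hb.neg.const_add (D.p r)).const_mul (D.p r + a)).div (hP r).2 h0
    have e1 : (D.p r + a) * (D.p r + -a) / (D.p r ^ 2 - a ^ 2) = 1 := by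
      rw [div_eq_one_iff_eq h0]; ring
    rw [e1] at l1
    have l2 : Tendsto (fun ε => 4 * D.p r * a / ((D.p r - a) * (D.p r + a * (1 - 2 * ε)))
        / ((D.p r + a) * (D.p r + -(a * (1 - 2 * ε))) / P ε r + 1)) (𝓝[≠] 0)
        (𝓝 (4 * D.p r * a / ((D.p r - a) * (D.p r + a)) / (1 + 1))) :=
      (tendsto_const_nhds.div ((hb.const_add (D.p r)).const_mul (D.p r - a))
        (mul_ne_zero h2 h1)).div (l1.add_const 1) (by norm_num)
    have e2 : 4 * D.p r * a / ((D.p r - a) * (D.p r + a)) / (1 + 1)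
        = 2 * a * D.p r / (D.p r ^ 2 - a ^ 2) := by
      rw [show D.p r ^ 2 - a ^ 2 = (D.p r - a) * (D.p r + a) by ring]
      field_simp
      ring
    rw [e2] at l2
    refine l2.congr' ?_
    filter_upwards [self_mem_nhdsWithin, (hP r).1, (hP r).2.eventually_ne h0,
      (hb.const_add (D.p r)).eventually_ne h1,
      (l1.add_const 1).eventually_ne (by norm_num : (1 : ℂ) + 1 ≠ 0)] with ε hε hsq hPne hpb hg
    have hε : ε ≠ 0 := hε
    have hg2 : ((D.p r + a) * (D.p r + -(a * (1 - 2 * ε))) / P ε r) ^ 2 - 1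
        = 4 * D.p r * a * ε / ((D.p r - a) * (D.p r + a * (1 - 2 * ε))) := by
      rw [div_pow, hsq, eq_div_iff (mul_ne_zero h2 hpb), sub_mul, div_mul_eq_mul_div, sub_eq_iff_eq_add,
        div_eq_iff (by rw [← hsq]; exact pow_ne_zero 2 hPne)]
      ring
    generalize (D.p r + a) * (D.p r + -(a * (1 - 2 * ε))) / P ε r = g at *
    rw [div_eq_div_iff hg hε, div_mul_eq_mul_div, ← hg2]
    ring
  have := tendsto_prod_sub_one_div Finset.univ fun r _ => tendsto_zpow_sub_one_div (n r) (key r)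
  have e3 : -D.xi a n = ∑ r, (n r : ℂ) * (2 * a * D.p r / (D.p r ^ 2 - a ^ 2)) := by
    unfold xi
    rw [Finset.mul_sum, ← Finset.sum_neg_distrib]
    refine Finset.sum_congr rfl fun r _ => ?_
    rw [show D.p r ^ 2 - a ^ 2 = -(a ^ 2 - D.p r ^ 2) by ring, div_neg]
    ring
  rw [e3]
  exact this

theorem tendsto_uQ3_uQ2 (h : LaxSystem D.p S V Λ c) (h0 : n ∈ S) (h1 : n + e l ∈ S)
    (ha : a ≠ 0) (haV : a ∈ V) (haV' : -a ∈ V) (hpa : ∀ r, D.p r ^ 2 ≠ a ^ 2)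
    {P : ℂ → Fin N → ℂ} (hP : D.Q2Branch a P) (cA cD ξ₀ : ℂ) {δ : ℂ} (hδ : δ ≠ 0) :
    Tendsto (fun ε : ℂ =>
      ((δ / (4 * a ^ 2))⁻¹ * D.uQ3 Λ l a (a * (1 - 2 * ε)) (P ε)
        (δ / (4 * a ^ 2) * (cA * ε))
        (δ / (8 * a ^ 2) * (1 / ε + 1 - ξ₀ + ((3 + ξ₀ ^ 2) / 2 + 2 * cA * cD) * ε))
        (δ / (8 * a ^ 2) * (1 / ε + 1 + ξ₀ + ((3 + ξ₀ ^ 2) / 2 + 2 * cA * cD) * ε))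
        (δ / (4 * a ^ 2) * (cD * ε)) n - 1 / ε - 1 - ε) / (2 * ε))
      (𝓝[≠] 0) (𝓝 (D.uQ2 Λ l a cA cD ξ₀ n)) := by
  set b : ℂ → ℂ := fun ε => a * (1 - 2 * ε) with hb
  set T := D.bigT Λ l n with hT
  set g := (3 + ξ₀ ^ 2) / 2 + 2 * cA * cD with hg
  have hbl : Tendsto b (𝓝[≠] 0) (𝓝 a) := tendsto_b a
  have hid : Tendsto (fun ε : ℂ => ε) (𝓝[≠] 0) (𝓝 0) := tendsto_nhdsWithin_of_tendsto_nhds tendsto_id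
  have ev0 : ∀ᶠ ε : ℂ in 𝓝[≠] 0, ε ≠ 0 := self_mem_nhdsWithin
  have ev1 : ∀ᶠ ε : ℂ in 𝓝[≠] 0, 1 - ε ≠ 0 :=
    (hid.const_sub 1).eventually_ne (by norm_num)
  have evb : ∀ᶠ ε in 𝓝[≠] 0, b ε ∈ V := hbl.eventually (h.isOpen.mem_nhds haV)
  have evb' : ∀ᶠ ε in 𝓝[≠] 0, -b ε ∈ V := hbl.neg.eventually (h.isOpen.mem_nhds haV')
  have eb : ∀ ε, b ε = a + -2 * a * ε := fun ε => by simp only [hb]; ring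
  have eb' : ∀ ε, -b ε = -a + 2 * a * ε := fun ε => by simp only [hb]; ring
  have Tdiff : ∀ {y : ℂ}, y ∈ V → ∀ x, HasDerivAt (T x) (deriv (T x) y) y := fun hy x => by
    have := deriv_bigT h h0 h1 hy x
    rw [hT, this.deriv]; exact this
  have T0 : ∀ x, T x x = 0 := fun x => by simp only [hT, bigT]; ring
  -- the diagonal terms
  have lA : Tendsto (fun ε => T a (b ε) / (a - b ε)) (𝓝[≠] 0)
      (𝓝 (1 - 2 * a * D.smallS Λ l n a a)) := by
    have := (tendsto_diff_quot (Tdiff haV a) (-2 * a)).div_const (2 * a)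
    convert this.congr' ?_ using 2
    · rw [smallS_eq h h0 h1 haV]; field_simp; ring
    · filter_upwards [ev0] with ε hε
      rw [T0, ← eb, show a - b ε = 2 * a * ε by rw [eb]; ring]
      field_simp; ring
  have lD : Tendsto (fun ε => T (-a) (-b ε) / (-a - -b ε)) (𝓝[≠] 0)
      (𝓝 (1 + 2 * a * D.smallS Λ l n (-a) (-a))) := by
    have := (tendsto_diff_quot (Tdiff haV' (-a)) (2 * a)).div_const (-2 * a)
    convert this.congr' ?_ using 2
    · rw [smallS_eq h h0 h1 haV']; field_simp; ring
    · filter_upwards [ev0] with ε hε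
      rw [T0, ← eb', show -a - -b ε = -2 * a * ε by rw [eb]; ring]
      field_simp; ring
  -- the mixed terms
  set t₁ : ℂ → ℂ := fun ε => T a (-b ε) / (a - -b ε) with ht₁
  set t₂ : ℂ → ℂ := fun ε => T (-a) (b ε) / (-a - b ε) with ht₂
  have ls : Tendsto (fun ε => (t₂ ε - 1) / ε) (𝓝[≠] 0) (𝓝 (2 * a * D.smallS Λ l n (-a) a)) := by
    have h3 := tendsto_diff_quot (Tdiff haV (-a)) (-2 * a)
    have h4 := (h3.const_sub (2 * a)).div ((hid.const_sub 1).const_mul (2 * a))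
      (by simpa using ha)
    convert h4.congr' ?_ using 2
    · rw [smallS_eq h h0 h1 haV, sub_zero]; field_simp; ring
    · filter_upwards [ev0, ev1] with ε hε h1ε
      have e1 : T (-a) a = -(2 * a) := by
        have := bigT_self_neg h h0 h1 haV haV'
        rw [hT, bigT_swap, this]
      simp only [ht₂, Pi.div_apply]
      rw [e1, ← eb, show -a - b ε = -(2 * a * (1 - ε)) by rw [eb]; ring]
      field_simp
      ring
  have lν : Tendsto (fun ε => (t₁ ε + t₂ ε - 2) / ε ^ 2) (𝓝[≠] 0)
      (𝓝 (4 * a ^ 2 * D.bigZ Λ l n a)) := by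
    set α : ℂ → ℂ := fun x => (D.p l + x) * Λ (n + e l) x with hα
    have dβ : ∀ {x}, x ∈ V → HasDerivAt (Λ n) (deriv (Λ n) x) x := fun hx =>
      ((h.diff n h0).differentiableAt (h.isOpen.mem_nhds hx)).hasDerivAt
    have dα : ∀ {x}, x ∈ V →
        HasDerivAt α (1 * Λ (n + e l) x + (D.p l + x) * deriv (Λ (n + e l)) x) x := fun {x} hx =>
      ((hasDerivAt_id x).const_add (D.p l)).mul
        (((h.diff _ h1).differentiableAt (h.isOpen.mem_nhds hx)).hasDerivAt)
    have h3 := (((tendsto_diff_quot (dα haV) (-2 * a)).mul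
      (tendsto_diff_quot (dβ haV') (2 * a))).sub
      ((tendsto_diff_quot (dβ haV) (-2 * a)).mul (tendsto_diff_quot (dα haV') (2 * a)))).neg.div
      ((hid.const_sub 1).const_mul (2 * a)) (by simpa using ha)
    convert h3.congr' ?_ using 2
    · rw [bigZ, sub_zero]
      field_simp
      ring
    · filter_upwards [ev0, ev1, evb, evb'] with ε hε h1ε hbV hbV'
      have e1 : T a (-a) = 2 * a := bigT_self_neg h h0 h1 haV haV'
      have e2 : T (b ε) (-b ε) = 2 * b ε := bigT_self_neg h h0 h1 hbV hbV'
      have e3 : ∀ x y, T x y = α x * Λ n y - Λ n x * α y := fun x y => by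
        simp only [hT, bigT, hα]; ring
      simp only [Pi.div_apply, ht₁, ht₂]
      rw [← eb, ← eb', show -a - b ε = -(2 * a * (1 - ε)) by rw [eb]; ring,
        show a - -b ε = 2 * a * (1 - ε) by rw [eb']; ring]
      rw [e3] at e1 e2 ⊢
      rw [e3]
      have e4 : b ε = a - 2 * a * ε := by rw [eb]; ring
      field_simp
      linear_combination -e1 - e2 - 2 * e4
  set s : ℂ → ℂ := fun ε => (t₂ ε - 1) / ε with hs
  set ν : ℂ → ℂ := fun ε => (t₁ ε + t₂ ε - 2) / ε ^ 2 with hν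
  set F : ℂ → ℂ := fun ε => D.facF (P ε) n a (-b ε) with hF
  set f : ℂ → ℂ := fun ε => (F ε - 1) / ε with hf
  have lf : Tendsto f (𝓝[≠] 0) (𝓝 (-D.xi a n)) := hP.tendsto_facF_mixed hpa n
  have lF : Tendsto F (𝓝[≠] 0) (𝓝 1) := tendsto_of_sub_one_div lf
  have lh : Tendsto (fun ε => (F ε)⁻¹) (𝓝[≠] 0) (𝓝 1) := by
    simpa using lF.inv₀ one_ne_zero
  have lA1 := ((lν.sub (lf.mul ls)).add ((hid.mul lf).mul lν))
  have lA2 := ((((lf.pow 2).mul lh).sub (lf.mul ls)).add ((hid.mul ls).mul ((lf.pow 2).mul lh)))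
  have lm : Tendsto (fun ε => 1 + ε + g * ε ^ 2) (𝓝[≠] 0) (𝓝 (1 + 0 + g * 0 ^ 2)) :=
    (hid.const_add 1).add ((hid.pow 2).const_mul g)
  have main := (((((lm.mul (lA1.add lA2)).const_mul (1 / 4)).const_add ((g - 1) / 2)).sub
    ((lf.sub ls).const_mul (ξ₀ / 2))).sub ((hid.mul (lA1.sub lA2)).const_mul (ξ₀ / 4))).add
    (((((hP.tendsto_facF hpa n).mul lA).const_mul (cA / 2)).add
    (((hP.tendsto_facF_neg hpa n).mul lD).const_mul (cD / 2))))
  convert main.congr' ?_ using 2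
  · rw [uQ2, hg]; ring
  · filter_upwards [ev0, lF.eventually_ne one_ne_zero,
      (eventually_all.2 fun r => (hP r).1 : ∀ᶠ ε in 𝓝[≠] 0, ∀ r, P ε r ^ 2
        = (D.p r ^ 2 - a ^ 2) * (D.p r ^ 2 - (a * (1 - 2 * ε)) ^ 2)),
      (eventually_all.2 fun r => (hP r).2.eventually_ne (sub_ne_zero.2 (hpa r)) :
        ∀ᶠ ε in 𝓝[≠] 0, ∀ r, P ε r ≠ 0)] with ε hε hFne hsq hPne
    have hFinv : D.facF (P ε) n (-a) (b ε) = (F ε)⁻¹ := by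
      have := D.facF_mul_neg (n := n) (x := a) (y := -b ε) (P := P ε)
        (fun r => by rw [hsq r, neg_sq]) hPne
      rw [neg_neg] at this
      exact (inv_eq_of_mul_eq_one_right this).symm
    have r1 : t₂ ε = 1 + ε * s ε := by simp only [hs]; field_simp; ring
    have r2 : t₁ ε = 1 - ε * s ε + ε ^ 2 * ν ε := by simp only [hs, hν]; field_simp; ring
    have r3 : F ε = 1 + ε * f ε := by simp only [hf]; field_simp; ring
    have r4 : (F ε)⁻¹ = 1 - ε * f ε + ε ^ 2 * f ε ^ 2 * (F ε)⁻¹ := by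
      have : F ε * (F ε)⁻¹ = 1 := mul_inv_cancel₀ hFne
      rw [r3] at this ⊢
      linear_combination (1 - ε * f ε) * this
    have e1 : D.uQ3 Λ l a (b ε) (P ε) (δ / (4 * a ^ 2) * (cA * ε))
        (δ / (8 * a ^ 2) * (1 / ε + 1 - ξ₀ + g * ε)) (δ / (8 * a ^ 2) * (1 / ε + 1 + ξ₀ + g * ε))
        (δ / (4 * a ^ 2) * (cD * ε)) n = δ / (4 * a ^ 2) * (
          cA * ε * (D.facF (P ε) n a (b ε) * (T a (b ε) / (a - b ε)))
          + 1 / 2 * (1 / ε + 1 - ξ₀ + g * ε) * (F ε * t₁ ε)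
          + 1 / 2 * (1 / ε + 1 + ξ₀ + g * ε) * ((F ε)⁻¹ * t₂ ε)
          + cD * ε * (D.facF (P ε) n (-a) (-b ε) * (T (-a) (-b ε) / (-a - -b ε)))) := by
      simp only [uQ3, bigS_eq, hFinv, ht₁, ht₂, hF, hT]
      ring
    rw [e1, inv_mul_cancel_left₀ (div_ne_zero hδ (mul_ne_zero (by norm_num) (pow_ne_zero 2 ha)))]
    have e2 : F ε * t₁ ε = 1 + ε * (f ε - s ε) + ε ^ 2 * (ν ε - f ε * s ε + ε * f ε * ν ε) := by
      rw [r2, r3]; ring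
    have e3 : (F ε)⁻¹ * t₂ ε = 1 + ε * (s ε - f ε)
        + ε ^ 2 * (f ε ^ 2 * (F ε)⁻¹ - f ε * s ε + ε * s ε * (f ε ^ 2 * (F ε)⁻¹)) := by
      rw [r1]
      linear_combination (1 + ε * s ε) * r4
    rw [e2, e3]
    field_simp
    ring

/-! ### `Q2` -/

/-- The value at a corner, as a function of `ε`, in the passage from `Q3` to `Q2`. -/
def approxQ2 (D : InitialData N) (Λ : Lattice N → ℂ → ℂ) (l : Fin N) (a cA cD ξ₀ : ℂ)
    (P : ℂ → Fin N → ℂ) (n : Lattice N) (ε : ℂ) : ℂ :=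
  ((1 / (4 * a ^ 2))⁻¹ * D.uQ3 Λ l a (a * (1 - 2 * ε)) (P ε)
    (1 / (4 * a ^ 2) * (cA * ε))
    (1 / (8 * a ^ 2) * (1 / ε + 1 - ξ₀ + ((3 + ξ₀ ^ 2) / 2 + 2 * cA * cD) * ε))
    (1 / (8 * a ^ 2) * (1 / ε + 1 + ξ₀ + ((3 + ξ₀ ^ 2) / 2 + 2 * cA * cD) * ε))
    (1 / (4 * a ^ 2) * (cD * ε)) n - 1 / ε - 1 - ε) / (2 * ε)

theorem quad_Q2_rescale {a x y A B C T U U₁ U₂ U₃ : ℂ} (ha : a ≠ 0) (hx : x ≠ 0) (hy : y ≠ 0)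
    (hA : A ≠ 0) (hB : B ≠ 0)
    (hq : a ^ 2 * A / x * (1 / (4 * a ^ 2) * U * (1 / (4 * a ^ 2) * U₂)
        + 1 / (4 * a ^ 2) * U₁ * (1 / (4 * a ^ 2) * U₃))
      - a ^ 2 * B / y * (1 / (4 * a ^ 2) * U * (1 / (4 * a ^ 2) * U₁)
        + 1 / (4 * a ^ 2) * U₂ * (1 / (4 * a ^ 2) * U₃))
      - a ^ 2 * (y - x) * C / (x * y) * (1 / (4 * a ^ 2) * U₁ * (1 / (4 * a ^ 2) * U₂)
        + 1 / (4 * a ^ 2) * U * (1 / (4 * a ^ 2) * U₃))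
      = a ^ 2 * (y - x) * C / (x * y) / (a ^ 2 * A / x * (a ^ 2 * B / y)) * (1 / 4 * T)) :
    (y * A * (U * U₂ + U₁ * U₃) - x * B * (U * U₁ + U₂ * U₃)
      - (y - x) * C * (U₁ * U₂ + U * U₃)) * (A * B) = 4 * x * y * (y - x) * (C * T) := by
  have e1 : a ^ 2 * A / x * (1 / (4 * a ^ 2) * U * (1 / (4 * a ^ 2) * U₂)
        + 1 / (4 * a ^ 2) * U₁ * (1 / (4 * a ^ 2) * U₃))
      - a ^ 2 * B / y * (1 / (4 * a ^ 2) * U * (1 / (4 * a ^ 2) * U₁)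
        + 1 / (4 * a ^ 2) * U₂ * (1 / (4 * a ^ 2) * U₃))
      - a ^ 2 * (y - x) * C / (x * y) * (1 / (4 * a ^ 2) * U₁ * (1 / (4 * a ^ 2) * U₂)
        + 1 / (4 * a ^ 2) * U * (1 / (4 * a ^ 2) * U₃))
      = 1 / (16 * a ^ 2 * x * y) * (y * A * (U * U₂ + U₁ * U₃) - x * B * (U * U₁ + U₂ * U₃)
      - (y - x) * C * (U₁ * U₂ + U * U₃)) := by
    field_simp
    ring
  have e2 : a ^ 2 * (y - x) * C / (x * y) / (a ^ 2 * A / x * (a ^ 2 * B / y)) * (1 / 4 * T)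
      = 1 / (16 * a ^ 2 * x * y) * (4 * x * y * (y - x) * (C * T) / (A * B)) := by
    field_simp
    ring
  rw [e1, e2] at hq
  rw [mul_left_cancel₀ (by simp [ha, hx, hy]) hq, div_mul_cancel₀ _ (mul_ne_zero hA hB)]

/-- The equation satisfied by `(U - k) / (2 ε)` if `U / (4 a²)` solves `Q3`, with the singular
terms removed. -/
theorem quad_Q2_aux {a ε x y v v₁ v₂ v₃ T G : ℂ} (ha : a ≠ 0) (hε : ε ≠ 0) (hx : x ≠ 0)
    (hy : y ≠ 0)
    (h1 : 1 - ε ^ 2 * (1 - ε) ^ 2 * x * x ≠ 0) (h2 : 1 - ε ^ 2 * (1 - ε) ^ 2 * y * y ≠ 0)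
    (hG : ε ^ 2 * (G * ((1 - ε ^ 2 * (1 - ε) ^ 2 * x * x) * (1 - ε ^ 2 * (1 - ε) ^ 2 * y * y)))
      = (1 - ε ^ 2 * (1 - ε) ^ 2 * x * y) * T - (1 - ε ^ 3) ^ 2
        * ((1 - ε ^ 2 * (1 - ε) ^ 2 * x * x) * (1 - ε ^ 2 * (1 - ε) ^ 2 * y * y)))
    (hq : a ^ 2 * (1 - ε ^ 2 * (1 - ε) ^ 2 * x * x) / x
        * (1 / (4 * a ^ 2) * ((1 + ε + ε ^ 2) / ε + 2 * ε * v)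
          * (1 / (4 * a ^ 2) * ((1 + ε + ε ^ 2) / ε + 2 * ε * v₂))
        + 1 / (4 * a ^ 2) * ((1 + ε + ε ^ 2) / ε + 2 * ε * v₁)
          * (1 / (4 * a ^ 2) * ((1 + ε + ε ^ 2) / ε + 2 * ε * v₃)))
      - a ^ 2 * (1 - ε ^ 2 * (1 - ε) ^ 2 * y * y) / y
        * (1 / (4 * a ^ 2) * ((1 + ε + ε ^ 2) / ε + 2 * ε * v)
          * (1 / (4 * a ^ 2) * ((1 + ε + ε ^ 2) / ε + 2 * ε * v₁))
        + 1 / (4 * a ^ 2) * ((1 + ε + ε ^ 2) / ε + 2 * ε * v₂)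
          * (1 / (4 * a ^ 2) * ((1 + ε + ε ^ 2) / ε + 2 * ε * v₃)))
      - a ^ 2 * (y - x) * (1 - ε ^ 2 * (1 - ε) ^ 2 * x * y) / (x * y)
        * (1 / (4 * a ^ 2) * ((1 + ε + ε ^ 2) / ε + 2 * ε * v₁)
          * (1 / (4 * a ^ 2) * ((1 + ε + ε ^ 2) / ε + 2 * ε * v₂))
        + 1 / (4 * a ^ 2) * ((1 + ε + ε ^ 2) / ε + 2 * ε * v)
          * (1 / (4 * a ^ 2) * ((1 + ε + ε ^ 2) / ε + 2 * ε * v₃)))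
      = a ^ 2 * (y - x) * (1 - ε ^ 2 * (1 - ε) ^ 2 * x * y) / (x * y)
        / (a ^ 2 * (1 - ε ^ 2 * (1 - ε) ^ 2 * x * x) / x
          * (a ^ 2 * (1 - ε ^ 2 * (1 - ε) ^ 2 * y * y) / y)) * (1 / 4 * T)) :
    y * (1 - ε ^ 2 * (1 - ε) ^ 2 * x * x) * (v * v₂ + v₁ * v₃)
      - x * (1 - ε ^ 2 * (1 - ε) ^ 2 * y * y) * (v * v₁ + v₂ * v₃)
      - (y - x) * (1 - ε ^ 2 * (1 - ε) ^ 2 * x * y) * (v₁ * v₂ + v * v₃)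
      - x * y * (x - y) * ((1 - ε) * (1 - ε ^ 3)) * (v + v₁ + v₂ + v₃)
      + x * y * (x - y) * G = 0 := by
  have h3 := quad_Q2_rescale ha hx hy h1 h2 hq
  have hk : ε * ((1 + ε + ε ^ 2) / ε) = 1 + ε + ε ^ 2 := mul_div_cancel₀ _ hε
  generalize (1 + ε + ε ^ 2) / ε = k at *
  set A := 1 - ε ^ 2 * (1 - ε) ^ 2 * x * x with hA
  set B := 1 - ε ^ 2 * (1 - ε) ^ 2 * y * y with hB
  set C := 1 - ε ^ 2 * (1 - ε) ^ 2 * x * y with hC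
  have hABC : y * A - x * B - (y - x) * C = 2 * (ε ^ 2 * (1 - ε) ^ 2) * (x * y * (y - x)) := by
    simp only [hA, hB, hC]; ring
  have h4 : y * A * ((k + 2 * ε * v) * (k + 2 * ε * v₂) + (k + 2 * ε * v₁) * (k + 2 * ε * v₃))
      - x * B * ((k + 2 * ε * v) * (k + 2 * ε * v₁) + (k + 2 * ε * v₂) * (k + 2 * ε * v₃))
      - (y - x) * C * ((k + 2 * ε * v₁) * (k + 2 * ε * v₂) + (k + 2 * ε * v) * (k + 2 * ε * v₃))
      = 4 * x * y * (y - x) * (ε ^ 2 * G + (1 - ε ^ 3) ^ 2) := by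
    apply mul_right_cancel₀ (mul_ne_zero h1 h2)
    linear_combination h3 - 4 * x * y * (y - x) * hG
  apply mul_left_cancel₀ (mul_ne_zero (by norm_num) (pow_ne_zero 2 hε) : (4 * ε ^ 2 : ℂ) ≠ 0)
  linear_combination h4 - (2 * k ^ 2 + 2 * ε * k * (v + v₁ + v₂ + v₃)) * hABC
    - (4 * (1 - ε) ^ 2 * (ε * k + (1 + ε + ε ^ 2)) * (x * y * (y - x))
      + 4 * ε ^ 2 * (1 - ε) ^ 2 * (x * y * (y - x)) * (v + v₁ + v₂ + v₃)) * hk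

theorem solvesOn_Q2 (h : LaxSystem D.p S V Λ c) (ha : a ≠ 0) (haV : a ∈ V) (haV' : -a ∈ V)
    (hpa : ∀ r, D.p r ^ 2 ≠ a ^ 2) (l : Fin N) (cA cD ξ₀ : ℂ) :
    SolvesOn {n | n ∈ S ∧ n + e l ∈ S}
      (fun j k => EqQ2 (ringParam a (D.p j)) (ringParam a (D.p k))) (D.uQ2 Λ l a cA cD ξ₀) := by
  intro n j k h0 h1 h2 h3
  obtain ⟨P, hP⟩ := D.exists_Q2Branch hpa
  have lim : ∀ m, m ∈ S ∧ m + e l ∈ S → Tendsto (D.approxQ2 Λ l a cA cD ξ₀ P m) (𝓝[≠] 0)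
      (𝓝 (D.uQ2 Λ l a cA cD ξ₀ m)) := fun m hm =>
    tendsto_uQ3_uQ2 h hm.1 hm.2 ha haV haV' hpa hP cA cD ξ₀ one_ne_zero
  set g := (3 + ξ₀ ^ 2) / 2 + 2 * cA * cD with hg
  set w := cA * cD with hw
  have hid : Tendsto (fun ε : ℂ => ε) (𝓝[≠] 0) (𝓝 0) := tendsto_nhdsWithin_of_tendsto_nhds tendsto_id
  have hbl := tendsto_b a
  have den : ∀ r, Tendsto (fun ε => 2 * D.p r ^ 2 - a ^ 2 - (a * (1 - 2 * ε)) ^ 2 + 2 * P ε r)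
      (𝓝[≠] 0) (𝓝 (2 * D.p r ^ 2 - a ^ 2 - a ^ 2 + 2 * (D.p r ^ 2 - a ^ 2))) := fun r =>
    ((hbl.pow 2).const_sub _).add ((hP r).2.const_mul 2)
  have den0 : ∀ r, 2 * D.p r ^ 2 - a ^ 2 - a ^ 2 + 2 * (D.p r ^ 2 - a ^ 2) ≠ 0 := fun r h0 =>
    hpa r (by linear_combination (1 / 4 : ℂ) * h0)
  set π : Fin N → ℂ → ℂ := fun r ε =>
    4 * a ^ 2 / (2 * D.p r ^ 2 - a ^ 2 - (a * (1 - 2 * ε)) ^ 2 + 2 * P ε r) with hπ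
  have lπ : ∀ r, Tendsto (π r) (𝓝[≠] 0) (𝓝 (ringParam a (D.p r))) := by
    intro r
    have e1 : ringParam a (D.p r)
        = 4 * a ^ 2 / (2 * D.p r ^ 2 - a ^ 2 - a ^ 2 + 2 * (D.p r ^ 2 - a ^ 2)) := by
      unfold ringParam
      rw [show 2 * D.p r ^ 2 - a ^ 2 - a ^ 2 + 2 * (D.p r ^ 2 - a ^ 2)
        = 4 * (D.p r ^ 2 - a ^ 2) by ring, mul_div_mul_left _ _ (by norm_num : (4 : ℂ) ≠ 0)]
    rw [e1]
    exact (tendsto_const_nhds (x := 4 * a ^ 2)).div (den r) (den0 r)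
  set v := D.approxQ2 Λ l a cA cD ξ₀ P n with hv
  set v₁ := D.approxQ2 Λ l a cA cD ξ₀ P (n + e j) with hv₁
  set v₂ := D.approxQ2 Λ l a cA cD ξ₀ P (n + e k) with hv₂
  set v₃ := D.approxQ2 Λ l a cA cD ξ₀ P (n + e j + e k) with hv₃
  have l0 := lim n h0
  have l1 := lim _ h1
  have l2 := lim _ h2
  have l3 := lim _ h3
  set η : ℂ → ℂ := fun ε => (1 - ε) ^ 2 with hη
  set E : ℂ → ℂ := fun ε => (2 * g + 8 * w - 8) + (g ^ 2 - 4 * g - 20 * w) * ε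
    - 2 * (g ^ 2 - 4 * w) * ε ^ 2 with hE
  have lη : Tendsto η (𝓝[≠] 0) (𝓝 ((1 - 0) ^ 2)) := (hid.const_sub 1).pow 2
  have lE : Tendsto E (𝓝[≠] 0) (𝓝 ((2 * g + 8 * w - 8) + (g ^ 2 - 4 * g - 20 * w) * 0
    - 2 * (g ^ 2 - 4 * w) * 0 ^ 2)) :=
    ((hid.const_mul _).const_add _).sub ((hid.pow 2).const_mul _)
  have lη0 : ∀ r₁ r₂, Tendsto (fun ε => 1 - ε ^ 2 * η ε * π r₁ ε * π r₂ ε) (𝓝[≠] 0)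
      (𝓝 (1 - 0 ^ 2 * (1 - 0) ^ 2 * ringParam a (D.p r₁) * ringParam a (D.p r₂))) := fun r₁ r₂ =>
    ((((hid.pow 2).mul lη).mul (lπ r₁)).mul (lπ r₂)).const_sub 1
  have one_ne : ∀ r, (1 - 0 ^ 2 * (1 - 0) ^ 2 * ringParam a (D.p r) * ringParam a (D.p r) : ℂ) ≠ 0 :=
    fun r => by simp
  set M : ℂ → ℂ := fun ε => η ε * (π j ε ^ 2 + π k ε ^ 2 - π j ε * π k ε)
      + ε * (E ε * (1 - ε ^ 2 * η ε * π j ε * π k ε))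
      - ε ^ 2 * (η ε ^ 2 * (π j ε ^ 2 * π k ε ^ 2))
      + (2 * ε - ε ^ 4) * ((1 - ε ^ 2 * η ε * π j ε * π j ε) * (1 - ε ^ 2 * η ε * π k ε * π k ε))
    with hM
  set G : ℂ → ℂ := fun ε => M ε
      / ((1 - ε ^ 2 * η ε * π j ε * π j ε) * (1 - ε ^ 2 * η ε * π k ε * π k ε)) with hG
  have lG := (((lη.mul ((((lπ j).pow 2).add ((lπ k).pow 2)).sub ((lπ j).mul (lπ k)))).add
    (hid.mul (lE.mul (lη0 j k)))).sub ((hid.pow 2).mul ((lη.pow 2).mul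
      (((lπ j).pow 2).mul ((lπ k).pow 2))))).add
    (((hid.const_mul 2).sub (hid.pow 4)).mul ((lη0 j j).mul (lη0 k k)))
  have lG' : Tendsto G (𝓝[≠] 0) _ := lG.div ((lη0 j j).mul (lη0 k k)) (mul_ne_zero (one_ne j) (one_ne k))
  have main := (((((lπ k).mul (lη0 j j)).mul ((l0.mul l2).add (l1.mul l3))).sub
    (((lπ j).mul (lη0 k k)).mul ((l0.mul l1).add (l2.mul l3)))).sub
    ((((lπ k).sub (lπ j)).mul (lη0 j k)).mul ((l1.mul l2).add (l0.mul l3)))).sub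
    (((((lπ j).mul (lπ k)).mul ((lπ j).sub (lπ k))).mul ((hid.const_sub 1).mul
      ((hid.pow 3).const_sub 1))).mul (((l0.add l1).add l2).add l3)) |>.add
    ((((lπ j).mul (lπ k)).mul ((lπ j).sub (lπ k))).mul lG')
  have hev : ∀ᶠ ε in 𝓝[≠] 0, π k ε * (1 - ε ^ 2 * η ε * π j ε * π j ε) * (v ε * v₂ ε + v₁ ε * v₃ ε)
      - π j ε * (1 - ε ^ 2 * η ε * π k ε * π k ε) * (v ε * v₁ ε + v₂ ε * v₃ ε)
      - (π k ε - π j ε) * (1 - ε ^ 2 * η ε * π j ε * π k ε) * (v₁ ε * v₂ ε + v ε * v₃ ε)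
      - π j ε * π k ε * (π j ε - π k ε) * ((1 - ε) * (1 - ε ^ 3)) * (v ε + v₁ ε + v₂ ε + v₃ ε)
      + π j ε * π k ε * (π j ε - π k ε) * G ε = 0 := by
    filter_upwards [(self_mem_nhdsWithin : ∀ᶠ ε : ℂ in 𝓝[≠] 0, ε ≠ 0),
      hbl.eventually (h.isOpen.mem_nhds haV), hbl.neg.eventually (h.isOpen.mem_nhds haV'),
      (hid.const_sub 1).eventually_ne (by norm_num : (1 - 0 : ℂ) ≠ 0),
      ((hid.const_mul 2).const_sub 1).eventually_ne (by norm_num : (1 - 2 * 0 : ℂ) ≠ 0),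
      (eventually_all.2 fun r => (hP r).1 : ∀ᶠ ε in 𝓝[≠] 0, ∀ r, P ε r ^ 2
        = (D.p r ^ 2 - a ^ 2) * (D.p r ^ 2 - (a * (1 - 2 * ε)) ^ 2)),
      (eventually_all.2 fun r => (hP r).2.eventually_ne (sub_ne_zero.2 (hpa r)) :
        ∀ᶠ ε in 𝓝[≠] 0, ∀ r, P ε r ≠ 0),
      (eventually_all.2 fun r => (den r).eventually_ne (den0 r) :
        ∀ᶠ ε in 𝓝[≠] 0, ∀ r, 2 * D.p r ^ 2 - a ^ 2 - (a * (1 - 2 * ε)) ^ 2 + 2 * P ε r ≠ 0),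
      (lη0 j j).eventually_ne (one_ne j), (lη0 k k).eventually_ne (one_ne k)]
      with ε hε hbV hbV' hε1 hε2 hsq hP0 hden hd1 hd2
    have hε : ε ≠ 0 := hε
    have hpb : ∀ r, D.p r ^ 2 ≠ (a * (1 - 2 * ε)) ^ 2 := fun r hr => by
      have := hsq r
      rw [sub_eq_zero.2 hr, mul_zero] at this
      exact hP0 r (pow_eq_zero_iff two_ne_zero |>.1 this)
    have hab : a ^ 2 ≠ (a * (1 - 2 * ε)) ^ 2 := fun hr => by
      have : 4 * a ^ 2 * (ε * (1 - ε)) = 0 := by linear_combination hr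
      simp [ha, hε, hε1] at this
    have q3 := uQ3_quad h (P := P ε) (1 / (4 * a ^ 2) * (cA * ε))
      (1 / (8 * a ^ 2) * (1 / ε + 1 - ξ₀ + g * ε)) (1 / (8 * a ^ 2) * (1 / ε + 1 + ξ₀ + g * ε))
      (1 / (4 * a ^ 2) * (cD * ε)) l h0 h1 h2 h3 haV haV' hbV hbV' ha
      hab hpa hpb (hsq)
    have hu : ∀ m, D.uQ3 Λ l a (a * (1 - 2 * ε)) (P ε) (1 / (4 * a ^ 2) * (cA * ε))
        (1 / (8 * a ^ 2) * (1 / ε + 1 - ξ₀ + g * ε)) (1 / (8 * a ^ 2) * (1 / ε + 1 + ξ₀ + g * ε))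
        (1 / (4 * a ^ 2) * (cD * ε)) m = 1 / (4 * a ^ 2) * ((1 + ε + ε ^ 2) / ε
          + 2 * ε * D.approxQ2 Λ l a cA cD ξ₀ P m ε) := by
      intro m
      rw [approxQ2, ← hg]
      generalize D.uQ3 Λ l a (a * (1 - 2 * ε)) _ _ _ _ _ m = X
      field_simp
      ring
    rw [hu, hu, hu, hu] at q3
    have hπ0 : ∀ r, π r ε ≠ 0 := fun r =>
      div_ne_zero (mul_ne_zero (by norm_num) (pow_ne_zero 2 ha)) (hden r)
    have pr : ∀ r, π r ε * P ε r = a ^ 2 * (1 - ε ^ 2 * η ε * π r ε * π r ε) ∧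
        π r ε * (2 * D.p r ^ 2 - a ^ 2 - (a * (1 - 2 * ε)) ^ 2)
          = 2 * a ^ 2 * (1 + ε ^ 2 * η ε * π r ε * π r ε) := by
      intro r
      have e1 : π r ε * (2 * D.p r ^ 2 - a ^ 2 - (a * (1 - 2 * ε)) ^ 2 + 2 * P ε r) = 4 * a ^ 2 :=
        div_mul_cancel₀ _ (hden r)
      have e2 : (2 * D.p r ^ 2 - a ^ 2 - (a * (1 - 2 * ε)) ^ 2 + 2 * P ε r)
          * (2 * D.p r ^ 2 - a ^ 2 - (a * (1 - 2 * ε)) ^ 2 - 2 * P ε r)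
          = 16 * a ^ 4 * (ε ^ 2 * η ε) := by
        simp only [hη]; linear_combination -4 * hsq r
      have e3 : 2 * D.p r ^ 2 - a ^ 2 - (a * (1 - 2 * ε)) ^ 2 - 2 * P ε r
          = 4 * a ^ 2 * (ε ^ 2 * η ε) * π r ε := by
        have h4 : (4 * a ^ 2 : ℂ) ≠ 0 := mul_ne_zero (by norm_num) (pow_ne_zero 2 ha)
        apply mul_left_cancel₀ h4
        linear_combination π r ε * e2
          - (2 * D.p r ^ 2 - a ^ 2 - (a * (1 - 2 * ε)) ^ 2 - 2 * P ε r) * e1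
      constructor
      · linear_combination (1 / 4 : ℂ) * e1 - (1 / 4 : ℂ) * π r ε * e3
      · linear_combination (1 / 2 : ℂ) * e1 + (1 / 2 : ℂ) * π r ε * e3
    obtain ⟨j1, j2⟩ := pr j
    obtain ⟨k1, k2⟩ := pr k
    have hPj : P ε j = a ^ 2 * (1 - ε ^ 2 * η ε * π j ε * π j ε) / π j ε := by
      rw [eq_div_iff (hπ0 j)]; linear_combination j1
    have hPk : P ε k = a ^ 2 * (1 - ε ^ 2 * η ε * π k ε * π k ε) / π k ε := by
      rw [eq_div_iff (hπ0 k)]; linear_combination k1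
    have hpq : D.p j ^ 2 - D.p k ^ 2 = a ^ 2 * (π k ε - π j ε) * (1 - ε ^ 2 * η ε * π j ε * π k ε)
        / (π j ε * π k ε) := by
      rw [eq_div_iff (mul_ne_zero (hπ0 j) (hπ0 k))]
      linear_combination (1 / 2 : ℂ) * π k ε * j2 - (1 / 2 : ℂ) * π j ε * k2
    have hC : 4 * a * (a * (1 - 2 * ε)) * (1 / (8 * a ^ 2) * (1 / ε + 1 - ξ₀ + g * ε)
        * (1 / (8 * a ^ 2) * (1 / ε + 1 + ξ₀ + g * ε)) * (a - a * (1 - 2 * ε)) ^ 2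
        - 1 / (4 * a ^ 2) * (cA * ε) * (1 / (4 * a ^ 2) * (cD * ε)) * (a + a * (1 - 2 * ε)) ^ 2)
        = 1 / 4 * (1 + ε ^ 3 * E ε) := by
      simp only [hE, hw]
      field_simp
      rw [hg]
      ring
    have hGM : G ε * ((1 - ε ^ 2 * η ε * π j ε * π j ε) * (1 - ε ^ 2 * η ε * π k ε * π k ε)) = M ε :=
      div_mul_cancel₀ _ (mul_ne_zero hd1 hd2)
    have hMe : ε ^ 2 * M ε = (1 - ε ^ 2 * η ε * π j ε * π k ε) * (1 + ε ^ 3 * E ε)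
        - (1 - ε ^ 3) ^ 2 * ((1 - ε ^ 2 * η ε * π j ε * π j ε) * (1 - ε ^ 2 * η ε * π k ε * π k ε)) := by
      simp only [hM]; ring
    rw [hC, hPj, hPk, hpq] at q3
    have hπj := hπ0 j
    have hπk := hπ0 k
    have star := quad_Q2_aux ha hε hπj hπk hd1 hd2 (hGM.symm ▸ hMe) q3
    linear_combination star
  have hz := tendsto_nhds_unique (main.congr' (hev.mono fun ε hε => hε)) tendsto_const_nhds
  simp only [EqQ2]
  generalize ringParam a (D.p j) = r₁ at *
  generalize ringParam a (D.p k) = r₂ at *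
  have e1 : ((1 - 0) ^ 2 * (r₁ ^ 2 + r₂ ^ 2 - r₁ * r₂) +
      0 * ((2 * g + 8 * w - 8 + (g ^ 2 - 4 * g - 20 * w) * 0 - 2 * (g ^ 2 - 4 * w) * 0 ^ 2) *
        (1 - 0 ^ 2 * (1 - 0) ^ 2 * r₁ * r₂)) - 0 ^ 2 * (((1 - 0) ^ 2) ^ 2 * (r₁ ^ 2 * r₂ ^ 2)) +
      (2 * 0 - 0 ^ 4) * ((1 - 0 ^ 2 * (1 - 0) ^ 2 * r₁ * r₁) * (1 - 0 ^ 2 * (1 - 0) ^ 2 * r₂ * r₂)))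
      / ((1 - 0 ^ 2 * (1 - 0) ^ 2 * r₁ * r₁) * (1 - 0 ^ 2 * (1 - 0) ^ 2 * r₂ * r₂))
      = r₁ ^ 2 + r₂ ^ 2 - r₁ * r₂ := by
    norm_num
  rw [e1] at hz
  linear_combination -hz

/-! ### `Q1` -/

theorem uQ2_scaled {δ cA cB cD : ℂ} (ξ₀ : ℂ) (hδ : cB ^ 2 + 4 * cA * cD = δ ^ 2 / 4) {ε : ℂ}
    (hε : ε ≠ 0) (l : Fin N) (n : Lattice N) :
    ε * (D.uQ2 Λ l a (2 * cA / ε) (2 * cD / ε) (ξ₀ + 2 * cB / ε) n - δ ^ 2 / (4 * ε ^ 2))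
      = D.uQ1 Λ l a cA cB cD ξ₀ n + ε * (1 / 4 * ((D.xi a n + ξ₀) ^ 2 + 1)
        + a * (D.xi a n + ξ₀) * D.smallS Λ l n (-a) a + a ^ 2 * D.bigZ Λ l n a) := by
  unfold uQ2 uQ1
  rw [show δ ^ 2 / (4 * ε ^ 2) = (δ ^ 2 / 4) / ε ^ 2 by field_simp, ← hδ]
  field_simp
  ring

theorem tendsto_uQ2_uQ1 {δ cA cB cD : ℂ} (ξ₀ : ℂ) (hδ : cB ^ 2 + 4 * cA * cD = δ ^ 2 / 4)
    (l : Fin N) (n : Lattice N) :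
    Tendsto (fun ε : ℂ =>
      ε * (D.uQ2 Λ l a (2 * cA / ε) (2 * cD / ε) (ξ₀ + 2 * cB / ε) n - δ ^ 2 / (4 * ε ^ 2)))
      (𝓝[≠] 0) (𝓝 (D.uQ1 Λ l a cA cB cD ξ₀ n)) := by
  have hid : Tendsto (fun ε : ℂ => ε) (𝓝[≠] 0) (𝓝 0) :=
    tendsto_nhdsWithin_of_tendsto_nhds tendsto_id
  have h1 := (hid.mul_const (1 / 4 * ((D.xi a n + ξ₀) ^ 2 + 1)
    + a * (D.xi a n + ξ₀) * D.smallS Λ l n (-a) a + a ^ 2 * D.bigZ Λ l n a)).const_add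
    (D.uQ1 Λ l a cA cB cD ξ₀ n)
  rw [zero_mul, add_zero] at h1
  refine h1.congr' ?_
  filter_upwards [self_mem_nhdsWithin] with ε hε
  exact (uQ2_scaled ξ₀ hδ hε l n).symm

theorem solvesOn_Q1 (h : LaxSystem D.p S V Λ c) (ha : a ≠ 0) (haV : a ∈ V) (haV' : -a ∈ V)
    (hpa : ∀ r, D.p r ^ 2 ≠ a ^ 2) (l : Fin N) {δ cA cB cD : ℂ} (ξ₀ : ℂ)
    (hδ : cB ^ 2 + 4 * cA * cD = δ ^ 2 / 4) :
    SolvesOn {n | n ∈ S ∧ n + e l ∈ S}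
      (fun j k => EqQ1 δ (ringParam a (D.p j)) (ringParam a (D.p k)))
      (D.uQ1 Λ l a cA cB cD ξ₀) := by
  intro n j k h0 h1 h2 h3
  have lim := fun m => tendsto_uQ2_uQ1 (D := D) (Λ := Λ) (a := a) ξ₀ hδ l m
  set p := ringParam a (D.p j)
  set q := ringParam a (D.p k)
  set v : Lattice N → ℂ → ℂ := fun m ε =>
    ε * (D.uQ2 Λ l a (2 * cA / ε) (2 * cD / ε) (ξ₀ + 2 * cB / ε) m - δ ^ 2 / (4 * ε ^ 2)) with hv
  have hid : Tendsto (fun ε : ℂ => ε) (𝓝[≠] 0) (𝓝 0) :=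
    tendsto_nhdsWithin_of_tendsto_nhds tendsto_id
  have l0 : Tendsto (v n) _ _ := lim n
  have l1 : Tendsto (v (n + e j)) _ _ := lim (n + e j)
  have l2 : Tendsto (v (n + e k)) _ _ := lim (n + e k)
  have l3 : Tendsto (v (n + e j + e k)) _ _ := lim (n + e j + e k)
  have main := (((((l0.sub l2).const_mul p).mul (l1.sub l3)).sub
    (((l0.sub l1).const_mul q).mul (l2.sub l3))).add
    ((hid.mul (((l0.add l1).add l2).add l3)).const_mul (p * q * (p - q)))).sub
    ((hid.pow 2).const_mul (p * q * (p - q) * (p ^ 2 - p * q + q ^ 2)))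
  have hev : ∀ᶠ ε : ℂ in 𝓝[≠] 0,
      p * (v n ε - v (n + e k) ε) * (v (n + e j) ε - v (n + e j + e k) ε)
      - q * (v n ε - v (n + e j) ε) * (v (n + e k) ε - v (n + e j + e k) ε)
      + p * q * (p - q) * (ε * (v n ε + v (n + e j) ε + v (n + e k) ε + v (n + e j + e k) ε))
      - p * q * (p - q) * (p ^ 2 - p * q + q ^ 2) * ε ^ 2 = - (δ ^ 2 * p * q * (p - q)) := by
    filter_upwards [self_mem_nhdsWithin] with ε hε
    have hε : ε ≠ 0 := hε
    have q2 := solvesOn_Q2 h ha haV haV' hpa l (2 * cA / ε) (2 * cD / ε) (ξ₀ + 2 * cB / ε)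
      n j k h0 h1 h2 h3
    unfold EqQ2 at q2
    simp only [hv]
    have hδε : ε ^ 2 * (δ ^ 2 / (4 * ε ^ 2)) = δ ^ 2 / 4 := by field_simp
    linear_combination ε ^ 2 * q2 - 4 * p * q * (p - q) * hδε
  have hz := tendsto_nhds_unique (main.congr' hev) tendsto_const_nhds
  unfold EqQ1
  linear_combination hz

/-! ### `H3` -/

theorem vartheta_add_e {P : Fin N → ℂ} (hP : ∀ r, P r ≠ 0) (hap : ∀ r, a - D.p r ≠ 0)
    (n : Lattice N) (j : Fin N) :
    D.vartheta a P (n + e j) = D.vartheta a P n * (P j / (a - D.p j)) := by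
  unfold vartheta
  rw [Finset.prod_congr rfl fun r _ => by
    rw [Pi.add_apply, zpow_add₀ (div_ne_zero (hP r) (hap r))], Finset.prod_mul_distrib]
  congr 1
  rw [Finset.prod_eq_single j]
  · simp [e]
  · intro r _ hr
    simp [e, hr]
  · simp

theorem vartheta_ne_zero {P : Fin N → ℂ} (hP : ∀ r, P r ≠ 0) (hap : ∀ r, a - D.p r ≠ 0)
    (n : Lattice N) : D.vartheta a P n ≠ 0 :=
  Finset.prod_ne_zero_iff.2 fun r _ => zpow_ne_zero _ (div_ne_zero (hP r) (hap r))

theorem sgn_eq_prod (n : Lattice N) : sgn n = ∏ r, (-1 : ℂ) ^ n r := by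
  unfold sgn
  induction (Finset.univ : Finset (Fin N)) using Finset.induction_on with
  | empty => simp
  | insert r s hr ih => rw [Finset.sum_insert hr, Finset.prod_insert hr, ← ih, zpow_add₀ (by simp)]

theorem solvesOn_H3 (h : LaxSystem D.p S V Λ c) (ha : a ≠ 0) (haV : a ∈ V) (haV' : -a ∈ V)
    (hpa : ∀ r, D.p r ^ 2 ≠ a ^ 2) {δ : ℂ} {P : Fin N → ℂ} {cA cB cC cD : ℂ}
    (hP : ∀ r, P r ^ 2 = a ^ 2 - D.p r ^ 2) (hδ : cA * cD - cB * cC = -δ / (4 * a)) :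
    SolvesOn S (fun j k => EqH3 δ (D.p j) (P j) (D.p k) (P k)) (D.uH3 Λ a P cA cB cC cD) := by
  intro n j k h0 h1 h2 h3
  have hP0 : ∀ r, P r ≠ 0 := fun r h0 => hpa r (by
    have := hP r
    rw [h0] at this
    linear_combination this)
  have hap : ∀ r, a - D.p r ≠ 0 := fun r h0 => hpa r (by
    linear_combination -(D.p r + a) * h0)
  have t0 := D.vartheta_ne_zero hP0 hap n
  have t1 := D.vartheta_add_e hP0 hap n j
  have t2 := D.vartheta_add_e hP0 hap n k
  have t3 := D.vartheta_add_e hP0 hap (n + e j) k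
  rw [t1] at t3
  have h3' : n + e k + e j ∈ S := by rwa [add_right_comm]
  have w1 := h.wronskian n j h0 h1 a haV haV'
  have w2 := h.wronskian n k h0 h2 a haV haV'
  have uu := h.up_up n j k h0 h1 h2 a haV
  have uu' := h.up_up n j k h0 h1 h2 (-a) haV'
  have dd := h.down_down n j k h2 h1 h3 a haV
  have dd' := h.down_down n j k h2 h1 h3 (-a) haV'
  have s0 := sgn_sq n
  have hj := hP j
  have hk := hP k
  have aj := hap j
  have ak := hap k
  have Pj := hP0 j
  have Pk := hP0 k
  unfold EqH3 uH3
  rw [t1, t2, t3, sgn_add_e (n + e j) k, sgn_add_e n j, sgn_add_e n k]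
  set κ := D.p j - D.p k + c (n + e j) - c (n + e k)
  set θ := D.vartheta a P n
  set p := D.p j
  set q := D.p k
  generalize P j = X at *
  generalize P k = Y at *
  set s := sgn n
  obtain ⟨φ, hφ⟩ : ∃ φ, φ = θ * Λ n a := ⟨_, rfl⟩
  obtain ⟨ψ, hψ⟩ : ∃ ψ, ψ = θ⁻¹ * Λ n (-a) := ⟨_, rfl⟩
  obtain ⟨φ₁, hφ₁⟩ : ∃ φ, φ = θ * (X / (a - p)) * Λ (n + e j) a := ⟨_, rfl⟩
  obtain ⟨ψ₁, hψ₁⟩ : ∃ φ, φ = (θ * (X / (a - p)))⁻¹ * Λ (n + e j) (-a) := ⟨_, rfl⟩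
  obtain ⟨φ₂, hφ₂⟩ : ∃ φ, φ = θ * (Y / (a - q)) * Λ (n + e k) a := ⟨_, rfl⟩
  obtain ⟨ψ₂, hψ₂⟩ : ∃ φ, φ = (θ * (Y / (a - q)))⁻¹ * Λ (n + e k) (-a) := ⟨_, rfl⟩
  obtain ⟨φ₃, hφ₃⟩ : ∃ φ, φ = θ * (X / (a - p)) * (Y / (a - q)) * Λ (n + e j + e k) a := ⟨_, rfl⟩
  obtain ⟨ψ₃, hψ₃⟩ : ∃ φ, φ = (θ * (X / (a - p)) * (Y / (a - q)))⁻¹ * Λ (n + e j + e k) (-a) :=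
    ⟨_, rfl⟩
  have xφ : X * φ₁ = θ * ((p + a) * Λ (n + e j) a) := by
    rw [hφ₁]; field_simp; linear_combination Λ (n + e j) a * hj
  have yφ : Y * φ₂ = θ * ((q + a) * Λ (n + e k) a) := by
    rw [hφ₂]; field_simp; linear_combination Λ (n + e k) a * hk
  have xψ : X * ψ₁ = θ⁻¹ * ((a - p) * Λ (n + e j) (-a)) := by
    rw [hψ₁]; field_simp
  have yψ : Y * ψ₂ = θ⁻¹ * ((a - q) * Λ (n + e k) (-a)) := by
    rw [hψ₂]; field_simp
  have E1 : X * φ₁ - Y * φ₂ = κ * φ := by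
    rw [xφ, yφ, hφ]; linear_combination θ * uu
  have E2 : X * ψ₁ - Y * ψ₂ = -κ * ψ := by
    rw [xψ, yψ, hψ]; linear_combination -θ⁻¹ * uu'
  have E3 : Y * φ₁ - X * φ₂ = κ * φ₃ := by
    rw [hφ₃, hφ₁, hφ₂]
    field_simp
    linear_combination dd
  have E4 : X * ψ₂ - Y * ψ₁ = κ * ψ₃ := by
    have e1 : X * ψ₂ - Y * ψ₁ = θ⁻¹ * ((a - p) * (a - q) / (X * Y))
        * ((p + a) * Λ (n + e k) (-a) - (q + a) * Λ (n + e j) (-a)) := by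
      rw [hψ₂, hψ₁]
      field_simp
      linear_combination (a - q) * Λ (n + e k) (-a) * hj - (a - p) * Λ (n + e j) (-a) * hk
    rw [e1, hψ₃]
    field_simp
    linear_combination dd'
  have E5 : X * (φ₁ * ψ + ψ₁ * φ) = 2 * a := by
    have := inv_mul_cancel₀ t0
    rw [hψ, hφ]
    linear_combination θ⁻¹ * Λ n (-a) * xφ + θ * Λ n a * xψ + w1
      + ((p + a) * Λ (n + e j) a * Λ n (-a) - (p - a) * Λ (n + e j) (-a) * Λ n a) * this
  have E6 : Y * (φ₂ * ψ + ψ₂ * φ) = 2 * a := by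
    have := inv_mul_cancel₀ t0
    rw [hψ, hφ]
    linear_combination θ⁻¹ * Λ n (-a) * yφ + θ * Λ n a * yψ + w2
      + ((q + a) * Λ (n + e k) a * Λ n (-a) - (q - a) * Λ (n + e k) (-a) * Λ n a) * this
  have E7 : κ * (ψ * φ₃ - φ * ψ₃) = 2 * a * ((p ^ 2 - q ^ 2) / (X * Y)) := by
    have e1 : κ * (ψ * φ₃ - φ * ψ₃)
        = Y * (φ₁ * ψ + ψ₁ * φ) - X * (φ₂ * ψ + ψ₂ * φ) := by
      linear_combination -ψ * E3 + φ * E4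
    rw [e1]
    have e2 : φ₁ * ψ + ψ₁ * φ = 2 * a / X := by rw [eq_div_iff Pj]; linear_combination E5
    have e3 : φ₂ * ψ + ψ₂ * φ = 2 * a / Y := by rw [eq_div_iff Pk]; linear_combination E6
    rw [e2, e3]
    field_simp
    linear_combination hk - hj
  have hδ' : 2 * (cA * cD - cB * cC) * (2 * a) = -δ := by
    rw [hδ]; field_simp; ring
  have key : Y * (((cA + s * cB) * φ + (s * cC + cD) * ψ) * ((cA + -s * cB) * φ₁ + (-s * cC + cD) * ψ₁)
        + ((cA + -s * cB) * φ₂ + (-s * cC + cD) * ψ₂) * ((cA + - -s * cB) * φ₃ + (- -s * cC + cD) * ψ₃))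
      - X * (((cA + s * cB) * φ + (s * cC + cD) * ψ) * ((cA + -s * cB) * φ₂ + (-s * cC + cD) * ψ₂)
        + ((cA + -s * cB) * φ₁ + (-s * cC + cD) * ψ₁) * ((cA + - -s * cB) * φ₃ + (- -s * cC + cD) * ψ₃))
      = κ * (2 * (cA * cD - s ^ 2 * (cB * cC))) * (ψ * φ₃ - φ * ψ₃) := by
    linear_combination ((cA + s * cB) * φ + (s * cC + cD) * ψ)
        * ((cA + -s * cB) * E3 - (-s * cC + cD) * E4)
      - ((cA + s * cB) * φ₃ + (s * cC + cD) * ψ₃)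
        * ((cA + -s * cB) * E1 + (-s * cC + cD) * E2)
  rw [s0] at key
  simp only [hφ, hψ, hφ₁, hψ₁, hφ₂, hψ₂, hφ₃, hψ₃] at key E7
  linear_combination key + 2 * (cA * cD - cB * cC) * E7 + (p ^ 2 - q ^ 2) / (X * Y) * hδ'

theorem tendsto_bigS {ι : Type*} {F : Filter ι} {y : ι → ℂ} (hy : Tendsto y F (cocompact ℂ))
    (h0 : Tendsto (Λ n) (cocompact ℂ) (𝓝 1)) (h1 : Tendsto (Λ (n + e l)) (cocompact ℂ) (𝓝 1))
    (x : ℂ) : Tendsto (fun ε => D.bigS Λ l n x (y ε)) F (𝓝 (Λ n x)) := by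
  have i1 : Tendsto (fun ζ => 1 / (ζ - x)) (cocompact ℂ) (𝓝 0) := tendsto_one_div_sub_cocompact x
  have hne : ∀ᶠ ζ in cocompact ℂ, ζ - x ≠ 0 := by
    filter_upwards [(isCompact_singleton (x := x)).compl_mem_cocompact] with ζ hζ
    exact sub_ne_zero.2 hζ
  have main := ((i1.neg.mul_const ((D.p l + x) * Λ (n + e l) x)).mul h0).add
    ((((i1.const_mul (D.p l + x)).const_add 1).mul_const (Λ n x)).mul h1)
  have e1 : -0 * ((D.p l + x) * Λ (n + e l) x) * 1 + (1 + (D.p l + x) * 0) * Λ n x * 1 = Λ n x := by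
    ring
  rw [e1] at main
  refine Tendsto.comp (g := fun ζ => D.bigS Λ l n x ζ) (main.congr' ?_) hy
  filter_upwards [hne] with ζ hζ
  have : x - ζ ≠ 0 := fun h => hζ (by linear_combination -h)
  unfold bigS
  rw [show x - ζ = -(ζ - x) by ring]
  field_simp
  ring

/-- The factor `F(x, b)` in the limit `b → ∞`. -/
theorem tendsto_facF_infty {P : Fin N → ℂ} {P' : ℂ → Fin N → ℂ} (hP : ∀ r, P r ≠ 0)
    (hP' : ∀ r, Tendsto (fun ε => ε ^ 2 * P' ε r) (𝓝[≠] 0) (𝓝 (P r))) {x : ℂ} (τ : ℂ)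
    (hτ : τ ≠ 0) (hx : ∀ r, D.p r + x ≠ 0) (n : Lattice N) :
    Tendsto (fun ε : ℂ => D.facF (P' ε) n x (τ * (1 / ε ^ 2))) (𝓝[≠] 0)
      (𝓝 (∏ r, (τ * ((D.p r + x) / P r)) ^ n r)) := by
  unfold facF
  have hid : Tendsto (fun ε : ℂ => ε) (𝓝[≠] 0) (𝓝 0) :=
    tendsto_nhdsWithin_of_tendsto_nhds tendsto_id
  refine tendsto_finsetProd _ fun r _ => Tendsto.zpow₀ ?_ _ (Or.inl
    (mul_ne_zero hτ (div_ne_zero (hx r) (hP r))))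
  have main := ((((hid.pow 2).mul_const (D.p r)).add_const τ).const_mul (D.p r + x)).div (hP' r)
    (hP r)
  have e1 : (D.p r + x) * (0 ^ 2 * D.p r + τ) / P r = τ * ((D.p r + x) / P r) := by ring
  rw [e1] at main
  refine main.congr' ?_
  filter_upwards [self_mem_nhdsWithin, (hP' r).eventually_ne (hP r)] with ε hε h0
  have hε : ε ≠ 0 := hε
  have h0' := right_ne_zero_of_mul h0
  simp only [Pi.div_apply]
  field_simp

theorem tendsto_uQ3_uH3 (hpa : ∀ r, D.p r ^ 2 ≠ a ^ 2) {s : ℂ} (hs : s ≠ 0)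
    {P : Fin N → ℂ} {P' : ℂ → Fin N → ℂ} (cA cB cC cD : ℂ)
    (hP : ∀ r, P r ^ 2 = a ^ 2 - D.p r ^ 2)
    (hP' : ∀ r, Tendsto (fun ε => ε ^ 2 * P' ε r) (𝓝[≠] 0) (𝓝 (P r)))
    (h0 : Tendsto (Λ n) (cocompact ℂ) (𝓝 1)) (h1 : Tendsto (Λ (n + e l)) (cocompact ℂ) (𝓝 1)) :
    Tendsto (fun ε : ℂ =>
      (ε ^ 3 * (s / 2))⁻¹ * D.uQ3 Λ l a (1 / ε ^ 2) (P' ε)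
        (ε ^ 3 * (s / 2 * cA)) (ε ^ 3 * (s / 2 * cB))
        (ε ^ 3 * (s / 2 * cC)) (ε ^ 3 * (s / 2 * cD)) n)
      (𝓝[≠] 0) (𝓝 (D.uH3 Λ a P cA cB cC cD n)) := by
  have hP0 : ∀ r, P r ≠ 0 := fun r h0 => hpa r (by
    have := hP r
    rw [h0] at this
    linear_combination this)
  have hap : ∀ r, a - D.p r ≠ 0 := fun r h0 => hpa r (by
    linear_combination -(D.p r + a) * h0)
  have hx : ∀ r, D.p r + a ≠ 0 := fun r h0 => hpa r (by
    linear_combination (D.p r - a) * h0)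
  have hx' : ∀ r, D.p r + -a ≠ 0 := fun r h0 => hap r (by linear_combination -h0)
  have b1 : Tendsto (fun ε : ℂ => 1 / ε ^ 2) (𝓝[≠] 0) (cocompact ℂ) := by
    have h1 : Tendsto (fun ε : ℂ => ε ^ 2) (𝓝[≠] 0) (𝓝[≠] 0) := by
      refine tendsto_nhdsWithin_iff.2 ⟨?_, ?_⟩
      · have hid : Tendsto (fun ε : ℂ => ε) (𝓝[≠] 0) (𝓝 0) :=
          tendsto_nhdsWithin_of_tendsto_nhds tendsto_id
        simpa using hid.pow 2
      · filter_upwards [self_mem_nhdsWithin] with ε hε using pow_ne_zero 2 hε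
    have h2 := tendsto_inv₀_nhdsNE_zero.comp h1
    rw [Metric.cobounded_eq_cocompact] at h2
    exact h2.congr fun ε => by simp
  have b2 : Tendsto (fun ε : ℂ => -(1 / ε ^ 2)) (𝓝[≠] 0) (cocompact ℂ) :=
    tendsto_neg_cocompact.comp b1
  have f1 := D.tendsto_facF_infty hP0 hP' 1 one_ne_zero hx n
  have f2 := D.tendsto_facF_infty hP0 hP' (-1) (by simp) hx n
  have f3 := D.tendsto_facF_infty hP0 hP' 1 one_ne_zero hx' n
  have f4 := D.tendsto_facF_infty hP0 hP' (-1) (by simp) hx' n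
  have hv : ∀ r, (D.p r + a) / P r = P r / (a - D.p r) := fun r => by
    rw [div_eq_div_iff (hP0 r) (hap r)]; linear_combination -hP r
  have hv' : ∀ r, (D.p r + -a) / P r = -1 * (P r / (a - D.p r))⁻¹ := fun r => by
    rw [inv_div]; ring
  have p1 : ∏ r, (1 * ((D.p r + a) / P r)) ^ n r = D.vartheta a P n := by
    simp only [hv, one_mul]; rfl
  have p2 : ∏ r, (-1 * ((D.p r + a) / P r)) ^ n r = sgn n * D.vartheta a P n := by
    simp only [hv, mul_zpow, Finset.prod_mul_distrib, sgn_eq_prod]; rfl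
  have p3 : ∏ r, (1 * ((D.p r + -a) / P r)) ^ n r = sgn n * (D.vartheta a P n)⁻¹ := by
    simp only [hv', one_mul, mul_zpow, Finset.prod_mul_distrib, sgn_eq_prod, inv_zpow,
      Finset.prod_inv_distrib]; rfl
  have p4 : ∏ r, (-1 * ((D.p r + -a) / P r)) ^ n r = (D.vartheta a P n)⁻¹ := by
    have : ∀ r, -1 * ((D.p r + -a) / P r) = (P r / (a - D.p r))⁻¹ := fun r => by rw [hv']; ring
    simp only [this, inv_zpow, Finset.prod_inv_distrib]
    rfl
  rw [p1] at f1
  rw [p2] at f2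
  rw [p3] at f3
  rw [p4] at f4
  have main := ((((f1.mul (D.tendsto_bigS b1 h0 h1 a)).const_mul cA).add
    ((f2.mul (D.tendsto_bigS b2 h0 h1 a)).const_mul cB)).add
    ((f3.mul (D.tendsto_bigS b1 h0 h1 (-a))).const_mul cC)).add
    ((f4.mul (D.tendsto_bigS b2 h0 h1 (-a))).const_mul cD)
  have e1 : D.uH3 Λ a P cA cB cC cD n = cA * (D.vartheta a P n * Λ n a)
      + cB * (sgn n * D.vartheta a P n * Λ n a) + cC * (sgn n * (D.vartheta a P n)⁻¹ * Λ n (-a))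
      + cD * ((D.vartheta a P n)⁻¹ * Λ n (-a)) := by
    unfold uH3; ring
  rw [e1]
  refine main.congr' ?_
  filter_upwards [self_mem_nhdsWithin] with ε hε
  have hε : ε ≠ 0 := hε
  unfold uQ3
  simp only [one_mul, neg_mul]
  field_simp

end InitialData

/-! ### Expansions at infinity -/

theorem tendsto_inv_punctured_cocompact :
    Tendsto (fun ε : ℂ => 1 / ε) (𝓝[≠] 0) (cocompact ℂ) := by
  have h := tendsto_inv₀_nhdsNE_zero (α := ℂ)
  rw [Metric.cobounded_eq_cocompact] at h
  exact h.congr fun ε => by simp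

theorem HasExpansion.tendsto {f : ℂ → ℂ} {c d : ℂ} (h : HasExpansion f c d) :
    Tendsto f (cocompact ℂ) (𝓝 1) := by
  have i1 : Tendsto (fun ζ : ℂ => 1 / ζ) (cocompact ℂ) (𝓝 0) := by
    simpa using tendsto_one_div_sub_cocompact 0
  have h3 : Tendsto (fun ζ : ℂ => 1 / ζ ^ 3) (cocompact ℂ) (𝓝 0) := by
    simpa [one_div] using i1.pow 3
  have h1 := h.trans_tendsto h3
  have h2 := ((i1.const_mul c).add ((i1.pow 2).const_mul d)).const_add 1
  have h4 := h1.add h2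
  simp only [mul_zero, add_zero, zero_add, ne_eq, OfNat.ofNat_ne_zero, not_false_eq_true,
    zero_pow] at h4
  refine h4.congr fun ζ => ?_
  simp only [one_div, inv_pow]
  ring

/-- In the variable `ε = 1 / ζ`, an expansion at infinity of a holomorphic function is a Taylor
expansion, and can be differentiated. -/
theorem HasExpansion.exists_local {f : ℂ → ℂ} {c d : ℂ} {V : Set ℂ} (h : HasExpansion f c d)
    (hV : IsOpen V) (hV' : V ∈ cocompact ℂ) (hf : DifferentiableOn ℂ f V) :
    ∃ M M' : ℂ → ℂ, (∀ᶠ ε in 𝓝[≠] 0, f (1 / ε) = M ε ∧ deriv f (1 / ε) = -ε ^ 2 * M' ε) ∧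
      M 0 = 1 ∧ M' 0 = c ∧ HasDerivAt M c 0 ∧ HasDerivAt M' (2 * d) 0 := by
  have hinv := tendsto_inv_punctured_cocompact
  set m₀ : ℂ → ℂ := fun ε => (f (1 / ε) - 1 - c * ε) / ε ^ 2 with hm₀
  set m := Function.update m₀ 0 d with hm
  have hmne : ∀ ε, ε ≠ 0 → m ε = m₀ ε := fun ε hε => by
    rw [hm, Function.update_of_ne hε]
  have m0 : m 0 = d := by rw [hm, Function.update_self]
  have hcont : ContinuousAt m 0 := by
    rw [hm, continuousAt_update_same]
    have h1 := h.comp_tendsto hinv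
    have h2 : (fun ε => m₀ ε - d) =O[𝓝[≠] 0] fun ε : ℂ => ε := by
      have h3 := h1.mul (Asymptotics.isBigO_refl (fun ε : ℂ => 1 / ε ^ 2) (𝓝[≠] 0))
      refine (h3.congr' ?_ ?_)
      · filter_upwards [self_mem_nhdsWithin] with ε hε
        have hε : ε ≠ 0 := hε
        simp only [Function.comp, hm₀]
        field_simp
        ring
      · filter_upwards [self_mem_nhdsWithin] with ε hε
        have hε : ε ≠ 0 := hε
        simp only [Function.comp]
        field_simp
    have h4 : Tendsto (fun ε => m₀ ε - d) (𝓝[≠] 0) (𝓝 0) :=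
      h2.trans_tendsto (tendsto_nhdsWithin_of_tendsto_nhds tendsto_id)
    simpa using h4.add_const d
  have hdiff : ∀ᶠ ε in 𝓝[≠] 0, DifferentiableAt ℂ m ε := by
    filter_upwards [self_mem_nhdsWithin, hinv hV'] with ε hε hεV
    have hε : ε ≠ 0 := hε
    have h1 : DifferentiableAt ℂ f (1 / ε) := hf.differentiableAt (hV.mem_nhds hεV)
    have h2 : DifferentiableAt ℂ (fun ε : ℂ => 1 / ε) ε :=
      (differentiableAt_const 1).div differentiableAt_id hε
    have h3 : DifferentiableAt ℂ m₀ ε :=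
      (((h1.comp ε h2).sub_const 1).sub (differentiableAt_id.const_mul c)).div
        (differentiableAt_id.pow 2) (pow_ne_zero 2 hε)
    refine h3.congr_of_eventuallyEq ?_
    filter_upwards [isOpen_ne.mem_nhds hε] with x hx using hmne x hx
  have han := Complex.analyticAt_of_differentiable_on_punctured_nhds_of_continuousAt hdiff hcont
  set M : ℂ → ℂ := fun ε => 1 + c * ε + ε ^ 2 * m ε with hM
  set M' : ℂ → ℂ := fun ε => c + 2 * ε * m ε + ε ^ 2 * deriv m ε with hM'
  have hMd : ∀ ε, DifferentiableAt ℂ m ε → HasDerivAt M (M' ε) ε := fun ε hd => by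
    have h1 := (((hasDerivAt_id ε).const_mul c).const_add 1).add
      (((hasDerivAt_id ε).pow 2).mul hd.hasDerivAt)
    refine h1.congr_deriv ?_
    simp only [hM', id, Pi.pow_apply]
    ring
  refine ⟨M, M', ?_, by simp [hM], by simp [hM'], ?_, ?_⟩
  · have hfM : ∀ ε, ε ≠ 0 → f (1 / ε) = M ε := fun ε hε => by
      simp only [hM, hmne ε hε, hm₀]
      field_simp
      ring
    filter_upwards [self_mem_nhdsWithin, hdiff] with ε hε hd
    have hε : ε ≠ 0 := hε
    refine ⟨hfM ε hε, ?_⟩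
    have hi : HasDerivAt (fun z : ℂ => z⁻¹) (-((1 / ε) ^ 2)⁻¹) (1 / ε) :=
      hasDerivAt_inv (one_div_ne_zero hε)
    have h2 : HasDerivAt (M ∘ fun z : ℂ => z⁻¹) (M' ε * -((1 / ε) ^ 2)⁻¹) (1 / ε) :=
      HasDerivAt.comp (1 / ε) (by simpa using hMd ε hd) hi
    have h3 : f =ᶠ[𝓝 (1 / ε)] M ∘ fun z => z⁻¹ := by
      filter_upwards [isOpen_ne.mem_nhds (one_div_ne_zero hε)] with z hz
      have := hfM z⁻¹ (inv_ne_zero hz)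
      rw [one_div, inv_inv] at this
      exact this
    rw [h3.deriv_eq, h2.deriv]
    field_simp
  · simpa [hM'] using hMd 0 han.differentiableAt
  · have h1 := ((((hasDerivAt_id (0 : ℂ)).const_mul 2).mul
      han.differentiableAt.hasDerivAt).const_add c).add
      (((hasDerivAt_id (0 : ℂ)).pow 2).mul han.deriv.differentiableAt.hasDerivAt)
    refine (h1.congr_deriv ?_).congr_of_eventuallyEq (Eventually.of_forall fun ε => ?_)
    · simp [m0]
    · simp only [hM', id, Pi.mul_apply, Pi.add_apply, Pi.pow_apply]

namespace InitialData

variable {N : ℕ} {D : InitialData N} {Λ : Lattice N → ℂ → ℂ} {S : Set (Lattice N)} {V : Set ℂ}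
  {c : Lattice N → ℂ} {n : Lattice N} {j k l : Fin N} {a : ℂ}

/-- `ρ(1 / ε)`, without the sign. -/
theorem exists_local_rho (D : InitialData N) (n : Lattice N) :
    ∃ r : ℂ → ℂ, (∀ᶠ ε in 𝓝[≠] 0, D.rho n (1 / ε) = sgn n * r ε) ∧ r 0 = 1 ∧
      HasDerivAt r (2 * D.varrho n) 0 := by
  set r : ℂ → ℂ := fun ε => ∏ r, ((1 + D.p r * ε) / (1 - D.p r * ε)) ^ n r with hr
  have hid : Tendsto (fun ε : ℂ => ε) (𝓝[≠] 0) (𝓝 0) :=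
    tendsto_nhdsWithin_of_tendsto_nhds tendsto_id
  have hl : ∀ x : ℂ, Tendsto (fun ε : ℂ => 1 - x * ε) (𝓝[≠] 0) (𝓝 1) := fun x => by
    simpa using (hid.const_mul x).const_sub 1
  have r0 : r 0 = 1 := by simp [hr]
  refine ⟨r, ?_, r0, ?_⟩
  · filter_upwards [self_mem_nhdsWithin] with ε hε
    have hε : ε ≠ 0 := hε
    rw [sgn_eq_prod, hr, ← Finset.prod_mul_distrib]
    refine Finset.prod_congr rfl fun i _ => ?_
    rw [← mul_zpow]
    congr 1
    rw [show D.p i + 1 / ε = (1 + D.p i * ε) / ε by field_simp; ring,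
      show D.p i - 1 / ε = -(1 - D.p i * ε) / ε by field_simp; ring,
      div_div_div_cancel_right₀ hε, div_neg, neg_one_mul]
  · rw [hasDerivAt_iff_tendsto_slope_zero]
    have h1 : ∀ i ∈ (Finset.univ : Finset (Fin N)), Tendsto
        (fun ε => (((1 + D.p i * ε) / (1 - D.p i * ε)) ^ n i - 1) / ε) (𝓝[≠] 0)
        (𝓝 (n i * (2 * D.p i / 1))) := fun i _ => by
      refine tendsto_zpow_sub_one_div (n i) ?_
      refine ((tendsto_const_nhds (x := 2 * D.p i)).div (hl (D.p i)) one_ne_zero).congr' ?_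
      filter_upwards [self_mem_nhdsWithin, (hl (D.p i)).eventually_ne one_ne_zero] with ε hε h0
      have hε : ε ≠ 0 := hε
      simp only [Pi.div_apply]
      field_simp
      ring
    have h2 := tendsto_prod_sub_one_div Finset.univ h1
    have e1 : ∑ i, (n i : ℂ) * (2 * D.p i / 1) = 2 * D.varrho n := by
      unfold varrho
      rw [Finset.mul_sum]
      exact Finset.sum_congr rfl fun i _ => by ring
    rw [e1] at h2
    refine h2.congr fun ε => ?_
    rw [zero_add, r0, smul_eq_mul]
    simp only [hr]
    ring

theorem exists_local_xi (D : InitialData N) (n : Lattice N) :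
    ∃ x : ℂ → ℂ, (∀ᶠ ε in 𝓝[≠] 0, D.xi (1 / ε) n = x ε) ∧ x 0 = 0 ∧
      HasDerivAt x (2 * D.varrho n) 0 := by
  set x : ℂ → ℂ := fun ε => ε * (2 * ∑ r, D.p r / (1 - D.p r ^ 2 * ε ^ 2) * n r) with hx
  refine ⟨x, ?_, by simp [hx], ?_⟩
  · filter_upwards [self_mem_nhdsWithin] with ε hε
    have hε : ε ≠ 0 := hε
    unfold xi
    simp only [hx, Finset.mul_sum]
    refine Finset.sum_congr rfl fun r _ => ?_
    rw [show (1 / ε) ^ 2 - D.p r ^ 2 = (1 - D.p r ^ 2 * ε ^ 2) / ε ^ 2 by field_simp,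
      div_div_eq_mul_div]
    field_simp
  · rw [hasDerivAt_iff_tendsto_slope_zero]
    have h1 : ContinuousAt (fun ε : ℂ => 2 * ∑ r, D.p r / (1 - D.p r ^ 2 * ε ^ 2) * n r) 0 := by
      refine continuousAt_const.mul (tendsto_finsetSum _ fun r _ => ?_)
      refine ContinuousAt.mul (ContinuousAt.div continuousAt_const (by fun_prop) (by simp))
        continuousAt_const
    have h2 := h1.tendsto.mono_left (nhdsWithin_le_nhds (s := {0}ᶜ))
    have e1 : 2 * ∑ r, D.p r / (1 - D.p r ^ 2 * 0 ^ 2) * (n r : ℂ) = 2 * D.varrho n := by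
      unfold varrho; simp
    rw [e1] at h2
    refine h2.congr' ?_
    filter_upwards [self_mem_nhdsWithin] with ε hε
    have hε : ε ≠ 0 := hε
    simp only [hx, zero_add, smul_eq_mul, zero_mul, sub_zero]
    rw [inv_mul_cancel_left₀ hε]

/-- The combination of Jost functions in the terms of `Q2` and `Q1` with plane-wave factors, for
`a = 1 / ε`. -/
def waveTerm (p : ℂ) (M M' M₁ M₁' : ℂ → ℂ) (ε : ℂ) : ℂ :=
  M ε * M₁ ε + ε * (1 + p * ε) * (M₁ ε * M' ε - M ε * M₁' ε)

/-- The combination of Jost functions in the other terms of `Q2` and `Q1`, for `a = 1 / ε`. -/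
def mixedTerm (p : ℂ) (M M' M₁ M₁' : ℂ → ℂ) (ε : ℂ) : ℂ :=
  1 + ε * (1 - p * ε) * (M₁ (-ε) * M' ε) + ε * (1 + p * ε) * (M (-ε) * M₁' ε) - M (-ε) * M₁ ε

section

variable {M M' M₁ M₁' : ℂ → ℂ} {d c₀ c₁ : ℂ}

theorem tendsto_neg_punctured : Tendsto (fun ε : ℂ => -ε) (𝓝[≠] 0) (𝓝[≠] 0) := by
  refine tendsto_nhdsWithin_iff.2 ⟨?_, ?_⟩
  · have : Tendsto (fun ε : ℂ => ε) (𝓝[≠] 0) (𝓝 0) :=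
      tendsto_nhdsWithin_of_tendsto_nhds tendsto_id
    simpa using this.neg
  · filter_upwards [self_mem_nhdsWithin] with ε hε using neg_ne_zero.2 hε

theorem hasDerivAt_comp_neg {M : ℂ → ℂ} {c : ℂ} (h : HasDerivAt M c 0) :
    HasDerivAt (fun ε => M (-ε)) (-c) 0 := by
  have h1 : HasDerivAt (M ∘ fun ε : ℂ => -ε) (c * -1) 0 :=
    HasDerivAt.comp (0 : ℂ) (by simpa using h) (hasDerivAt_neg (0 : ℂ))
  exact h1.congr_deriv (by ring)

theorem hasDerivAt_waveTerm (p : ℂ) (hM : HasDerivAt M c₀ 0) (hM₁ : HasDerivAt M₁ c₁ 0)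
    (hM' : ContinuousAt M' 0) (hM₁' : ContinuousAt M₁' 0) (h0 : M 0 = 1) (h1 : M₁ 0 = 1)
    (h0' : M' 0 = c₀) (h1' : M₁' 0 = c₁) : HasDerivAt (waveTerm p M M' M₁ M₁') (2 * c₀) 0 := by
  have h2 : HasDerivAt (fun ε : ℂ => ε * ((1 + p * ε) * (M₁ ε * M' ε - M ε * M₁' ε)))
      (c₀ - c₁) 0 := by
    rw [hasDerivAt_iff_tendsto_slope_zero]
    have hc : ContinuousAt (fun ε : ℂ => (1 + p * ε) * (M₁ ε * M' ε - M ε * M₁' ε)) 0 :=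
      ContinuousAt.mul (by fun_prop)
        ((hM₁.continuousAt.mul hM').sub (hM.continuousAt.mul hM₁'))
    have h3 := hc.tendsto.mono_left (nhdsWithin_le_nhds (s := {0}ᶜ))
    have e1 : (1 + p * 0) * (M₁ 0 * M' 0 - M 0 * M₁' 0) = c₀ - c₁ := by
      rw [h0, h1, h0', h1']; ring
    rw [e1] at h3
    refine h3.congr' ?_
    filter_upwards [self_mem_nhdsWithin] with ε hε
    have hε : ε ≠ 0 := hε
    simp only [zero_add, smul_eq_mul, zero_mul, sub_zero]
    field_simp
  refine (((hM.mul hM₁).add h2).congr_deriv ?_).congr_of_eventuallyEq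
    (Eventually.of_forall fun ε => ?_)
  · rw [h0, h1]; ring
  · simp only [waveTerm, Pi.mul_apply, Pi.add_apply]; ring

theorem hasDerivAt_mixedTerm (p : ℂ) (hM : HasDerivAt M c₀ 0) (hM₁ : HasDerivAt M₁ c₁ 0)
    (hM' : ContinuousAt M' 0) (hM₁' : ContinuousAt M₁' 0) (h0 : M 0 = 1) (h1 : M₁ 0 = 1)
    (h0' : M' 0 = c₀) (h1' : M₁' 0 = c₁) : HasDerivAt (mixedTerm p M M' M₁ M₁') (2 * c₀) 0 := by
  have hMn := hasDerivAt_comp_neg hM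
  have hMn₁ := hasDerivAt_comp_neg hM₁
  have h2 : HasDerivAt (fun ε : ℂ => ε * ((1 - p * ε) * (M₁ (-ε) * M' ε)
      + (1 + p * ε) * (M (-ε) * M₁' ε))) (c₀ + c₁) 0 := by
    rw [hasDerivAt_iff_tendsto_slope_zero]
    have hc : ContinuousAt (fun ε : ℂ => (1 - p * ε) * (M₁ (-ε) * M' ε)
        + (1 + p * ε) * (M (-ε) * M₁' ε)) 0 :=
      (ContinuousAt.mul (by fun_prop) (hMn₁.continuousAt.mul hM')).add
        (ContinuousAt.mul (by fun_prop) (hMn.continuousAt.mul hM₁'))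
    have h3 := hc.tendsto.mono_left (nhdsWithin_le_nhds (s := {0}ᶜ))
    have e1 : (1 - p * 0) * (M₁ (-0) * M' 0) + (1 + p * 0) * (M (-0) * M₁' 0) = c₀ + c₁ := by
      rw [neg_zero, h0, h1, h0', h1']; ring
    rw [e1] at h3
    refine h3.congr' ?_
    filter_upwards [self_mem_nhdsWithin] with ε hε
    have hε : ε ≠ 0 := hε
    simp only [zero_add, smul_eq_mul, zero_mul, sub_zero]
    field_simp
  refine (((h2.sub (hMn.mul hM₁)).const_add 1).congr_deriv ?_).congr_of_eventuallyEq
    (Eventually.of_forall fun ε => ?_)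
  · rw [neg_zero, h0, h1]; ring
  · simp only [mixedTerm, Pi.mul_apply, Pi.sub_apply]; ring

/-- The common part of the passages from `Q1` to `H1` and from `Q2` to `H2`. -/
theorem local_terms
    (h : ∀ᶠ ε in 𝓝[≠] 0, Λ n (1 / ε) = M ε ∧ deriv (Λ n) (1 / ε) = -ε ^ 2 * M' ε)
    (h₁ : ∀ᶠ ε in 𝓝[≠] 0, Λ (n + e l) (1 / ε) = M₁ ε
      ∧ deriv (Λ (n + e l)) (1 / ε) = -ε ^ 2 * M₁' ε) :
    ∀ᶠ ε in 𝓝[≠] 0,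
      2 * (1 / ε) * D.smallS Λ l n (-(1 / ε)) (1 / ε) = mixedTerm (D.p l) M M' M₁ M₁' ε ∧
      1 - 2 * (1 / ε) * D.smallS Λ l n (1 / ε) (1 / ε) = waveTerm (D.p l) M M' M₁ M₁' ε ∧
      1 + 2 * (1 / ε) * D.smallS Λ l n (-(1 / ε)) (-(1 / ε))
        = waveTerm (D.p l) M M' M₁ M₁' (-ε) ∧
      2 * (1 / ε) * D.bigZ Λ l n (1 / ε)
        = -ε ^ 2 * ((M₁ ε - ε * (1 + D.p l * ε) * M₁' ε) * M' (-ε)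
          - (M₁ (-ε) + ε * (1 - D.p l * ε) * M₁' (-ε)) * M' ε) := by
  have hn := tendsto_neg_punctured
  filter_upwards [self_mem_nhdsWithin, h, h₁, hn.eventually h, hn.eventually h₁]
    with ε hε ⟨a1, a2⟩ ⟨b1, b2⟩ ⟨a3, a4⟩ ⟨b3, b4⟩
  have hε : ε ≠ 0 := hε
  rw [show 1 / -ε = -(1 / ε) by rw [div_neg]] at a3 a4 b3 b4
  unfold smallS bigZ
  rw [a1, a2, a3, a4, b1, b2, b3, b4]
  simp only [waveTerm, mixedTerm]
  refine ⟨?_, ?_, ?_, ?_⟩ <;> field_simp <;> ring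

end

/-- `(φ ε - φ (-ε)) / ε` and similar limits at `0`. -/
theorem tendsto_slope_of_hasDerivAt {φ : ℂ → ℂ} {φ' : ℂ} (h : HasDerivAt φ φ' 0) (h0 : φ 0 = 0) :
    Tendsto (fun ε => φ ε / ε) (𝓝[≠] 0) (𝓝 φ') := by
  refine (hasDerivAt_iff_tendsto_slope_zero.1 h).congr fun ε => ?_
  rw [zero_add, h0, sub_zero, smul_eq_mul, inv_mul_eq_div]

/-- The terms with plane-wave factors, in the limits to `H2` and `H1`. -/
theorem tendsto_waveTerms {W r : ℂ → ℂ} {w ρ : ℂ} (hW : HasDerivAt W w 0) (hr : HasDerivAt r ρ 0)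
    (hW0 : W 0 = 1) (hr0 : r 0 = 1) (ρ₁ : ℂ) :
    Tendsto (fun ε => ((1 + 2 * ρ₁ * ε) * (r ε * W ε) + (-1 + 2 * ρ₁ * ε) * (r (-ε) * W (-ε))) / ε)
      (𝓝[≠] 0) (𝓝 (2 * (ρ + w) + 4 * ρ₁)) := by
  have h1 : HasDerivAt (fun ε : ℂ => 1 + 2 * ρ₁ * ε) (2 * ρ₁) 0 := by
    simpa using ((hasDerivAt_id (0 : ℂ)).const_mul (2 * ρ₁)).const_add 1
  have h2 : HasDerivAt (fun ε : ℂ => -1 + 2 * ρ₁ * ε) (2 * ρ₁) 0 := by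
    simpa using ((hasDerivAt_id (0 : ℂ)).const_mul (2 * ρ₁)).const_add (-1)
  have h3 := (h1.mul (hr.mul hW)).add
    (h2.mul ((hasDerivAt_comp_neg hr).mul (hasDerivAt_comp_neg hW)))
  refine tendsto_slope_of_hasDerivAt (h3.congr_deriv ?_) ?_
  · simp only [Pi.mul_apply, neg_zero, hW0, hr0]; ring
  · rw [neg_zero, hW0, hr0]; ring

variable {d c₀ c₁ d₁ : ℂ}

theorem tendsto_uQ1_uH1 (hV : IsOpen V) (hV' : V ∈ cocompact ℂ)
    (hf : DifferentiableOn ℂ (Λ n) V) (hf₁ : DifferentiableOn ℂ (Λ (n + e l)) V)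
    {Λε : Lattice N → ℂ} (h : HasExpansion (Λ n) (Λε n) d)
    (h₁ : HasExpansion (Λ (n + e l)) c₁ d₁) (cA cB ρ₀ ρ₁ : ℂ) {δ : ℂ} (hδ : δ ≠ 0) :
    Tendsto (fun ε : ℂ =>
      D.uQ1 Λ l (1 / ε) (δ / 4 * (cA * (1 + 2 * ρ₁ * ε))) (δ / 2 * cB)
        (δ / 4 * (cA * (-1 + 2 * ρ₁ * ε))) (2 * ε * ρ₀) n / (ε * δ))
      (𝓝[≠] 0) (𝓝 (D.uH1 Λε cA cB ρ₀ ρ₁ n)) := by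
  obtain ⟨M, M', hloc, M0, M0', hM, hM'⟩ := h.exists_local hV hV' hf
  obtain ⟨M₁, M₁', hloc₁, M10, M10', hM₁, hM₁'⟩ := h₁.exists_local hV hV' hf₁
  obtain ⟨r, hr, r0, hr'⟩ := D.exists_local_rho n
  obtain ⟨x, hx, x0, hx'⟩ := D.exists_local_xi n
  have hW := hasDerivAt_waveTerm (D.p l) hM hM₁ hM'.continuousAt hM₁'.continuousAt M0 M10 M0' M10'
  have hX := hasDerivAt_mixedTerm (D.p l) hM hM₁ hM'.continuousAt hM₁'.continuousAt M0 M10 M0' M10'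
  have W0 : waveTerm (D.p l) M M' M₁ M₁' 0 = 1 := by simp [waveTerm, M0, M10]
  have X0 : mixedTerm (D.p l) M M' M₁ M₁' 0 = 0 := by simp [mixedTerm, M0, M10]
  have t1 := tendsto_waveTerms hW hr' W0 r0 ρ₁
  have t2 := tendsto_slope_of_hasDerivAt hX X0
  have t3 := tendsto_slope_of_hasDerivAt hx' x0
  have main := (((t3.add_const (2 * ρ₀)).add t2).const_mul (cB / 2)).add
    (t1.const_mul (cA * sgn n / 4))
  have e1 : D.uH1 Λε cA cB ρ₀ ρ₁ n = cB / 2 * (2 * D.varrho n + 2 * ρ₀ + 2 * Λε n)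
      + cA * sgn n / 4 * (2 * (2 * D.varrho n + 2 * Λε n) + 4 * ρ₁) := by
    unfold uH1; ring
  rw [e1]
  refine main.congr' ?_
  filter_upwards [self_mem_nhdsWithin, local_terms (D := D) hloc hloc₁, hr, tendsto_neg_punctured.eventually hr,
    hx] with ε hε ⟨s1, s2, s3, _⟩ hr1 hr2 hx1
  have hε : ε ≠ 0 := hε
  rw [show 1 / -ε = -(1 / ε) by rw [div_neg]] at hr2
  unfold uQ1
  rw [s1, s2, s3, hr1, hr2, hx1]
  field_simp
  ring

theorem tendsto_uQ2_uH2 (hV : IsOpen V) (hV' : V ∈ cocompact ℂ)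
    (hf : DifferentiableOn ℂ (Λ n) V) (hf₁ : DifferentiableOn ℂ (Λ (n + e l)) V)
    {Λε Λε2 : Lattice N → ℂ} (h : HasExpansion (Λ n) (Λε n) (Λε2 n))
    (h₁ : HasExpansion (Λ (n + e l)) c₁ d₁) (cA ρ₀ ρ₁ : ℂ) :
    Tendsto (fun ε : ℂ =>
      (D.uQ2 Λ l (1 / ε) (cA * (ε + 2 * ρ₁ * ε ^ 2)) (cA * (-ε + 2 * ρ₁ * ε ^ 2))
        (2 * ε * ρ₀) n - 1 / 4) / ε ^ 2)
      (𝓝[≠] 0) (𝓝 (D.uH2 Λε Λε2 cA ρ₀ ρ₁ n)) := by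
  obtain ⟨M, M', hloc, M0, M0', hM, hM'⟩ := h.exists_local hV hV' hf
  obtain ⟨M₁, M₁', hloc₁, M10, M10', hM₁, hM₁'⟩ := h₁.exists_local hV hV' hf₁
  obtain ⟨r, hr, r0, hr'⟩ := D.exists_local_rho n
  obtain ⟨x, hx, x0, hx'⟩ := D.exists_local_xi n
  have hW := hasDerivAt_waveTerm (D.p l) hM hM₁ hM'.continuousAt hM₁'.continuousAt M0 M10 M0' M10'
  have hX := hasDerivAt_mixedTerm (D.p l) hM hM₁ hM'.continuousAt hM₁'.continuousAt M0 M10 M0' M10'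
  have W0 : waveTerm (D.p l) M M' M₁ M₁' 0 = 1 := by simp [waveTerm, M0, M10]
  have X0 : mixedTerm (D.p l) M M' M₁ M₁' 0 = 0 := by simp [mixedTerm, M0, M10]
  have t1 := tendsto_waveTerms hW hr' W0 r0 ρ₁
  have t2 := tendsto_slope_of_hasDerivAt hX X0
  have t3 := tendsto_slope_of_hasDerivAt hx' x0
  have hid : Tendsto (fun ε : ℂ => ε) (𝓝[≠] 0) (𝓝 0) :=
    tendsto_nhdsWithin_of_tendsto_nhds tendsto_id
  have lin : ∀ τ : ℂ, HasDerivAt (fun ε : ℂ => ε * (1 + τ * ε)) 1 0 := fun τ => by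
    have h1 : HasDerivAt (fun ε : ℂ => 1 + τ * ε) τ 0 := by
      simpa using ((hasDerivAt_id (0 : ℂ)).const_mul τ).const_add 1
    exact ((hasDerivAt_id (0 : ℂ)).mul h1).congr_deriv (by simp)
  have q1 : HasDerivAt (fun ε => (M₁ ε - ε * (1 + D.p l * ε) * M₁' ε) * M' (-ε)
          - (M₁ (-ε) + ε * (1 + -D.p l * ε) * M₁' (-ε)) * M' ε) (-(4 * Λε2 n)) 0 := by
    have h1 := ((hM₁.sub ((lin (D.p l)).mul hM₁')).mul (hasDerivAt_comp_neg hM')).sub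
      (((hasDerivAt_comp_neg hM₁).add ((lin (-D.p l)).mul (hasDerivAt_comp_neg hM₁'))).mul hM')
    refine h1.congr_deriv ?_
    simp only [Pi.mul_apply, Pi.sub_apply, Pi.add_apply, neg_zero, zero_mul, M10, M0', M10']
    ring
  have t4 := tendsto_slope_of_hasDerivAt q1 (by rw [neg_zero, M10, M0']; ring)
  have t5 := t3.add_const (2 * ρ₀)
  have main := ((((t5.pow 2).const_mul (1 / 4)).add ((t5.mul t2).const_mul (1 / 2))).add
    (t4.const_mul (-1 / 2))).add ((((hid.pow 2).const_mul (4 * ρ₁ ^ 2)).sub_const 1).const_mul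
      (cA ^ 2)) |>.add (t1.const_mul (cA * sgn n / 2))
  have e1 : D.uH2 Λε Λε2 cA ρ₀ ρ₁ n = 1 / 4 * (2 * D.varrho n + 2 * ρ₀) ^ 2
      + 1 / 2 * ((2 * D.varrho n + 2 * ρ₀) * (2 * Λε n)) + -1 / 2 * (-(4 * Λε2 n))
      + cA ^ 2 * (4 * ρ₁ ^ 2 * 0 ^ 2 - 1)
      + cA * sgn n / 2 * (2 * (2 * D.varrho n + 2 * Λε n) + 4 * ρ₁) := by
    unfold uH2; ring
  rw [e1]
  refine main.congr' ?_
  filter_upwards [self_mem_nhdsWithin, local_terms (D := D) hloc hloc₁, hr, tendsto_neg_punctured.eventually hr,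
    hx] with ε hε ⟨s1, s2, s3, s4⟩ hr1 hr2 hx1
  have hε : ε ≠ 0 := hε
  rw [show 1 / -ε = -(1 / ε) by rw [div_neg]] at hr2
  have s1' : D.smallS Λ l n (-(1 / ε)) (1 / ε) = ε / 2 * mixedTerm (D.p l) M M' M₁ M₁' ε := by
    rw [← s1]; field_simp
  have s4' := congrArg (fun z => ε / 2 * z) s4
  have s5 : ε / 2 * (2 * (1 / ε) * D.bigZ Λ l n (1 / ε)) = D.bigZ Λ l n (1 / ε) := by field_simp
  simp only [s5] at s4'
  unfold uQ2
  rw [s1', s2, s3, s4', hr1, hr2, hx1]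
  field_simp
  ring

end InitialData

end

end LatticeIST

open Filter Topology Set MeasureTheory
open Complex (I)

namespace LatticeIST

noncomputable section

/-! ### Integrals along the boundary of a half-plane -/

theorem integrable_of_bound {f : ℝ → ℂ} {C : ℝ} (hf : AEStronglyMeasurable f)
    (h : ∀ᵐ s, ‖f s‖ ≤ C / (1 + s ^ 2)) : Integrable f := by
  refine (integrable_inv_one_add_sq.const_mul C).mono' hf ?_
  simpa only [div_eq_mul_inv] using h

theorem norm_sq_vertical (x s : ℝ) : ‖(x + s * I : ℂ)‖ ^ 2 = x ^ 2 + s ^ 2 := by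
  rw [← Complex.normSq_eq_norm_sq, Complex.normSq_add_mul_I]

section

variable {F : ℂ → ℂ} {C : ℝ}

theorem continuous_vertical (hF : DifferentiableOn ℂ F {z | 0 < z.re}) {x : ℝ} (hx : 0 < x) :
    Continuous fun s : ℝ => F (x + s * I) :=
  hF.continuousOn.comp_continuous (by fun_prop) fun s => by simpa using hx

theorem norm_vertical_le (hC : ∀ z : ℂ, 0 < z.re → ‖F z‖ ≤ C / (1 + ‖z‖ ^ 2)) {x : ℝ} (hx : 0 < x)
    (s : ℝ) : ‖F (x + s * I)‖ ≤ C / (1 + s ^ 2) := by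
  have h1 := hC (x + s * I) (by simpa using hx)
  have hC0 : 0 ≤ C := by
    have := (norm_nonneg _).trans h1
    by_contra hneg
    exact absurd this (not_le.2 (div_neg_of_neg_of_pos (not_le.1 hneg) (by positivity)))
  rw [norm_sq_vertical] at h1
  refine h1.trans (div_le_div_of_nonneg_left hC0 (by positivity) ?_)
  nlinarith [sq_nonneg x]

theorem integral_vertical_eq (hF : DifferentiableOn ℂ F {z | 0 < z.re})
    (hC : ∀ z : ℂ, 0 < z.re → ‖F z‖ ≤ C / (1 + ‖z‖ ^ 2)) {x y : ℝ} (hx : 0 < x) (hxy : x ≤ y) :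
    ∫ s : ℝ, F (x + s * I) = ∫ s : ℝ, F (y + s * I) := by
  have hy := hx.trans_le hxy
  have hint : ∀ {x : ℝ}, 0 < x → Tendsto (fun T : ℝ => ∫ s in -T..T, F (x + s * I)) atTop
      (𝓝 (∫ s : ℝ, F (x + s * I))) := fun {x} hx =>
    intervalIntegral_tendsto_integral (integrable_of_bound
      (continuous_vertical hF hx).aestronglyMeasurable (Eventually.of_forall fun s =>
        norm_vertical_le hC hx s)) tendsto_neg_atTop_atBot tendsto_id
  have hinv : Tendsto (fun T : ℝ => C / (1 + T ^ 2) * |y - x|) atTop (𝓝 0) := by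
    have h1 : Tendsto (fun T : ℝ => 1 + T ^ 2) atTop atTop :=
      tendsto_atTop_add_const_left _ _ (tendsto_pow_atTop two_ne_zero)
    simpa using (h1.const_div_atTop C).mul_const |y - x|
  have hhor : ∀ τ : ℝ → ℝ, (∀ T, τ T ^ 2 = T ^ 2) →
      Tendsto (fun T : ℝ => ∫ u in x..y, F (u + τ T * I)) atTop (𝓝 0) := fun τ hτ => by
    refine squeeze_zero_norm (fun T => ?_) hinv
    refine intervalIntegral.norm_integral_le_of_norm_le_const fun u hu => ?_
    rw [uIoc_of_le hxy] at hu
    have := norm_vertical_le hC (hx.trans hu.1) (τ T)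
    rwa [hτ] at this
  have h1 := hhor (fun T => -T) fun T => by ring
  have h2 := hhor (fun T => T) fun T => rfl
  have main := ((h1.sub h2).add ((hint hy).const_mul I)).sub
    ((hint hx).const_mul I)
  have h0 : ∀ T : ℝ, (∫ u in x..y, F (u + (-T : ℝ) * I))
      - (∫ u in x..y, F (u + T * I))
      + I * (∫ s in -T..T, F (y + s * I))
      - I * (∫ s in -T..T, F (x + s * I)) = 0 := fun T => by
    have := Complex.integral_boundary_rect_eq_zero_of_differentiableOn F
      (x + (-T : ℝ) * I) (y + T * I) (hF.mono fun z hz => ?_)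
    · simpa using this
    · rw [Complex.mem_reProdIm] at hz
      have := hz.1
      simp only [Complex.add_re, Complex.ofReal_re, Complex.mul_re, Complex.I_re, mul_zero,
        Complex.ofReal_im, Complex.I_im, mul_one, sub_self, add_zero] at this
      rw [uIcc_of_le hxy] at this
      exact hx.trans_le this.1
  have hz := tendsto_nhds_unique (main.congr h0) tendsto_const_nhds
  have : I * ((∫ s : ℝ, F (y + s * I)) - ∫ s : ℝ, F (x + s * I)) = 0 := by
    linear_combination hz
  exact (sub_eq_zero.1 ((mul_eq_zero.1 this).resolve_left Complex.I_ne_zero)).symm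

theorem integral_vertical_eq_zero (hF : DifferentiableOn ℂ F {z | 0 < z.re})
    (hC : ∀ z : ℂ, 0 < z.re → ‖F z‖ ≤ C / (1 + ‖z‖ ^ 2)) {x : ℝ} (hx : 0 < x) :
    ∫ s : ℝ, F (x + s * I) = 0 := by
  have h1 : Tendsto (fun y : ℝ => ∫ s : ℝ, F (y + s * I)) atTop (𝓝 (∫ _ : ℝ, (0 : ℂ))) := by
    refine tendsto_integral_filter_of_dominated_convergence (fun s => C / (1 + s ^ 2)) ?_ ?_ ?_ ?_
    · filter_upwards [eventually_gt_atTop 0] with y hy using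
        (continuous_vertical hF hy).aestronglyMeasurable
    · filter_upwards [eventually_gt_atTop 0] with y hy using
        Eventually.of_forall fun s => norm_vertical_le hC hy s
    · simpa only [div_eq_mul_inv] using integrable_inv_one_add_sq.const_mul C
    · refine Eventually.of_forall fun s => ?_
      have h2 : Tendsto (fun y : ℝ => 1 + (y ^ 2 + s ^ 2)) atTop atTop :=
        tendsto_atTop_add_const_left _ _ (tendsto_atTop_add_const_right _ _
          (tendsto_pow_atTop two_ne_zero))
      refine squeeze_zero_norm' ?_ (h2.const_div_atTop C)
      filter_upwards [eventually_gt_atTop 0] with y hy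
      rw [← norm_sq_vertical]
      exact hC _ (by simpa using hy)
  rw [integral_zero] at h1
  refine tendsto_nhds_unique (tendsto_const_nhds.congr' ?_) h1
  filter_upwards [eventually_ge_atTop x] with y hy using integral_vertical_eq hF hC hx hy

/-- Radial boundary values `F*(s)` at the points `-i s` of the imaginary axis, except at `0`. -/
def RadialLimit (F : ℂ → ℂ) (Fs : ℝ → ℂ) : Prop :=
  ∀ s : ℝ, s ≠ 0 → Tendsto (fun x : ℝ => F (x - s * I)) (𝓝[>] 0) (𝓝 (Fs s))

theorem ae_ne_zero : ∀ᵐ s : ℝ, s ≠ 0 := by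
  simp [ae_iff, measure_singleton]

theorem integral_boundary_eq_zero (hF : DifferentiableOn ℂ F {z | 0 < z.re})
    (hC : ∀ z : ℂ, 0 < z.re → ‖F z‖ ≤ C / (1 + ‖z‖ ^ 2)) {Fs : ℝ → ℂ} (hs : RadialLimit F Fs) :
    Integrable Fs ∧ ∫ s, Fs s = 0 := by
  have hm : ∀ᶠ x : ℝ in 𝓝[>] 0, 0 < x := self_mem_nhdsWithin
  have hsub : ∀ x s : ℝ, F (x - s * I) = F (x + (-s : ℝ) * I) := fun x s => by
    push_cast; ring_nf
  have hcont : ∀ x : ℝ, 0 < x → AEStronglyMeasurable fun s : ℝ => F (x - s * I) :=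
    fun x hx => by
      simp only [hsub]
      exact ((continuous_vertical hF hx).comp continuous_neg).aestronglyMeasurable
  have hb : ∀ x s : ℝ, 0 < x → ‖F (x - s * I)‖ ≤ C / (1 + s ^ 2) := fun x s hx => by
    have := norm_vertical_le hC hx (-s)
    rwa [neg_sq, ← hsub] at this
  have hlim : ∀ᵐ s : ℝ, Tendsto (fun x : ℝ => F (x - s * I)) (𝓝[>] 0) (𝓝 (Fs s)) := by
    filter_upwards [ae_ne_zero] with s h0 using hs s h0
  constructor
  · obtain ⟨u, hu⟩ := exists_seq_tendsto (𝓝[>] (0 : ℝ))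
    obtain ⟨m, hm'⟩ := (hu.eventually hm).exists_forall_of_atTop
    refine integrable_of_bound (C := C) (aestronglyMeasurable_of_tendsto_ae atTop
      (f := fun (k : ℕ) (s : ℝ) => F ((u (k + m) : ℝ) - s * I)) (fun k => hcont (u (k + m)) (hm' (k + m) (by omega))) ?_) ?_
    · filter_upwards [hlim] with s h1
      exact (h1.comp hu).comp (tendsto_add_atTop_nat m)
    · filter_upwards [hlim] with s h1
      exact le_of_tendsto h1.norm (hm.mono fun x hx => hb x s hx)
  · have h1 : Tendsto (fun x : ℝ => ∫ s : ℝ, F (x - s * I)) (𝓝[>] 0) (𝓝 (∫ s, Fs s)) := by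
      refine tendsto_integral_filter_of_dominated_convergence (fun s => C / (1 + s ^ 2)) ?_ ?_ ?_ hlim
      · filter_upwards [hm] with x hx using hcont x hx
      · filter_upwards [hm] with x hx using Eventually.of_forall fun s => hb x s hx
      · simpa only [div_eq_mul_inv] using integrable_inv_one_add_sq.const_mul C
    refine tendsto_nhds_unique h1 (tendsto_const_nhds.congr' ?_)
    filter_upwards [hm] with x hx
    simp only [hsub]
    rw [integral_neg_eq_self (fun s : ℝ => F (x + s * I)), integral_vertical_eq_zero hF hC hx]

/-- In the right half-plane, `1 / (z + x)` is of the order of `1 / (1 + ‖z‖)`. -/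
theorem exists_le_norm_add_of_re {x : ℂ} (hx : 0 < x.re) :
    ∃ δ > 0, ∀ z : ℂ, 0 ≤ z.re → 1 + ‖z‖ ≤ δ * ‖z + x‖ := by
  refine ⟨(1 + ‖x‖) / x.re + 1, by positivity, fun z hz => ?_⟩
  have h1 : x.re ≤ ‖z + x‖ := by
    have := Complex.re_le_norm (z + x)
    rw [Complex.add_re] at this
    linarith
  have h2 : ‖z‖ ≤ ‖z + x‖ + ‖x‖ := by simpa using norm_sub_le (z + x) x
  have h3 : 1 + ‖x‖ ≤ (1 + ‖x‖) / x.re * ‖z + x‖ := by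
    rw [div_mul_eq_mul_div, le_div_iff₀ hx]
    exact mul_le_mul_of_nonneg_left h1 (by positivity)
  linarith

theorem add_ne_zero_of_re {x z : ℂ} (hx : 0 < x.re) (hz : 0 ≤ z.re) : z + x ≠ 0 := fun h => by
  have := congrArg Complex.re h
  simp only [Complex.add_re, Complex.zero_re] at this
  linarith

theorem one_add_sq_le (t : ℝ) (ht : 0 ≤ t) : (1 + t ^ 2 : ℝ) ≤ (1 + t) ^ 2 := by nlinarith

theorem norm_le_of_mul_bounds {u v : ℂ} {A B t : ℝ} (ht : 0 ≤ t) (hu : ‖u‖ * (1 + t) ≤ A)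
    (hv : ‖v‖ * (1 + t) ≤ B) : ‖u * v‖ ≤ A * B / (1 + t ^ 2) := by
  rw [le_div_iff₀ (by positivity), norm_mul]
  calc ‖u‖ * ‖v‖ * (1 + t ^ 2) ≤ ‖u‖ * ‖v‖ * (1 + t) ^ 2 :=
        mul_le_mul_of_nonneg_left (one_add_sq_le t ht) (by positivity)
    _ = ‖u‖ * (1 + t) * (‖v‖ * (1 + t)) := by ring
    _ ≤ A * B := mul_le_mul hu hv (by positivity) ((by positivity : (0:ℝ) ≤ ‖u‖ * (1 + t)).trans hu)

theorem exists_norm_inv_add_le {x : ℂ} (hx : 0 < x.re) :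
    ∃ δ, ∀ z : ℂ, 0 ≤ z.re → ‖1 / (z + x)‖ * (1 + ‖z‖) ≤ δ := by
  obtain ⟨δ, -, h⟩ := exists_le_norm_add_of_re hx
  refine ⟨δ, fun z hz => ?_⟩
  rw [norm_div, norm_one, one_div_mul_eq_div, div_le_iff₀ (norm_pos_iff.2 (add_ne_zero_of_re hx hz))]
  exact h z hz

theorem differentiableOn_inv_add {x : ℂ} (hx : 0 < x.re) :
    DifferentiableOn ℂ (fun z => 1 / (z + x)) {z | 0 < z.re} := fun _ hz =>
  ((differentiableAt_const 1).div (differentiableAt_id.add_const x)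
    (add_ne_zero_of_re hx (le_of_lt hz))).differentiableWithinAt

theorem tendsto_radial (s : ℝ) :
    Tendsto (fun x : ℝ => (x : ℂ) - s * I) (𝓝[>] 0) (𝓝 (-(s * I))) := by
  have h : ContinuousAt (fun x : ℝ => (x : ℂ) - s * I) 0 := by fun_prop
  simpa using h.tendsto.mono_left (nhdsWithin_le_nhds (s := Ioi 0))

theorem tendsto_radial_inv_add {x : ℂ} (hx : 0 < x.re) (s : ℝ) :
    Tendsto (fun y : ℝ => 1 / ((y : ℂ) - s * I + x)) (𝓝[>] 0)
      (𝓝 (1 / (x - s * I))) := by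
  have h1 := (tendsto_radial s).add_const x
  rw [neg_add_eq_sub] at h1
  refine tendsto_const_nhds.div h1 ?_
  have := add_ne_zero_of_re hx (z := -(s * I)) (by simp)
  rwa [neg_add_eq_sub] at this

theorem integral_mirror_eq_zero {m : ℂ → ℂ} {ms : ℝ → ℂ} (hm : DifferentiableOn ℂ m {z | 0 < z.re})
    (hC : ∀ z : ℂ, 0 < z.re → ‖m z‖ * (1 + ‖z‖) ≤ C) (hs : RadialLimit m ms) {x : ℂ}
    (hx : 0 < x.re) : Integrable (fun s => ms s * (1 / (x - s * I))) ∧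
      ∫ s, ms s * (1 / (x - s * I)) = 0 := by
  obtain ⟨δ, hδ⟩ := exists_norm_inv_add_le hx
  exact integral_boundary_eq_zero (F := fun z => m z * (1 / (z + x))) (C := C * δ)
    (hm.mul (differentiableOn_inv_add hx))
    (fun z hz => norm_le_of_mul_bounds (norm_nonneg z) (hC z hz) (hδ z (le_of_lt hz)))
    fun s h0 => (hs s h0).mul (tendsto_radial_inv_add hx s)

theorem radialLimit_inv_add {x : ℂ} (hx : 0 < x.re) :
    RadialLimit (fun z => 1 / (z + x)) fun s => 1 / (x - s * I) :=
  fun s _ => tendsto_radial_inv_add hx s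

theorem integral_inv_mul_inv {x : ℂ} (hx : 0 < x.re) :
    Integrable (fun s : ℝ => 1 / ((1 - s * I) * (x + s * I))) ∧
    ∫ s : ℝ, 1 / ((1 - s * I) * (x + s * I)) = 2 * Real.pi / (x + 1) := by
  have h1 : (0 : ℝ) < (1 : ℂ).re := by simp
  obtain ⟨δ, hδ⟩ := exists_norm_inv_add_le h1
  obtain ⟨i1, e1⟩ := integral_mirror_eq_zero (differentiableOn_inv_add h1)
    (fun z hz => hδ z (le_of_lt hz)) (radialLimit_inv_add h1) hx
  have i2 := i1.comp_neg
  have e2 := integral_neg_eq_self (fun s : ℝ => 1 / (1 - s * I) * (1 / (x - s * I)))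
    volume
  rw [e1] at e2
  have e3 : ∫ s : ℝ, ((1 + s ^ 2 : ℝ)⁻¹ : ℂ) = Real.pi := by
    rw [← integral_univ_inv_one_add_sq, ← integral_complex_ofReal]
    simp
  have i3 : Integrable fun s : ℝ => ((1 + s ^ 2 : ℝ)⁻¹ : ℂ) := by
    simpa using integrable_inv_one_add_sq.ofReal (𝕜 := ℂ)
  have hx1 : x + 1 ≠ 0 := add_ne_zero_of_re h1 hx.le
  have key : ∀ s : ℝ, 1 / ((1 - s * I) * (x + s * I))
      = 1 / (x + 1) * (2 * ((1 + s ^ 2 : ℝ)⁻¹ : ℂ) + (1 - x)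
        * (1 / (1 - (-s : ℝ) * I) * (1 / (x - (-s : ℝ) * I)))) := fun s => by
    have a1 : (1 - s * I : ℂ) ≠ 0 := by
      have := add_ne_zero_of_re h1 (z := -(s * I)) (by simp)
      rwa [neg_add_eq_sub] at this
    have a2 : (1 + s * I : ℂ) ≠ 0 := by
      have := add_ne_zero_of_re h1 (z := s * I) (by simp)
      rwa [add_comm] at this
    have a3 : (x + s * I : ℂ) ≠ 0 := by
      have := add_ne_zero_of_re hx (z := s * I) (by simp)
      rwa [add_comm] at this
    have a4 : ((1 + s ^ 2 : ℝ) : ℂ) = (1 - s * I) * (1 + s * I) := by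
      push_cast
      linear_combination (s : ℂ) ^ 2 * Complex.I_sq
    rw [a4, show (1 - (-s : ℝ) * I : ℂ) = 1 + s * I by push_cast; ring,
      show (x - (-s : ℝ) * I : ℂ) = x + s * I by push_cast; ring]
    field_simp
    ring
  simp only [key]
  constructor
  · exact ((i3.const_mul 2).add (i2.const_mul _)).const_mul _
  · rw [integral_const_mul, integral_add (i3.const_mul 2) (i2.const_mul _), integral_const_mul,
      integral_const_mul, e3, e2]
    ring

theorem exists_norm_dslope_le {N : ℂ → ℂ} {w : ℂ → ℝ} (hN : DifferentiableOn ℂ N {z | 0 < z.re})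
    (hw : ∀ z, 1 ≤ w z) {C : ℝ} (hC : ∀ z : ℂ, 0 < z.re → ‖N z‖ ≤ C * w z) {x : ℂ} (hx : 0 < x.re) :
    ∃ B, ∀ z : ℂ, 0 < z.re → ‖dslope N x z‖ * (1 + ‖z‖) ≤ B * w z := by
  have hopen : IsOpen {z : ℂ | 0 < z.re} := isOpen_lt continuous_const Complex.continuous_re
  obtain ⟨r, hr, hball⟩ := Metric.nhds_basis_closedBall.mem_iff.1 (hopen.mem_nhds hx)
  have hd : DifferentiableOn ℂ (dslope N x) {z | 0 < z.re} :=
    (Complex.differentiableOn_dslope (hopen.mem_nhds hx)).2 hN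
  obtain ⟨B₁, hB₁⟩ := (isCompact_closedBall x r).exists_bound_of_continuousOn
    (hd.continuousOn.mono hball)
  have hC0 : 0 ≤ C := by
    have h1 := (norm_nonneg _).trans (hC x hx)
    by_contra hneg
    exact absurd h1 (not_le.2 (mul_neg_of_neg_of_pos (not_le.1 hneg) (by linarith [hw x])))
  have hB0 : 0 ≤ B₁ := (norm_nonneg _).trans (hB₁ x (Metric.mem_closedBall_self hr.le))
  refine ⟨B₁ * (1 + (r + ‖x‖)) + (C + ‖N x‖) * ((1 + ‖x‖) / r + 1), fun z hz => ?_⟩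
  have hwz := hw z
  by_cases hzr : z ∈ Metric.closedBall x r
  · have h1 : ‖z‖ ≤ r + ‖x‖ := by
      have h2 : ‖z - x‖ ≤ r := by simpa [dist_eq_norm] using hzr
      have h3 : ‖z‖ ≤ ‖z - x‖ + ‖x‖ := by simpa using norm_add_le (z - x) x
      linarith
    have h2 : ‖dslope N x z‖ * (1 + ‖z‖) ≤ B₁ * (1 + (r + ‖x‖)) :=
      mul_le_mul (hB₁ z hzr) (by linarith) (by positivity) hB0
    have h3 : 0 ≤ (C + ‖N x‖) * ((1 + ‖x‖) / r + 1) := by positivity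
    have h4 : 0 ≤ B₁ * (1 + (r + ‖x‖)) := by positivity
    nlinarith
  · have h1 : r < ‖z - x‖ := by simpa [dist_eq_norm] using hzr
    have hne : z ≠ x := fun h => by rw [h, sub_self, norm_zero] at h1; linarith
    have h2 : ‖dslope N x z‖ * ‖z - x‖ ≤ (C + ‖N x‖) * w z := by
      rw [dslope_of_ne _ hne, slope_def_field, ← norm_mul, div_mul_cancel₀ _ (sub_ne_zero.2 hne)]
      calc ‖N z - N x‖ ≤ ‖N z‖ + ‖N x‖ := norm_sub_le _ _
        _ ≤ C * w z + ‖N x‖ * w z := add_le_add (hC z hz) (le_mul_of_one_le_right (norm_nonneg _) hwz)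
        _ = _ := by ring
    have h3 : 1 + ‖z‖ ≤ ((1 + ‖x‖) / r + 1) * ‖z - x‖ := by
      have h4 : ‖z‖ ≤ ‖z - x‖ + ‖x‖ := by simpa using norm_add_le (z - x) x
      have h5 : 1 + ‖x‖ ≤ (1 + ‖x‖) / r * ‖z - x‖ := by
        rw [div_mul_eq_mul_div, le_div_iff₀ hr]
        exact mul_le_mul_of_nonneg_left h1.le (by positivity)
      linarith
    calc ‖dslope N x z‖ * (1 + ‖z‖) ≤ ‖dslope N x z‖ * (((1 + ‖x‖) / r + 1) * ‖z - x‖) :=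
          mul_le_mul_of_nonneg_left h3 (norm_nonneg _)
      _ = ((1 + ‖x‖) / r + 1) * (‖dslope N x z‖ * ‖z - x‖) := by ring
      _ ≤ ((1 + ‖x‖) / r + 1) * ((C + ‖N x‖) * w z) := mul_le_mul_of_nonneg_left h2 (by positivity)
      _ ≤ _ := by
        have : 0 ≤ B₁ * (1 + (r + ‖x‖)) * w z := by positivity
        linarith

/-- Cauchy's formula for the right half-plane. -/
theorem integral_cauchy {m : ℂ → ℂ} {ms : ℝ → ℂ} (hm : DifferentiableOn ℂ m {z | 0 < z.re})
    (hC : ∀ z : ℂ, 0 < z.re → ‖m z‖ * (1 + ‖z‖) ≤ C) (hs : RadialLimit m ms) {x : ℂ}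
    (hx : 0 < x.re) : Integrable (fun s => ms s / (x + s * I)) ∧
      ∫ s, ms s / (x + s * I) = 2 * Real.pi * m x := by
  have h1 : (0 : ℝ) < (1 : ℂ).re := by simp
  have hopen : IsOpen {z : ℂ | 0 < z.re} := isOpen_lt continuous_const Complex.continuous_re
  set N : ℂ → ℂ := fun z => (z + 1) * m z with hN
  have hNd : DifferentiableOn ℂ N {z | 0 < z.re} := (differentiableOn_id.add_const 1).mul hm
  have hNC : ∀ z : ℂ, 0 < z.re → ‖N z‖ ≤ C * 1 := fun z hz => by
    rw [hN, norm_mul, mul_one, mul_comm]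
    refine (mul_le_mul_of_nonneg_left ?_ (norm_nonneg _)).trans (hC z hz)
    have := norm_add_le z 1
    rw [norm_one] at this
    linarith
  obtain ⟨B, hB⟩ := exists_norm_dslope_le (w := fun _ => 1) hNd (fun _ => le_rfl) hNC hx
  obtain ⟨δ, hδ⟩ := exists_norm_inv_add_le h1
  have hF := integral_boundary_eq_zero (F := fun z => dslope N x z * (1 / (z + 1)))
    (C := B * δ) (Fs := fun s => -(ms s / (x + s * I))
      + N x * (1 / ((1 - s * I) * (x + s * I))))
    (((Complex.differentiableOn_dslope (hopen.mem_nhds hx)).2 hNd).mul (differentiableOn_inv_add h1))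
    (fun z hz => norm_le_of_mul_bounds (norm_nonneg z) (by simpa using hB z hz)
      (hδ z (le_of_lt hz))) fun s h0 => by
    have a1 : (1 - s * I : ℂ) ≠ 0 := by
      have := add_ne_zero_of_re h1 (z := -(s * I)) (by simp)
      rwa [neg_add_eq_sub] at this
    have a3 : (x + s * I : ℂ) ≠ 0 := by
      have := add_ne_zero_of_re hx (z := s * I) (by simp)
      rwa [add_comm] at this
    have l1 := (tendsto_radial s).sub_const x
    have hne : -(s * I) - x ≠ 0 := fun h => a3 (by linear_combination -h)
    have l2 := (((((tendsto_radial s).add_const 1).mul (hs s h0)).sub_const (N x)).div l1 hne).mul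
      (tendsto_radial_inv_add h1 s)
    have e1 : ((-(s * I) + 1) * ms s - N x) / (-(s * I) - x)
        * (1 / (1 - s * I)) = -(ms s / (x + s * I))
      + N x * (1 / ((1 - s * I) * (x + s * I))) := by
      rw [show -(s * I) - x = -(x + s * I) by ring, neg_add_eq_sub]
      field_simp
      ring
    rw [e1] at l2
    refine l2.congr' ?_
    filter_upwards [l1.eventually_ne hne] with y hy
    rw [dslope_of_ne _ (sub_ne_zero.1 hy), slope_def_field]
    rfl
  obtain ⟨i0, e0⟩ := integral_inv_mul_inv hx
  have i1 : Integrable fun s => ms s / (x + s * I) := by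
    have := ((i0.const_mul (N x)).sub hF.1)
    refine this.congr (Eventually.of_forall fun s => ?_)
    simp only [Pi.sub_apply]
    ring
  refine ⟨i1, ?_⟩
  have h2 := hF.2
  have i1' : Integrable fun s => -(ms s / (x + s * I)) := i1.neg
  rw [integral_add i1' (i0.const_mul _), integral_neg, integral_const_mul, e0] at h2
  have hx1 : x + 1 ≠ 0 := add_ne_zero_of_re h1 hx.le
  have e3 : N x * (2 * Real.pi / (x + 1)) = 2 * Real.pi * m x := by
    simp only [hN]
    field_simp
  rw [e3] at h2
  linear_combination -h2

end

/-! ### Cauchy integrals along the boundary of a half-plane -/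

/-- The Cauchy integral, over the points `-i t` of the imaginary axis. -/
def lineCauchy (φ : ℝ → ℂ) (w : ℂ) : ℂ := 1 / (2 * Real.pi) * ∫ t : ℝ, φ t / (w + t * I)

structure IsDensity (φ : ℝ → ℂ) : Prop where
  cont : ContinuousOn φ {0}ᶜ
  bound : ∃ C, ∀ t, ‖φ t‖ * (1 + |t|) ≤ C

theorem aestronglyMeasurable_of_continuousOn_compl {f : ℝ → ℂ} {a : ℝ}
    (h : ContinuousOn f {a}ᶜ) : AEStronglyMeasurable f := by
  have h1 := h.aestronglyMeasurable (μ := volume) (measurableSet_singleton a).compl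
  rwa [Measure.restrict_eq_self_of_ae_mem (by simp [ae_iff, measure_singleton])] at h1

theorem tendsto_ofReal_cocompact : Tendsto (fun y : ℝ => (y : ℂ)) atTop (cocompact ℂ) := by
  rw [← Metric.cobounded_eq_cocompact, ← tendsto_norm_atTop_iff_cobounded]
  simpa using tendsto_abs_atTop_atTop

theorem norm_mul_I (t : ℝ) : ‖(t * I : ℂ)‖ = |t| := by simp

namespace IsDensity

variable {φ : ℝ → ℂ}

theorem comp_neg (h : IsDensity φ) : IsDensity fun t => φ (-t) := by
  obtain ⟨C, hC⟩ := h.bound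
  exact ⟨h.cont.comp continuous_neg.continuousOn fun t ht => neg_ne_zero.2 ht,
    C, fun t => by simpa using hC (-t)⟩

theorem exists_bound (h : IsDensity φ) : ∃ C, ∀ t, ‖φ t‖ ≤ C := by
  obtain ⟨C, hC⟩ := h.bound
  exact ⟨C, fun t => (le_mul_of_one_le_right (norm_nonneg _)
    (by linarith [abs_nonneg t])).trans (hC t)⟩

theorem aestronglyMeasurable_div (h : IsDensity φ) (w : ℂ) (hw : w.re ≠ 0) :
    AEStronglyMeasurable fun t : ℝ => φ t / (w + t * I) := by
  simp only [div_eq_mul_inv]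
  refine aestronglyMeasurable_of_continuousOn_compl (a := 0)
    (h.cont.fun_mul (Continuous.continuousOn (Continuous.inv₀ (by fun_prop) fun t h0 => hw ?_)))
  simpa using congrArg Complex.re h0

/-- The kernel, uniformly near a point of the right half-plane. -/
theorem exists_bound_div (h : IsDensity φ) {w : ℂ} (hw : 0 < w.re) :
    ∃ A δ, ∀ w' ∈ Metric.ball w (w.re / 2), ∀ t : ℝ,
      ‖φ t / (w' + t * I)‖ ≤ A / (1 + t ^ 2) ∧
      1 + |t| ≤ δ * ‖w' + t * I‖ := by
  obtain ⟨C, hC⟩ := h.bound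
  obtain ⟨δ, hδ0, hδ⟩ := exists_le_norm_add_of_re hw
  refine ⟨C * (2 * δ), 2 * δ, fun w' hw' t => ?_⟩
  have h0 : ‖w - w'‖ < w.re / 2 := by simpa [dist_comm, dist_eq_norm] using hw'
  have h1 := hδ (t * I) (by simp)
  rw [norm_mul_I, add_comm (t * I : ℂ)] at h1
  have h2 : w.re / 2 ≤ w'.re := by
    have := (Complex.re_le_norm (w - w')).trans h0.le
    rw [Complex.sub_re] at this
    linarith
  have h3 : w'.re ≤ ‖w' + t * I‖ := by
    have := Complex.re_le_norm (w' + t * I)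
    simpa using this
  have h4 : ‖w + t * I‖ ≤ ‖w' + t * I‖ + ‖w - w'‖ := by
    have := norm_add_le (w' + t * I) (w - w')
    rwa [show w' + t * I + (w - w') = w + t * I by ring] at this
  have h5 : 1 + |t| ≤ 2 * δ * ‖w' + t * I‖ := by
    refine h1.trans ?_
    rw [mul_comm 2 δ, mul_assoc]
    exact mul_le_mul_of_nonneg_left (by linarith) hδ0.le
  refine ⟨?_, h5⟩
  have hpos : 0 < ‖w' + t * I‖ := by linarith
  have h6 := norm_le_of_mul_bounds (u := φ t) (v := 1 / (w' + t * I)) (abs_nonneg t) (hC t)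
    (B := 2 * δ) (by rwa [norm_div, norm_one, one_div_mul_eq_div, div_le_iff₀ hpos])
  rwa [sq_abs, mul_one_div] at h6

theorem integrable_div (h : IsDensity φ) {w : ℂ} (hw : 0 < w.re) :
    Integrable fun t : ℝ => φ t / (w + t * I) := by
  obtain ⟨A, δ, hA⟩ := h.exists_bound_div hw
  exact integrable_of_bound (h.aestronglyMeasurable_div w hw.ne') (Eventually.of_forall fun t =>
    (hA w (Metric.mem_ball_self (by linarith)) t).1)

theorem lineCauchy_neg (φ : ℝ → ℂ) (w : ℂ) :
    lineCauchy φ (-w) = -lineCauchy (fun t => φ (-t)) w := by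
  unfold lineCauchy
  rw [← integral_neg_eq_self, ← mul_neg, ← integral_neg]
  congr 2
  funext t
  rw [← div_neg]
  push_cast
  ring_nf

theorem integrable_div_neg (h : IsDensity φ) {w : ℂ} (hw : 0 < w.re) :
    Integrable fun t : ℝ => φ t / (-w + t * I) := by
  have h1 := (h.comp_neg.integrable_div hw).comp_neg.neg
  refine h1.congr (Eventually.of_forall fun t => ?_)
  simp only [Pi.neg_apply, neg_neg]
  rw [← div_neg]
  push_cast
  ring_nf

theorem differentiableOn (h : IsDensity φ) : DifferentiableOn ℂ (lineCauchy φ) {z | 0 < z.re} := by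
  intro w hw
  have hw : 0 < w.re := hw
  obtain ⟨A, δ, hA⟩ := h.exists_bound_div hw
  have hball : Metric.ball w (w.re / 2) ∈ 𝓝 w := Metric.ball_mem_nhds w (by linarith)
  have hne : ∀ w' ∈ Metric.ball w (w.re / 2), ∀ t : ℝ, w' + t * I ≠ 0 :=
    fun w' hw' t h0 => by
      have := (hA w' hw' t).2
      rw [h0, norm_zero, mul_zero] at this
      linarith [abs_nonneg t]
  have hre : ∀ w' ∈ Metric.ball w (w.re / 2), w'.re ≠ 0 := fun w' hw' h0 =>
    hne w' hw' (-w'.im) (Complex.ext (by simp [h0]) (by simp))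
  have main := hasDerivAt_integral_of_dominated_loc_of_deriv_le (μ := volume)
    (F := fun w' (t : ℝ) => φ t / (w' + t * I))
    (F' := fun w' (t : ℝ) => -(φ t / (w' + t * I) * (1 / (w' + t * I))))
    (bound := fun t => A / (1 + t ^ 2) * |δ|) (x₀ := w) hball
    (by filter_upwards [hball] with w' hw' using h.aestronglyMeasurable_div w' (hre w' hw'))
    (h.integrable_div hw)
    ((h.aestronglyMeasurable_div w hw.ne').mul (Continuous.aestronglyMeasurable (by
      refine continuous_const.div (by fun_prop) fun t => hne w (Metric.mem_ball_self (by linarith)) t))).neg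
    (Eventually.of_forall fun t w' hw' => ?_) ?_ (Eventually.of_forall fun t w' hw' => ?_)
  · exact (main.2.const_mul _).differentiableAt.differentiableWithinAt
  · have h1 := hA w' hw' t
    have hpos : 0 < ‖w' + t * I‖ := norm_pos_iff.2 (hne w' hw' t)
    rw [norm_neg, norm_mul]
    refine mul_le_mul h1.1 ?_ (norm_nonneg _) ((norm_nonneg _).trans h1.1)
    rw [norm_div, norm_one, div_le_iff₀ hpos]
    have := mul_le_mul_of_nonneg_right (le_abs_self δ) hpos.le
    linarith [h1.2, abs_nonneg t]
  · exact (by simpa only [div_eq_mul_inv] using integrable_inv_one_add_sq.const_mul A :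
      Integrable fun t : ℝ => A / (1 + t ^ 2)).mul_const _
  · have hd := ((hasDerivAt_const w' (φ t)).div ((hasDerivAt_id w').add_const (t * I))
      (hne w' hw' t))
    refine hd.congr_deriv ?_
    have := hne w' hw' t
    simp only [id]
    field_simp
    ring

theorem differentiableOn_neg (h : IsDensity φ) :
    DifferentiableOn ℂ (fun z => lineCauchy φ (-z)) {z | 0 < z.re} := by
  simp only [lineCauchy_neg]
  exact h.comp_neg.differentiableOn.neg

theorem tendsto_atTop (h : IsDensity φ) :
    Tendsto (fun y : ℝ => lineCauchy φ y) atTop (𝓝 0) := by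
  obtain ⟨C, hC⟩ := h.bound
  obtain ⟨δ, -, hδ⟩ := exists_le_norm_add_of_re (x := 1) (by simp)
  have h1 : Tendsto (fun y : ℝ => ∫ t : ℝ, φ t / (y + t * I)) atTop
      (𝓝 (∫ _ : ℝ, (0 : ℂ))) := by
    refine tendsto_integral_filter_of_dominated_convergence (fun t => C * δ / (1 + t ^ 2))
      ?_ ?_ ?_ (Eventually.of_forall fun t => ?_)
    · filter_upwards [eventually_gt_atTop 0] with y hy using
        h.aestronglyMeasurable_div y (by simpa using hy.ne')
    · filter_upwards [eventually_ge_atTop 1] with y hy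
      refine Eventually.of_forall fun t => ?_
      have h2 : ‖(t * I + 1 : ℂ)‖ ≤ ‖(y + t * I : ℂ)‖ := by
        rw [← sq_le_sq₀ (norm_nonneg _) (norm_nonneg _), norm_sq_vertical, add_comm,
          ← Complex.ofReal_one, norm_sq_vertical]
        nlinarith
      have h3 := hδ (t * I) (by simp)
      have h4 : 0 < ‖(y + t * I : ℂ)‖ := by
        refine norm_pos_iff.2 fun h0 => ?_
        have := congrArg Complex.re h0
        simp at this
        linarith
      have hδ' : 0 ≤ δ := by
        by_contra hneg
        nlinarith [norm_nonneg (t * I + 1 : ℂ), norm_nonneg (t * I : ℂ)]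
      have h6 := norm_le_of_mul_bounds (u := φ t) (v := 1 / (y + t * I)) (abs_nonneg t)
        (hC t) (B := δ) (by
          rw [norm_div, norm_one, one_div_mul_eq_div, div_le_iff₀ h4]
          rw [norm_mul_I] at h3
          exact h3.trans (mul_le_mul_of_nonneg_left h2 hδ'))
      rwa [sq_abs, mul_one_div] at h6
    · simpa only [div_eq_mul_inv] using integrable_inv_one_add_sq.const_mul (C * δ)
    · have h2 : Tendsto (fun y : ℝ => (y : ℂ) + t * I) atTop (cocompact ℂ) := by
        have h3 := tendsto_norm_cocompact_atTop (E := ℂ)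
        rw [← Metric.cobounded_eq_cocompact, ← tendsto_norm_atTop_iff_cobounded]
        refine tendsto_atTop_mono (fun y => ?_) tendsto_id
        simpa using Complex.re_le_norm ((y : ℂ) + t * I)
      have h4 := ((tendsto_one_div_sub_cocompact 0).comp h2).const_mul (φ t)
      simpa [Function.comp_def, div_eq_mul_inv] using h4
  simpa [lineCauchy] using h1.const_mul (1 / (2 * Real.pi : ℂ))

/-- The jump of the Cauchy integral is a Poisson integral. -/
theorem lineCauchy_sub (h : IsDensity φ) {x : ℝ} (hx : 0 < x) (s : ℝ) :
    lineCauchy φ (x - s * I) - lineCauchy φ (-(x + s * I))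
      = 1 / Real.pi * ∫ u : ℝ, φ (s + x * u) * ((1 + u ^ 2 : ℝ)⁻¹ : ℂ) := by
  have i1 := h.integrable_div (w := x - s * I) (by simpa using hx)
  have i2 := h.integrable_div_neg (w := x + s * I) (by simpa using hx)
  unfold lineCauchy
  rw [← mul_sub, ← integral_sub i1 i2]
  set G : ℝ → ℂ := fun t => φ t / (x - s * I + t * I)
    - φ t / (-(x + s * I) + t * I) with hG
  have e1 : ∀ u : ℝ, G (s + x * u) = 2 / x * (φ (s + x * u) * ((1 + u ^ 2 : ℝ)⁻¹ : ℂ)) := fun u => by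
    have hx' : (x : ℂ) ≠ 0 := by exact_mod_cast hx.ne'
    have a1 : (1 + u * I : ℂ) ≠ 0 := by
      have := add_ne_zero_of_re (x := 1) (by simp) (z := u * I) (by simp)
      rwa [add_comm] at this
    have a2 : (-1 + u * I : ℂ) ≠ 0 := by
      have := add_ne_zero_of_re (x := 1) (by simp) (z := -(u * I)) (by simp)
      intro h0
      exact this (by linear_combination -h0)
    have a4 : ((1 + u ^ 2 : ℝ) : ℂ) = -((-1 + u * I) * (1 + u * I)) := by
      push_cast
      linear_combination (u : ℂ) ^ 2 * Complex.I_sq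
    rw [a4]
    simp only [hG]
    rw [show (x - s * I + ((s + x * u : ℝ) : ℂ) * I : ℂ)
        = x * (1 + u * I) by push_cast; ring,
      show (-(x + s * I) + ((s + x * u : ℝ) : ℂ) * I : ℂ)
        = x * (-1 + u * I) by push_cast; ring]
    field_simp
    ring
  have e2 : ∫ u : ℝ, G (s + x * u) = (x : ℂ)⁻¹ * ∫ t, G t := by
    rw [MeasureTheory.Measure.integral_comp_mul_left (fun v => G (s + v)) x,
      integral_add_left_eq_self G s, abs_of_pos (inv_pos.2 hx), Complex.real_smul]
    push_cast
    rfl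
  simp only [e1] at e2
  rw [integral_const_mul] at e2
  have hx' : (x : ℂ) ≠ 0 := by exact_mod_cast hx.ne'
  have e3 : ∫ t, G t = 2 * ∫ u : ℝ, φ (s + x * u) * ((1 + u ^ 2 : ℝ)⁻¹ : ℂ) := by
    generalize ∫ t, G t = A at *
    generalize ∫ u : ℝ, φ (s + x * u) * ((1 + u ^ 2 : ℝ)⁻¹ : ℂ) = B at *
    field_simp at e2
    linear_combination -e2
  rw [e3]
  field_simp

theorem continuousOn_comp_affine (h : IsDensity φ) {x : ℝ} (hx : x ≠ 0) (s : ℝ) :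
    ContinuousOn (fun u : ℝ => φ (s + x * u) * ((1 + u ^ 2 : ℝ)⁻¹ : ℂ)) {-s / x}ᶜ := by
  refine ContinuousOn.fun_mul (f := fun u : ℝ => φ (s + x * u)) (ContinuousOn.comp (g := φ)
    (f := fun u : ℝ => s + x * u) h.cont (by fun_prop) fun u hu h0 => hu ?_) ?_
  · have h0 : s + x * u = 0 := h0
    have : u = -s / x := by rw [eq_div_iff hx]; linarith
    exact this
  · refine Continuous.continuousOn (Continuous.inv₀ (by fun_prop) fun u => ?_)
    exact_mod_cast (by positivity : (0 : ℝ) < 1 + u ^ 2).ne'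

theorem norm_poisson_kernel_le {C : ℝ} (hC : ∀ t, ‖φ t‖ ≤ C) (t u : ℝ) :
    ‖φ t * ((1 + u ^ 2 : ℝ)⁻¹ : ℂ)‖ ≤ C * (1 + u ^ 2)⁻¹ := by
  rw [norm_mul, ← Complex.ofReal_inv, Complex.norm_real, Real.norm_eq_abs,
    abs_of_pos (by positivity : (0 : ℝ) < (1 + u ^ 2)⁻¹)]
  exact mul_le_mul_of_nonneg_right (hC t) (by positivity)

theorem exists_norm_jump_le (h : IsDensity φ) : ∃ B, ∀ x : ℝ, 0 < x → ∀ s : ℝ,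
    ‖lineCauchy φ (x - s * I) - lineCauchy φ (-(x + s * I))‖ ≤ B := by
  obtain ⟨C, hC⟩ := h.exists_bound
  refine ⟨‖(1 / Real.pi : ℂ)‖ * ∫ u : ℝ, C * (1 + u ^ 2)⁻¹, fun x hx s => ?_⟩
  rw [h.lineCauchy_sub hx, norm_mul]
  exact mul_le_mul_of_nonneg_left (norm_integral_le_of_norm_le
    (integrable_inv_one_add_sq.const_mul C)
    (Eventually.of_forall fun u => norm_poisson_kernel_le hC _ u)) (norm_nonneg _)

theorem tendsto_jump (h : IsDensity φ) {s : ℝ} (hs : s ≠ 0) :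
    Tendsto (fun x : ℝ => lineCauchy φ (x - s * I) - lineCauchy φ (-(x + s * I)))
      (𝓝[>] 0) (𝓝 (φ s)) := by
  obtain ⟨C, hC⟩ := h.exists_bound
  have h1 : Tendsto (fun x : ℝ => ∫ u : ℝ, φ (s + x * u) * ((1 + u ^ 2 : ℝ)⁻¹ : ℂ)) (𝓝[>] 0)
      (𝓝 (∫ u : ℝ, φ s * ((1 + u ^ 2 : ℝ)⁻¹ : ℂ))) := by
    refine tendsto_integral_filter_of_dominated_convergence (fun u => C * (1 + u ^ 2)⁻¹) ?_ ?_
      (integrable_inv_one_add_sq.const_mul C) (Eventually.of_forall fun u => ?_)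
    · filter_upwards [self_mem_nhdsWithin] with x hx using
        aestronglyMeasurable_of_continuousOn_compl (h.continuousOn_comp_affine (ne_of_gt hx) s)
    · exact Eventually.of_forall fun x => Eventually.of_forall fun u =>
        norm_poisson_kernel_le hC _ u
    · refine Tendsto.mul_const _ ?_
      have h2 : ContinuousAt φ s := h.cont.continuousAt (isOpen_ne.mem_nhds hs)
      refine h2.tendsto.comp ?_
      have h3 : ContinuousAt (fun x : ℝ => s + x * u) 0 := by fun_prop
      simpa using h3.tendsto.mono_left (nhdsWithin_le_nhds (s := Ioi 0))
  have h2 := h1.const_mul (1 / Real.pi : ℂ)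
  have e3 : ∫ u : ℝ, ((1 + u ^ 2 : ℝ)⁻¹ : ℂ) = Real.pi := by
    rw [← integral_univ_inv_one_add_sq, ← integral_complex_ofReal]
    simp
  rw [integral_const_mul, e3, show (1 / Real.pi : ℂ) * (φ s * Real.pi) = φ s by
    field_simp] at h2
  refine h2.congr' ?_
  filter_upwards [self_mem_nhdsWithin] with x hx using (h.lineCauchy_sub hx s).symm

end IsDensity

/-! ### The bilinear relation on the boundary of a half-plane -/

/-- Bounded solutions, in the right half-plane, of a singular integral equation on its boundary. -/
structure HalfPlaneSolves (Z : Finset ℂ) (f₀ : ℂ) (b : ℂ → ℂ) (φ : ℝ → ℂ) (f : ℂ → ℂ) : Prop where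
  pole : ∀ ζ ∈ Z, 0 < ζ.re
  density : IsDensity φ
  cont : ContinuousOn f {z | 0 ≤ z.re}
  bound : ∃ B, ∀ z : ℂ, 0 ≤ z.re → ‖f z‖ ≤ B
  eq : ∀ z : ℂ, 0 < z.re → f z = f₀ - ∑ ζ ∈ Z, b ζ / (z + ζ) + lineCauchy φ (-z)

namespace HalfPlaneSolves

variable {Z : Finset ℂ} {f₀ g₀ : ℂ} {b b' : ℂ → ℂ} {φ ψ : ℝ → ℂ} {f g : ℂ → ℂ}

theorem differentiableOn (h : HalfPlaneSolves Z f₀ b φ f) :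
    DifferentiableOn ℂ f {z | 0 < z.re} := by
  refine DifferentiableOn.congr (f := fun z => f₀ - ∑ ζ ∈ Z, b ζ * (1 / (z + ζ))
    + lineCauchy φ (-z)) ?_ fun z hz => by simpa only [mul_one_div] using h.eq z hz
  exact ((DifferentiableOn.fun_sum fun ζ hζ =>
    (differentiableOn_inv_add (h.pole ζ hζ)).const_mul (b ζ)).const_sub f₀).add
    h.density.differentiableOn_neg

theorem tendsto_atTop_sum (Z : Finset ℂ) (b : ℂ → ℂ) :
    Tendsto (fun y : ℝ => ∑ ζ ∈ Z, b ζ / ((y : ℂ) + ζ)) atTop (𝓝 0) := by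
  rw [← Finset.sum_const_zero (s := Z)]
  refine tendsto_finsetSum _ fun ζ _ => ?_
  have := ((tendsto_one_div_sub_cocompact (-ζ)).comp tendsto_ofReal_cocompact).const_mul (b ζ)
  simpa [Function.comp_def, div_eq_mul_inv] using this

theorem tendsto_atTop (h : HalfPlaneSolves Z f₀ b φ f) :
    Tendsto (fun y : ℝ => f y) atTop (𝓝 f₀) := by
  have h1 := ((tendsto_atTop_sum Z b).const_sub f₀).add h.density.comp_neg.tendsto_atTop.neg
  rw [sub_zero, neg_zero, add_zero] at h1
  refine h1.congr' ?_
  filter_upwards [eventually_gt_atTop 0] with y hy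
  rw [h.eq y (by simpa using hy), IsDensity.lineCauchy_neg]

theorem tendsto_radial_of (h : HalfPlaneSolves Z f₀ b φ f) (s : ℝ) :
    Tendsto (fun x : ℝ => f (x - s * I)) (𝓝[>] 0) (𝓝 (f (-(s * I)))) := by
  refine (h.cont (-(s * I)) (by simp)).tendsto.comp (tendsto_nhdsWithin_iff.2
    ⟨tendsto_radial s, ?_⟩)
  filter_upwards [self_mem_nhdsWithin] with x hx
  simpa using le_of_lt hx

/-- The continuation of `f(-z)` across the boundary, without its poles. -/
def cont' (f₀ : ℂ) (φ : ℝ → ℂ) (z : ℂ) : ℂ := f₀ + lineCauchy φ z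

theorem cont'_eq (h : HalfPlaneSolves Z f₀ b φ f) {x : ℝ} (hx : 0 < x) (s : ℝ) :
    cont' f₀ φ (x - s * I) = f (x + s * I)
      + ∑ ζ ∈ Z, b ζ * (1 / (x + s * I + ζ))
      + (lineCauchy φ (x - s * I) - lineCauchy φ (-(x + s * I))) := by
  have := h.eq (x + s * I) (by simpa using hx)
  simp only [mul_one_div]
  unfold cont'
  linear_combination -this

theorem exists_norm_cont'_le (h : HalfPlaneSolves Z f₀ b φ f) :
    ∃ B, ∀ z : ℂ, 0 < z.re → ‖cont' f₀ φ z‖ ≤ B := by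
  obtain ⟨B₁, h1⟩ := h.bound
  obtain ⟨B₂, h2⟩ := h.density.exists_norm_jump_le
  refine ⟨B₁ + ∑ ζ ∈ Z, ‖b ζ‖ * (1 / ζ.re) + B₂, fun z hz => ?_⟩
  have hz' : z = (z.re : ℂ) - ((-z.im : ℝ) : ℂ) * I := by
    conv_lhs => rw [← Complex.re_add_im z]
    push_cast; ring
  rw [hz', h.cont'_eq hz]
  refine (norm_add_le _ _).trans (add_le_add ((norm_add_le _ _).trans (add_le_add ?_ ?_)) (h2 _ hz _))
  · exact h1 _ (by simpa using hz.le)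
  · refine (norm_sum_le _ _).trans (Finset.sum_le_sum fun ζ hζ => ?_)
    rw [norm_mul, norm_div, norm_one]
    refine mul_le_mul_of_nonneg_left (one_div_le_one_div_of_le (h.pole ζ hζ) ?_) (norm_nonneg _)
    have := Complex.re_le_norm (z.re + ((-z.im : ℝ) : ℂ) * I + ζ)
    simp only [Complex.add_re, Complex.ofReal_re, Complex.mul_re, Complex.I_re, mul_zero,
      Complex.ofReal_im, Complex.I_im, mul_one, sub_self, add_zero] at this
    linarith

theorem tendsto_cont' (h : HalfPlaneSolves Z f₀ b φ f) {s : ℝ} (hs : s ≠ 0) :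
    Tendsto (fun x : ℝ => cont' f₀ φ (x - s * I)) (𝓝[>] 0)
      (𝓝 (f (s * I) + ∑ ζ ∈ Z, b ζ * (1 / (ζ + s * I)) + φ s)) := by
  have e : ∀ x : ℝ, (x : ℂ) - (-s : ℝ) * I = x + s * I := fun x => by
    push_cast; ring
  have h1 := h.tendsto_radial_of (-s)
  rw [show -(((-s : ℝ) : ℂ) * I) = s * I by push_cast; ring] at h1
  have h2 : Tendsto (fun x : ℝ => ∑ ζ ∈ Z, b ζ * (1 / (x - (-s : ℝ) * I + ζ))) (𝓝[>] 0)
      (𝓝 (∑ ζ ∈ Z, b ζ * (1 / (ζ - (-s : ℝ) * I)))) :=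
    tendsto_finsetSum _ fun ζ hζ => (tendsto_radial_inv_add (h.pole ζ hζ) (-s)).const_mul (b ζ)
  simp only [e] at h1 h2
  rw [show ∑ ζ ∈ Z, b ζ * (1 / (ζ - (-s : ℝ) * I))
    = ∑ ζ ∈ Z, b ζ * (1 / (ζ + s * I)) from Finset.sum_congr rfl fun ζ _ => by
      push_cast; ring_nf] at h2
  refine ((h1.add h2).add (h.density.tendsto_jump hs)).congr' ?_
  filter_upwards [self_mem_nhdsWithin] with x hx using (h.cont'_eq hx s).symm

variable {α₀ α₁ : ℂ}

/-- The numerators at the poles. -/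
def poleNum (α₀ α₁ : ℂ) (b b' f g : ℂ → ℂ) (ζ z : ℂ) : ℂ :=
  (α₀ + α₁ * z) * g z * b ζ - (α₀ - α₁ * z) * f z * b' ζ

/-- The Wronskian, continued from the boundary to the half-plane. -/
def wronskianCont (Z : Finset ℂ) (α₀ α₁ f₀ g₀ : ℂ) (φ ψ : ℝ → ℂ) (b b' f g : ℂ → ℂ) (z : ℂ) : ℂ :=
  (α₀ + α₁ * z) * g z * cont' f₀ φ z - (α₀ - α₁ * z) * f z * cont' g₀ ψ z
    + ∑ ζ ∈ Z, dslope (poleNum α₀ α₁ b b' f g ζ) ζ z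

theorem norm_linear_le (α₀ α₁ z : ℂ) : ‖α₀ + α₁ * z‖ ≤ (‖α₀‖ + ‖α₁‖) * (1 + ‖z‖) := by
  refine (norm_add_le _ _).trans ?_
  rw [norm_mul]
  nlinarith [norm_nonneg α₀, norm_nonneg α₁, norm_nonneg z, mul_nonneg (norm_nonneg α₀) (norm_nonneg z)]

theorem norm_linear_le' (α₀ α₁ z : ℂ) : ‖α₀ - α₁ * z‖ ≤ (‖α₀‖ + ‖α₁‖) * (1 + ‖z‖) := by
  simpa [sub_eq_add_neg] using norm_linear_le α₀ (-α₁) z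

theorem norm_mul_mul_le {l u v : ℂ} {E A B t : ℝ} (hl : ‖l‖ ≤ E * t) (hu : ‖u‖ ≤ A)
    (hv : ‖v‖ ≤ B) : ‖l * u * v‖ ≤ E * A * B * t := by
  rw [norm_mul, norm_mul]
  have hA := (norm_nonneg _).trans hu
  calc ‖l‖ * ‖u‖ * ‖v‖ ≤ E * t * A * B :=
        mul_le_mul (mul_le_mul hl hu (norm_nonneg _) ((norm_nonneg _).trans hl)) hv
          (norm_nonneg _) (mul_nonneg ((norm_nonneg _).trans hl) hA)
    _ = _ := by ring

theorem isOpen_re_pos : IsOpen {z : ℂ | 0 < z.re} :=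
  isOpen_lt continuous_const Complex.continuous_re

theorem differentiableOn_poleNum (hf : HalfPlaneSolves Z f₀ b φ f) (hg : HalfPlaneSolves Z g₀ b' ψ g)
    (ζ : ℂ) : DifferentiableOn ℂ (poleNum α₀ α₁ b b' f g ζ) {z | 0 < z.re} :=
  ((((differentiableOn_id.const_mul α₁).const_add α₀).mul hg.differentiableOn).mul_const (b ζ)).sub
    ((((differentiableOn_id.const_mul α₁).const_sub α₀).mul hf.differentiableOn).mul_const (b' ζ))

theorem exists_norm_poleNum_le (hf : HalfPlaneSolves Z f₀ b φ f)
    (hg : HalfPlaneSolves Z g₀ b' ψ g) (ζ : ℂ) :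
    ∃ C, ∀ z : ℂ, 0 < z.re → ‖poleNum α₀ α₁ b b' f g ζ z‖ ≤ C * (1 + ‖z‖) := by
  obtain ⟨A, hA⟩ := hf.bound
  obtain ⟨B, hB⟩ := hg.bound
  refine ⟨(‖α₀‖ + ‖α₁‖) * B * ‖b ζ‖ + (‖α₀‖ + ‖α₁‖) * A * ‖b' ζ‖, fun z hz => ?_⟩
  unfold poleNum
  have h1 := norm_mul_mul_le (v := b ζ) (norm_linear_le α₀ α₁ z) (hB z hz.le) le_rfl
  have h2 := norm_mul_mul_le (v := b' ζ) (norm_linear_le' α₀ α₁ z) (hA z hz.le) le_rfl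
  exact (norm_sub_le _ _).trans ((add_le_add h1 h2).trans_eq (add_mul _ _ _).symm)

theorem differentiableOn_wronskianCont (hf : HalfPlaneSolves Z f₀ b φ f)
    (hg : HalfPlaneSolves Z g₀ b' ψ g) :
    DifferentiableOn ℂ (wronskianCont Z α₀ α₁ f₀ g₀ φ ψ b b' f g) {z | 0 < z.re} := by
  refine (((((differentiableOn_id.const_mul α₁).const_add α₀).mul hg.differentiableOn).mul
    (hf.density.differentiableOn.const_add f₀)).sub
    ((((differentiableOn_id.const_mul α₁).const_sub α₀).mul hf.differentiableOn).mul
    (hg.density.differentiableOn.const_add g₀))).add (DifferentiableOn.fun_sum fun ζ hζ => ?_)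
  exact (Complex.differentiableOn_dslope (isOpen_re_pos.mem_nhds (hf.pole ζ hζ))).2
    (differentiableOn_poleNum hf hg ζ)

theorem exists_norm_sum_dslope_le (hf : HalfPlaneSolves Z f₀ b φ f)
    (hg : HalfPlaneSolves Z g₀ b' ψ g) : ∃ C, ∀ z : ℂ, 0 < z.re →
      ‖∑ ζ ∈ Z, dslope (poleNum α₀ α₁ b b' f g ζ) ζ z‖ ≤ C := by
  have h1 : ∀ ζ ∈ Z, ∃ C, ∀ z : ℂ, 0 < z.re → ‖dslope (poleNum α₀ α₁ b b' f g ζ) ζ z‖ ≤ C :=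
    fun ζ hζ => by
      obtain ⟨C, hC⟩ := exists_norm_poleNum_le (α₀ := α₀) (α₁ := α₁) hf hg ζ
      obtain ⟨B, hB⟩ := exists_norm_dslope_le (w := fun z => 1 + ‖z‖)
        (differentiableOn_poleNum (α₀ := α₀) (α₁ := α₁) hf hg ζ)
        (fun z => by linarith [norm_nonneg z]) hC (hf.pole ζ hζ)
      exact ⟨B, fun z hz => le_of_mul_le_mul_right (hB z hz) (by positivity)⟩
  choose! C hC using h1
  exact ⟨∑ ζ ∈ Z, C ζ, fun z hz => (norm_sum_le _ _).trans (Finset.sum_le_sum fun ζ hζ => hC ζ hζ z hz)⟩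

theorem exists_norm_wronskianCont_le (hf : HalfPlaneSolves Z f₀ b φ f)
    (hg : HalfPlaneSolves Z g₀ b' ψ g) : ∃ C, ∀ z : ℂ, 0 < z.re →
      ‖wronskianCont Z α₀ α₁ f₀ g₀ φ ψ b b' f g z‖ ≤ C * (1 + ‖z‖) := by
  obtain ⟨A, hA⟩ := hf.bound
  obtain ⟨B, hB⟩ := hg.bound
  obtain ⟨A', hA'⟩ := hf.exists_norm_cont'_le
  obtain ⟨B', hB'⟩ := hg.exists_norm_cont'_le
  obtain ⟨C, hC⟩ := exists_norm_sum_dslope_le (α₀ := α₀) (α₁ := α₁) hf hg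
  refine ⟨(‖α₀‖ + ‖α₁‖) * B * A' + (‖α₀‖ + ‖α₁‖) * A * B' + C, fun z hz => ?_⟩
  unfold wronskianCont
  have h1 := norm_mul_mul_le (norm_linear_le α₀ α₁ z) (hB z hz.le) (hA' z hz)
  have h2 := norm_mul_mul_le (norm_linear_le' α₀ α₁ z) (hA z hz.le) (hB' z hz)
  have h3 := hC z hz
  have h4 : C ≤ C * (1 + ‖z‖) :=
    le_mul_of_one_le_right ((norm_nonneg _).trans h3) (by linarith [norm_nonneg z])
  refine (norm_add_le _ _).trans ((add_le_add ((norm_sub_le _ _).trans (add_le_add h1 h2))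
    (h3.trans h4)).trans_eq (by ring))

/-- The Wronskian at the points of the boundary. -/
def lineWronskian (α₀ α₁ : ℂ) (f g : ℂ → ℂ) (s : ℝ) : ℂ :=
  (α₀ - α₁ * (s * I)) * g (-(s * I)) * f (s * I)
    - (α₀ + α₁ * (s * I)) * g (s * I) * f (-(s * I))

theorem radialLimit_wronskianCont (hf : HalfPlaneSolves Z f₀ b φ f)
    (hg : HalfPlaneSolves Z g₀ b' ψ g)
    (hres : ∀ ζ ∈ Z, (α₀ + α₁ * ζ) * g ζ * b ζ = (α₀ - α₁ * ζ) * f ζ * b' ζ)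
    (hφψ : ∀ s : ℝ, s ≠ 0 → (α₀ - α₁ * (s * I)) * g (-(s * I)) * φ s
      = (α₀ + α₁ * (s * I)) * f (-(s * I)) * ψ s) :
    RadialLimit (wronskianCont Z α₀ α₁ f₀ g₀ φ ψ b b' f g) (lineWronskian α₀ α₁ f g) := by
  intro s hs
  have lz := tendsto_radial s
  have lf := hf.tendsto_radial_of s
  have lg := hg.tendsto_radial_of s
  have lA := ((lz.const_mul α₁).const_add α₀)
  have lB := ((lz.const_mul α₁).const_sub α₀)
  have hne : ∀ ζ ∈ Z, -(s * I) - ζ ≠ 0 := fun ζ hζ h0 => by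
    have := congrArg Complex.re h0
    have h1 := hf.pole ζ hζ
    simp at this
    linarith
  have ld : Tendsto (fun x : ℝ => ∑ ζ ∈ Z, dslope (poleNum α₀ α₁ b b' f g ζ) ζ (x - s * I))
      (𝓝[>] 0) (𝓝 (∑ ζ ∈ Z, ((α₀ + α₁ * -(s * I)) * g (-(s * I)) * b ζ
        - (α₀ - α₁ * -(s * I)) * f (-(s * I)) * b' ζ) / (-(s * I) - ζ))) := by
    refine tendsto_finsetSum _ fun ζ hζ => ?_
    have l1 := lz.sub_const ζ
    refine ((((lA.mul lg).mul_const (b ζ)).sub ((lB.mul lf).mul_const (b' ζ))).div l1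
      (hne ζ hζ)).congr' ?_
    filter_upwards [l1.eventually_ne (hne ζ hζ)] with x hx
    have h0 : poleNum α₀ α₁ b b' f g ζ ζ = 0 := sub_eq_zero.2 (hres ζ hζ)
    rw [dslope_of_ne _ (sub_ne_zero.1 hx), slope_def_field, h0, sub_zero]
    rfl
  have main := (((lA.mul lg).mul (hf.tendsto_cont' hs)).sub
    ((lB.mul lf).mul (hg.tendsto_cont' hs))).add ld
  refine main.trans_eq ?_
  congr 1
  have e1 : ∑ ζ ∈ Z, ((α₀ + α₁ * -(s * I)) * g (-(s * I)) * b ζ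
        - (α₀ - α₁ * -(s * I)) * f (-(s * I)) * b' ζ) / (-(s * I) - ζ)
      = -((α₀ + α₁ * -(s * I)) * g (-(s * I))
          * ∑ ζ ∈ Z, b ζ * (1 / (ζ + s * I)))
        + (α₀ - α₁ * -(s * I)) * f (-(s * I))
          * ∑ ζ ∈ Z, b' ζ * (1 / (ζ + s * I)) := by
    rw [Finset.mul_sum, Finset.mul_sum, ← Finset.sum_neg_distrib, ← Finset.sum_add_distrib]
    refine Finset.sum_congr rfl fun ζ hζ => ?_
    rw [show -(s * I) - ζ = -(ζ + s * I) by ring, div_neg]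
    generalize ζ + s * I = w
    ring
  rw [e1]
  unfold lineWronskian
  linear_combination hφψ s hs

theorem lineWronskian_neg (α₀ α₁ : ℂ) (f g : ℂ → ℂ) (s : ℝ) :
    lineWronskian α₀ α₁ f g (-s) = -lineWronskian α₀ α₁ f g s := by
  unfold lineWronskian
  push_cast
  rw [show -(-(s : ℂ) * I) = s * I by ring,
    show -(s : ℂ) * I = -(s * I) by ring]
  ring

end HalfPlaneSolves

/-- A holomorphic function in the half-plane that grows at most linearly and has odd boundary
values is linear. -/
theorem linear_of_odd_boundary {h : ℂ → ℂ} {W : ℝ → ℂ} {C : ℝ}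
    (hd : DifferentiableOn ℂ h {z | 0 < z.re})
    (hC : ∀ z : ℂ, 0 < z.re → ‖h z‖ ≤ C * (1 + ‖z‖)) (hW : RadialLimit h W)
    (hodd : ∀ s, W (-s) = -W s) {x y : ℂ} (hx : 0 < x.re) (hy : 0 < y.re) :
    h x * y = h y * x := by
  obtain ⟨δ, hδ⟩ := exists_norm_inv_add_le hx
  obtain ⟨δ', hδ'⟩ := exists_norm_inv_add_le hy
  have hm := (hd.mul (differentiableOn_inv_add hx)).mul (differentiableOn_inv_add hy)
  have hb : ∀ z : ℂ, 0 < z.re → ‖h z * (1 / (z + x)) * (1 / (z + y))‖ * (1 + ‖z‖) ≤ C * δ * δ' :=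
    fun z hz => by
      have h1 : ‖h z * (1 / (z + x))‖ ≤ C * δ := by
        rw [norm_mul]
        have hC0 : 0 ≤ C := by
          have := (norm_nonneg _).trans (hC z hz)
          by_contra hneg
          nlinarith [norm_nonneg z]
        calc ‖h z‖ * ‖1 / (z + x)‖ ≤ C * (1 + ‖z‖) * ‖1 / (z + x)‖ :=
              mul_le_mul_of_nonneg_right (hC z hz) (norm_nonneg _)
          _ = C * (‖1 / (z + x)‖ * (1 + ‖z‖)) := by ring
          _ ≤ C * δ := mul_le_mul_of_nonneg_left (hδ z hz.le) hC0
      rw [norm_mul, mul_assoc]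
      exact mul_le_mul h1 (hδ' z hz.le) (by positivity) ((norm_nonneg _).trans h1)
  have hs : RadialLimit (fun z => h z * (1 / (z + x)) * (1 / (z + y))) _ := fun s h0 =>
    ((hW s h0).mul (tendsto_radial_inv_add hx s)).mul (tendsto_radial_inv_add hy s)
  obtain ⟨i1, e1⟩ := integral_cauchy hm hb hs hx
  obtain ⟨i2, e2⟩ := integral_cauchy hm hb hs hy
  have h0 : ∫ s : ℝ, (W s * (1 / (x - s * I)) * (1 / (y - s * I))
      / (x + s * I) - W s * (1 / (x - s * I)) * (1 / (y - s * I))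
      / (y + s * I)) = 0 := by
    set J : ℝ → ℂ := fun s => W s * (1 / (x - s * I)) * (1 / (y - s * I))
      / (x + s * I) - W s * (1 / (x - s * I)) * (1 / (y - s * I))
      / (y + s * I) with hJ
    have hneg : ∀ s, J (-s) = -J s := fun s => by
      simp only [hJ, hodd]
      have a1 := add_ne_zero_of_re hx (z := s * I) (by simp)
      have a2 := add_ne_zero_of_re hx (z := -(s * I)) (by simp)
      have a3 := add_ne_zero_of_re hy (z := s * I) (by simp)
      have a4 := add_ne_zero_of_re hy (z := -(s * I)) (by simp)
      rw [neg_add_eq_sub] at a2 a4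
      rw [add_comm] at a1 a3
      push_cast
      rw [show x - -(s : ℂ) * I = x + s * I by ring,
        show y - -(s : ℂ) * I = y + s * I by ring,
        show x + -(s : ℂ) * I = x - s * I by ring,
        show y + -(s : ℂ) * I = y - s * I by ring]
      field_simp
      ring
    have h1 := integral_neg_eq_self J volume
    simp only [hneg] at h1
    rw [integral_neg] at h1
    linear_combination (-1 / 2 : ℂ) * h1
  rw [integral_sub i1 i2, e1, e2] at h0
  have hpi : (2 * Real.pi : ℂ) ≠ 0 := by
    exact_mod_cast (mul_pos two_pos Real.pi_pos).ne'
  rw [← mul_sub] at h0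
  have h2 := (mul_eq_zero.1 h0).resolve_left hpi
  have b1 := add_ne_zero_of_re hx hx.le
  have b2 := add_ne_zero_of_re hy hy.le
  have b3 := add_ne_zero_of_re hx hy.le
  have b4 := add_ne_zero_of_re hy hx.le
  have hxx : x ≠ 0 := fun h => by rw [h] at hx; simp at hx
  have hyy : y ≠ 0 := fun h => by rw [h] at hy; simp at hy
  have h2' : h x * (1 / (x + x)) * (1 / (x + y)) - h y * (1 / (y + x)) * (1 / (y + y)) = 0 := h2
  have key : h x * y - h y * x = (x + x) * (y + y) * (x + y) / 2
      * (h x * (1 / (x + x)) * (1 / (x + y)) - h y * (1 / (y + x)) * (1 / (y + y))) := by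
    rw [add_comm y x]
    field_simp
    ring
  rw [h2', mul_zero] at key
  exact sub_eq_zero.1 key

theorem HalfPlaneSolves.lineWronskian_eq {Z : Finset ℂ} {f₀ g₀ α₀ α₁ : ℂ} {b b' : ℂ → ℂ}
    {φ ψ : ℝ → ℂ} {f g : ℂ → ℂ} (hf : HalfPlaneSolves Z f₀ b φ f)
    (hg : HalfPlaneSolves Z g₀ b' ψ g)
    (hres : ∀ ζ ∈ Z, (α₀ + α₁ * ζ) * g ζ * b ζ = (α₀ - α₁ * ζ) * f ζ * b' ζ)
    (hφψ : ∀ s : ℝ, s ≠ 0 → (α₀ - α₁ * (s * I)) * g (-(s * I)) * φ s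
      = (α₀ + α₁ * (s * I)) * f (-(s * I)) * ψ s) {s : ℝ} (hs : s ≠ 0) :
    lineWronskian α₀ α₁ f g s = -(2 * α₁ * f₀ * g₀ * (s * I)) := by
  set h := wronskianCont Z α₀ α₁ f₀ g₀ φ ψ b b' f g with hh
  obtain ⟨C, hC⟩ := exists_norm_wronskianCont_le (α₀ := α₀) (α₁ := α₁) hf hg
  have hW := radialLimit_wronskianCont hf hg hres hφψ
  have lin := fun {x y : ℂ} => linear_of_odd_boundary (x := x) (y := y)
    (differentiableOn_wronskianCont (α₀ := α₀) (α₁ := α₁) hf hg) hC hW (lineWronskian_neg α₀ α₁ f g)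
  have h1 : (0 : ℝ) < (1 : ℂ).re := by simp
  have e1 : lineWronskian α₀ α₁ f g s = h 1 * -(s * I) := by
    refine tendsto_nhds_unique (hW s hs) (((tendsto_radial s).const_mul (h 1)).congr' ?_)
    filter_upwards [self_mem_nhdsWithin] with x hx
    have := lin (x := x - s * I) (by simpa using hx) h1
    rw [mul_one] at this
    exact this.symm
  have e2 : h 1 = 2 * α₁ * f₀ * g₀ := by
    obtain ⟨B, hB⟩ := exists_norm_sum_dslope_le (α₀ := α₀) (α₁ := α₁) hf hg
    have hinv : Tendsto (fun y : ℝ => 1 / (y : ℂ)) atTop (𝓝 0) := by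
      simpa [Function.comp_def] using (tendsto_one_div_sub_cocompact 0).comp tendsto_ofReal_cocompact
    have ld : Tendsto (fun y : ℝ => 1 / (y : ℂ)
        * ∑ ζ ∈ Z, dslope (poleNum α₀ α₁ b b' f g ζ) ζ y) atTop (𝓝 0) := by
      have hb : Tendsto (fun y : ℝ => ‖1 / (y : ℂ)‖ * B) atTop (𝓝 0) := by
        simpa using hinv.norm.mul_const B
      refine squeeze_zero_norm' ?_ hb
      filter_upwards [eventually_gt_atTop 0] with y hy
      rw [norm_mul]
      exact mul_le_mul_of_nonneg_left (hB y (by simpa using hy)) (norm_nonneg _)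
    have cf : Tendsto (fun y : ℝ => cont' f₀ φ y) atTop (𝓝 (f₀ + 0)) :=
      hf.density.tendsto_atTop.const_add f₀
    have cg : Tendsto (fun y : ℝ => cont' g₀ ψ y) atTop (𝓝 (g₀ + 0)) :=
      hg.density.tendsto_atTop.const_add g₀
    have main := (((((hinv.const_mul α₀).add_const α₁).mul hg.tendsto_atTop).mul cf).sub
      ((((hinv.const_mul α₀).sub_const α₁).mul hf.tendsto_atTop).mul cg)).add ld
    have e3 : 2 * α₁ * f₀ * g₀ = (α₀ * 0 + α₁) * g₀ * (f₀ + 0) - (α₀ * 0 - α₁) * f₀ * (g₀ + 0) + 0 := by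
      ring
    rw [e3]
    refine tendsto_nhds_unique (tendsto_const_nhds.congr' ?_) main
    filter_upwards [eventually_gt_atTop 0] with y hy
    have hy' : (y : ℂ) ≠ 0 := by exact_mod_cast hy.ne'
    have := lin (x := y) (by simpa using hy) h1
    rw [mul_one] at this
    have e4 : h 1 = 1 / (y : ℂ) * h y := by
      rw [hh]
      rw [this]
      field_simp
    rw [e4, hh]
    unfold wronskianCont
    field_simp
  rw [e1, e2]
  ring

theorem norm_add_lt_norm_sub_iff (a b : ℂ) :
    ‖a + b‖ < ‖a - b‖ ↔ (b * (starRingEnd ℂ) a).re < 0 := by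
  rw [← sq_lt_sq₀ (norm_nonneg _) (norm_nonneg _), ← Complex.normSq_eq_norm_sq,
    ← Complex.normSq_eq_norm_sq]
  simp only [Complex.normSq_apply, Complex.add_re, Complex.add_im, Complex.sub_re, Complex.sub_im,
    Complex.mul_re, Complex.conj_re, Complex.conj_im]
  constructor <;> intro h <;> nlinarith

/-- Local boundedness and decay at infinity give a global bound. -/
theorem exists_bound_of_local {F : ℂ → ℂ} {S : Set ℂ}
    (hloc : ∀ x ∈ closure S, ∃ C, ∀ᶠ y in 𝓝[S] x, ‖F y‖ ≤ C)
    (hinf : ∃ C, ∀ᶠ y in cocompact ℂ ⊓ 𝓟 S, ‖F y‖ * (1 + ‖y‖) ≤ C) :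
    ∃ C, ∀ y ∈ S, ‖F y‖ * (1 + ‖y‖) ≤ C := by
  obtain ⟨C, hC⟩ := hinf
  rw [eventually_inf_principal] at hC
  obtain ⟨K, hK, hKC⟩ := mem_cocompact.1 hC
  obtain ⟨B, hB⟩ : ∃ B, ∀ y ∈ K, y ∈ S → ‖F y‖ ≤ B := by
    refine hK.induction_on (p := fun s => ∃ B, ∀ y ∈ s, y ∈ S → ‖F y‖ ≤ B) ⟨0, by simp⟩
      (fun s t hst ⟨B, hB⟩ => ⟨B, fun y hy => hB y (hst hy)⟩)
      (fun s t ⟨B, hB⟩ ⟨B', hB'⟩ => ⟨max B B', fun y hy hyS => hy.elim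
        (fun h => (hB y h hyS).trans (le_max_left _ _))
        fun h => (hB' y h hyS).trans (le_max_right _ _)⟩) fun x _ => ?_
    by_cases hx : x ∈ closure S
    · obtain ⟨B, hB⟩ := hloc x hx
      rw [eventually_nhdsWithin_iff] at hB
      exact ⟨_, mem_nhdsWithin_of_mem_nhds hB, B, fun y hy => hy⟩
    · exact ⟨_, mem_nhdsWithin_of_mem_nhds (isClosed_closure.isOpen_compl.mem_nhds hx), 0,
        fun y hy hyS => absurd (subset_closure hyS) hy⟩
  obtain ⟨T, hT⟩ := hK.isBounded.exists_norm_le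
  refine ⟨max C (B * (1 + T)), fun y hy => ?_⟩
  by_cases hyK : y ∈ K
  · refine le_max_of_le_right (mul_le_mul (hB y hyK hy) (by linarith [hT y hyK]) (by positivity) ?_)
    exact (norm_nonneg _).trans (hB y hyK hy)
  · exact le_max_of_le_left (hKC hyK hy)

theorem exists_eventually_le_of_tendsto {F : ℂ → ℂ} {l : Filter ℂ} {x : ℂ}
    (h : Tendsto F l (𝓝 x)) : ∃ C, ∀ᶠ y in l, ‖F y‖ ≤ C :=
  ⟨‖x‖ + 1, (h.norm.eventually_lt_const (lt_add_one _)).mono fun _ h => h.le⟩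

theorem norm_mul_sub_one_le {u v A B t : ℝ} {x y : ℂ} (ht : 1 ≤ t) (hx : ‖x - 1‖ ≤ A / t)
    (hy : ‖y - 1‖ ≤ B / t) (hu : u = A * B + A + B) (hv : v = u / t) : ‖x * y - 1‖ ≤ v := by
  have h0 : 0 < t := by linarith
  have hA : 0 ≤ A := by
    have := (norm_nonneg _).trans hx
    rwa [le_div_iff₀ h0, zero_mul] at this
  have hB : 0 ≤ B := by
    have := (norm_nonneg _).trans hy
    rwa [le_div_iff₀ h0, zero_mul] at this
  have e : x * y - 1 = (x - 1) * (y - 1) + (x - 1) + (y - 1) := by ring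
  rw [e, hv, hu, add_div, add_div]
  refine (norm_add_le _ _).trans (add_le_add ((norm_add_le _ _).trans (add_le_add ?_ hx)) hy)
  rw [norm_mul, mul_div_assoc]
  refine mul_le_mul (hx.trans (div_le_self hA ht)) hy (norm_nonneg _) hA

theorem norm_zpow_le {r : ℂ} {C : ℝ} (h1 : ‖r‖ ≤ C) (h2 : ‖r⁻¹‖ ≤ C) (n : ℤ) :
    ‖r ^ n‖ ≤ C ^ n.natAbs := by
  obtain ⟨m, rfl | rfl⟩ := n.eq_nat_or_neg
  · rw [zpow_natCast, norm_pow, Int.natAbs_natCast]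
    exact pow_le_pow_left₀ (norm_nonneg _) h1 m
  · rw [zpow_neg, zpow_natCast, ← inv_pow, norm_pow, Int.natAbs_neg, Int.natAbs_natCast]
    exact pow_le_pow_left₀ (norm_nonneg _) h2 m

namespace InitialData

variable {N : ℕ} {D : InitialData N} {Z : Finset ℂ} {c : ℂ → ℂ}

theorem Direct.jostΛ_zero_ne (h : D.Direct 1) (h0 : (0 : ℂ) ∉ D.regP 1) :
    D.jostΛ 0 0 ≠ 0 ∨ D.jostΛ 1 0 ≠ 0 := by
  by_contra hcon
  push Not at hcon
  have hd := h.directScattering 0 h0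
  have key : ∀ m : ℕ, D.jostΛ (-m) 0 = 0 ∧ D.jostΛ (1 - m) 0 = 0 := by
    intro m
    induction m with
    | zero => simpa using hcon
    | succ m ih =>
      have h1 := hd.1 (-((m + 1 : ℕ) : ℤ))
      rw [show -((m + 1 : ℕ) : ℤ) + 2 = 1 - m by push_cast; ring,
        show -((m + 1 : ℕ) : ℤ) + 1 = -m by push_cast; ring, ih.1, ih.2] at h1
      simp only [mul_zero, sub_zero, zero_add] at h1
      refine ⟨(mul_eq_zero.1 h1).resolve_left (h.q_ne _), ?_⟩
      rw [show 1 - ((m + 1 : ℕ) : ℤ) = -m by push_cast; ring]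
      exact ih.1
  have h2 := hd.2.1.comp (tendsto_neg_atTop_atBot.comp (tendsto_natCast_atTop_atTop (R := ℤ)))
  have h3 := tendsto_nhds_unique h2 (tendsto_const_nhds.congr fun m => ((key m).1).symm)
  exact one_ne_zero h3

/-- `A - 1 = O(1 / ζ)`. -/
theorem Direct.exists_norm_specA_sub_one_le (h : D.Direct 1) :
    ∃ C, ∀ ζ ∉ D.regP 1, ζ ≠ 0 → ‖2 * ζ * (D.specA ζ - 1)‖ ≤ C := by
  obtain ⟨A, hA⟩ := h.exists_norm_jostΛ_sub_one_le 1
  obtain ⟨B, hB⟩ := h.exists_norm_jostΥ_sub_one_le 0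
  obtain ⟨B', hB'⟩ := h.exists_norm_jostΥ_sub_one_le 1
  refine ⟨‖D.q 0‖ * ((B * A + B + A) + (B' * A + B' + A)) + (B * A + B + A) + (B' * A + B' + A),
    fun ζ hζ h0 => ?_⟩
  have ht : (1 : ℝ) ≤ 1 + ‖ζ‖ := by linarith [norm_nonneg ζ]
  have h1 := norm_mul_sub_one_le ht (hB ζ hζ) (hA ζ hζ 1 le_rfl) rfl rfl
  have h2 := norm_mul_sub_one_le ht (hB' ζ hζ) (hA ζ hζ 0 zero_le_one) rfl rfl
  have e : 2 * ζ * (D.specA ζ - 1) = D.q 0 * ((D.jostΥ 0 ζ * D.jostΛ 1 ζ - 1)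
      - (D.jostΥ 1 ζ * D.jostΛ 0 ζ - 1)) + ζ * (D.jostΥ 0 ζ * D.jostΛ 1 ζ - 1)
      + ζ * (D.jostΥ 1 ζ * D.jostΛ 0 ζ - 1) := by
    unfold specA
    field_simp
    ring
  have h0' : (0 : ℝ) < 1 + ‖ζ‖ := by linarith
  have p1 := (norm_nonneg _).trans h1
  have p2 := (norm_nonneg _).trans h2
  have aux : ∀ {u : ℂ} {E : ℝ}, ‖u‖ ≤ E / (1 + ‖ζ‖) → ‖u‖ ≤ E ∧ ‖ζ * u‖ ≤ E := by
    intro u E hu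
    rw [le_div_iff₀ h0'] at hu
    rw [norm_mul]
    constructor <;> nlinarith [norm_nonneg ζ, norm_nonneg u, mul_nonneg (norm_nonneg ζ) (norm_nonneg u)]
  rw [e]
  refine (norm_add_le _ _).trans (add_le_add ((norm_add_le _ _).trans (add_le_add ?_ (aux h1).2))
    (aux h2).2)
  rw [norm_mul]
  exact mul_le_mul_of_nonneg_left ((norm_sub_le _ _).trans (add_le_add (aux h1).1 (aux h2).1))
    (norm_nonneg _)

/-- `B = O(1 / ζ)`. -/
theorem Direct.exists_norm_specB_le (h : D.Direct 1) :
    ∃ C, ∀ ζ ∉ D.regP 1, -ζ ∉ D.regP 1 → ζ ≠ 0 → ‖2 * ζ * D.specB ζ‖ ≤ C := by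
  obtain ⟨A, hA⟩ := h.exists_norm_jostΛ_sub_one_le 1
  obtain ⟨B, hB⟩ := h.exists_norm_jostΥ_sub_one_le 0
  obtain ⟨B', hB'⟩ := h.exists_norm_jostΥ_sub_one_le 1
  refine ⟨(1 + ‖D.q 0‖) * ((A * B' + A + B') + (A * B + A + B)), fun ζ hζ hζ' h0 => ?_⟩
  have ht : (1 : ℝ) ≤ 1 + ‖ζ‖ := by linarith [norm_nonneg ζ]
  have hA' := fun i hi => hA (-ζ) hζ' i hi
  simp only [norm_neg] at hA'
  have h1 := norm_mul_sub_one_le ht (hA' 0 zero_le_one) (hB' ζ hζ) rfl rfl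
  have h2 := norm_mul_sub_one_le ht (hA' 1 le_rfl) (hB ζ hζ) rfl rfl
  have e : 2 * ζ * D.specB ζ = (D.q 0 - ζ) * ((D.jostΛ 0 (-ζ) * D.jostΥ 1 ζ - 1)
      - (D.jostΛ 1 (-ζ) * D.jostΥ 0 ζ - 1)) := by
    unfold specB
    field_simp
    ring
  have h0' : (0 : ℝ) < 1 + ‖ζ‖ := by linarith
  rw [e, norm_mul]
  have h3 : ‖D.q 0 - ζ‖ ≤ (1 + ‖D.q 0‖) * (1 + ‖ζ‖) := by
    have := norm_sub_le (D.q 0) ζ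
    nlinarith [norm_nonneg (D.q 0), norm_nonneg ζ, mul_nonneg (norm_nonneg (D.q 0)) (norm_nonneg ζ)]
  have h4 := (norm_sub_le (D.jostΛ 0 (-ζ) * D.jostΥ 1 ζ - 1) (D.jostΛ 1 (-ζ) * D.jostΥ 0 ζ - 1)).trans
    (add_le_add h1 h2)
  rw [← add_div, le_div_iff₀ h0'] at h4
  calc _ ≤ (1 + ‖D.q 0‖) * (1 + ‖ζ‖) * ‖(D.jostΛ 0 (-ζ) * D.jostΥ 1 ζ - 1)
      - (D.jostΛ 1 (-ζ) * D.jostΥ 0 ζ - 1)‖ := mul_le_mul_of_nonneg_right h3 (norm_nonneg _)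
    _ = (1 + ‖D.q 0‖) * (‖(D.jostΛ 0 (-ζ) * D.jostΥ 1 ζ - 1)
      - (D.jostΛ 1 (-ζ) * D.jostΥ 0 ζ - 1)‖ * (1 + ‖ζ‖)) := by ring
    _ ≤ _ := mul_le_mul_of_nonneg_left h4 (by positivity)

namespace LineSetting

theorem direct (h : D.LineSetting Z c) : D.Direct 1 := ⟨le_rfl, h.param_ne, h.admissible.summable⟩

theorem mem_regP_iff (h : D.LineSetting Z c) (z : ℂ) : D.q 0 * z ∈ D.regP 1 ↔ z.re < 0 := by
  have h0 := h.param_ne 0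
  have hpos : 0 < Complex.normSq (D.q 0) := Complex.normSq_pos.2 h0
  have hre : ∀ w : ℂ, (D.q 0 * w * (starRingEnd ℂ) (D.q 0)).re = Complex.normSq (D.q 0) * w.re := by
    intro w
    rw [mul_right_comm, Complex.mul_conj, Complex.re_ofReal_mul]
  constructor
  · intro hz
    by_contra hneg
    have hc : ContinuousAt (fun t : ℝ => D.q 0 * (z + t)) 0 := by fun_prop
    have hev : ∀ᶠ t : ℝ in 𝓝[>] 0, D.q 0 * (z + t) ∈ D.regP 1 :=
      (hc.eventually ((D.isOpen_regP 1).mem_nhds (by simpa using hz))).filter_mono nhdsWithin_le_nhds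
    obtain ⟨t, ht, ht0⟩ := (hev.and self_mem_nhdsWithin).exists
    refine disjoint_left.1 h.disjoint ht ?_
    rw [← neg_mem_regP_iff]
    refine ⟨0, ?_⟩
    rw [one_mul, norm_add_lt_norm_sub_iff, ← mul_neg, hre]
    have ht0 : 0 < t := ht0
    refine mul_neg_of_pos_of_neg hpos ?_
    simp
    linarith
  · intro hz
    refine ⟨0, ?_⟩
    rw [one_mul, norm_add_lt_norm_sub_iff, hre]
    exact mul_neg_of_pos_of_neg hpos hz

theorem notMem_regP_iff (h : D.LineSetting Z c) (z : ℂ) : D.q 0 * z ∉ D.regP 1 ↔ 0 ≤ z.re := by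
  rw [h.mem_regP_iff, not_lt]

theorem mem_regPstar_iff (h : D.LineSetting Z c) (z : ℂ) :
    D.q 0 * z ∈ D.regPstar 1 ↔ 0 < z.re := by
  rw [← neg_mem_regP_iff, ← mul_neg, h.mem_regP_iff]
  simp

theorem mem_frontier (h : D.LineSetting Z c) {z : ℂ} (hz : z.re = 0) :
    D.q 0 * z ∈ frontier (D.regP 1) := by
  rw [(D.isOpen_regP 1).frontier_eq]
  refine ⟨?_, (h.notMem_regP_iff z).2 hz.ge⟩
  have hc : ContinuousAt (fun t : ℝ => D.q 0 * (z - t)) 0 := by fun_prop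
  have hl := hc.tendsto.mono_left (nhdsWithin_le_nhds (s := Ioi (0 : ℝ)))
  simp only [Complex.ofReal_zero, sub_zero] at hl
  refine mem_closure_of_tendsto hl ?_
  filter_upwards [self_mem_nhdsWithin] with t ht
  rw [h.mem_regP_iff]
  have ht : 0 < t := ht
  simp [hz, ht]

theorem notMem_closure_iff (h : D.LineSetting Z c) (z : ℂ) :
    D.q 0 * z ∉ closure (D.regP 1) ↔ 0 < z.re := by
  constructor
  · intro hz
    refine lt_of_le_of_ne ((h.notMem_regP_iff z).1 fun h1 => hz (subset_closure h1)) fun h1 => hz ?_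
    exact frontier_subset_closure (h.mem_frontier h1.symm)
  · intro hz hcl
    exact disjoint_left.1 (h.disjoint.closure_left (D.isOpen_regPstar 1)) hcl
      ((h.mem_regPstar_iff z).2 hz)

theorem mul_div (h : D.LineSetting Z c) (ζ : ℂ) : D.q 0 * (ζ / D.q 0) = ζ :=
  mul_div_cancel₀ _ (h.param_ne 0)

theorem zero_notMem (h : D.LineSetting Z c) : (0 : ℂ) ∉ D.regP 1 := by
  simpa using (h.notMem_regP_iff 0).2 (by simp)

theorem specA_ne_zero (h : D.LineSetting Z c) {ζ : ℂ} (hζ : ζ ∉ D.regP 1) (h0 : ζ ≠ 0)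
    (hZ : ζ ∉ Z) : D.specA ζ ≠ 0 := fun hA => by
  by_cases hcl : ζ ∈ closure (D.regP 1)
  · exact h.boundary_ne ζ (by rw [(D.isOpen_regP 1).frontier_eq]; exact ⟨hcl, hζ⟩) h0 hA
  · exact hZ ((h.admissible.zeros ζ).2 ⟨hcl, h0, hA⟩)

theorem re_pos_of_mem (h : D.LineSetting Z c) {ζ : ℂ} (hζ : ζ ∈ Z) : 0 < (ζ / D.q 0).re := by
  rw [← h.notMem_closure_iff, h.mul_div]
  exact ((h.admissible.zeros ζ).1 hζ).1

theorem param_line (h : D.LineSetting Z c) {z : ℂ} (hz : z.re = 0) (r : Fin N) :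
    D.p r + D.q 0 * z ≠ 0 ∧ D.p r - D.q 0 * z ≠ 0 := by
  refine ⟨fun h0 => (h.plane_wave r).1 ?_, fun h0 => (h.plane_wave r).1 ?_⟩
  · rw [show D.p r = D.q 0 * -z by linear_combination h0]
    exact h.mem_frontier (by simp [hz])
  · rw [show D.p r = D.q 0 * z by linear_combination h0]
    exact h.mem_frontier hz

theorem param_zero (h : D.LineSetting Z c) {ζ : ℂ} (hζ : ζ ∈ Z) (r : Fin N) :
    D.p r + ζ ≠ 0 ∧ D.p r - ζ ≠ 0 :=
  ⟨fun h0 => ((h.plane_wave r).2 ζ hζ).2 (by linear_combination h0),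
    fun h0 => ((h.plane_wave r).2 ζ hζ).1 (by linear_combination -h0)⟩

/-- The plane-wave factors are bounded on the line. -/
theorem exists_norm_rho_le (h : D.LineSetting Z c) (n : Lattice N) :
    ∃ C, ∀ z : ℂ, z.re = 0 → ‖D.rho n (D.q 0 * z)‖ ≤ C := by
  have h1 : ∀ r : Fin N, ∃ C, ∀ z : ℂ, z.re = 0 →
      ‖D.p r + D.q 0 * z‖ ≤ C * ‖D.p r - D.q 0 * z‖ := fun r => by
    have hw : (D.p r / D.q 0).re ≠ 0 := fun h0 => (h.plane_wave r).1 (by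
      rw [← h.mul_div (D.p r)]; exact h.mem_frontier h0)
    set w := D.p r / D.q 0 with hwdef
    refine ⟨1 + 2 * ‖w‖ / |w.re|, fun z hz => ?_⟩
    rw [← h.mul_div (D.p r), ← hwdef, ← mul_add, ← mul_sub, norm_mul, norm_mul, mul_left_comm]
    refine mul_le_mul_of_nonneg_left ?_ (norm_nonneg _)
    have h2 : |w.re| ≤ ‖w - z‖ := by
      have := Complex.abs_re_le_norm (w - z)
      rwa [Complex.sub_re, hz, sub_zero] at this
    have h3 : ‖w + z‖ ≤ ‖2 * w‖ + ‖w - z‖ := by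
      have := norm_sub_le (2 * w) (w - z)
      rwa [show 2 * w - (w - z) = w + z by ring] at this
    rw [norm_mul, Complex.norm_ofNat] at h3
    have h4 : 2 * ‖w‖ ≤ 2 * ‖w‖ / |w.re| * ‖w - z‖ := by
      rw [div_mul_eq_mul_div, le_div_iff₀ (abs_pos.2 hw)]
      exact mul_le_mul_of_nonneg_left h2 (by positivity)
    linarith
  choose C hC using h1
  refine ⟨∏ r, C r ^ (n r).natAbs, fun z hz => ?_⟩
  unfold rho
  rw [norm_prod]
  refine Finset.prod_le_prod (fun r _ => norm_nonneg _) fun r _ => norm_zpow_le ?_ ?_ _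
  · rw [norm_div, div_le_iff₀ (norm_pos_iff.2 (h.param_line hz r).2)]
    exact hC r z hz
  · rw [inv_div, norm_div, div_le_iff₀ (norm_pos_iff.2 (h.param_line hz r).1)]
    simpa [sub_eq_add_neg] using hC r (-z) (by simp [hz])

end LineSetting

theorem Direct.eventually_half_le_norm_specA (h : D.Direct 1) :
    ∀ᶠ ζ in cocompact ℂ ⊓ 𝓟 (D.regP 1)ᶜ, 1 ≤ ‖ζ‖ ∧ 1 / 2 ≤ ‖D.specA ζ‖ := by
  obtain ⟨C, hC⟩ := h.exists_norm_specA_sub_one_le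
  rw [eventually_inf_principal]
  filter_upwards [(tendsto_norm_cocompact_atTop (E := ℂ)).eventually_ge_atTop (max 1 C)] with ζ hζ hP
  have h1 : 1 ≤ ‖ζ‖ := (le_max_left _ _).trans hζ
  have h2 : C ≤ ‖ζ‖ := (le_max_right _ _).trans hζ
  have h3 := hC ζ hP (norm_pos_iff.1 (by linarith))
  rw [norm_mul, norm_mul, Complex.norm_ofNat] at h3
  have h4 : ‖D.specA ζ - 1‖ ≤ 1 / 2 := by
    by_contra hneg
    push Not at hneg
    nlinarith
  refine ⟨h1, ?_⟩
  have := norm_sub_norm_le 1 (D.specA ζ)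
  rw [norm_one, norm_sub_rev] at this
  linarith

namespace LineSetting

theorem neg_mem_line (h : D.LineSetting Z c) (ζ : ℂ) :
    (ζ ∉ D.regP 1 ∧ -ζ ∉ D.regP 1) ↔ (ζ / D.q 0).re = 0 := by
  rw [← h.mul_div ζ, ← mul_neg, h.notMem_regP_iff, h.notMem_regP_iff, h.mul_div,
    Complex.neg_re, neg_nonneg]
  exact ⟨fun h => le_antisymm h.2 h.1, fun h => ⟨h.ge, h.le⟩⟩

theorem notMem_Z (h : D.LineSetting Z c) {ζ : ℂ} (hζ : ζ ∉ D.regP 1) (hζ' : -ζ ∉ D.regP 1) :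
    ζ ∉ Z := fun hZ => (h.re_pos_of_mem hZ).ne' ((h.neg_mem_line ζ).1 ⟨hζ, hζ'⟩)

theorem continuousOn_refl (h : D.LineSetting Z c) :
    ContinuousOn D.refl ({ζ | ζ ∉ D.regP 1 ∧ -ζ ∉ D.regP 1} \ {0}) :=
  h.direct.continuousOn_specB.div (h.direct.continuousOn_specA.mono fun _ hζ => ⟨hζ.1.1, hζ.2⟩)
    fun _ hζ => h.specA_ne_zero hζ.1.1 hζ.2 (h.notMem_Z hζ.1.1 hζ.1.2)

theorem refl_mul (h : D.LineSetting Z c) {ζ : ℂ} (hζ : ζ ∉ D.regP 1) (hζ' : -ζ ∉ D.regP 1)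
    (h0 : ζ ≠ 0) (i : ℤ) : D.refl ζ * D.jostΛ i ζ * D.rho (D.pos i) ζ
      = D.jostΥ i ζ / D.specA ζ - D.jostΛ i (-ζ) := by
  have hA := h.specA_ne_zero hζ h0 (h.notMem_Z hζ hζ')
  rw [h.direct.jostΥ_eq_specA_specB hζ hζ' h0 i]
  unfold refl
  field_simp
  ring

theorem exists_norm_jostΥ_div_le (h : D.LineSetting Z c) (i : ℤ) :
    ∃ C, ∀ᶠ ζ in 𝓝[(D.regP 1)ᶜ \ {0}] 0, ‖D.jostΥ i ζ / D.specA ζ‖ ≤ C := by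
  obtain ⟨b, hb, hA⟩ := h.boundary_zero
  obtain ⟨C, hC⟩ := exists_eventually_le_of_tendsto
    ((h.direct.continuousOn_jostΥ i 0 h.zero_notMem).mono sdiff_subset).tendsto
  refine ⟨C / b, ?_⟩
  filter_upwards [hA, hC] with ζ h1 h2
  rw [norm_div]
  exact div_le_div₀ ((norm_nonneg _).trans h2) h2 hb h1

theorem exists_norm_refl_le (h : D.LineSetting Z c) :
    ∃ C, ∀ ζ ∉ D.regP 1, -ζ ∉ D.regP 1 → ζ ≠ 0 → ‖D.refl ζ‖ * (1 + ‖ζ‖) ≤ C := by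
  set S : Set ℂ := {ζ | ζ ∉ D.regP 1 ∧ -ζ ∉ D.regP 1} \ {0} with hS
  have hSP : S ⊆ (D.regP 1)ᶜ \ {0} := fun ζ hζ => ⟨hζ.1.1, hζ.2⟩
  have hcl : closure S ⊆ {ζ | ζ ∉ D.regP 1 ∧ -ζ ∉ D.regP 1} := by
    refine closure_minimal sdiff_subset ?_
    exact ((D.isOpen_regP 1).isClosed_compl).inter
      ((D.isOpen_regP 1).isClosed_compl.preimage continuous_neg)
  suffices ∃ C, ∀ ζ ∈ S, ‖D.refl ζ‖ * (1 + ‖ζ‖) ≤ C from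
    this.imp fun C hC ζ h1 h2 h3 => hC ζ ⟨⟨h1, h2⟩, h3⟩
  refine exists_bound_of_local (fun x hx => ?_) ?_
  · by_cases h0 : x = 0
    · subst h0
      have main : ∀ i, D.jostΛ i 0 ≠ 0 → ∃ C, ∀ᶠ y in 𝓝[S] 0, ‖D.refl y‖ ≤ C := fun i hi => by
        obtain ⟨C, hC⟩ := h.exists_norm_jostΥ_div_le i
        have cΛ := (h.direct.continuousOn_jostΛ i 0 h.zero_notMem).mono
          (hSP.trans sdiff_subset)
        have cΛ' : Tendsto (fun ζ => D.jostΛ i (-ζ)) (𝓝[S] 0) (𝓝 (D.jostΛ i 0)) := by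
          refine (h.direct.continuousOn_jostΛ i 0 h.zero_notMem).tendsto.comp
            (tendsto_nhdsWithin_iff.2 ⟨?_, ?_⟩)
          · simpa using (continuous_neg (G := ℂ)).continuousAt.tendsto.mono_left
              (nhdsWithin_le_nhds (a := (0 : ℂ)) (s := S))
          · filter_upwards [self_mem_nhdsWithin] with ζ hζ using hζ.1.2
        obtain ⟨C', hC'⟩ := exists_eventually_le_of_tendsto cΛ'
        have hr := fun r => h.param_line (z := 0) rfl r
        simp only [mul_zero] at hr
        have hsub : S ⊆ {ζ | ∀ r, D.p r + ζ ≠ 0 ∧ D.p r - ζ ≠ 0} := fun ζ hζ r => by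
          rw [← h.mul_div ζ]
          exact h.param_line ((h.neg_mem_line ζ).1 hζ.1) r
        have cρ := (D.continuousOn_rho (D.pos i) 0 hr).mono hsub
        have h1 := (cΛ.tendsto.mul cρ.tendsto).norm
        have hpos : 0 < ‖D.jostΛ i 0 * D.rho (D.pos i) 0‖ :=
          norm_pos_iff.2 (mul_ne_zero hi (D.rho_ne_zero _ hr))
        refine ⟨(C + C') / (‖D.jostΛ i 0 * D.rho (D.pos i) 0‖ / 2), ?_⟩
        filter_upwards [h1.eventually_const_lt (half_lt_self hpos), hC',
          hC.filter_mono (nhdsWithin_mono _ hSP), self_mem_nhdsWithin] with ζ h1 h2 h3 h4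
        have h5 := h.refl_mul h4.1.1 h4.1.2 h4.2 i
        rw [le_div_iff₀ (by linarith)]
        calc _ ≤ ‖D.refl ζ‖ * ‖D.jostΛ i ζ * D.rho (D.pos i) ζ‖ :=
              mul_le_mul_of_nonneg_left h1.le (norm_nonneg _)
          _ = ‖D.jostΥ i ζ / D.specA ζ - D.jostΛ i (-ζ)‖ := by rw [← norm_mul, ← mul_assoc, h5]
          _ ≤ _ := (norm_sub_le _ _).trans (add_le_add h3 h2)
      exact (h.direct.jostΛ_zero_ne h.zero_notMem).elim (main 0) (main 1)
    · exact exists_eventually_le_of_tendsto (h.continuousOn_refl x ⟨hcl hx, h0⟩).tendsto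
  · obtain ⟨C, hC⟩ := h.direct.exists_norm_specB_le
    refine ⟨2 * C, ?_⟩
    have h1 := h.direct.eventually_half_le_norm_specA
    have hle : cocompact ℂ ⊓ 𝓟 S ≤ cocompact ℂ ⊓ 𝓟 (D.regP 1)ᶜ :=
      inf_le_inf_left _ (principal_mono.2 (hSP.trans sdiff_subset))
    filter_upwards [hle h1, mem_inf_of_right (mem_principal_self S)] with ζ h2 h3
    have h4 := hC ζ h3.1.1 h3.1.2 h3.2
    rw [norm_mul, norm_mul, Complex.norm_ofNat] at h4
    unfold refl
    have hA : 0 < ‖D.specA ζ‖ := by linarith [h2.2]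
    rw [norm_div, div_mul_eq_mul_div, div_le_iff₀ hA]
    have h5 : 0 ≤ C := (by positivity : 0 ≤ 2 * ‖ζ‖ * ‖D.specB ζ‖).trans h4
    nlinarith [norm_nonneg (D.specB ζ), h2.1, h2.2, mul_nonneg h5 (sub_nonneg.2 h2.2)]

/-- The boundary point with coordinate `s`. -/
theorem line_mem (h : D.LineSetting Z c) (s : ℝ) :
    D.q 0 * -(s * I) ∉ D.regP 1 ∧ -(D.q 0 * -(s * I)) ∉ D.regP 1 := by
  rw [h.neg_mem_line, mul_div_cancel_left₀ _ (h.param_ne 0)]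
  simp

theorem exists_line_eq (h : D.LineSetting Z c) {ζ : ℂ} (hζ : ζ ∉ D.regP 1) (hζ' : -ζ ∉ D.regP 1)
    (h0 : ζ ≠ 0) : ∃ s : ℝ, s ≠ 0 ∧ ζ = D.q 0 * (s * I) := by
  have h1 := (h.neg_mem_line ζ).1 ⟨hζ, hζ'⟩
  have h2 := Complex.re_add_im (ζ / D.q 0)
  rw [h1, Complex.ofReal_zero, zero_add] at h2
  refine ⟨(ζ / D.q 0).im, fun hs => h0 ?_, by rw [h2, h.mul_div]⟩
  rw [← h.mul_div ζ, ← h2, hs]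
  simp

theorem line_ne_zero (h : D.LineSetting Z c) {s : ℝ} (hs : s ≠ 0) :
    D.q 0 * -(s * I) ≠ 0 :=
  mul_ne_zero (h.param_ne 0) (neg_ne_zero.2 (mul_ne_zero (by exact_mod_cast hs) Complex.I_ne_zero))

theorem norm_le_scale (h : D.LineSetting Z c) (z : ℂ) :
    1 + ‖z‖ ≤ (1 + ‖D.q 0‖⁻¹) * (1 + ‖D.q 0 * z‖) := by
  have hq : 0 < ‖D.q 0‖ := norm_pos_iff.2 (h.param_ne 0)
  have e : ‖D.q 0‖⁻¹ * (‖D.q 0‖ * ‖z‖) = ‖z‖ := by field_simp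
  have h4 : 0 ≤ ‖D.q 0‖⁻¹ := by positivity
  rw [norm_mul]
  nlinarith [mul_nonneg hq.le (norm_nonneg z)]

/-- The density of the integral equation. -/
def lineDensity (D : InitialData N) (n : Lattice N) (f : ℂ → ℂ) (s : ℝ) : ℂ :=
  D.refl (D.q 0 * -(s * I)) * f (D.q 0 * -(s * I))
    * D.rho n (D.q 0 * -(s * I))

/-- The residues of the integral equation. -/
def lineResidue (D : InitialData N) (C : ℂ → ℂ) (n : Lattice N) (f : ℂ → ℂ) (z : ℂ) : ℂ :=
  C (D.q 0 * z) * f (D.q 0 * z) * D.rho n (D.q 0 * z) / D.q 0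

def scaled (D : InitialData N) (Z : Finset ℂ) : Finset ℂ := Z.image (· / D.q 0)

theorem mul_mem_of_mem_scaled (h : D.LineSetting Z c) {z : ℂ} (hz : z ∈ scaled D Z) :
    D.q 0 * z ∈ Z := by
  obtain ⟨w, hw, rfl⟩ := Finset.mem_image.1 hz
  rwa [h.mul_div]

theorem re_pos_of_mem_scaled (h : D.LineSetting Z c) {z : ℂ} (hz : z ∈ scaled D Z) : 0 < z.re := by
  obtain ⟨w, hw, rfl⟩ := Finset.mem_image.1 hz
  exact h.re_pos_of_mem hw

theorem isDensity_lineDensity (h : D.LineSetting Z c) (n : Lattice N) {f : ℂ → ℂ}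
    (hf : ContinuousOn f (D.regP 1)ᶜ) (hb : ∃ b, ∀ ζ ∉ D.regP 1, ‖f ζ‖ ≤ b) :
    IsDensity (lineDensity D n f) := by
  obtain ⟨b, hb⟩ := hb
  obtain ⟨C, hC⟩ := h.exists_norm_refl_le
  obtain ⟨B, hB⟩ := h.exists_norm_rho_le n
  have hc : Continuous fun s : ℝ => D.q 0 * -(s * I) := by fun_prop
  constructor
  · refine ContinuousOn.mul (ContinuousOn.mul ?_ ?_) ?_
    · exact h.continuousOn_refl.comp hc.continuousOn fun s hs => ⟨h.line_mem s, h.line_ne_zero hs⟩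
    · exact hf.comp hc.continuousOn fun s hs => (h.line_mem s).1
    · exact (D.continuousOn_rho n).comp hc.continuousOn fun s hs r => h.param_line (by simp) r
  · set M := 1 + ‖D.q 0‖⁻¹ with hM
    set C' := max (C * M) ‖D.refl 0‖ with hC'
    have h1 : ∀ s : ℝ, ‖D.refl (D.q 0 * -(s * I))‖ * (1 + |s|) ≤ C' := fun s => by
      by_cases hs : s = 0
      · rw [hs]; simp [hC']
      · refine le_max_of_le_left ?_
        have h2 := hC _ (h.line_mem s).1 (h.line_mem s).2 (h.line_ne_zero hs)
        have h3 : 1 + |s| ≤ M * (1 + ‖D.q 0 * -(s * I)‖) := by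
          simpa using h.norm_le_scale (-(s * I))
        calc _ ≤ ‖D.refl (D.q 0 * -(s * I))‖ * (M * (1 + ‖D.q 0 * -(s * I)‖)) :=
              mul_le_mul_of_nonneg_left h3 (norm_nonneg _)
          _ = ‖D.refl (D.q 0 * -(s * I))‖ * (1 + ‖D.q 0 * -(s * I)‖) * M := by ring
          _ ≤ C * M := mul_le_mul_of_nonneg_right h2 (by positivity)
    refine ⟨C' * b * B, fun s => ?_⟩
    have e : ‖lineDensity D n f s‖ * (1 + |s|) = ‖D.refl (D.q 0 * -(s * I))‖ * (1 + |s|)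
        * ‖f (D.q 0 * -(s * I))‖ * ‖D.rho n (D.q 0 * -(s * I))‖ := by
      unfold lineDensity
      rw [norm_mul, norm_mul]
      ring
    have hb' := hb _ (h.line_mem s).1
    have hC0 : 0 ≤ C' := le_max_of_le_right (norm_nonneg _)
    rw [e]
    exact mul_le_mul (mul_le_mul (h1 s) hb' (norm_nonneg _) hC0)
      (hB _ (by simp)) (norm_nonneg _) (mul_nonneg hC0 ((norm_nonneg _).trans hb'))

theorem sieRHS_eq (h : D.LineSetting Z c) (C : ℂ → ℂ) (n : Lattice N) (f : ℂ → ℂ) (z : ℂ) :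
    sieRHS D.lineInt Z C D.refl (D.rho n) f (D.q 0 * z)
      = 1 - ∑ ζ ∈ scaled D Z, lineResidue D C n f ζ / (z + ζ)
        + lineCauchy (lineDensity D n f) (-z) := by
  have hq := h.param_ne 0
  unfold sieRHS
  congr 1
  · congr 1
    unfold scaled
    rw [Finset.sum_image fun x _ y _ hxy => (div_left_inj' hq).1 hxy]
    refine Finset.sum_congr rfl fun ζ _ => ?_
    unfold lineResidue
    rw [h.mul_div, show D.q 0 * z + ζ = D.q 0 * (z + ζ / D.q 0) by rw [mul_add, h.mul_div]]
    simp only [div_eq_mul_inv, mul_inv]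
    ring
  · unfold lineInt lineCauchy
    rw [← integral_const_mul, ← integral_const_mul]
    refine integral_congr_ae (Eventually.of_forall fun s => ?_)
    have e1 : -I * D.q 0 * s = D.q 0 * -(s * I) := by ring
    simp only [e1]
    unfold lineDensity
    rw [← mul_add, show -(s * I) + z = -(-z + s * I) by ring]
    generalize -z + s * I = w
    generalize D.q 0 * -(s * I) = σ
    rw [mul_neg, div_neg]
    have hI := Complex.I_ne_zero
    have hpi : (Real.pi : ℂ) ≠ 0 := by exact_mod_cast Real.pi_ne_zero
    by_cases hw : w = 0
    · simp [hw]
    · field_simp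

theorem halfPlaneSolves (h : D.LineSetting Z c) {n : Lattice N} {f : ℂ → ℂ}
    (hf : D.IsLineSolution Z c n f) :
    HalfPlaneSolves (scaled D Z) 1 (lineResidue D (D.coefC 1 c) n f) (lineDensity D n f)
      fun z => f (D.q 0 * z) where
  pole _ := h.re_pos_of_mem_scaled
  density := h.isDensity_lineDensity n hf.1 hf.2.1
  cont := hf.1.comp (by fun_prop) fun z hz => (h.notMem_regP_iff z).2 hz
  bound := hf.2.1.imp fun b hb z hz => hb _ ((h.notMem_regP_iff z).2 hz)
  eq z hz := by rw [hf.2.2 _ ((h.mem_regPstar_iff z).2 hz), h.sieRHS_eq]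

end LineSetting

end InitialData

theorem lineCauchy_sub' {φ ψ : ℝ → ℂ} {z : ℂ} (hφ : IsDensity φ) (hψ : IsDensity ψ)
    (hz : 0 < z.re) :
    lineCauchy (fun s => φ s - ψ s) (-z) = lineCauchy φ (-z) - lineCauchy ψ (-z) := by
  unfold lineCauchy
  rw [← mul_sub, ← integral_sub (hφ.integrable_div_neg hz) (hψ.integrable_div_neg hz)]
  simp only [sub_div]

theorem IsDensity.sub {φ ψ : ℝ → ℂ} (hφ : IsDensity φ) (hψ : IsDensity ψ) :
    IsDensity fun s => φ s - ψ s := by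
  obtain ⟨A, hA⟩ := hφ.bound
  obtain ⟨B, hB⟩ := hψ.bound
  refine ⟨hφ.cont.sub hψ.cont, A + B, fun s => ?_⟩
  have h1 : 0 ≤ 1 + |s| := by positivity
  exact (mul_le_mul_of_nonneg_right (norm_sub_le _ _) h1).trans
    (by rw [add_mul]; exact add_le_add (hA s) (hB s))

theorem HalfPlaneSolves.sub {Z : Finset ℂ} {f₀ g₀ : ℂ} {b b' : ℂ → ℂ} {φ ψ : ℝ → ℂ} {f g : ℂ → ℂ}
    (hf : HalfPlaneSolves Z f₀ b φ f) (hg : HalfPlaneSolves Z g₀ b' ψ g) :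
    HalfPlaneSolves Z (f₀ - g₀) (fun ζ => b ζ - b' ζ) (fun s => φ s - ψ s) fun z => f z - g z where
  pole := hf.pole
  density := hf.density.sub hg.density
  cont := hf.cont.sub hg.cont
  bound := by
    obtain ⟨A, hA⟩ := hf.bound
    obtain ⟨B, hB⟩ := hg.bound
    exact ⟨A + B, fun z hz => (norm_sub_le _ _).trans (add_le_add (hA z hz) (hB z hz))⟩
  eq z hz := by
    rw [hf.eq z hz, hg.eq z hz, lineCauchy_sub' hf.density hg.density hz]
    simp only [sub_div, Finset.sum_sub_distrib]
    ring

theorem norm_one_div_sub_mul_le {ζ z : ℂ} (h1 : 1 ≤ ‖ζ‖) (h2 : 2 * ‖z‖ ≤ ‖ζ‖) :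
    ‖1 / (ζ - z)‖ * (1 + ‖ζ‖) ≤ 4 := by
  have h3 : ‖ζ‖ / 2 ≤ ‖ζ - z‖ := by
    have := norm_sub_norm_le ζ z
    linarith
  have h4 : 0 < ‖ζ - z‖ := by linarith
  rw [norm_div, norm_one, one_div_mul_eq_div, div_le_iff₀ h4]
  linarith

namespace InitialData

variable {N : ℕ} {D : InitialData N} {Z : Finset ℂ} {c : ℂ → ℂ}

namespace LineSetting

/-- The quotient `Υ / A - 1` without its poles. -/
def jumpRemainder (D : InitialData N) (Z : Finset ℂ) (i : ℤ) (ζ : ℂ) : ℂ :=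
  D.jostΥ i ζ / D.specA ζ - 1 - ∑ z ∈ Z, D.jostΥ i z / deriv D.specA z * (1 / (ζ - z))

theorem continuousOn_sum_poles (r : ℂ → ℂ) :
    ContinuousOn (fun ζ : ℂ => ∑ z ∈ Z, r z * (1 / (ζ - z))) (↑Z)ᶜ :=
  continuousOn_finsetSum _ fun z hz => continuousOn_const.mul
    (continuousOn_const.div (by fun_prop) fun ζ hζ h0 => hζ (by
      rw [sub_eq_zero.1 h0]; exact hz))

theorem continuousOn_jumpRemainder (h : D.LineSetting Z c) (i : ℤ) :
    ContinuousOn (jumpRemainder D Z i) ((D.regP 1)ᶜ \ ({0} ∪ ↑Z)) := by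
  refine (((h.direct.continuousOn_jostΥ i).mono sdiff_subset).div
    (h.direct.continuousOn_specA.mono fun ζ hζ => ⟨hζ.1, fun h0 => hζ.2 (Or.inl h0)⟩)
    fun ζ hζ => ?_).sub continuousOn_const |>.sub ((continuousOn_sum_poles _).mono fun ζ hζ h0 =>
      hζ.2 (Or.inr h0))
  exact h.specA_ne_zero hζ.1 (fun h0 => hζ.2 (Or.inl h0)) fun h0 => hζ.2 (Or.inr h0)

theorem isOpen_compl_closure : IsOpen (closure (D.regP 1))ᶜ := isClosed_closure.isOpen_compl

theorem zero_notMem_compl_closure (h : D.LineSetting Z c) : (0 : ℂ) ∉ (closure (D.regP 1))ᶜ := by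
  have := (h.notMem_closure_iff 0).not.2 (by simp)
  rwa [mul_zero] at this

theorem exists_entire_part (h : D.LineSetting Z c) (i : ℤ) :
    ∃ E, DifferentiableOn ℂ E (closure (D.regP 1))ᶜ ∧
      ∀ ζ ∉ closure (D.regP 1), ζ ∉ Z → jumpRemainder D Z i ζ = E ζ - 1 := by
  have hne : ∀ ζ ∈ (closure (D.regP 1))ᶜ, ζ ≠ 0 := fun ζ hζ h0 =>
    h.zero_notMem_compl_closure (h0 ▸ hζ)
  obtain ⟨E, hE, hEq⟩ := exists_partial_fractions isOpen_compl_closure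
    (h.direct.differentiableOn_jostΥ i)
    (h.direct.differentiableOn_specA.mono fun ζ hζ => ⟨hζ, hne ζ hζ⟩)
    (fun z hz => ((h.admissible.zeros z).1 hz).2.2)
    (fun z hz hzZ => h.specA_ne_zero (fun h0 => hz (subset_closure h0)) (hne z hz) hzZ)
    h.admissible.simple
  refine ⟨E, hE, fun ζ hζ hζZ => ?_⟩
  unfold jumpRemainder
  rw [hEq ζ hζ hζZ]
  ring

theorem exists_bound_jumpRemainder (h : D.LineSetting Z c) (i : ℤ) :
    ∃ C, ∀ ζ ∈ (D.regP 1)ᶜ \ ({0} ∪ ↑Z), ‖jumpRemainder D Z i ζ‖ * (1 + ‖ζ‖) ≤ C := by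
  have hcl : closure ((D.regP 1)ᶜ \ ({0} ∪ ↑Z)) ⊆ (D.regP 1)ᶜ :=
    closure_minimal sdiff_subset (D.isOpen_regP 1).isClosed_compl
  refine exists_bound_of_local (fun x hx => ?_) ?_
  · by_cases hZ : x ∈ Z
    · obtain ⟨E, hE, hEq⟩ := h.exists_entire_part i
      have hxU : x ∈ (closure (D.regP 1))ᶜ := ((h.admissible.zeros x).1 hZ).1
      have hU := isOpen_compl_closure.mem_nhds hxU
      obtain ⟨C, hC⟩ := exists_eventually_le_of_tendsto
        (((hE.differentiableAt hU).continuousAt.sub continuousAt_const).tendsto :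
          Tendsto (fun ζ => E ζ - 1) _ _)
      refine ⟨C, ?_⟩
      filter_upwards [mem_nhdsWithin_of_mem_nhds hU, mem_nhdsWithin_of_mem_nhds hC,
        self_mem_nhdsWithin] with ζ h1 h2 h3
      rw [hEq ζ h1 fun h0 => h3.2 (Or.inr h0)]
      exact h2
    · by_cases h0 : x = 0
      · subst h0
        obtain ⟨C, hC⟩ := h.exists_norm_jostΥ_div_le i
        have hcont := (continuousOn_sum_poles (Z := Z) fun z => D.jostΥ i z / deriv D.specA z).continuousAt
          (Z.finite_toSet.isClosed.isOpen_compl.mem_nhds hZ)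
        obtain ⟨C', hC'⟩ := exists_eventually_le_of_tendsto hcont.tendsto
        refine ⟨C + 1 + C', ?_⟩
        filter_upwards [hC.filter_mono (nhdsWithin_mono _ fun ζ hζ =>
          (⟨hζ.1, fun h0 => hζ.2 (Or.inl h0)⟩ : ζ ∈ (D.regP 1)ᶜ \ {0})),
          mem_nhdsWithin_of_mem_nhds hC'] with ζ h1 h2
        refine (norm_sub_le _ _).trans (add_le_add ((norm_sub_le _ _).trans ?_) h2)
        rw [norm_one]
        exact add_le_add h1 le_rfl
      · exact exists_eventually_le_of_tendsto (h.continuousOn_jumpRemainder i x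
          ⟨hcl hx, fun h1 => h1.elim h0 hZ⟩).tendsto
  · obtain ⟨C, hC⟩ := h.direct.exists_norm_jostΥ_sub_one_le i
    obtain ⟨C', hC'⟩ := h.direct.exists_norm_specA_sub_one_le
    refine ⟨2 * (C + C') + ∑ z ∈ Z, ‖D.jostΥ i z / deriv D.specA z‖ * 4, ?_⟩
    have hle : cocompact ℂ ⊓ 𝓟 ((D.regP 1)ᶜ \ ({0} ∪ ↑Z)) ≤ cocompact ℂ ⊓ 𝓟 (D.regP 1)ᶜ :=
      inf_le_inf_left _ (principal_mono.2 sdiff_subset)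
    have hZ : ∀ᶠ ζ : ℂ in cocompact ℂ, ∀ z ∈ Z, 2 * ‖z‖ ≤ ‖ζ‖ :=
      (Filter.eventually_all_finset Z).2 fun z _ =>
        (tendsto_norm_cocompact_atTop (E := ℂ)).eventually_ge_atTop (2 * ‖z‖)
    filter_upwards [hle h.direct.eventually_half_le_norm_specA, mem_inf_of_left hZ,
      mem_inf_of_right (mem_principal_self _)] with ζ h1 h2 h3
    have hA0 : 0 < ‖D.specA ζ‖ := by linarith [h1.2]
    have h0 : ζ ≠ 0 := fun h0 => h3.2 (Or.inl h0)
    have hpos : (0 : ℝ) < 1 + ‖ζ‖ := by positivity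
    have a1 := hC ζ h3.1
    rw [le_div_iff₀ hpos] at a1
    have a2 := hC' ζ h3.1 h0
    rw [norm_mul, norm_mul, Complex.norm_ofNat] at a2
    have e1 : D.jostΥ i ζ / D.specA ζ - 1
        = ((D.jostΥ i ζ - 1) - (D.specA ζ - 1)) / D.specA ζ := by
      have := norm_pos_iff.1 hA0
      field_simp
      ring
    have b1 : ‖D.jostΥ i ζ / D.specA ζ - 1‖ * (1 + ‖ζ‖) ≤ 2 * (C + C') := by
      rw [e1, norm_div, div_mul_eq_mul_div, div_le_iff₀ hA0]
      have b2 : ‖D.jostΥ i ζ - 1 - (D.specA ζ - 1)‖ * (1 + ‖ζ‖) ≤ C + C' := by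
        refine (mul_le_mul_of_nonneg_right (norm_sub_le _ _) hpos.le).trans ?_
        nlinarith [norm_nonneg (D.specA ζ - 1), h1.1]
      have b3 : 0 ≤ C + C' := (by positivity : (0:ℝ) ≤ _).trans b2
      nlinarith [h1.2]
    have b4 : ‖∑ z ∈ Z, D.jostΥ i z / deriv D.specA z * (1 / (ζ - z))‖ * (1 + ‖ζ‖)
        ≤ ∑ z ∈ Z, ‖D.jostΥ i z / deriv D.specA z‖ * 4 := by
      refine (mul_le_mul_of_nonneg_right (norm_sum_le _ _) hpos.le).trans ?_
      rw [Finset.sum_mul]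
      refine Finset.sum_le_sum fun z hz => ?_
      rw [norm_mul, mul_assoc]
      exact mul_le_mul_of_nonneg_left (norm_one_div_sub_mul_le h1.1 (h2 z hz)) (norm_nonneg _)
    unfold jumpRemainder
    refine (mul_le_mul_of_nonneg_right (norm_sub_le _ _) hpos.le).trans ?_
    rw [add_mul]
    exact add_le_add b1 b4

theorem line_not_excluded (h : D.LineSetting Z c) {s : ℝ} (hs : s ≠ 0) :
    D.q 0 * -(s * I) ∈ (D.regP 1)ᶜ \ ({0} ∪ ↑Z) :=
  ⟨(h.line_mem s).1, fun h0 => h0.elim (h.line_ne_zero hs)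
    (h.notMem_Z (h.line_mem s).1 (h.line_mem s).2)⟩

theorem radialLimit_of_continuousOn (h : D.LineSetting Z c) {F : ℂ → ℂ}
    (hF : ContinuousOn F ((D.regP 1)ᶜ \ ({0} ∪ ↑Z))) :
    RadialLimit (fun z => F (D.q 0 * z)) fun s => F (D.q 0 * -(s * I)) := fun s hs => by
  have hlim := (tendsto_radial s).const_mul (D.q 0)
  have hm := h.line_not_excluded hs
  refine (hF _ hm).tendsto.comp (tendsto_nhdsWithin_iff.2 ⟨hlim, ?_⟩)
  have hop : IsOpen (({0} ∪ ↑Z)ᶜ : Set ℂ) :=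
    ((Set.finite_singleton 0).union Z.finite_toSet).isClosed.isOpen_compl
  filter_upwards [hlim.eventually (hop.mem_nhds hm.2), self_mem_nhdsWithin] with x h1 h2
  refine ⟨(h.notMem_regP_iff _).2 ?_, h1⟩
  have h2 : 0 < x := h2
  simpa using h2.le

theorem integral_jumpRemainder (h : D.LineSetting Z c) (i : ℤ) {x : ℂ} (hx : 0 < x.re) :
    Integrable (fun s : ℝ => jumpRemainder D Z i (D.q 0 * -(s * I))
      * (1 / (x - s * I))) ∧
    ∫ s : ℝ, jumpRemainder D Z i (D.q 0 * -(s * I)) * (1 / (x - s * I)) = 0 := by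
  obtain ⟨E, hE, hEq⟩ := h.exists_entire_part i
  obtain ⟨C, hC⟩ := h.exists_bound_jumpRemainder i
  have hU : ∀ z : ℂ, 0 < z.re → D.q 0 * z ∈ (closure (D.regP 1))ᶜ := fun z hz =>
    (h.notMem_closure_iff z).2 hz
  have hEC : ∀ ζ ∈ (closure (D.regP 1))ᶜ, ‖E ζ - 1‖ * (1 + ‖ζ‖) ≤ C := fun ζ hζ => by
    have hev : ∀ᶠ w in 𝓝[≠] ζ, ‖E w - 1‖ * (1 + ‖w‖) ≤ C := by
      have hfin : ∀ᶠ w in 𝓝[≠] ζ, w ∉ (Z : Set ℂ) := by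
        have := (Z.finite_toSet.sdiff (t := {ζ})).isClosed.isOpen_compl.mem_nhds
          (x := ζ) (by simp)
        filter_upwards [mem_nhdsWithin_of_mem_nhds this, self_mem_nhdsWithin] with w h1 h2 h3
        exact h1 ⟨h3, h2⟩
      filter_upwards [hfin, mem_nhdsWithin_of_mem_nhds (isOpen_compl_closure.mem_nhds hζ)] with
        w h1 h2
      rw [← hEq w h2 h1]
      exact hC w ⟨fun h0 => h2 (subset_closure h0), fun h0 => h0.elim
        (fun h0 => h.zero_notMem_compl_closure (by rwa [← Set.mem_singleton_iff.1 h0])) h1⟩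
    have hc : ContinuousAt (fun w => ‖E w - 1‖ * (1 + ‖w‖)) ζ :=
      (((hE.differentiableAt (isOpen_compl_closure.mem_nhds hζ)).continuousAt.sub
        continuousAt_const).norm).mul (by fun_prop)
    exact le_of_tendsto (hc.tendsto.mono_left nhdsWithin_le_nhds) hev
  refine integral_mirror_eq_zero (m := fun z => E (D.q 0 * z) - 1) (C := C * (1 + ‖D.q 0‖⁻¹))
    ((hE.comp (by fun_prop) fun z hz => hU z hz).sub_const 1) (fun z hz => ?_) ?_ hx
  · calc _ ≤ ‖E (D.q 0 * z) - 1‖ * ((1 + ‖D.q 0‖⁻¹) * (1 + ‖D.q 0 * z‖)) :=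
          mul_le_mul_of_nonneg_left (h.norm_le_scale z) (norm_nonneg _)
      _ = ‖E (D.q 0 * z) - 1‖ * (1 + ‖D.q 0 * z‖) * (1 + ‖D.q 0‖⁻¹) := by ring
      _ ≤ _ := mul_le_mul_of_nonneg_right (hEC _ (hU z hz)) (by positivity)
  · intro s hs
    refine (h.radialLimit_of_continuousOn (h.continuousOn_jumpRemainder i) s hs).congr' ?_
    have hlim := (tendsto_radial s).const_mul (D.q 0)
    have hop : IsOpen ((↑Z)ᶜ : Set ℂ) := Z.finite_toSet.isClosed.isOpen_compl
    filter_upwards [self_mem_nhdsWithin, hlim.eventually (hop.mem_nhds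
      fun h0 => (h.line_not_excluded hs).2 (Or.inr h0))] with y hy hyZ
    have hy : 0 < y := hy
    exact hEq _ (hU _ (by simpa using hy)) hyZ

theorem integral_jostΛ (h : D.LineSetting Z c) (i : ℤ) {x : ℂ} (hx : 0 < x.re) :
    Integrable (fun s : ℝ => (D.jostΛ i (-(D.q 0 * -(s * I))) - 1)
      * (1 / (x - s * I))) ∧
    ∫ s : ℝ, (D.jostΛ i (-(D.q 0 * -(s * I))) - 1) * (1 / (x - s * I))
      = 2 * Real.pi * (D.jostΛ i (D.q 0 * x) - 1) := by
  obtain ⟨C, hC⟩ := h.direct.exists_norm_jostΛ_sub_one_le i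
  have hP : ∀ z : ℂ, 0 < z.re → D.q 0 * z ∉ D.regP 1 := fun z hz => (h.notMem_regP_iff z).2 hz.le
  obtain ⟨i1, e1⟩ := integral_cauchy (m := fun z => D.jostΛ i (D.q 0 * z) - 1)
    (ms := fun s => D.jostΛ i (D.q 0 * -(s * I)) - 1) (C := C * (1 + ‖D.q 0‖⁻¹))
    (((h.direct.differentiableOn_jostΛ i).comp (by fun_prop) fun z hz =>
      (h.notMem_closure_iff z).2 hz).sub_const 1)
    (fun z hz => by
      have h1 := hC _ (hP z hz) i le_rfl
      rw [le_div_iff₀ (by positivity)] at h1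
      calc _ ≤ ‖D.jostΛ i (D.q 0 * z) - 1‖ * ((1 + ‖D.q 0‖⁻¹) * (1 + ‖D.q 0 * z‖)) :=
            mul_le_mul_of_nonneg_left (h.norm_le_scale z) (norm_nonneg _)
        _ = ‖D.jostΛ i (D.q 0 * z) - 1‖ * (1 + ‖D.q 0 * z‖) * (1 + ‖D.q 0‖⁻¹) := by ring
        _ ≤ _ := mul_le_mul_of_nonneg_right h1 (by positivity))
    (fun s hs => (h.radialLimit_of_continuousOn
      ((h.direct.continuousOn_jostΛ i).mono sdiff_subset) s hs).sub_const 1) hx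
  have e2 : (fun s : ℝ => (D.jostΛ i (-(D.q 0 * -(s * I))) - 1) * (1 / (x - s * I)))
      = fun s : ℝ => (fun s : ℝ => (D.jostΛ i (D.q 0 * -(s * I)) - 1)
        / (x + s * I)) (-s) := by
    funext s
    simp only [Complex.ofReal_neg, neg_mul, mul_neg, neg_neg, ← sub_eq_add_neg, mul_one_div]
  rw [e2]
  exact ⟨i1.comp_neg, by rw [integral_neg_eq_self (fun s : ℝ =>
    (D.jostΛ i (D.q 0 * -(s * I)) - 1) / (x + s * I)), e1]⟩

theorem integral_pole {x y : ℂ} (hx : 0 < x.re) (hy : 0 < y.re) :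
    Integrable (fun s : ℝ => 1 / (x - s * I) / (y + s * I)) ∧
    ∫ s : ℝ, 1 / (x - s * I) / (y + s * I) = 2 * Real.pi * (1 / (y + x)) := by
  obtain ⟨δ, hδ⟩ := exists_norm_inv_add_le hx
  exact integral_cauchy (differentiableOn_inv_add hx) (fun z hz => hδ z hz.le)
    (radialLimit_inv_add hx) hy

theorem lineCauchy_jostΛ (h : D.LineSetting Z c) (i : ℤ) {x : ℂ} (hx : 0 < x.re) :
    lineCauchy (lineDensity D (D.pos i) (D.jostΛ i)) (-x) = D.jostΛ i (D.q 0 * x) - 1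
      + ∑ z ∈ Z, D.jostΥ i z / deriv D.specA z / D.q 0 * (1 / (x + z / D.q 0)) := by
  obtain ⟨i1, e1⟩ := h.integral_jumpRemainder i hx
  obtain ⟨i2, e2⟩ := h.integral_jostΛ i hx
  have hpole := fun z (hz : z ∈ Z) => integral_pole hx (h.re_pos_of_mem hz)
  have i3 := integrable_finsetSum Z fun z hz =>
    (hpole z hz).1.const_mul (D.jostΥ i z / deriv D.specA z / D.q 0)
  have e3 := integral_finsetSum Z fun z hz =>
    (hpole z hz).1.const_mul (D.jostΥ i z / deriv D.specA z / D.q 0)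
  have hq := h.param_ne 0
  have key : ∀ s : ℝ, s ≠ 0 → lineDensity D (D.pos i) (D.jostΛ i) s / (-x + s * I)
      = -(jumpRemainder D Z i (D.q 0 * -(s * I)) * (1 / (x - s * I))
        - (D.jostΛ i (-(D.q 0 * -(s * I))) - 1) * (1 / (x - s * I))
        - ∑ z ∈ Z, D.jostΥ i z / deriv D.specA z / D.q 0
          * (1 / (x - s * I) / (z / D.q 0 + s * I))) := fun s hs => by
    have h1 := h.refl_mul (h.line_mem s).1 (h.line_mem s).2 (h.line_ne_zero hs) i
    unfold lineDensity
    rw [h1, show -x + s * I = -(x - s * I) by ring, div_neg]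
    have h2 : ∑ z ∈ Z, D.jostΥ i z / deriv D.specA z / D.q 0
          * (1 / (x - s * I) / (z / D.q 0 + s * I))
        = -((∑ z ∈ Z, D.jostΥ i z / deriv D.specA z * (1 / (D.q 0 * -(s * I) - z)))
          * (1 / (x - s * I))) := by
      rw [Finset.sum_mul, ← Finset.sum_neg_distrib]
      refine Finset.sum_congr rfl fun z hz => ?_
      have h3 : D.q 0 * -(s * I) - z = -(D.q 0 * (z / D.q 0 + s * I)) := by
        rw [mul_add, h.mul_div]
        ring
      rw [h3]
      generalize z / D.q 0 + s * I = w
      simp only [div_eq_mul_inv, inv_neg, mul_inv]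
      ring
    rw [h2]
    unfold jumpRemainder
    generalize x - s * I = w
    ring
  have i12 : Integrable fun s : ℝ => jumpRemainder D Z i (D.q 0 * -(s * I))
      * (1 / (x - s * I)) - (D.jostΛ i (-(D.q 0 * -(s * I))) - 1)
      * (1 / (x - s * I)) := i1.sub i2
  unfold lineCauchy
  rw [integral_congr_ae (ae_ne_zero.mono fun s hs => key s hs), integral_neg,
    integral_sub i12 i3, integral_sub i1 i2, e1, e2, e3]
  have e4 : ∑ z ∈ Z, ∫ s : ℝ, D.jostΥ i z / deriv D.specA z / D.q 0
        * (1 / (x - s * I) / (z / D.q 0 + s * I))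
      = 2 * Real.pi * ∑ z ∈ Z, D.jostΥ i z / deriv D.specA z / D.q 0 * (1 / (x + z / D.q 0)) := by
    rw [Finset.mul_sum]
    refine Finset.sum_congr rfl fun z hz => ?_
    rw [integral_const_mul, (hpole z hz).2, add_comm x]
    ring
  rw [e4]
  have hpi : (Real.pi : ℂ) ≠ 0 := by exact_mod_cast Real.pi_ne_zero
  field_simp
  ring

theorem isLineSolution_jostΛ (h : D.LineSetting Z c) (i : ℤ) :
    D.IsLineSolution Z c (D.pos i) (D.jostΛ i) := by
  refine ⟨h.direct.continuousOn_jostΛ i, ?_, fun ζ hζ => ?_⟩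
  · obtain ⟨C, hC⟩ := h.direct.exists_norm_jostΛ_sub_one_le i
    refine ⟨1 + C, fun ζ hζ => ?_⟩
    have h1 := hC ζ hζ i le_rfl
    have hp : (1 : ℝ) ≤ 1 + ‖ζ‖ := by linarith [norm_nonneg ζ]
    have hC0 : 0 ≤ C := by
      have := (norm_nonneg _).trans h1
      rwa [le_div_iff₀ (by linarith), zero_mul] at this
    have h2 := norm_add_le 1 (D.jostΛ i ζ - 1)
    rw [add_sub_cancel, norm_one] at h2
    linarith [div_le_self hC0 hp]
  · have hx : 0 < (ζ / D.q 0).re := by rwa [← h.mem_regPstar_iff, h.mul_div]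
    have h1 := h.sieRHS_eq (D.coefC 1 c) (D.pos i) (D.jostΛ i) (ζ / D.q 0)
    rw [h.lineCauchy_jostΛ i hx, h.mul_div] at h1
    rw [h1]
    have h2 : ∑ z ∈ scaled D Z, lineResidue D (D.coefC 1 c) (D.pos i) (D.jostΛ i) z / (ζ / D.q 0 + z)
        = ∑ z ∈ Z, D.jostΥ i z / deriv D.specA z / D.q 0 * (1 / (ζ / D.q 0 + z / D.q 0)) := by
      unfold scaled
      rw [Finset.sum_image fun x _ y _ hxy => (div_left_inj' (h.param_ne 0)).1 hxy]
      refine Finset.sum_congr rfl fun z hz => ?_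
      have hzs : z ∈ D.regPstar 1 := by
        rw [← h.mul_div z, h.mem_regPstar_iff]
        exact h.re_pos_of_mem hz
      unfold lineResidue coefC
      rw [h.mul_div, if_pos hzs, h.norming z hz hzs i]
      ring
    rw [h2]
    ring

variable {C f g : ℂ → ℂ} {n : Lattice N} {f₀ g₀ : ℂ}

/-- The relation between the solutions at neighbouring lattice points, on the line. -/
theorem wronskian_succ (h : D.LineSetting Z c) {j : Fin N}
    (hf : HalfPlaneSolves (scaled D Z) f₀ (lineResidue D C n f) (lineDensity D n f)
      fun z => f (D.q 0 * z))
    (hg : HalfPlaneSolves (scaled D Z) g₀ (lineResidue D C (n + e j) g) (lineDensity D (n + e j) g)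
      fun z => g (D.q 0 * z)) {ζ : ℂ} (hζ : ζ ∉ D.regP 1) (hζ' : -ζ ∉ D.regP 1) (h0 : ζ ≠ 0) :
    (D.p j + ζ) * g ζ * f (-ζ) - (D.p j - ζ) * g (-ζ) * f ζ = 2 * f₀ * g₀ * ζ := by
  obtain ⟨s, hs, rfl⟩ := h.exists_line_eq hζ hζ' h0
  have key := HalfPlaneSolves.lineWronskian_eq (α₀ := D.p j) (α₁ := D.q 0) hf hg (fun z hz => ?_)
    (fun s _ => ?_) hs
  · unfold HalfPlaneSolves.lineWronskian at key
    simp only [mul_neg] at key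
    linear_combination -key
  · have hr := h.param_zero (h.mul_mem_of_mem_scaled hz) j
    unfold lineResidue
    rw [rho_add_e n j hr.1 hr.2]
    have hne := hr.2
    field_simp
  · have hr := h.param_line (z := -(s * I)) (by simp) j
    unfold lineDensity
    rw [rho_add_e n j hr.1 hr.2]
    have e1 : D.p j - D.q 0 * (s * I) = D.p j + D.q 0 * -(s * I) := by ring
    have e2 : D.p j + D.q 0 * (s * I) = D.p j - D.q 0 * -(s * I) := by ring
    rw [e1, e2]
    have hne := hr.2
    clear e1 e2 hr
    generalize D.q 0 * -(s * I) = σ at *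
    field_simp

theorem wronskian_self (h : D.LineSetting Z c)
    (hf : HalfPlaneSolves (scaled D Z) f₀ (lineResidue D C n f) (lineDensity D n f)
      fun z => f (D.q 0 * z))
    (hg : HalfPlaneSolves (scaled D Z) g₀ (lineResidue D C n g) (lineDensity D n g)
      fun z => g (D.q 0 * z)) {ζ : ℂ} (hζ : ζ ∉ D.regP 1) (hζ' : -ζ ∉ D.regP 1) (h0 : ζ ≠ 0) :
    g ζ * f (-ζ) = g (-ζ) * f ζ := by
  obtain ⟨s, hs, rfl⟩ := h.exists_line_eq hζ hζ' h0
  have key := HalfPlaneSolves.lineWronskian_eq (α₀ := 1) (α₁ := 0) hf hg (fun z hz => ?_)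
    (fun s _ => ?_) hs
  · unfold HalfPlaneSolves.lineWronskian at key
    simp only [mul_neg] at key
    linear_combination -key
  · unfold lineResidue
    ring
  · unfold lineDensity
    ring

/-- A homogeneous solution that vanishes on the line vanishes. -/
theorem eq_zero_of_line {b : ℂ → ℂ} {φ : ℝ → ℂ} {Z' : Finset ℂ} {f : ℂ → ℂ}
    (hf : HalfPlaneSolves Z' f₀ b φ f)
    (hz : ∀ s : ℝ, s ≠ 0 → f (-(s * I)) = 0) {z : ℂ} (hz0 : 0 ≤ z.re) : f z = 0 := by
  have h1 : (0 : ℝ) < (1 : ℂ).re := by simp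
  have hin : ∀ z : ℂ, 0 < z.re → f z = 0 := fun z hz0 => by
    obtain ⟨B, hB⟩ := hf.bound
    obtain ⟨δ, hδ⟩ := exists_norm_inv_add_le h1
    obtain ⟨-, e1⟩ := integral_cauchy (m := fun z => f z * (1 / (z + 1))) (ms := fun _ => 0)
      (C := B * δ) (hf.differentiableOn.mul (differentiableOn_inv_add h1)) (fun z hz => by
        rw [norm_mul, mul_assoc]
        exact mul_le_mul (hB z hz.le) (hδ z hz.le) (by positivity)
          ((norm_nonneg _).trans (hB z hz.le)))
      (fun s hs => by
        have := (hf.tendsto_radial_of s).mul (tendsto_radial_inv_add h1 s)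
        rwa [hz s hs, zero_mul] at this) hz0
    simp only [zero_div, integral_zero] at e1
    have hpi : (2 * Real.pi : ℂ) ≠ 0 := by
      exact_mod_cast (mul_pos two_pos Real.pi_pos).ne'
    refine (mul_eq_zero.1 ((mul_eq_zero.1 e1.symm).resolve_left hpi)).resolve_right ?_
    exact one_div_ne_zero (add_ne_zero_of_re h1 hz0.le)
  rcases hz0.lt_or_eq with h2 | h2
  · exact hin z h2
  · obtain ⟨s, rfl⟩ : ∃ s : ℝ, z = -(s * I) :=
      ⟨-z.im, Complex.ext (by simp [← h2]) (by simp)⟩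
    refine tendsto_nhds_unique (hf.tendsto_radial_of s) (tendsto_const_nhds.congr' ?_)
    filter_upwards [self_mem_nhdsWithin] with x hx
    have hx : 0 < x := hx
    exact (hin _ (by simpa using hx)).symm

theorem eq_jostΛ (h : D.LineSetting Z c) (i : ℤ) (hf : D.IsLineSolution Z c (D.pos i) f) {ζ : ℂ}
    (hζ : ζ ∉ D.regP 1) : f ζ = D.jostΛ i ζ := by
  have h1 := h.halfPlaneSolves (h.isLineSolution_jostΛ i)
  have h2 := h.halfPlaneSolves (h.isLineSolution_jostΛ (i + 1))
  rw [pos_succ] at h2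
  have hd : HalfPlaneSolves (scaled D Z) 0
      (lineResidue D (D.coefC 1 c) (D.pos i) fun ζ => f ζ - D.jostΛ i ζ)
      (lineDensity D (D.pos i) fun ζ => f ζ - D.jostΛ i ζ)
      fun z => f (D.q 0 * z) - D.jostΛ i (D.q 0 * z) := by
    convert (h.halfPlaneSolves hf).sub h1 using 1
    · ring
    · funext z
      unfold lineResidue
      ring
    · funext s
      unfold lineDensity
      ring
  have hline : ∀ s : ℝ, s ≠ 0 → f (D.q 0 * -(s * I)) - D.jostΛ i (D.q 0 * -(s * I))
      = 0 := fun s hs => by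
    obtain ⟨m1, m2⟩ := h.line_mem s
    have h0 := h.line_ne_zero hs
    have w := h.direct.wronskian m1 m2 i
    have w1 := h.wronskian_self hd h1 m1 m2 h0
    have w2 := h.wronskian_succ hd h2 m1 m2 h0
    change (D.q i + _) * _ * _ - (D.q i - _) * _ * _ = _ at w2
    generalize D.q 0 * -(s * I) = σ at *
    refine (mul_eq_zero.1 (?_ : 2 * σ * (f σ - D.jostΛ i σ) = 0)).resolve_left
      (mul_ne_zero two_ne_zero h0)
    rw [← w]
    linear_combination (-(D.q i + σ) * D.jostΛ (i + 1) σ) * w1 + D.jostΛ i σ * w2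
  have hz : 0 ≤ (ζ / D.q 0).re := by rwa [← h.notMem_regP_iff, h.mul_div]
  have := eq_zero_of_line hd hline hz
  rw [h.mul_div] at this
  exact sub_eq_zero.1 this

theorem pos_mem_lineRegular (h : D.LineSetting Z c) (i : ℤ) : D.pos i ∈ D.lineRegular Z c :=
  ⟨D.jostΛ i, h.isLineSolution_jostΛ i, h.direct.exists_hasExpansionIn i,
    fun _ hg _ hζ => h.eq_jostΛ i hg hζ⟩

theorem neBot_line (h : D.LineSetting Z c) :
    (cocompact ℂ ⊓ 𝓟 {ζ | ζ ∉ D.regP 1 ∧ -ζ ∉ D.regP 1}).NeBot := by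
  have hlim : Tendsto (fun s : ℝ => D.q 0 * -(s * I)) atTop (cocompact ℂ) := by
    rw [← Metric.cobounded_eq_cocompact, ← tendsto_norm_atTop_iff_cobounded]
    simp only [norm_mul, norm_neg, Complex.norm_I, mul_one, Complex.norm_real]
    exact (tendsto_abs_atTop_atTop).const_mul_atTop (norm_pos_iff.2 (h.param_ne 0))
  exact (tendsto_inf.2 ⟨hlim, tendsto_principal.2 (Eventually.of_forall h.line_mem)⟩).neBot

theorem edgeRelations (h : D.LineSetting Z c) {Λ : Lattice N → ℂ → ℂ} {Λε Λε2 : Lattice N → ℂ}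
    (hΛ : ∀ n ∈ D.lineRegular Z c, D.IsLineSolution Z c n (Λ n) ∧
      HasExpansionIn (D.regP 1)ᶜ (Λ n) (Λε n) (Λε2 n)) :
    EdgeRelations D (D.lineRegular Z c) Λε Λε2 := by
  set S := {ζ | ζ ∉ D.regP 1 ∧ -ζ ∉ D.regP 1} with hS
  have := h.neBot_line
  have hl : ∀ n ∈ D.lineRegular Z c, (fun ζ => Λ n ζ - (1 + Λε n / ζ + Λε2 n / ζ ^ 2))
      =o[cocompact ℂ ⊓ 𝓟 S] fun ζ => 1 / ζ ^ 2 := fun n hn =>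
    (hΛ n hn).2.mono (inf_le_inf_left _ (principal_mono.2 fun ζ hζ => hζ.1))
  have hneg : Tendsto (fun ζ : ℂ => -ζ) (cocompact ℂ ⊓ 𝓟 S) (cocompact ℂ ⊓ 𝓟 S) := by
    refine tendsto_inf.2 ⟨tendsto_neg_cocompact.mono_left inf_le_left,
      tendsto_principal.2 ?_⟩
    filter_upwards [mem_inf_of_right (mem_principal_self S)] with ζ hζ
    exact ⟨hζ.2, by rw [neg_neg]; exact hζ.1⟩
  have hl' : ∀ n ∈ D.lineRegular Z c, (fun ζ => Λ n (-ζ) - (1 - Λε n / ζ + Λε2 n / ζ ^ 2))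
      =o[cocompact ℂ ⊓ 𝓟 S] fun ζ => 1 / ζ ^ 2 := by
    intro n hn
    refine ((hl n hn).comp_tendsto hneg).congr (fun ζ => ?_) fun ζ => ?_
    · simp only [Function.comp, neg_sq, div_neg, ← sub_eq_add_neg]
    · simp only [Function.comp, neg_sq]
  intro n j h0 h1
  refine edge_relation inf_le_left (hl n h0) (hl' n h0) (hl _ h1) (hl' _ h1) ?_
  filter_upwards [mem_inf_of_right (mem_principal_self S),
    mem_inf_of_left ((isCompact_singleton (x := (0 : ℂ))).compl_mem_cocompact)] with ζ hζ hne
  have := h.wronskian_succ (h.halfPlaneSolves (hΛ n h0).1) (h.halfPlaneSolves (hΛ _ h1).1)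
    hζ.1 hζ.2 hne
  linear_combination this

end LineSetting

end InitialData

end

end LatticeIST

open Filter Topology LatticeIST in
theorem mainTheorem3 {N : ℕ} (D : InitialData N) (Z : Finset ℂ) (c : ℂ → ℂ) :
    (∀ (K : ℝ) (L : ℝ → ℂ), D.ContourSetting K L Z c →
      ∀ Λ : Lattice N → ℂ → ℂ,
      (∀ n ∈ D.regular K L Z c, D.IsSolution K L Z c n (Λ n)) →
      -- the direct problem, and the reconstruction of its solution on the staircase
      D.DirectScattering K ∧
      (∀ i : ℤ, D.pos i ∈ D.regular K L Z c ∧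
        ∀ ζ, -ζ ∈ extRegion L → Λ (D.pos i) ζ = D.jostΛ i ζ) ∧
      -- the direction of the shifts is arbitrary
      (∀ (n : Lattice N) (l l' : Fin N), n ∈ D.regular K L Z c →
        n + e l ∈ D.regular K L Z c → n + e l' ∈ D.regular K L Z c →
        ∀ x y : ℂ, -x ∈ extRegion L → -y ∈ extRegion L →
          D.smallS Λ l n x y = D.smallS Λ l' n x y ∧
          (x ∈ extRegion L → D.bigZ Λ l n x = D.bigZ Λ l' n x)) ∧
      -- the solutions of Q2, Q1 and H3
      (∀ a : ℂ, a ≠ 0 → a ∈ extRegion L → -a ∈ extRegion L → (∀ r, D.p r ^ 2 ≠ a ^ 2) →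
        (∀ i, ‖(D.q i + a) / (D.q i - a)‖ < K ∧ ‖(D.q i - a) / (D.q i + a)‖ < K) →
        ∀ l : Fin N,
        (∀ cA cD ξ₀ : ℂ,
          SolvesOn {n | n ∈ D.regular K L Z c ∧ n + e l ∈ D.regular K L Z c}
            (fun j k => EqQ2 (ringParam a (D.p j)) (ringParam a (D.p k))) (D.uQ2 Λ l a cA cD ξ₀) ∧
          ∀ (n : Lattice N) (δ : ℂ) (P : ℂ → Fin N → ℂ), n ∈ D.regular K L Z c →
            n + e l ∈ D.regular K L Z c → δ ≠ 0 →
            (∀ r, (∀ᶠ ε in 𝓝[≠] 0, P ε r ^ 2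
                = (D.p r ^ 2 - a ^ 2) * (D.p r ^ 2 - (a * (1 - 2 * ε)) ^ 2)) ∧
              Tendsto (fun ε => P ε r) (𝓝[≠] 0) (𝓝 (D.p r ^ 2 - a ^ 2))) →
            Tendsto (fun ε : ℂ =>
              ((δ / (4 * a ^ 2))⁻¹ * D.uQ3 Λ l a (a * (1 - 2 * ε)) (P ε)
                (δ / (4 * a ^ 2) * (cA * ε))
                (δ / (8 * a ^ 2) * (1 / ε + 1 - ξ₀ + ((3 + ξ₀ ^ 2) / 2 + 2 * cA * cD) * ε))
                (δ / (8 * a ^ 2) * (1 / ε + 1 + ξ₀ + ((3 + ξ₀ ^ 2) / 2 + 2 * cA * cD) * ε))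
                (δ / (4 * a ^ 2) * (cD * ε)) n - 1 / ε - 1 - ε) / (2 * ε))
              (𝓝[≠] 0) (𝓝 (D.uQ2 Λ l a cA cD ξ₀ n))) ∧
        (∀ δ cA cB cD ξ₀ : ℂ, cB ^ 2 + 4 * cA * cD = δ ^ 2 / 4 →
          SolvesOn {n | n ∈ D.regular K L Z c ∧ n + e l ∈ D.regular K L Z c}
            (fun j k => EqQ1 δ (ringParam a (D.p j)) (ringParam a (D.p k))) (D.uQ1 Λ l a cA cB cD ξ₀) ∧
          ∀ n : Lattice N, n ∈ D.regular K L Z c → n + e l ∈ D.regular K L Z c →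
            Tendsto (fun ε : ℂ =>
              ε * (D.uQ2 Λ l a (2 * cA / ε) (2 * cD / ε) (ξ₀ + 2 * cB / ε) n
                - δ ^ 2 / (4 * ε ^ 2)))
              (𝓝[≠] 0) (𝓝 (D.uQ1 Λ l a cA cB cD ξ₀ n))) ∧
        (∀ (δ : ℂ) (P : Fin N → ℂ) (cA cB cC cD : ℂ), (∀ r, P r ^ 2 = a ^ 2 - D.p r ^ 2) →
          cA * cD - cB * cC = -δ / (4 * a) →
          SolvesOn (D.regular K L Z c)
            (fun j k => EqH3 δ (D.p j) (P j) (D.p k) (P k)) (D.uH3 Λ a P cA cB cC cD) ∧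
          ∀ (n : Lattice N) (s : ℂ) (P' : ℂ → Fin N → ℂ), n ∈ D.regular K L Z c →
            n + e l ∈ D.regular K L Z c → s ^ 2 = δ → δ ≠ 0 →
            (∀ r, (∀ᶠ ε in 𝓝[≠] 0, P' ε r ^ 2
                = (D.p r ^ 2 - a ^ 2) * (D.p r ^ 2 - (1 / ε ^ 2) ^ 2)) ∧
              Tendsto (fun ε => ε ^ 2 * P' ε r) (𝓝[≠] 0) (𝓝 (P r))) →
            Tendsto (fun ε : ℂ =>
              (ε ^ 3 * (s / 2))⁻¹ * D.uQ3 Λ l a (1 / ε ^ 2) (P' ε)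
                (ε ^ 3 * (s / 2 * cA)) (ε ^ 3 * (s / 2 * cB))
                (ε ^ 3 * (s / 2 * cC)) (ε ^ 3 * (s / 2 * cD)) n)
              (𝓝[≠] 0) (𝓝 (D.uH3 Λ a P cA cB cC cD n)))) ∧
      -- the solutions of H2 and H1
      (∀ n ∈ D.regular K L Z c, ∃ l₁ l₂, HasExpansion (Λ n) l₁ l₂) ∧
      (∀ Λε Λε2 : Lattice N → ℂ,
        (∀ n ∈ D.regular K L Z c, HasExpansion (Λ n) (Λε n) (Λε2 n)) →
        (∀ cA ρ₀ ρ₁ : ℂ,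
          SolvesOn (D.regular K L Z c) (fun j k => EqH2 (D.p j) (D.p k))
            (D.uH2 Λε Λε2 cA ρ₀ ρ₁) ∧
          ∀ (n : Lattice N) (l : Fin N), n ∈ D.regular K L Z c → n + e l ∈ D.regular K L Z c →
            Tendsto (fun ε : ℂ =>
              (D.uQ2 Λ l (1 / ε) (cA * (ε + 2 * ρ₁ * ε ^ 2)) (cA * (-ε + 2 * ρ₁ * ε ^ 2))
                (2 * ε * ρ₀) n - 1 / 4) / ε ^ 2)
              (𝓝[≠] 0) (𝓝 (D.uH2 Λε Λε2 cA ρ₀ ρ₁ n))) ∧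
        (∀ cA cB ρ₀ ρ₁ : ℂ, cA ^ 2 - cB ^ 2 = -1 →
          SolvesOn (D.regular K L Z c) (fun j k => EqH1 (D.p j) (D.p k))
            (D.uH1 Λε cA cB ρ₀ ρ₁) ∧
          ∀ (n : Lattice N) (l : Fin N) (δ : ℂ), n ∈ D.regular K L Z c →
            n + e l ∈ D.regular K L Z c → δ ≠ 0 →
            Tendsto (fun ε : ℂ =>
              D.uQ1 Λ l (1 / ε) (δ / 4 * (cA * (1 + 2 * ρ₁ * ε))) (δ / 2 * cB)
                (δ / 4 * (cA * (-1 + 2 * ρ₁ * ε))) (2 * ε * ρ₀) n / (ε * δ))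
              (𝓝[≠] 0) (𝓝 (D.uH1 Λε cA cB ρ₀ ρ₁ n))))) ∧
    -- H2 and H1 under the weakest summability condition
    (D.LineSetting Z c →
      ∀ (Λ : Lattice N → ℂ → ℂ) (Λε Λε2 : Lattice N → ℂ),
      (∀ n ∈ D.lineRegular Z c, D.IsLineSolution Z c n (Λ n) ∧
        HasExpansionIn (D.regP 1)ᶜ (Λ n) (Λε n) (Λε2 n)) →
      D.DirectScattering 1 ∧
      (∀ i : ℤ, D.pos i ∈ D.lineRegular Z c ∧
        ∀ ζ ∉ D.regP 1, Λ (D.pos i) ζ = D.jostΛ i ζ) ∧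
      (∀ cA ρ₀ ρ₁ : ℂ,
        SolvesOn (D.lineRegular Z c) (fun j k => EqH2 (D.p j) (D.p k))
          (D.uH2 Λε Λε2 cA ρ₀ ρ₁)) ∧
      (∀ cA cB ρ₀ ρ₁ : ℂ, cA ^ 2 - cB ^ 2 = -1 →
        SolvesOn (D.lineRegular Z c) (fun j k => EqH1 (D.p j) (D.p k))
          (D.uH1 Λε cA cB ρ₀ ρ₁))) := by
  refine ⟨fun K L h Λ hΛ => ?_, ?_⟩
  · have hL := h.laxSystem hΛ
    have hV : {ζ | -ζ ∈ extRegion L} ∈ cocompact ℂ :=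
      tendsto_neg_cocompact h.contour.extRegion_mem_cocompact
    have lim : ∀ n ∈ D.regular K L Z c, Tendsto (Λ n) (cocompact ℂ) (𝓝 1) := fun n hn =>
      (h.hasExpansion hΛ hn).choose_spec.tendsto
    refine ⟨h.direct.directScattering, fun i => ⟨h.pos_mem_regular i, fun ζ hζ =>
      h.eq_jostΛ i (hΛ _ (h.pos_mem_regular i)) hζ⟩, fun n l l' h0 h1 h2 x y hx hy =>
      ⟨InitialData.smallS_indep hL h0 h1 h2 hx hy, fun hx' => InitialData.bigZ_indep hL h0 h1 h2 hx
        (by simpa using hx')⟩, fun a ha ha1 ha2 hpa _ l => ?_,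
      fun n hn => ⟨_, h.hasExpansion hΛ hn⟩, fun Λε Λε2 hE => ?_⟩
    · have haV : a ∈ {ζ | -ζ ∈ extRegion L} := ha2
      have haV' : -a ∈ {ζ | -ζ ∈ extRegion L} := by simpa using ha1
      exact ⟨fun cA cD ξ₀ => ⟨InitialData.solvesOn_Q2 hL ha haV haV' hpa l cA cD ξ₀,
        fun n δ P h0 h1 hδ hP => InitialData.tendsto_uQ3_uQ2 hL h0 h1 ha haV haV' hpa hP cA cD ξ₀ hδ⟩,
        fun δ cA cB cD ξ₀ hδ => ⟨InitialData.solvesOn_Q1 hL ha haV haV' hpa l ξ₀ hδ,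
          fun n _ _ => InitialData.tendsto_uQ2_uQ1 ξ₀ hδ l n⟩,
        fun δ P cA cB cC cD hP hδ => ⟨InitialData.solvesOn_H3 hL ha haV haV' hpa hP hδ,
          fun n s P' h0 h1 hs hδ0 hP' => InitialData.tendsto_uQ3_uH3 hpa
            (fun h0 => hδ0 (by rw [← hs, h0]; ring)) cA cB cC cD hP (fun r => (hP' r).2)
            (lim n h0) (lim _ h1)⟩⟩
    · have hR := h.edgeRelations hΛ hE
      exact ⟨fun cA ρ₀ ρ₁ => ⟨hR.solvesOn_H2 cA ρ₀ ρ₁, fun n l h0 h1 =>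
          InitialData.tendsto_uQ2_uH2 h.isOpen_V hV (hL.diff n h0) (hL.diff _ h1) (hE n h0)
            (hE _ h1) cA ρ₀ ρ₁⟩,
        fun cA cB ρ₀ ρ₁ hAB => ⟨hR.solvesOn_H1 ρ₀ ρ₁ hAB, fun n l δ h0 h1 hδ =>
          InitialData.tendsto_uQ1_uH1 h.isOpen_V hV (hL.diff n h0) (hL.diff _ h1) (hE n h0)
            (hE _ h1) cA cB ρ₀ ρ₁ hδ⟩⟩
  · intro h Λ Λε Λε2 hΛ
    have hR := h.edgeRelations hΛ
    exact ⟨h.direct.directScattering, fun i => ⟨h.pos_mem_lineRegular i, fun ζ hζ =>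
      h.eq_jostΛ i (hΛ _ (h.pos_mem_lineRegular i)).1 hζ⟩,
      fun cA ρ₀ ρ₁ => hR.solvesOn_H2 cA ρ₀ ρ₁, fun cA cB ρ₀ ρ₁ hAB => hR.solvesOn_H1 ρ₀ ρ₁ hAB⟩
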